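/- **Setting.** Let $q$ be a power of a prime different from $2,3$, let $\mu\in\{\pm1\}$ with $q\equiv\mu \pmod 3$, and let $G=PGL_2(\mathbb F_q)$. Let $G$ act on the projective space $\mathbb P(\mathrm{Sym}^4)$ of nonzero binary quartic forms over $\mathbb F_q$ modulo scalars by $(g\cdot f)(X,Y)=f(dX-bY,\,aY-cX)$ for $g=\begin{pmatrix}a&b\\c&d\end{pmatrix}$. For $$f=z_0Y^4-4z_1Y^3X+6z_2Y^2X^2-4z_3YX^3+z_4X^4$$ put $I=\tfrac13(z_0z_4-4z_1z_3+3z_2^2)$, $J=\det\begin{pmatrix}z_0&z_1&z_2\\z_1&z_2&z_3\\z_2&z_3&z_4\end{pmatrix}$, $\Delta=I^3-J^2$, and, if $\Delta\ne0$, $\jmath(f)=1728\,I^3/\Delta$ (that is, $1-1728/\jmath=J^2/I^3$). For $i=1,2,4$ let $J_i$ be the set of $r\in\mathbb F_q\setminus\{0,1728\}$ such that $Z^3-4Z^2+\tfrac{256}{27}(1-\tfrac{1728}{r})$ has exactly $i-1$ roots in $\mathbb F_q$. A form with $\Delta\neq0$ has type $\mathcal F_i$ ($i=1,2,4$) if it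 has exactly $i$ linear factors over $\mathbb F_q$ up to scalars, and type $\mathcal F_4'$ (resp. $\mathcal F_2'$) if it has no linear factor over $\mathbb F_q$ and its splitting field is $\mathbb F_{q^2}$ (resp. $\mathbb F_{q^4}$). **Theorem.** (1) There are $q^4-q^2$ points of $\mathbb P(\mathrm{Sym}^4)$ with $\Delta\ne0$, and they form exactly $2q+2+\mu$ $G$-orbits. On each of these orbits $\jmath$ is constant, with value in $J_4\cup J_2\cup J_1\cup\{1728,0\}$, and each of them has size $|G|/d$ for some $d\in\{1,2,3,4,12,8\}$. For each value $r$ of $\jmath$ the number of orbits with $\jmath=r$ and of the given size is | | $\lvert G\rvert$ | $\lvert G\rvert/2$ | $\lvert G\rvert/3$ | $\lvert G\rvert/4$ | $\lvert G\rvert/12$ | $\lvert G\rvert/8$ | |---|---|---|---|---|---|---| | each $r\in J_4$ | 0 | 0 | 0 | 4 | 0 | 0 | | each $r\in J_2$ | 0 | 2 | 0 | 0 | 0 | 0 | | each $r\in J_1$ | 1 | 0 | 0 | 0 | 0 | 0 | | $r=1728$ | 0 | 0 | 0 | 3 | 0 | 2 | | $r=0$ | 0 | $1-\mu$ | $1+\mu$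 | $(1+\mu)/2$ | $(1+\mu)/2$ | 0 | (2) Notation and choices. Let $\varepsilon$ be a non-square in $\mathbb F_q$ with a square root $\sqrt\varepsilon\in\mathbb F_{q^2}$, let $\gamma$ be a generator of $\mathbb F_q^\times$, let $\imath\in\mathbb F_{q^2}$ with $\imath^2=-1$, and let $\eta\in\mathbb F_{q^2}$ with $\eta^2=\gamma$. If $q\equiv3\pmod 4$, let $\theta_0,\theta_1\in\mathbb F_q$ with $\theta_0^2+\theta_1^2=-1$ and $\theta_0$ a non-square. For each square $x$ in $\mathbb F_q$ fix a square root $\sqrt x\in\mathbb F_q$. Let $\omega$ be a primitive cube root of unity, $N(x)=x^{q+1}$ the norm from $\mathbb F_{q^2}$ to $\mathbb F_q$, $\tilde{\mathcal N}_4=\mathbb F_q\setminus\{0,1\}$, $\tilde{\mathcal N}_2=\{\lambda\in\mathbb F_{q^2}\setminus\{1\}:N(\lambda)=1\}$, $\mathcal N_i=\tilde{\mathcal N}_i\setminus\{-1,2,\tfrac12,-\omega,-\omega^2\}$, and $\jmath(\lambda)=256(\lambda^2-\lambda+1)^3/(\lambda^2(\lambda-1)^2)$. Put * $\mathcal E_r=X\big(\tfrac{256}{27}(1-\tfrac{1728}r)Y^3-4YX^2+X^3\big)$;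 * $\psi'_\alpha=(Y^2-\varepsilon X^2)(Y-\alpha X)(Y-\alpha^qX)$ and $\chi_1(\alpha)=N\big(\tfrac{\alpha-\sqrt\varepsilon}{\alpha+\sqrt\varepsilon}\big)$, for $\alpha\in\mathbb F_{q^2}\setminus(\mathbb F_q\cup\{\pm\sqrt\varepsilon\})$; * if $q\equiv1\pmod 4$ and $t\in\mathbb F_q$: $\chi(t)=\dfrac{t-\imath\eta/2}{t+\imath\eta/2}$, and $\upsilon'_t=(Y^2-tX^2)^2-\gamma X^4-4\sqrt{\gamma t}\,X^3Y$ if $\gamma t$ is a square, $\upsilon'_t=(Y^2-\gamma tX^2)^2-\gamma^3X^4-4\gamma^2\sqrt t\,X^3Y$ if $t$ is a nonzero square; * if $q\equiv3\pmod 4$ and $t\in\mathbb F_q$: $\chi(t)=\dfrac{2t+\theta_0+\imath}{2t+\theta_0-\imath}$, and $\upsilon'_t=(Y^2-tX^2)^2-X^4+2X^2\big((Y^2+tX^2)\theta_0+2XY\sqrt{-t}\,\theta_1\big)$ if $-t$ is a square, $\upsilon'_t=(Y^2+tX^2)^2-X^4-2X^2\big((Y^2-tX^2)\theta_0-2XY\sqrt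 t\,\theta_1\big)$ if $t$ is a nonzero square. For each class $\{\lambda,\lambda^{-1}\}\subset\tilde{\mathcal N}_4$ choose $\alpha_{\{\lambda,\lambda^{-1}\}}$ with $\chi_1(\alpha_{\{\lambda,\lambda^{-1}\}})\in\{\lambda,\lambda^{-1}\}$, and for each class $\{\lambda,\lambda^{-1}\}\subset\tilde{\mathcal N}_2$ choose $t_{\{\lambda,\lambda^{-1}\}}\in\mathbb F_q$ with $\chi(t_{\{\lambda,\lambda^{-1}\}})\in\{\lambda,\lambda^{-1}\}$; write $\psi'_{\{\lambda,\lambda^{-1}\}}$ and $\upsilon'_{\{\lambda,\lambda^{-1}\}}$ for the corresponding forms. All these choices are possible, and for every such choice the following list contains exactly one representative of each of the $2q+2+\mu$ orbits, with $\jmath$-invariant, type and isomorphism class of the stabilizer in $G$ as indicated ($D_4$ is the dihedral group of order $8$): | representative | $\jmath$ | type | stabilizer | |---|---|---|---| | $\mathcal E_r$, $r\in J_4$ | $r$ | $\mathcal F_4$ | $\mathbb Z/2\times\mathbb Z/2$ | | $\mathcal E_r$, $r\in J_2$ | $r$ | $\mathcal F_2$ | $\mathbb Z/2$ | | $\mathcal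 E_r$, $r\in J_1$ | $r$ | $\mathcal F_1$ | trivial | | $XY(Y-X)(Y+X)$ | $1728$ | $\mathcal F_4$ | $D_4$ | | $XY(Y^2-\varepsilon X^2)$ | $1728$ | $\mathcal F_2$ | $\mathbb Z/2\times\mathbb Z/2$ | | $X(Y^3-X^3)$, if $q\equiv1\ (3)$ | $0$ | $\mathcal F_4$ | $A_4$ | | $X(Y^3-\gamma X^3)$ and $X(Y^3-\gamma^2X^3)$, if $q\equiv1\ (3)$ | $0$ | $\mathcal F_1$ | $\mathbb Z/3$ | | $X(Y^3-X^3)$, if $q\equiv2\ (3)$ | $0$ | $\mathcal F_2$ | $\mathbb Z/2$ | | $\psi'_{\{-1\}}$ | $1728$ | $\mathcal F_4'$ | $D_4$ | | $\psi'_{\{2,1/2\}}$ | $1728$ | $\mathcal F_4'$ | $\mathbb Z/2\times\mathbb Z/2$ | | $\psi'_{\{-\omega,-\omega^2\}}$, if $q\equiv1\ (3)$ | $0$ | $\mathcal F_4'$ | $\mathbb Z/2\times\mathbb Z/2$ | | $\psi'_{\{\lambda,\lambda^{-1}\}}$, $\lambda\in\mathcal N_4$ ($3\lvert J_4\rvert$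 orbits) | $\jmath(\lambda)\in J_4$ | $\mathcal F_4'$ | $\mathbb Z/2\times\mathbb Z/2$ | | $\upsilon'_{\{-1\}}$ | $1728$ | $\mathcal F_2'$ | $\mathbb Z/4$ | | $\upsilon'_{\{-\omega,-\omega^2\}}$, if $q\equiv2\ (3)$ | $0$ | $\mathcal F_2'$ | $\mathbb Z/2$ | | $\upsilon'_{\{\lambda,\lambda^{-1}\}}$, $\lambda\in\mathcal N_2$ ($\lvert J_2\rvert$ orbits) | $\jmath(\lambda)\in J_2$ | $\mathcal F_2'$ | $\mathbb Z/2$ | -/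

import Mathlib

noncomputable section

namespace BinaryQuartic

open MvPolynomial

/-! ### Binary quartic forms and the action of `PGL₂` -/

/-- Binary quartic forms over `F`; the variables are `X = X 0` and `Y = X 1`. -/
abbrev QuarticForm (F : Type*) [Field F] : Type _ :=
  homogeneousSubmodule (Fin 2) F 4

/-- The projective space of binary quartic forms over `F`, i.e. nonzero forms up to scalars. -/
abbrev ProjQuartic (F : Type*) [Field F] : Type _ :=
  Projectivization F (QuarticForm F)

/-- The substitution `f(X, Y) ↦ f(dX - bY, aY - cX)` attached to `g = (a b; c d)`. -/
def subst {F : Type*} [Field F] (g : Matrix (Fin 2) (Fin 2) F) :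
    MvPolynomial (Fin 2) F →ₐ[F] MvPolynomial (Fin 2) F :=
  aeval ![C (g 1 1) * X 0 - C (g 0 1) * X 1, C (g 0 0) * X 1 - C (g 1 0) * X 0]

theorem subst_one {F : Type*} [Field F] (f : MvPolynomial (Fin 2) F) : subst 1 f = f := by
  have h : subst (1 : Matrix (Fin 2) (Fin 2) F) = AlgHom.id F _ := by
    apply MvPolynomial.algHom_ext
    intro i
    fin_cases i <;> simp [subst]
  rw [h]; rfl

theorem subst_mul {F : Type*} [Field F] (g h : Matrix (Fin 2) (Fin 2) F)
    (f : MvPolynomial (Fin 2) F) : subst (g * h) f = subst g (subst h f) := by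
  have e : subst (g * h) = (subst g).comp (subst h) := by
    apply MvPolynomial.algHom_ext
    intro i
    fin_cases i <;> simp [subst, Matrix.mul_apply, Fin.sum_univ_two] <;> ring
  rw [e]; rfl

theorem subst_mem {F : Type*} [Field F] (g : Matrix (Fin 2) (Fin 2) F)
    {f : MvPolynomial (Fin 2) F} (hf : f ∈ homogeneousSubmodule (Fin 2) F 4) :
    subst g f ∈ homogeneousSubmodule (Fin 2) F 4 := by
  rw [mem_homogeneousSubmodule] at hf ⊢
  have key : ∀ i : Fin 2,
      ((![C (g 1 1) * X 0 - C (g 0 1) * X 1, C (g 0 0) * X 1 - C (g 1 0) * X 0] :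
        Fin 2 → MvPolynomial (Fin 2) F) i).IsHomogeneous 1 := by
    intro i
    fin_cases i
    · exact ((isHomogeneous_X F 0).C_mul _).sub ((isHomogeneous_X F 1).C_mul _)
    · exact ((isHomogeneous_X F 1).C_mul _).sub ((isHomogeneous_X F 0).C_mul _)
  have h := hf.aeval _ key
  rwa [one_mul] at h

/-- `GL₂(F)` acts on binary quartic forms by `(g • f)(X, Y) = f(dX - bY, aY - cX)`. -/
instance {F : Type*} [Field F] :
    DistribMulAction (Matrix.GeneralLinearGroup (Fin 2) F) (QuarticForm F) where
  smul g f := ⟨subst (g : Matrix (Fin 2) (Fin 2) F) f.1, subst_mem _ f.2⟩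
  one_smul f := Subtype.ext (subst_one f.1)
  mul_smul _ _ f := Subtype.ext (subst_mul _ _ f.1)
  smul_zero g := Subtype.ext (map_zero (subst (g : Matrix (Fin 2) (Fin 2) F)))
  smul_add g f f' := Subtype.ext (map_add (subst (g : Matrix (Fin 2) (Fin 2) F)) f.1 f'.1)

theorem coe_smul {F : Type*} [Field F] (g : Matrix.GeneralLinearGroup (Fin 2) F)
    (f : QuarticForm F) :
    ((g • f : QuarticForm F) : MvPolynomial (Fin 2) F) =
      subst (g : Matrix (Fin 2) (Fin 2) F) f.1 := rfl

instance {F : Type*} [Field F] :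
    SMulCommClass (Matrix.GeneralLinearGroup (Fin 2) F) F (QuarticForm F) where
  smul_comm g c f :=
    Subtype.ext (map_smul (subst (g : Matrix (Fin 2) (Fin 2) F)) c f.1)

theorem subst_scalar {F : Type*} [Field F] (u : F) {f : MvPolynomial (Fin 2) F}
    (hf : f.IsHomogeneous 4) : subst (Matrix.scalar (Fin 2) u) f = u ^ 4 • f := by
  have e : subst (Matrix.scalar (Fin 2) u) = aeval (fun i : Fin 2 => C u * X i) := by
    apply MvPolynomial.algHom_ext
    intro i
    fin_cases i <;> simp [subst]
  rw [e]
  conv_lhs => rw [f.as_sum]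
  conv_rhs => rw [f.as_sum]
  rw [map_sum, Finset.smul_sum]
  refine Finset.sum_congr rfl fun d hd => ?_
  have hd4 : d 0 + d 1 = 4 := by
    have := hf (MvPolynomial.mem_support_iff.mp hd)
    simpa [Finsupp.weight_apply, Finsupp.sum_fintype, Fin.sum_univ_two] using this
  have hm : (monomial d (coeff d f) : MvPolynomial (Fin 2) F) =
      C (coeff d f) * (X 0 ^ d 0 * X 1 ^ d 1) := by
    rw [monomial_eq, Finsupp.prod_fintype _ _ (by simp)]
    simp [Fin.prod_univ_two]
  rw [hm, smul_eq_C_mul, ← hd4]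
  simp only [map_mul, map_pow, aeval_X, algHom_C, algebraMap_eq, pow_add]
  ring

/-- The induced action of `PGL₂(F)` on the projective space of binary quartic forms. -/
instance {F : Type*} [Field F] :
    MulAction (Matrix.ProjGenLinGroup (Fin 2) F) (ProjQuartic F) :=
  Matrix.ProjGenLinGroup.mulActionOfGL (by
    intro u P
    induction P using Projectivization.ind with
    | h v hv =>
      rw [Projectivization.smul_mk, Projectivization.mk_eq_mk_iff']
      exact ⟨(u : F) ^ 4, Subtype.ext (subst_scalar (u : F) v.2).symm⟩)

/-! ### Invariants -/

/-- The coefficients `z₀, …, z₄` of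
`f = z₀ Y⁴ - 4 z₁ Y³X + 6 z₂ Y²X² - 4 z₃ YX³ + z₄ X⁴`. -/
def z {F : Type*} [Field F] (f : MvPolynomial (Fin 2) F) (i : Fin 5) : F :=
  coeff (Finsupp.single 0 (i : ℕ) + Finsupp.single 1 (4 - (i : ℕ))) f /
    ((-1) ^ (i : ℕ) * (Nat.choose 4 i : F))

/-- The apolar invariant. -/
def invI {F : Type*} [Field F] (f : MvPolynomial (Fin 2) F) : F :=
  (z f 0 * z f 4 - 4 * z f 1 * z f 3 + 3 * z f 2 ^ 2) / 3

/-- The catalecticant invariant. -/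
def invJ {F : Type*} [Field F] (f : MvPolynomial (Fin 2) F) : F :=
  Matrix.det !![z f 0, z f 1, z f 2; z f 1, z f 2, z f 3; z f 2, z f 3, z f 4]

/-- The discriminant `Δ = I³ - J²`. -/
def disc {F : Type*} [Field F] (f : MvPolynomial (Fin 2) F) : F :=
  invI f ^ 3 - invJ f ^ 2

/-- The `j`-invariant of a form with nonzero discriminant: the solution `j` of
`1 - 1728 / j = J² / I³`, equivalently of `j / (j - 1728) = I³ / J²`; in particular `j = 0`
if `I = 0` and `j = 1728` if `J = 0`. -/
def jInv {F : Type*} [Field F] (f : MvPolynomial (Fin 2) F) : F :=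
  1728 * invI f ^ 3 / disc f

theorem z_smul {F : Type*} [Field F] (t : F) (f : MvPolynomial (Fin 2) F) (i : Fin 5) :
    z (t • f) i = t * z f i := by
  simp [z, mul_div_assoc]

theorem invI_smul {F : Type*} [Field F] (t : F) (f : MvPolynomial (Fin 2) F) :
    invI (t • f) = t ^ 2 * invI f := by
  simp only [invI, z_smul]; ring

theorem invJ_smul {F : Type*} [Field F] (t : F) (f : MvPolynomial (Fin 2) F) :
    invJ (t • f) = t ^ 3 * invJ f := by
  simp only [invJ, z_smul, Matrix.det_fin_three]
  simp
  ring

theorem disc_smul {F : Type*} [Field F] (t : F) (f : MvPolynomial (Fin 2) F) :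
    disc (t • f) = t ^ 6 * disc f := by
  simp only [disc, invI_smul, invJ_smul]; ring

theorem jInv_smul {F : Type*} [Field F] {t : F} (ht : t ≠ 0) (f : MvPolynomial (Fin 2) F) :
    jInv (t • f) = jInv f := by
  have h6 : t ^ 6 ≠ 0 := pow_ne_zero 6 ht
  rw [jInv, jInv, disc_smul, invI_smul,
    show 1728 * (t ^ 2 * invI f) ^ 3 = t ^ 6 * (1728 * invI f ^ 3) by ring,
    mul_div_mul_left _ _ h6]

/-- The point `P` of the projective space of forms has nonzero discriminant. -/
def DiscNeZero {F : Type*} [Field F] (P : ProjQuartic F) : Prop :=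
  Projectivization.lift (fun f : {v : QuarticForm F // v ≠ 0} => disc (f.1.1 : MvPolynomial (Fin 2) F) ≠ 0)
    (by
      intro a b t h
      have ht : t ≠ 0 := by
        rintro rfl
        exact a.2 (by simpa using h)
      have h' : (a.1.1 : MvPolynomial (Fin 2) F) = t • (b.1.1 : MvPolynomial (Fin 2) F) :=
        congrArg Subtype.val h
      simp [h', disc_smul, ht]) P

/-- The `j`-invariant of a point of the projective space of forms. -/
def projJ {F : Type*} [Field F] (P : ProjQuartic F) : F :=
  Projectivization.lift (fun f : {v : QuarticForm F // v ≠ 0} => jInv (f.1.1 : MvPolynomial (Fin 2) F))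
    (by
      intro a b t h
      have ht : t ≠ 0 := by
        rintro rfl
        exact a.2 (by simpa using h)
      have h' : (a.1.1 : MvPolynomial (Fin 2) F) = t • (b.1.1 : MvPolynomial (Fin 2) F) :=
        congrArg Subtype.val h
      simp [h', jInv_smul ht]) P

/-! ### Orbits and the sets `J₄`, `J₂`, `J₁` -/

/-- The `PGL₂(F)`-orbit of a point. -/
abbrev orb {F : Type*} [Field F] (P : ProjQuartic F) : Set (ProjQuartic F) :=
  MulAction.orbit (Matrix.ProjGenLinGroup (Fin 2) F) P

/-- The set of `PGL₂(F)`-orbits of forms with nonzero discriminant. -/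
def orbits (F : Type*) [Field F] : Set (Set (ProjQuartic F)) :=
  {O | ∃ P : ProjQuartic F, DiscNeZero P ∧ O = orb P}

/-- The number of orbits with nonzero discriminant, of `j`-invariant `r` and of size
`|PGL₂(F)| / d`. -/
def orbitCount {F : Type*} [Field F] (r : F) (d : ℕ) : ℕ :=
  {O ∈ orbits F | (∀ P ∈ O, projJ P = r) ∧
    O.ncard * d = Nat.card (Matrix.ProjGenLinGroup (Fin 2) F)}.ncard

/-- `Jset F i` is the set `Jᵢ` of those `r ≠ 0, 1728` for which
`Z³ - 4 Z² + (256/27) (1 - 1728/r)` has exactly `i - 1` roots in `F`. -/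
def Jset (F : Type*) [Field F] (i : ℕ) : Set F :=
  {r | r ≠ 0 ∧ r ≠ 1728 ∧
    {w : F | w ^ 3 - 4 * w ^ 2 + 256 / 27 * (1 - 1728 / r) = 0}.ncard + 1 = i}

/-! ### Types of forms -/

/-- The types of forms with nonzero discriminant. -/
inductive FormType
  | F4
  | F2
  | F1
  | F4'
  | F2'

/-- The number of linear factors over `F`, up to scalars, of a form without repeated factors,
counted as the points `(s : t)` of the projective line over `F` at which the form vanishes:
`tX - sY` divides `f` if and only if `f(s, t) = 0`. -/
def numLinearFactors {F : Type*} [Field F] (f : MvPolynomial (Fin 2) F) : ℕ :=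
  {p : Projectivization F (Fin 2 → F) | eval p.rep f = 0}.ncard

/-- The degree over `F` of the splitting field of the form `f`, i.e. of `f(1, Y)`. -/
def splittingDegree {F : Type*} [Field F] (f : MvPolynomial (Fin 2) F) : ℕ :=
  Module.finrank F
    (Polynomial.SplittingField (aeval ![(1 : Polynomial F), Polynomial.X] f))

/-- A form with nonzero discriminant has type `Fᵢ`, `i = 1, 2, 4`, if it has exactly `i` linear
factors over `F = 𝔽_q`; it has type `F₄'` or `F₂'` if it has no linear factor over `F` and its
splitting field is `𝔽_{q²}` or `𝔽_{q⁴}`, respectively. -/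
def HasType {F : Type*} [Field F] (f : MvPolynomial (Fin 2) F) : FormType → Prop
  | .F4 => numLinearFactors f = 4
  | .F2 => numLinearFactors f = 2
  | .F1 => numLinearFactors f = 1
  | .F4' => numLinearFactors f = 0 ∧ splittingDegree f = 2
  | .F2' => numLinearFactors f = 0 ∧ splittingDegree f = 4

/-- `f` is a nonzero quartic form and `P` is its class in the projective space of forms. -/
def IsClass {F : Type*} [Field F] (f : MvPolynomial (Fin 2) F) (P : ProjQuartic F) : Prop :=
  ∃ (hf : f ∈ homogeneousSubmodule (Fin 2) F 4) (h0 : (⟨f, hf⟩ : QuarticForm F) ≠ 0),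
    P = Projectivization.mk F ⟨f, hf⟩ h0

/-- `f` is a quartic form with nonzero discriminant, `j`-invariant `r` and type `T`, whose class
has stabilizer in `PGL₂(F)` isomorphic to `H`. -/
def Row {F : Type*} [Field F] (f : MvPolynomial (Fin 2) F) (r : F) (T : FormType)
    (H : Type) [Group H] : Prop :=
  ∃ P : ProjQuartic F, IsClass f P ∧ DiscNeZero P ∧ projJ P = r ∧ HasType f T ∧
    Nonempty (MulAction.stabilizer (Matrix.ProjGenLinGroup (Fin 2) F) P ≃* H)

/-- The cyclic group of order `n`. -/
abbrev Cyc (n : ℕ) : Type := Multiplicative (ZMod n)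

/-! ### Representatives -/

/-- The form `X ((256/27) (1 - 1728/r) Y³ - 4 Y X² + X³)`. -/
def formE {F : Type*} [Field F] (r : F) : MvPolynomial (Fin 2) F :=
  X 0 * (C (256 / 27 * (1 - 1728 / r)) * X 1 ^ 3 - 4 * X 1 * X 0 ^ 2 + X 0 ^ 3)

/-- The form `X (Y³ - c X³)`. -/
def formCube {F : Type*} [Field F] (c : F) : MvPolynomial (Fin 2) F :=
  X 0 * (X 1 ^ 3 - C c * X 0 ^ 3)

/-- The form `X Y (Y² - c X²)`. -/
def formSq {F : Type*} [Field F] (c : F) : MvPolynomial (Fin 2) F :=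
  X 0 * X 1 * (X 1 ^ 2 - C c * X 0 ^ 2)

/-- The form `(Y² - ε X²)(Y - α X)(Y - φ(α) X)`, where `α` lies in the quadratic extension `K` of
the finite field `F` and `φ` is the Frobenius of `K` over `F`, so that `α + φ(α)` is the trace and
`α φ(α)` is the norm of `α`. -/
def formPsi {F K : Type*} [Field F] [Field K] [Algebra F K] (ε : F) (α : K) :
    MvPolynomial (Fin 2) F :=
  (X 1 ^ 2 - C ε * X 0 ^ 2) *
    (X 1 ^ 2 - C (Algebra.trace F K α) * X 0 * X 1 + C (Algebra.norm F α) * X 0 ^ 2)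

open Classical in
/-- The forms `υ'_t` for `q ≡ 1 mod 4`; here `sq` is a choice of square roots in `F`. -/
def formUpsilon1 {F : Type*} [Field F] (γ : F) (sq : F → F) (t : F) :
    MvPolynomial (Fin 2) F :=
  if IsSquare (γ * t) then
    (X 1 ^ 2 - C t * X 0 ^ 2) ^ 2 - C γ * X 0 ^ 4 - C (4 * sq (γ * t)) * X 0 ^ 3 * X 1
  else
    (X 1 ^ 2 - C (γ * t) * X 0 ^ 2) ^ 2 - C (γ ^ 3) * X 0 ^ 4
      - C (4 * γ ^ 2 * sq t) * X 0 ^ 3 * X 1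

open Classical in
/-- The forms `υ'_t` for `q ≡ 3 mod 4`; here `sq` is a choice of square roots in `F`. -/
def formUpsilon3 {F : Type*} [Field F] (θ₀ θ₁ : F) (sq : F → F) (t : F) :
    MvPolynomial (Fin 2) F :=
  if IsSquare (-t) then
    (X 1 ^ 2 - C t * X 0 ^ 2) ^ 2 - X 0 ^ 4
      + 2 * X 0 ^ 2 * ((X 1 ^ 2 + C t * X 0 ^ 2) * C θ₀ + 2 * X 0 * X 1 * C (sq (-t) * θ₁))
  else
    (X 1 ^ 2 + C t * X 0 ^ 2) ^ 2 - X 0 ^ 4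
      - 2 * X 0 ^ 2 * ((X 1 ^ 2 - C t * X 0 ^ 2) * C θ₀ - 2 * X 0 * X 1 * C (sq t * θ₁))

/-- The `j`-invariant of a cross-ratio. -/
def jLambda {L : Type*} [Field L] (l : L) : L :=
  256 * (l ^ 2 - l + 1) ^ 3 / (l ^ 2 * (l - 1) ^ 2)

/-- `l` is none of `-1`, `2`, `1/2`, `-ω`, `-ω²`, where `ω` is a primitive cube root of unity. -/
def Generic {L : Type*} [Field L] (l : L) : Prop :=
  l ≠ -1 ∧ l ≠ 2 ∧ l ≠ 2⁻¹ ∧ ¬ IsPrimitiveRoot (-l) 3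

/-- The set `{l ∈ K : l ≠ 1, N(l) = 1}`. -/
def N2tilde (F K : Type*) [Field F] [Field K] [Algebra F K] : Set K :=
  {l | l ≠ 1 ∧ Algebra.norm F l = 1}

/-- The map `t ↦ (t - ιη/2) / (t + ιη/2)` if `q ≡ 1 mod 4`, and
`t ↦ (2t + θ₀ + ι) / (2t + θ₀ - ι)` otherwise. -/
def chiT {F K : Type*} [Field F] [Field K] [Algebra F K] (ι η : K) (θ₀ t : F) : K :=
  if Nat.card F % 4 = 1 then
    (algebraMap F K t - ι * η / 2) / (algebraMap F K t + ι * η / 2)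
  else
    (algebraMap F K (2 * t + θ₀) + ι) / (algebraMap F K (2 * t + θ₀) - ι)

/-- The auxiliary choices in the list of representatives. Here `F = 𝔽_q` and `K = 𝔽_{q²}`. -/
structure Choices (F K : Type*) [Field F] [Field K] [Algebra F K] where
  /-- a quadratic non-residue `ε` -/
  ε : F
  ε_nonsquare : ¬ IsSquare ε
  /-- a generator `γ` of the multiplicative group -/
  γ : Fˣ
  γ_generator : ∀ x : Fˣ, x ∈ Subgroup.zpowers γ
  /-- a square root of `ε` -/
  rootε : K
  rootε_sq : rootε ^ 2 = algebraMap F K ε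
  /-- a square root of `-1` -/
  ι : K
  ι_sq : ι ^ 2 = -1
  /-- a square root `η = θ²` of `γ = θ⁴` -/
  η : K
  η_sq : η ^ 2 = algebraMap F K γ
  /-- `θ₀ + ι θ₁` has norm `-1` and `θ₀` is a non-square, if `q ≡ 3 mod 4` -/
  θ₀ : F
  θ₁ : F
  θ_norm : Nat.card F % 4 = 3 → θ₀ ^ 2 + θ₁ ^ 2 = -1
  θ₀_nonsquare : Nat.card F % 4 = 3 → ¬ IsSquare θ₀
  /-- square roots of the squares of `F` -/
  sq : F → F
  sq_sq : ∀ x : F, IsSquare x → sq x ^ 2 = x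
  /-- for each class `{l, l⁻¹}` in `F \ {0, 1}`, an element `α ∈ K \ (F ∪ {±√ε})` such that
  `N((α - √ε) / (α + √ε)) ∈ {l, l⁻¹}` -/
  α : F → K
  α_inv : ∀ l : F, l ≠ 0 → l ≠ 1 → α l⁻¹ = α l
  α_mem : ∀ l : F, l ≠ 0 → l ≠ 1 →
    α l ∉ Set.range (algebraMap F K) ∧ α l ≠ rootε ∧ α l ≠ -rootε
  α_spec : ∀ l : F, l ≠ 0 → l ≠ 1 →
    Algebra.norm F ((α l - rootε) / (α l + rootε)) = l ∨
    Algebra.norm F ((α l - rootε) / (α l + rootε)) = l⁻¹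
  /-- for each class `{l, l⁻¹}` of elements `l ≠ 1` of norm `1`, an element `t ∈ F` whose image
  under `chiT` is `l` or `l⁻¹` -/
  t : K → F
  t_inv : ∀ l ∈ N2tilde F K, t l⁻¹ = t l
  t_spec : ∀ l ∈ N2tilde F K, chiT ι η θ₀ (t l) = l ∨ chiT ι η θ₀ (t l) = l⁻¹

namespace Choices

variable {F K : Type*} [Field F] [Field K] [Algebra F K]

/-- The representative `ψ'_α` for the class `{l, l⁻¹}` in `F \ {0, 1}`. -/
def psi (c : Choices F K) (l : F) : MvPolynomial (Fin 2) F := formPsi c.ε (c.α l)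

/-- The representative `υ'_t` for the class `{l, l⁻¹}` of elements of `K` of norm `1`. -/
def upsilon (c : Choices F K) (l : K) : MvPolynomial (Fin 2) F :=
  if Nat.card F % 4 = 1 then formUpsilon1 (c.γ : F) c.sq (c.t l)
  else formUpsilon3 c.θ₀ c.θ₁ c.sq (c.t l)

/-- The list of all representatives. -/
def reps (c : Choices F K) : Set (MvPolynomial (Fin 2) F) :=
  {f | (∃ r : F, r ≠ 0 ∧ r ≠ 1728 ∧ f = formE r) ∨
    f = formSq 1 ∨ f = formSq c.ε ∨ f = formCube 1 ∨
    (Nat.card F % 3 = 1 ∧ (f = formCube (c.γ : F) ∨ f = formCube ((c.γ : F) ^ 2))) ∨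
    (∃ l : F, l ≠ 0 ∧ l ≠ 1 ∧ f = c.psi l) ∨
    (∃ l ∈ N2tilde F K, f = c.upsilon l)}

end Choices

end BinaryQuartic

end

open BinaryQuartic

noncomputable section

namespace BinaryQuartic

open MvPolynomial

/-! ### Quartic forms by coefficients -/

/-! The classification is proved by counting, not by reducing an arbitrary form to a normal form.
Let G be `PGL₂(F)`, of order q³ - q. There are q⁴ - q² = q·|G| points with Δ ≠ 0
(`ncard_discNeZero`), that is, |G| points for each value of `j` on average. For every r in F one
exhibits pairwise inequivalent forms with `j = r` whose stabilizers have orders nᵢ with ∑ 1/nᵢ = 1.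
By orbit-stabilizer their orbits have |G| points together, so each fibre of `j` has at least |G|
points. Comparison with the total makes all these inequalities equalities, hence the listed orbits
are all orbits (`IsFamily.exists_mem_orb`).

A stabilizer is computed by following one root of the form: its order is at most the number of
possible images of that root times the number of elements fixing it (`card_le_of_cosets`), and
explicit elements attain the bound. The root is the point (0 : 1) for the forms with a linear factor
X. It is √ε for ψ' (`PsiData.exists_isFixing`), where comparison of coordinates over F restricts the
matrix. For υ' it is a root generating an extension of degree four (`UpsData.cases_of_carries`);
there no nontrivial element fixes it.

The forms over a given r ≠ 0, 1728 are found from the cross-ratio λ, with `j(λ) = r`. A root w in F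
of the resolvent cubic is a rational function of u = λ + 1/λ and conversely
(`exists_trace_of_root`), and Z² - uZ + 1 has its roots either in F or among the elements of norm
one of K. In the first case the resolvent has three roots in F, in the second exactly one
(`jLambda_mem_Jset_four`, `mem_Jset_two`). Of the six cross-ratios with the same `j`, grouped into
classes {λ, 1/λ}, the first case gives three classes and so three forms ψ'; the second gives one
class and one form υ'. Together with `formE r` the masses are 4·(1/4) over J₄, 2·(1/2) over J₂ and 1
over J₁. The values 1728 and 0 have their own lists.

Inequivalence is read off from having or not having a root in F, from the stabilizer, and from the
class {λ, 1/λ} for forms ψ' (`PsiData.param_eq_of_carries`); only X(Y³ - γX³) and X(Y³ - γ²X³) need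
a separate argument.

For r ≠ 0, 1728 the number of orbits is one more than the number of roots of the resolvent. Since w
determines r rationally, these roots can be counted over all such r at once: there are q - 4
(`sum_resolventRoots`). With five orbits over 1728 and 3 + μ over 0 this gives 2q + 2 + μ. -/

/-- The form `v₀ Y⁴ + v₁ Y³X + v₂ Y²X² + v₃ YX³ + v₄ X⁴`. -/
def ofCoeffs {F : Type*} [Field F] (v : Fin 5 → F) : MvPolynomial (Fin 2) F :=
  C (v 0) * X 1 ^ 4 + C (v 1) * X 1 ^ 3 * X 0 + C (v 2) * X 1 ^ 2 * X 0 ^ 2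
    + C (v 3) * X 1 * X 0 ^ 3 + C (v 4) * X 0 ^ 4

/-- The coefficients of `f(dX - bY, aY - cX)`, where `f` has coefficients `v`. -/
def act {F : Type*} [Field F] (a b c d : F) (v : Fin 5 → F) : Fin 5 → F :=
  ![v 0 * a ^ 4 - v 1 * a ^ 3 * b + v 2 * a ^ 2 * b ^ 2 - v 3 * a * b ^ 3 + v 4 * b ^ 4,
    -4 * v 0 * a ^ 3 * c + v 1 * (a ^ 3 * d + 3 * a ^ 2 * b * c)
      - 2 * v 2 * (a ^ 2 * b * d + a * b ^ 2 * c) + v 3 * (3 * a * b ^ 2 * d + b ^ 3 * c)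
      - 4 * v 4 * b ^ 3 * d,
    6 * v 0 * a ^ 2 * c ^ 2 - 3 * v 1 * (a ^ 2 * c * d + a * b * c ^ 2)
      + v 2 * (a ^ 2 * d ^ 2 + 4 * a * b * c * d + b ^ 2 * c ^ 2)
      - 3 * v 3 * (a * b * d ^ 2 + b ^ 2 * c * d) + 6 * v 4 * b ^ 2 * d ^ 2,
    -4 * v 0 * a * c ^ 3 + v 1 * (3 * a * c ^ 2 * d + b * c ^ 3)
      - 2 * v 2 * (a * c * d ^ 2 + b * c ^ 2 * d) + v 3 * (a * d ^ 3 + 3 * b * c * d ^ 2)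
      - 4 * v 4 * b * d ^ 3,
    v 0 * c ^ 4 - v 1 * c ^ 3 * d + v 2 * c ^ 2 * d ^ 2 - v 3 * c * d ^ 3 + v 4 * d ^ 4]

section

variable {F : Type*} [Field F]

theorem ofCoeffs_mem (v : Fin 5 → F) : ofCoeffs v ∈ homogeneousSubmodule (Fin 2) F 4 := by
  rw [mem_homogeneousSubmodule]
  have hX : ∀ (i : Fin 2) (n : ℕ), (X i ^ n : MvPolynomial (Fin 2) F).IsHomogeneous n :=
    fun i n => isHomogeneous_X_pow i n
  have h1 : (C (v 1) * X 1 ^ 3 * X 0 : MvPolynomial (Fin 2) F).IsHomogeneous 4 :=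
    ((hX 1 3).C_mul (v 1)).mul (isHomogeneous_X F 0)
  have h2 : (C (v 2) * X 1 ^ 2 * X 0 ^ 2 : MvPolynomial (Fin 2) F).IsHomogeneous 4 :=
    ((hX 1 2).C_mul (v 2)).mul (hX 0 2)
  have h3 : (C (v 3) * X 1 * X 0 ^ 3 : MvPolynomial (Fin 2) F).IsHomogeneous 4 :=
    ((isHomogeneous_X F 1).C_mul (v 3)).mul (hX 0 3)
  exact (((((hX 1 4).C_mul _).add h1).add h2).add h3).add ((hX 0 4).C_mul _)

theorem coeff_ofCoeffs (v : Fin 5 → F) (i : Fin 5) :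
    coeff (Finsupp.single 0 (i : ℕ) + Finsupp.single 1 (4 - (i : ℕ))) (ofCoeffs v) = v i := by
  have hm : ∀ (a b : ℕ) (c : F), (C c * X 1 ^ a * X 0 ^ b : MvPolynomial (Fin 2) F) =
      monomial (Finsupp.single 0 b + Finsupp.single 1 a) c := by
    intro a b c
    rw [X_pow_eq_monomial, X_pow_eq_monomial, C_mul_monomial, monomial_mul, add_comm]
    simp
  have e : ofCoeffs v = monomial (Finsupp.single 0 0 + Finsupp.single 1 4) (v 0)
      + monomial (Finsupp.single 0 1 + Finsupp.single 1 3) (v 1)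
      + monomial (Finsupp.single 0 2 + Finsupp.single 1 2) (v 2)
      + monomial (Finsupp.single 0 3 + Finsupp.single 1 1) (v 3)
      + monomial (Finsupp.single 0 4 + Finsupp.single 1 0) (v 4) := by
    simp only [← hm, ofCoeffs, pow_zero, pow_one, mul_one]
  have key : ∀ a b a' b' : ℕ, ((Finsupp.single (0 : Fin 2) a + Finsupp.single 1 b : Fin 2 →₀ ℕ) =
      Finsupp.single 0 a' + Finsupp.single 1 b') ↔ (a = a' ∧ b = b') := by
    intro a b a' b'
    constructor
    · intro h
      have h0 := DFunLike.congr_fun h 0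
      have h1 := DFunLike.congr_fun h 1
      simp at h0 h1
      exact ⟨h0, h1⟩
    · rintro ⟨rfl, rfl⟩; rfl
  rw [e]
  simp only [coeff_add, coeff_monomial, key]
  fin_cases i <;> simp

theorem exists_eq_ofCoeffs {f : MvPolynomial (Fin 2) F}
    (hf : f ∈ homogeneousSubmodule (Fin 2) F 4) : ∃ v, f = ofCoeffs v := by
  refine ⟨fun i => coeff (Finsupp.single 0 (i : ℕ) + Finsupp.single 1 (4 - (i : ℕ))) f, ?_⟩
  ext m
  by_cases hm : m 0 + m 1 = 4
  · obtain ⟨i, hi⟩ : ∃ i : Fin 5, m = Finsupp.single 0 (i : ℕ) + Finsupp.single 1 (4 - (i : ℕ)) := by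
      refine ⟨⟨m 0, by omega⟩, ?_⟩
      ext j
      fin_cases j
      · simp
      · simp; omega
    rw [hi, coeff_ofCoeffs]
  · have hd : m.degree ≠ 4 := by
      simpa [Finsupp.degree_eq_sum, Fin.sum_univ_two] using hm
    have h1 := (mem_homogeneousSubmodule 4 f).mp hf
    have h2 := (mem_homogeneousSubmodule 4 _).mp (ofCoeffs_mem
      (fun i : Fin 5 => coeff (Finsupp.single 0 (i : ℕ) + Finsupp.single 1 (4 - (i : ℕ))) f))
    rw [h1.coeff_eq_zero hd, h2.coeff_eq_zero hd]

theorem ofCoeffs_injective : Function.Injective (ofCoeffs : (Fin 5 → F) → _) := by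
  intro v w h
  funext i
  rw [← coeff_ofCoeffs v i, h, coeff_ofCoeffs]

theorem ofCoeffs_smul (c : F) (v : Fin 5 → F) : ofCoeffs (c • v) = c • ofCoeffs v := by
  simp only [ofCoeffs, Pi.smul_apply, smul_eq_mul, map_mul, smul_eq_C_mul]
  ring

theorem subst_ofCoeffs (g : Matrix (Fin 2) (Fin 2) F) (v : Fin 5 → F) :
    subst g (ofCoeffs v) = ofCoeffs (act (g 0 0) (g 0 1) (g 1 0) (g 1 1) v) := by
  simp [subst, ofCoeffs, act, map_ofNat C]
  ring

theorem z_ofCoeffs (v : Fin 5 → F) (i : Fin 5) :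
    z (ofCoeffs v) i = v i / ((-1) ^ (i : ℕ) * (Nat.choose 4 i : F)) := by
  rw [z, coeff_ofCoeffs]

/-- The value of a form with coefficients `v` at the point `(x, y)` of an extension field. -/
def value {L : Type*} [Field L] [Algebra F L] (v : Fin 5 → F) (x y : L) : L :=
  algebraMap F L (v 0) * y ^ 4 + algebraMap F L (v 1) * y ^ 3 * x
    + algebraMap F L (v 2) * y ^ 2 * x ^ 2 + algebraMap F L (v 3) * y * x ^ 3
    + algebraMap F L (v 4) * x ^ 4

theorem value_act {L : Type*} [Field L] [Algebra F L] (a b c d : F) (v : Fin 5 → F) (x y : L) :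
    value (act a b c d v) x y = value v (algebraMap F L d * x - algebraMap F L b * y)
      (algebraMap F L a * y - algebraMap F L c * x) := by
  simp [value, act, map_ofNat (algebraMap F L)]
  ring

theorem value_smul {L : Type*} [Field L] [Algebra F L] (k : F) (v : Fin 5 → F) (x y : L) :
    value (k • v) x y = algebraMap F L k * value v x y := by
  simp [value]
  ring

theorem value_mul {L : Type*} [Field L] [Algebra F L] (k : L) (v : Fin 5 → F) (x y : L) :
    value v (k * x) (k * y) = k ^ 4 * value v x y := by
  simp [value]
  ring

theorem eval_ofCoeffs (v : Fin 5 → F) (p : Fin 2 → F) :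
    eval p (ofCoeffs v) = value v (p 0) (p 1) := by
  simp [ofCoeffs, value]

/-- The transformation with matrix `(a b; c d)` maps the form with coefficients `v` to a multiple
of the form with coefficients `w`. -/
def Carries (a b c d : F) (v w : Fin 5 → F) : Prop :=
  ∃ k : F, k ≠ 0 ∧ act a b c d v = k • w

/-- The adjugate of the matrix takes the image of (x, y) back to det·(x, y), where `v` vanishes by
homogeneity. The determinant may be zero, and the points may lie in any extension: this is how roots
outside F are followed. -/
theorem Carries.value_eq_zero {L : Type*} [Field L] [Algebra F L] {a b c d : F} {v w : Fin 5 → F}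
    (h : Carries a b c d v w) {x y : L} (hv : value v x y = 0) :
    value w (algebraMap F L a * x + algebraMap F L b * y)
      (algebraMap F L c * x + algebraMap F L d * y) = 0 := by
  obtain ⟨k, hk, e⟩ := h
  have h1 := value_act a b c d v (algebraMap F L a * x + algebraMap F L b * y)
    (algebraMap F L c * x + algebraMap F L d * y)
  rw [e, value_smul] at h1
  have h2 : value v (algebraMap F L d * (algebraMap F L a * x + algebraMap F L b * y)
      - algebraMap F L b * (algebraMap F L c * x + algebraMap F L d * y))
      (algebraMap F L a * (algebraMap F L c * x + algebraMap F L d * y)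
      - algebraMap F L c * (algebraMap F L a * x + algebraMap F L b * y)) = 0 := by
    have := value_mul (algebraMap F L (a * d - b * c)) v x y
    rw [hv, mul_zero] at this
    rw [← this]
    simp only [map_sub, map_mul]
    congr 1 <;> ring
  rw [h2] at h1
  exact (mul_eq_zero.mp h1).resolve_left (by simpa using hk)

/-! ### The invariants in terms of the coefficients -/

/-- The apolar invariant of the form with coefficients `v`. -/
def coeffI (v : Fin 5 → F) : F := (12 * v 0 * v 4 - 3 * v 1 * v 3 + v 2 ^ 2) / 36

/-- The catalecticant invariant of the form with coefficients `v`. -/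
def coeffJ (v : Fin 5 → F) : F :=
  (72 * v 0 * v 2 * v 4 + 9 * v 1 * v 2 * v 3 - 2 * v 2 ^ 3 - 27 * v 0 * v 3 ^ 2
    - 27 * v 1 ^ 2 * v 4) / 432

/-- The discriminant of the form with coefficients `v`. -/
def coeffDisc (v : Fin 5 → F) : F := coeffI v ^ 3 - coeffJ v ^ 2

theorem invI_ofCoeffs (h2 : (2 : F) ≠ 0) (h3 : (3 : F) ≠ 0) (v : Fin 5 → F) :
    invI (ofCoeffs v) = coeffI v := by
  have h4 : (4 : F) ≠ 0 := by rw [show (4 : F) = 2 * 2 by norm_num]; positivity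
  have h6 : (6 : F) ≠ 0 := by rw [show (6 : F) = 2 * 3 by norm_num]; positivity
  have h36 : (36 : F) ≠ 0 := by rw [show (36 : F) = 6 * 6 by norm_num]; positivity
  simp [invI, z_ofCoeffs, coeffI, Nat.choose]
  field_simp
  ring

theorem invJ_ofCoeffs (h2 : (2 : F) ≠ 0) (h3 : (3 : F) ≠ 0) (v : Fin 5 → F) :
    invJ (ofCoeffs v) = coeffJ v := by
  have h4 : (4 : F) ≠ 0 := by rw [show (4 : F) = 2 * 2 by norm_num]; positivity
  have h6 : (6 : F) ≠ 0 := by rw [show (6 : F) = 2 * 3 by norm_num]; positivity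
  have h432 : (432 : F) ≠ 0 := by
    rw [show (432 : F) = 6 * 6 * 4 * 3 by norm_num]; positivity
  simp [invJ, z_ofCoeffs, coeffJ, Nat.choose, Matrix.det_fin_three]
  field_simp
  ring

theorem disc_ofCoeffs (h2 : (2 : F) ≠ 0) (h3 : (3 : F) ≠ 0) (v : Fin 5 → F) :
    disc (ofCoeffs v) = coeffDisc v := by
  rw [disc, invI_ofCoeffs h2 h3, invJ_ofCoeffs h2 h3, coeffDisc]

theorem jInv_ofCoeffs (h2 : (2 : F) ≠ 0) (h3 : (3 : F) ≠ 0) (v : Fin 5 → F) :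
    jInv (ofCoeffs v) = 1728 * coeffI v ^ 3 / coeffDisc v := by
  rw [jInv, invI_ofCoeffs h2 h3, disc_ofCoeffs h2 h3]

theorem coeffI_smul (k : F) (v : Fin 5 → F) : coeffI (k • v) = k ^ 2 * coeffI v := by
  simp only [coeffI, Pi.smul_apply, smul_eq_mul]
  ring

theorem coeffJ_smul (k : F) (v : Fin 5 → F) : coeffJ (k • v) = k ^ 3 * coeffJ v := by
  simp only [coeffJ, Pi.smul_apply, smul_eq_mul]
  ring

/-- `I` and `J` are covariants of weights 4 and 6 and of degrees 2 and 3, so `I³` and `J²` acquire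
the same factor under substitution and under scaling. -/
theorem coeffI_act (a b c d : F) (v : Fin 5 → F) :
    coeffI (act a b c d v) = (a * d - b * c) ^ 4 * coeffI v := by
  simp only [coeffI, act, Matrix.cons_val]
  ring

theorem coeffJ_act (a b c d : F) (v : Fin 5 → F) :
    coeffJ (act a b c d v) = (a * d - b * c) ^ 6 * coeffJ v := by
  simp only [coeffJ, act, Matrix.cons_val]
  ring

theorem coeffDisc_act (a b c d : F) (v : Fin 5 → F) :
    coeffDisc (act a b c d v) = (a * d - b * c) ^ 12 * coeffDisc v := by
  simp only [coeffDisc, coeffI_act, coeffJ_act]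
  ring

end

end BinaryQuartic

end

noncomputable section

namespace BinaryQuartic

open MvPolynomial

/-! ### Points of the projective space and elements of `PGL₂` -/

section

variable {F : Type*} [Field F]

theorem ofCoeffs_ne_zero {v : Fin 5 → F} (hv : v ≠ 0) :
    (⟨ofCoeffs v, ofCoeffs_mem v⟩ : QuarticForm F) ≠ 0 := by
  intro h
  apply hv
  apply ofCoeffs_injective
  have h0 : ofCoeffs v = 0 := congrArg Subtype.val h
  rw [h0]
  simp [ofCoeffs]

/-- The point of the projective space of forms with coefficients `v`. -/
def point (v : Fin 5 → F) (hv : v ≠ 0) : ProjQuartic F :=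
  Projectivization.mk F ⟨ofCoeffs v, ofCoeffs_mem v⟩ (ofCoeffs_ne_zero hv)

theorem isClass_ofCoeffs_iff {v : Fin 5 → F} {P : ProjQuartic F} :
    IsClass (ofCoeffs v) P ↔ ∃ hv : v ≠ 0, P = point v hv := by
  constructor
  · rintro ⟨hf, h0, rfl⟩
    refine ⟨?_, rfl⟩
    rintro rfl
    exact h0 (Subtype.ext (by simp [ofCoeffs]))
  · rintro ⟨hv, rfl⟩
    exact ⟨ofCoeffs_mem v, _, rfl⟩

theorem exists_eq_point (P : ProjQuartic F) : ∃ v, ∃ hv : v ≠ 0, P = point v hv := by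
  induction P using Projectivization.ind with
  | h f hf =>
    obtain ⟨f, hm⟩ := f
    obtain ⟨v, rfl⟩ := exists_eq_ofCoeffs hm
    exact ⟨v, isClass_ofCoeffs_iff.mp ⟨hm, hf, rfl⟩⟩

theorem point_eq_point_iff {v w : Fin 5 → F} {hv : v ≠ 0} {hw : w ≠ 0} :
    point v hv = point w hw ↔ ∃ k : F, k ≠ 0 ∧ v = k • w := by
  rw [point, point, Projectivization.mk_eq_mk_iff']
  constructor
  · rintro ⟨k, hk⟩
    have e : k • ofCoeffs w = ofCoeffs v := congrArg Subtype.val hk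
    rw [← ofCoeffs_smul] at e
    have := ofCoeffs_injective e
    refine ⟨k, ?_, this.symm⟩
    rintro rfl
    exact hv (by rw [← this, zero_smul])
  · rintro ⟨k, -, rfl⟩
    exact ⟨k, Subtype.ext (ofCoeffs_smul k w).symm⟩

theorem discNeZero_point (h2 : (2 : F) ≠ 0) (h3 : (3 : F) ≠ 0) {v : Fin 5 → F} (hv : v ≠ 0) :
    DiscNeZero (point v hv) ↔ coeffDisc v ≠ 0 := by
  rw [← disc_ofCoeffs h2 h3]
  rfl

theorem projJ_point (h2 : (2 : F) ≠ 0) (h3 : (3 : F) ≠ 0) {v : Fin 5 → F} (hv : v ≠ 0) :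
    projJ (point v hv) = 1728 * coeffI v ^ 3 / coeffDisc v := by
  rw [← jInv_ofCoeffs h2 h3]
  rfl

/-- The class in `PGL₂` of the matrix `(a b; c d)`. -/
def pgl (a b c d : F) (h : a * d - b * c ≠ 0) : Matrix.ProjGenLinGroup (Fin 2) F :=
  Matrix.ProjGenLinGroup.mk
    (Matrix.GeneralLinearGroup.mkOfDetNeZero !![a, b; c, d] (by simpa using h))

theorem exists_eq_pgl (g : Matrix.ProjGenLinGroup (Fin 2) F) :
    ∃ (a b c d : F) (h : a * d - b * c ≠ 0), g = pgl a b c d h := by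
  induction g using Matrix.ProjGenLinGroup.induction_on with
  | mk g =>
    have hd : g 0 0 * g 1 1 - g 0 1 * g 1 0 ≠ 0 := by
      rw [← Matrix.det_fin_two]
      exact g.det_ne_zero
    refine ⟨g 0 0, g 0 1, g 1 0, g 1 1, hd, ?_⟩
    rw [pgl]
    congr 1
    ext i j
    fin_cases i <;> fin_cases j <;> rfl

theorem pgl_smul_point {a b c d : F} {h : a * d - b * c ≠ 0} {v w : Fin 5 → F} {hv : v ≠ 0}
    {hw : w ≠ 0} : pgl a b c d h • point v hv = point w hw ↔ Carries a b c d v w := by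
  have e : pgl a b c d h • point v hv = Projectivization.mk F
      ((Matrix.GeneralLinearGroup.mkOfDetNeZero !![a, b; c, d] (by simpa using h) :
        Matrix.GeneralLinearGroup (Fin 2) F) • (⟨ofCoeffs v, ofCoeffs_mem v⟩ : QuarticForm F))
      ((smul_ne_zero_iff_ne _).mpr (ofCoeffs_ne_zero hv)) := rfl
  rw [e, show point w hw = Projectivization.mk F (⟨ofCoeffs w, ofCoeffs_mem w⟩ : QuarticForm F)
    (ofCoeffs_ne_zero hw) from rfl, Projectivization.mk_eq_mk_iff']
  have e2 : (((Matrix.GeneralLinearGroup.mkOfDetNeZero !![a, b; c, d] (by simpa using h) :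
        Matrix.GeneralLinearGroup (Fin 2) F) • (⟨ofCoeffs v, ofCoeffs_mem v⟩ : QuarticForm F)) :
        QuarticForm F).1 = ofCoeffs (act a b c d v) := by
    rw [coe_smul, subst_ofCoeffs]
    rfl
  constructor
  · rintro ⟨k, hk⟩
    have e3 := congrArg Subtype.val hk
    rw [e2] at e3
    have e4 : ofCoeffs (k • w) = ofCoeffs (act a b c d v) := by rw [ofCoeffs_smul]; exact e3
    have e5 := ofCoeffs_injective e4
    refine ⟨k, ?_, e5.symm⟩
    rintro rfl
    rw [zero_smul] at e5
    -- The factor cannot be zero: if the substituted form were zero, substitution of the inverse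
    -- matrix would give `v = 0`.
    have e6 : subst (!![a, b; c, d] : Matrix (Fin 2) (Fin 2) F) (ofCoeffs v) = 0 := by
      rw [subst_ofCoeffs]
      simp only [Matrix.of_apply, Matrix.cons_val', Matrix.cons_val_zero, Matrix.cons_val_one,
        Matrix.cons_val_fin_one]
      rw [← e5]
      simp [ofCoeffs]
    have e7 := congrArg (subst (!![a, b; c, d] : Matrix (Fin 2) (Fin 2) F)⁻¹) e6
    rw [← subst_mul, Matrix.nonsing_inv_mul _ (by simpa using h), subst_one, map_zero] at e7
    apply hv
    apply ofCoeffs_injective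
    rw [e7]
    simp [ofCoeffs]
  · rintro ⟨k, -, hk⟩
    refine ⟨k, Subtype.ext ?_⟩
    rw [e2, hk, ofCoeffs_smul]
    rfl

theorem pgl_eq_pgl_iff {a b c d a' b' c' d' : F} {h : a * d - b * c ≠ 0}
    {h' : a' * d' - b' * c' ≠ 0} :
    pgl a b c d h = pgl a' b' c' d' h' ↔
      ∃ u : F, u ≠ 0 ∧ a' = u * a ∧ b' = u * b ∧ c' = u * c ∧ d' = u * d := by
  rw [pgl, pgl, Matrix.ProjGenLinGroup.mk_eq_mk_iff]
  constructor
  · rintro ⟨u, hu⟩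
    refine ⟨u, u.ne_zero, ?_⟩
    have := fun i j => congrArg (fun g : Matrix.GeneralLinearGroup (Fin 2) F => g i j) hu
    have h00 := this 0 0
    have h01 := this 0 1
    have h10 := this 1 0
    have h11 := this 1 1
    simp [Matrix.GeneralLinearGroup.mkOfDetNeZero, Matrix.mul_apply, Fin.sum_univ_two] at h00 h01 h10 h11
    exact ⟨by rw [← h00, mul_comm], by rw [← h01, mul_comm], by rw [← h10, mul_comm],
      by rw [← h11, mul_comm]⟩
  · rintro ⟨u, hu, rfl, rfl, rfl, rfl⟩
    refine ⟨Units.mk0 u hu, ?_⟩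
    ext i j
    fin_cases i <;> fin_cases j <;>
      simp [Matrix.GeneralLinearGroup.mkOfDetNeZero, Matrix.mul_apply, Fin.sum_univ_two, mul_comm]

theorem pgl_mul_pgl {a b c d a' b' c' d' : F} (h : a * d - b * c ≠ 0)
    (h' : a' * d' - b' * c' ≠ 0) :
    pgl a b c d h * pgl a' b' c' d' h' =
      pgl (a * a' + b * c') (a * b' + b * d') (c * a' + d * c') (c * b' + d * d') (by
        have := mul_ne_zero h h'
        intro h0
        apply this
        rw [← h0]
        ring) := by
  rw [pgl, pgl, ← map_mul, pgl]
  congr 1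
  ext i j
  fin_cases i <;> fin_cases j <;>
    simp [Matrix.GeneralLinearGroup.mkOfDetNeZero, Matrix.mul_apply, Fin.sum_univ_two]

theorem one_eq_pgl : (1 : Matrix.ProjGenLinGroup (Fin 2) F) = pgl 1 0 0 1 (by simp) := by
  rw [pgl, ← map_one Matrix.ProjGenLinGroup.mk]
  congr 1
  ext i j
  fin_cases i <;> fin_cases j <;> simp [Matrix.GeneralLinearGroup.mkOfDetNeZero]

theorem pgl_eq_one_iff {a b c d : F} {h : a * d - b * c ≠ 0} :
    pgl a b c d h = 1 ↔ b = 0 ∧ c = 0 ∧ a = d := by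
  rw [one_eq_pgl, pgl_eq_pgl_iff]
  constructor
  · rintro ⟨u, hu, h1, h2, h3, h4⟩
    refine ⟨?_, ?_, ?_⟩
    · simpa [hu] using h2
    · simpa [hu] using h3
    · exact mul_left_cancel₀ hu (h1.symm.trans h4)
  · rintro ⟨rfl, rfl, rfl⟩
    have ha : a ≠ 0 := by rintro rfl; simp at h
    exact ⟨a⁻¹, inv_ne_zero ha, by simp [ha], by simp, by simp, by simp [ha]⟩

theorem mem_stabilizer_point {a b c d : F} {h : a * d - b * c ≠ 0} {v : Fin 5 → F} {hv : v ≠ 0} :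
    pgl a b c d h ∈ MulAction.stabilizer (Matrix.ProjGenLinGroup (Fin 2) F) (point v hv) ↔
      Carries a b c d v v := by
  rw [MulAction.mem_stabilizer_iff, pgl_smul_point]

theorem smul_discNeZero_iff (h2 : (2 : F) ≠ 0) (h3 : (3 : F) ≠ 0)
    (g : Matrix.ProjGenLinGroup (Fin 2) F) (P : ProjQuartic F) :
    DiscNeZero (g • P) ↔ DiscNeZero P := by
  obtain ⟨a, b, c, d, h, rfl⟩ := exists_eq_pgl g
  obtain ⟨v, hv, rfl⟩ := exists_eq_point P
  obtain ⟨w, hw, e⟩ := exists_eq_point (pgl a b c d h • point v hv)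
  rw [e]
  obtain ⟨k, hk, e'⟩ := pgl_smul_point.mp e
  have := coeffDisc_act a b c d v
  rw [e'] at this
  rw [discNeZero_point h2 h3, discNeZero_point h2 h3]
  have h6 : coeffDisc (k • w) = k ^ 6 * coeffDisc w := by
    simp only [coeffDisc, coeffI_smul, coeffJ_smul]; ring
  rw [h6] at this
  have hk6 := pow_ne_zero 6 hk
  have hd := pow_ne_zero 12 h
  constructor
  · intro hw0 hv0
    rw [hv0, mul_zero] at this
    exact (mul_ne_zero hk6 hw0) this
  · intro hv0 hw0
    rw [hw0, mul_zero] at this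
    exact (mul_ne_zero hd hv0) this.symm

/-- `I³` and `Δ` have the same degree and the same weight, so the factors `k ^ 6` and `det ^ 12`
cancel in the quotient. -/
theorem projJ_smul (h2 : (2 : F) ≠ 0) (h3 : (3 : F) ≠ 0)
    (g : Matrix.ProjGenLinGroup (Fin 2) F) (P : ProjQuartic F) : projJ (g • P) = projJ P := by
  obtain ⟨a, b, c, d, h, rfl⟩ := exists_eq_pgl g
  obtain ⟨v, hv, rfl⟩ := exists_eq_point P
  obtain ⟨w, hw, e⟩ := exists_eq_point (pgl a b c d h • point v hv)
  rw [e]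
  obtain ⟨k, hk, e'⟩ := pgl_smul_point.mp e
  have hI := coeffI_act a b c d v
  have hD := coeffDisc_act a b c d v
  have h6 : coeffDisc (k • w) = k ^ 6 * coeffDisc w := by
    simp only [coeffDisc, coeffI_smul, coeffJ_smul]; ring
  rw [e', coeffI_smul] at hI
  rw [e', h6] at hD
  rw [projJ_point h2 h3, projJ_point h2 h3]
  have hk6 := pow_ne_zero 6 hk
  have hd := pow_ne_zero 12 h
  rw [← mul_div_mul_left _ (coeffDisc w) hk6, ← mul_div_mul_left _ (coeffDisc v) hd, ← hD]
  congr 1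
  have : (k ^ 2 * coeffI w) ^ 3 = ((a * d - b * c) ^ 4 * coeffI v) ^ 3 := by rw [hI]
  linear_combination 1728 * this

theorem projJ_of_mem_orb (h2 : (2 : F) ≠ 0) (h3 : (3 : F) ≠ 0) {P Q : ProjQuartic F}
    (h : Q ∈ orb P) : projJ Q = projJ P := by
  obtain ⟨g, rfl⟩ := h
  exact projJ_smul h2 h3 g P

theorem discNeZero_of_mem_orb (h2 : (2 : F) ≠ 0) (h3 : (3 : F) ≠ 0) {P Q : ProjQuartic F}
    (h : Q ∈ orb P) : DiscNeZero Q ↔ DiscNeZero P := by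
  obtain ⟨g, rfl⟩ := h
  exact smul_discNeZero_iff h2 h3 g P

/-- The form with coefficients `v` vanishes at a point of the projective line over `F`. -/
def HasRoot (v : Fin 5 → F) : Prop :=
  ∃ x y : F, (x ≠ 0 ∨ y ≠ 0) ∧ value v x y = 0

theorem Carries.hasRoot {a b c d : F} (h : a * d - b * c ≠ 0) {v w : Fin 5 → F}
    (hc : Carries a b c d v w) (hr : HasRoot v) : HasRoot w := by
  obtain ⟨x, y, hxy, e⟩ := hr
  refine ⟨a * x + b * y, c * x + d * y, ?_, by simpa using hc.value_eq_zero e⟩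
  by_contra! h0
  have hx : (a * d - b * c) * x = 0 := by linear_combination d * h0.1 - b * h0.2
  have hy : (a * d - b * c) * y = 0 := by linear_combination a * h0.2 - c * h0.1
  rcases hxy with hx' | hy'
  · exact mul_ne_zero h hx' hx
  · exact mul_ne_zero h hy' hy

theorem mem_orb_point_iff {v w : Fin 5 → F} {hv : v ≠ 0} {hw : w ≠ 0} :
    point w hw ∈ orb (point v hv) ↔ ∃ a b c d, a * d - b * c ≠ 0 ∧ Carries a b c d v w := by
  constructor
  · rintro ⟨g, hg⟩
    obtain ⟨a, b, c, d, h, rfl⟩ := exists_eq_pgl g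
    exact ⟨a, b, c, d, h, pgl_smul_point.mp hg⟩
  · rintro ⟨a, b, c, d, h, hc⟩
    exact ⟨pgl a b c d h, pgl_smul_point.mpr hc⟩

/-! ### Types of forms in terms of the coefficients -/

/-- The projective line is the affine line of points (1 : y) together with (0 : 1), called infinity
below, where the form takes the value `v 0`. The second summand is the size of a subset of a
one-point type: 1 if X divides the form, and 0 otherwise. -/
theorem numLinearFactors_ofCoeffs [Finite F] (v : Fin 5 → F) :
    numLinearFactors (ofCoeffs v) = {y : F | value v 1 y = 0}.ncard
      + {_u : Unit | v 0 = 0}.ncard := by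
  have hne : ∀ y : F, (![1, y] : Fin 2 → F) ≠ 0 := fun y h => by simpa using congrFun h 0
  have hne' : (![0, 1] : Fin 2 → F) ≠ 0 := fun h => by simpa using congrFun h 1
  have hrep : ∀ (w : Fin 2 → F) (hw : w ≠ 0),
      eval (Projectivization.mk F w hw).rep (ofCoeffs v) = 0 ↔ value v (w 0) (w 1) = (0 : F) := by
    intro w hw
    obtain ⟨a, ha⟩ := Projectivization.exists_smul_eq_mk_rep F w hw
    rw [← ha, eval_ofCoeffs]
    simp only [Pi.smul_apply, Units.smul_def, smul_eq_mul]
    rw [value_mul]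
    simp
  set e : F ⊕ Unit → Projectivization F (Fin 2 → F) :=
    Sum.elim (fun y => Projectivization.mk F ![1, y] (hne y))
      (fun _ => Projectivization.mk F ![0, 1] hne') with he
  have hinj : Function.Injective e := by
    rintro (y | y) (y' | y') h
    on_goal 4 => rfl
    all_goals
      simp only [he, Sum.elim_inl, Sum.elim_inr] at h
      rw [Projectivization.mk_eq_mk_iff'] at h
      obtain ⟨a, ha⟩ := h
    · have h0 := congrFun ha 0
      have h1 := congrFun ha 1
      simp at h0 h1
      rw [h0, one_mul] at h1
      rw [h1]
    · have h0 := congrFun ha 0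
      simp at h0
    · have h0 := congrFun ha 0
      have h1 := congrFun ha 1
      simp at h0 h1
      simp [h0] at h1
  have hset : {p : Projectivization F (Fin 2 → F) | eval p.rep (ofCoeffs v) = 0} =
      e '' (Sum.inl '' {y : F | value v 1 y = 0} ∪ Sum.inr '' {_u : Unit | v 0 = 0}) := by
    ext p
    induction p using Projectivization.ind with
    | h w hw =>
      rw [Set.mem_ofPred_eq, hrep]
      constructor
      · intro h
        by_cases h0 : w 0 = 0
        · have h1 : w 1 ≠ 0 := by
            intro h1
            apply hw
            funext i
            fin_cases i <;> simp [h0, h1]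
          refine ⟨Sum.inr (), Or.inr ⟨(), ?_, rfl⟩, ?_⟩
          · rw [h0] at h
            simpa [value, h1] using h
          · simp only [he, Sum.elim_inr]
            rw [Projectivization.mk_eq_mk_iff']
            refine ⟨(w 1)⁻¹, ?_⟩
            funext i
            fin_cases i <;> simp [h0, h1]
        · refine ⟨Sum.inl (w 1 / w 0), Or.inl ⟨_, ?_, rfl⟩, ?_⟩
          · have := value_mul (w 0) v 1 (w 1 / w 0)
            rw [mul_div_cancel₀ _ h0, mul_one, h] at this
            exact (mul_eq_zero.mp this.symm).resolve_left (pow_ne_zero 4 h0)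
          · simp only [he, Sum.elim_inl]
            rw [Projectivization.mk_eq_mk_iff']
            refine ⟨(w 0)⁻¹, ?_⟩
            funext i
            fin_cases i <;> simp [h0, div_eq_inv_mul]
      · rintro ⟨_, ⟨y, hy, rfl⟩ | ⟨u, hu, rfl⟩, h⟩
        · simp only [he, Sum.elim_inl] at h
          rw [← hrep w hw, ← h, hrep]
          simpa using hy
        · simp only [he, Sum.elim_inr] at h
          rw [← hrep w hw, ← h, hrep]
          simpa [value] using hu
  rw [numLinearFactors, hset, Set.ncard_image_of_injective _ hinj, Set.ncard_union_eq,
    Set.ncard_image_of_injective _ Sum.inl_injective,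
    Set.ncard_image_of_injective _ Sum.inr_injective]
  rw [Set.disjoint_left]
  rintro _ ⟨y, -, rfl⟩ ⟨u, -, h⟩
  simp at h

theorem numLinearFactors_eq_zero [Finite F] {v : Fin 5 → F} (h : ¬ HasRoot v) :
    numLinearFactors (ofCoeffs v) = 0 := by
  rw [numLinearFactors_ofCoeffs]
  have h1 : {y : F | value v 1 y = 0} = ∅ := by
    ext y
    simp only [Set.mem_ofPred_eq, Set.mem_empty_iff_false, iff_false]
    exact fun hy => h ⟨1, y, Or.inl one_ne_zero, hy⟩
  have h2 : {_u : Unit | v 0 = 0} = ∅ := by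
    ext y
    simp only [Set.mem_ofPred_eq, Set.mem_empty_iff_false, iff_false]
    exact fun hy => h ⟨0, 1, Or.inr one_ne_zero, by simp [value, hy]⟩
  simp [h1, h2]

theorem numLinearFactors_of_infty [Finite F] {v : Fin 5 → F} (h : v 0 = 0) :
    numLinearFactors (ofCoeffs v) = {y : F | value v 1 y = 0}.ncard + 1 := by
  rw [numLinearFactors_ofCoeffs]
  simp [h]

/-- The polynomial `f(1, Y)`. -/
theorem dehomogenize_ofCoeffs (v : Fin 5 → F) :
    aeval ![(1 : Polynomial F), Polynomial.X] (ofCoeffs v) =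
      Polynomial.C (v 0) * Polynomial.X ^ 4 + Polynomial.C (v 1) * Polynomial.X ^ 3
        + Polynomial.C (v 2) * Polynomial.X ^ 2 + Polynomial.C (v 3) * Polynomial.X
        + Polynomial.C (v 4) := by
  simp [ofCoeffs]

end

end BinaryQuartic

end

noncomputable section

namespace BinaryQuartic

open MvPolynomial

/-! ### Recognition of small groups -/

section

variable {H : Type*} [Group H]

theorem nonempty_mulEquiv_unit (h : ∀ g : H, g = 1) : Nonempty (H ≃* Unit) :=
  have : Unique H := ⟨⟨1⟩, h⟩
  ⟨MulEquiv.ofUnique⟩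

theorem nonempty_mulEquiv_cyc_prime {p : ℕ} [Fact p.Prime] (h : Nat.card H = p) :
    Nonempty (H ≃* Cyc p) :=
  ⟨mulEquivOfPrimeCardEq h (by simp)⟩

theorem nonempty_mulEquiv_cyc_four [Finite H] (hH : Nat.card H ≤ 4) {a : H} (h4 : a ^ 4 = 1)
    (h2 : a ^ 2 ≠ 1) : Nat.card H = 4 ∧ Nonempty (H ≃* Cyc 4) := by
  have ho : orderOf a = 2 ^ (1 + 1) := orderOf_eq_prime_pow (by simpa using h2) (by simpa using h4)
  have hc : Nat.card H = 4 := by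
    have h := orderOf_le_card (x := a)
    rw [ho] at h
    norm_num at h
    omega
  have : IsCyclic H := isCyclic_of_orderOf_eq_card a (by rw [ho, hc]; norm_num)
  exact ⟨hc, ⟨mulEquivOfCyclicCardEq (by simp [hc])⟩⟩

theorem klein_mul_comm {s t : H} (hs : s * s = 1) (ht : t * t = 1) (hst : s * t = t * s) :
    (s * t) * (s * t) = 1 := by
  rw [mul_assoc, ← mul_assoc t, ← hst, mul_assoc, ht, mul_one, hs]

theorem ncard_klein {s t : H} (hs1 : s ≠ 1) (ht1 : t ≠ 1) (hne : s ≠ t) (hs : s * s = 1) :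
    ({1, s, t, s * t} : Set H).ncard = 4 := by
  have h1 : s * t ≠ 1 := fun h => hne (by
    rw [mul_eq_one_iff_eq_inv] at h
    rw [← inv_eq_of_mul_eq_one_left hs, h, inv_inv])
  classical
  have : ({1, s, t, s * t} : Set H) = (({1, s, t, s * t} : Finset H) : Set H) := by simp
  rw [this, Set.ncard_coe_finset]
  rw [Finset.card_insert_of_notMem, Finset.card_insert_of_notMem, Finset.card_insert_of_notMem,
    Finset.card_singleton]
  · simpa using hs1
  · simp [hne, ht1]
  · simp [hs1.symm, ht1.symm, h1.symm]

/-- The elements 1, s, t, st are distinct, so they exhaust a group of order at most four; then ts is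
one of them, and only st is possible. This and the next two lemmas take an upper bound for the
order, which will come from counting images of a root. -/
theorem nonempty_mulEquiv_klein [Finite H] (hH : Nat.card H ≤ 4) {s t : H} (hs : s * s = 1)
    (ht : t * t = 1) (hs1 : s ≠ 1) (ht1 : t ≠ 1) (hne : s ≠ t) :
    Nat.card H = 4 ∧ Nonempty (H ≃* Cyc 2 × Cyc 2) := by
  have hn := ncard_klein hs1 ht1 hne hs
  have hu : ({1, s, t, s * t} : Set H) = Set.univ := by
    apply Set.eq_of_subset_of_ncard_le (Set.subset_univ _)
    rwa [hn, Set.ncard_univ]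
  have hc : Nat.card H = 4 := by rw [← Set.ncard_univ, ← hu, hn]
  have hts : t * s = s * t := by
    have : t * s ∈ ({1, s, t, s * t} : Set H) := hu ▸ Set.mem_univ _
    rcases this with h | h | h | h
    · rw [mul_eq_one_iff_eq_inv, inv_eq_of_mul_eq_one_left hs] at h
      exact absurd h.symm hne
    · exact absurd (mul_eq_right.mp h) ht1
    · exact absurd (mul_eq_left.mp h) hs1
    · exact h
  have hall : ∀ h : H, h * h = 1 := by
    intro h
    have : h ∈ ({1, s, t, s * t} : Set H) := hu ▸ Set.mem_univ _
    rcases this with rfl | rfl | rfl | rfl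
    · simp
    · exact hs
    · exact ht
    · exact klein_mul_comm hs ht hts.symm
  have : Nontrivial H := ⟨s, 1, hs1⟩
  have i1 : IsKleinFour H := ⟨hc, by
    have hd : Monoid.exponent H ∣ 2 :=
      Monoid.exponent_dvd_of_forall_pow_eq_one fun h => by rw [pow_two, hall]
    rcases (Nat.dvd_prime Nat.prime_two).mp hd with h | h
    · exact absurd (Monoid.exp_eq_one_iff.mp h) (not_subsingleton H)
    · exact h⟩
  have i2 : IsKleinFour (Cyc 2 × Cyc 2) := ⟨by simp, by
    rw [Monoid.exponent_prod]; simp⟩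
  exact ⟨hc, IsKleinFour.nonempty_mulEquiv⟩

/-- The relations define a homomorphism from the dihedral group, with rotations going to powers of
`a` and reflections to `b` times such powers. It is injective because `b` is not a power of `a`; the
bound on the order makes it bijective. -/
theorem nonempty_mulEquiv_dihedral [Finite H] (hH : Nat.card H ≤ 8) {a b : H} (h4 : a ^ 4 = 1)
    (h2 : a ^ 2 ≠ 1) (hb : b * b = 1) (hb1 : b ≠ 1) (hba : b ≠ a ^ 2) (hab : b * a * b = a⁻¹) :
    Nat.card H = 8 ∧ Nonempty (H ≃* DihedralGroup 4) := by
  let f : Multiplicative (ZMod 4) →* H :=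
    { toFun := fun i => a ^ (Multiplicative.toAdd i).val
      map_one' := by simp
      map_mul' := fun i j => by
        rw [toAdd_mul, ZMod.val_add, ← pow_eq_pow_mod _ h4, pow_add] }
  let f' : ZMod 4 → H := fun i => f (Multiplicative.ofAdd i)
  have fadd : ∀ i j, f' (i + j) = f' i * f' j := fun i j => map_mul f _ _
  have fsub : ∀ i j, f' (i - j) = f' i * (f' j)⁻¹ := fun i j => by
    rw [← div_eq_mul_inv]; exact map_div f _ _
  have fcomm : ∀ i j, f' j * (f' i)⁻¹ = (f' i)⁻¹ * f' j := fun i j => by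
    rw [mul_inv_eq_iff_eq_mul, mul_assoc, eq_inv_mul_iff_mul_eq, ← fadd, ← fadd, add_comm]
  have binv : b⁻¹ = b := inv_eq_of_mul_eq_one_left hb
  have fb : ∀ i, b * f' i * b = (f' i)⁻¹ := fun i => by
    have h := conj_pow (a := b) (b := a) (i := i.val)
    rw [binv, hab, inv_pow] at h
    exact h.symm
  have fb' : ∀ i, f' i * b = b * (f' i)⁻¹ := fun i => by
    rw [← fb, ← mul_assoc, ← mul_assoc, hb, one_mul]
  let φ : DihedralGroup 4 →* H :=
    { toFun := fun x => match x with
        | .r i => f' i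
        | .sr i => b * f' i
      map_one' := map_one f
      map_mul' := by
        rintro (i | i) (j | j)
        · exact fadd i j
        · change b * f' (j - i) = f' i * (b * f' j)
          rw [← mul_assoc, fb', fsub, mul_assoc, fcomm]
        · change b * f' (i + j) = b * f' i * f' j
          rw [fadd, mul_assoc]
        · change f' (j - i) = b * f' i * (b * f' j)
          rw [← mul_assoc, fb, fsub, fcomm] }
  have h1 : a ^ 1 ≠ 1 := fun h => h2 (by rw [pow_one] at h; rw [h, one_pow])
  have h3 : a ^ 3 ≠ 1 := fun h => h1 (by
    rw [show 4 = 3 + 1 by norm_num, pow_add, h, one_mul] at h4; exact h4)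
  have b1 : b * a ^ 1 ≠ 1 := fun h => by
    have e : b = a⁻¹ := by rw [pow_one] at h; exact mul_eq_one_iff_eq_inv.mp h
    apply h2
    rw [e, ← mul_inv_rev, inv_eq_one] at hb
    rw [pow_two, hb]
  have b2 : b * a ^ 2 ≠ 1 := fun h => by
    apply hba
    rw [mul_eq_one_iff_eq_inv.mp h, inv_eq_iff_mul_eq_one, ← pow_add]
    exact h4
  have b3 : b * a ^ 3 ≠ 1 := fun h => by
    have e : b = a := by
      rw [mul_eq_one_iff_eq_inv.mp h, inv_eq_iff_mul_eq_one, ← pow_succ]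
      exact h4
    apply h2
    rw [e] at hb
    rw [pow_two, hb]
  have hφ : Function.Injective φ := by
    rw [injective_iff_map_eq_one]
    rintro (i | i) h
    · change a ^ i.val = 1 at h
      fin_cases i
      · rfl
      · exact absurd h h1
      · exact absurd h h2
      · exact absurd h h3
    · change b * a ^ i.val = 1 at h
      fin_cases i
      · have h' : b * a ^ 0 = 1 := h
        rw [pow_zero, mul_one] at h'
        exact absurd h' hb1
      · exact absurd h b1
      · exact absurd h b2
      · exact absurd h b3
  have hle := Nat.card_le_card_of_injective φ hφ
  have hc : Nat.card H = 8 := by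
    rw [DihedralGroup.nat_card] at hle
    omega
  have hbij : Function.Bijective φ := by
    rw [Nat.bijective_iff_injective_and_card]
    exact ⟨hφ, by rw [DihedralGroup.nat_card, hc]⟩
  exact ⟨hc, ⟨(MulEquiv.ofBijective φ hbij).symm⟩⟩

/-- The Klein group generated by `s, t` and the element `a` of order three force the order 12. The
action on the four cosets of ⟨a⟩ has as kernel the normal core of ⟨a⟩, which is trivial since ⟨a⟩
has prime order and is not normal. So H embeds in S₄ with index two. -/
theorem nonempty_mulEquiv_alternating [Finite H] (hH : Nat.card H ≤ 12) {s t a : H}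
    (hs : s * s = 1) (ht : t * t = 1) (hst : s * t = t * s) (hs1 : s ≠ 1) (ht1 : t ≠ 1)
    (hne : s ≠ t) (ha : a ^ 3 = 1) (ha1 : a ≠ 1) (hsa : s * a * s⁻¹ ∉ Subgroup.zpowers a) :
    Nat.card H = 12 ∧ Nonempty (H ≃* alternatingGroup (Fin 4)) := by
  let K : Subgroup H :=
    { carrier := {1, s, t, s * t}
      mul_mem' := by
        have e1 : s * (s * t) = t := by rw [← mul_assoc, hs, one_mul]
        have e2 : t * (s * t) = s := by rw [hst, ← mul_assoc, ht, one_mul]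
        have e3 : s * t * s = t := by rw [hst, mul_assoc, hs, mul_one]
        have e4 : s * t * t = s := by rw [mul_assoc, ht, mul_one]
        have e5 := klein_mul_comm hs ht hst
        rintro _ _ (rfl | rfl | rfl | rfl) (rfl | rfl | rfl | rfl) <;>
          simp [hs, ht, e1, e2, e3, e4, e5, ← hst]
      one_mem' := by simp
      inv_mem' := by
        have e1 : s⁻¹ = s := inv_eq_of_mul_eq_one_left hs
        have e2 : t⁻¹ = t := inv_eq_of_mul_eq_one_left ht
        rintro _ (rfl | rfl | rfl | rfl) <;> simp [e1, e2, ← hst] }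
  have hK : Nat.card K = 4 := by
    rw [← ncard_klein hs1 ht1 hne hs]
    exact Nat.card_coe_set_eq _
  have h4 : 4 ∣ Nat.card H := hK ▸ Subgroup.card_subgroup_dvd_card K
  have hoa : orderOf a = 3 := orderOf_eq_prime ha ha1
  have h3 : 3 ∣ Nat.card H := hoa ▸ orderOf_dvd_natCard a
  have h12 : Nat.card H = 12 := by
    have hd : 12 ∣ Nat.card H := Nat.Coprime.mul_dvd_of_dvd_of_dvd (by norm_num) h4 h3
    have := Nat.le_of_dvd Nat.card_pos hd
    omega
  refine ⟨h12, ?_⟩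
  have hC : Nat.card (Subgroup.zpowers a) = 3 := by rw [Nat.card_zpowers, hoa]
  have hQ : Nat.card (H ⧸ Subgroup.zpowers a) = 4 := by
    have := Subgroup.card_eq_card_quotient_mul_card_subgroup (Subgroup.zpowers a)
    rw [h12, hC] at this
    omega
  have hcore : (Subgroup.zpowers a).normalCore = ⊥ := by
    by_contra hb
    have hle := Subgroup.normalCore_le (Subgroup.zpowers a)
    have hd := Subgroup.card_dvd_of_le hle
    rw [hC] at hd
    rcases (Nat.dvd_prime Nat.prime_three).mp hd with h | h
    · exact hb (Subgroup.card_eq_one.mp h)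
    · have he := Subgroup.eq_of_le_of_card_ge hle (by rw [hC, h])
      have hn := Subgroup.normalCore_normal (Subgroup.zpowers a)
      rw [he] at hn
      exact hsa (hn.conj_mem a (Subgroup.mem_zpowers a) s)
  rw [Subgroup.normalCore_eq_ker] at hcore
  have : Finite (H ⧸ Subgroup.zpowers a) := inferInstance
  let e : (H ⧸ Subgroup.zpowers a) ≃ Fin 4 := Finite.equivFinOfCardEq hQ
  let ψ : H →* Equiv.Perm (Fin 4) := (e.permCongrHom.toMonoidHom).comp
    (MulAction.toPermHom H (H ⧸ Subgroup.zpowers a))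
  have hψ : Function.Injective ψ :=
    e.permCongrHom.injective.comp ((MonoidHom.ker_eq_bot_iff _).mp hcore)
  have hr : Nat.card ψ.range = 12 := by
    rw [← h12]
    exact (Nat.card_congr (MonoidHom.ofInjective hψ).toEquiv).symm
  have hi : ψ.range.index = 2 := by
    have := Subgroup.card_mul_index ψ.range
    rw [hr, Nat.card_perm, Nat.card_fin] at this
    simp [Nat.factorial] at this
    omega
  have hA := Equiv.Perm.eq_alternatingGroup_of_index_eq_two hi
  exact ⟨(MonoidHom.ofInjective hψ).trans (MulEquiv.subgroupCongr hA)⟩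

end

end BinaryQuartic

end

noncomputable section

namespace BinaryQuartic

open MvPolynomial

/-! ### Counting -/

section

variable {F : Type*} [Field F]

theorem act_translate (h : F) (v : Fin 5 → F) : act 1 0 (-h) 1 (act 1 0 h 1 v) = v := by
  funext i
  fin_cases i <;> simp [act] <;> ring

theorem coeffDisc_translate (h : F) (v : Fin 5 → F) :
    coeffDisc (act 1 0 h 1 v) = coeffDisc v := by
  rw [coeffDisc_act]
  ring

/-- The pairs (I, J) with Δ = 0 form a cuspidal cubic, parametrized bijectively by `t = J / I`, with
the cusp at `t = 0`; uniqueness is `eq_of_sq_cube`. -/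
theorem exists_sq_cube {i k : F} (h : i ^ 3 - k ^ 2 = 0) : ∃ t, i = t ^ 2 ∧ k = t ^ 3 := by
  by_cases hi : i = 0
  · refine ⟨0, by simp [hi], ?_⟩
    rw [hi] at h
    have : k ^ 2 = 0 := by linear_combination -h
    simpa using this
  · refine ⟨k / i, ?_, ?_⟩
    · field_simp
      linear_combination h
    · field_simp
      linear_combination k * h

theorem eq_of_sq_cube {t t' : F} (h2 : t ^ 2 = t' ^ 2) (h3 : t ^ 3 = t' ^ 3) : t = t' := by
  by_cases h0 : t' = 0
  · rw [h0] at h2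
    simpa [h0] using h2
  · have h : t' ^ 2 * t = t' ^ 2 * t' := by linear_combination h3 - t * h2
    exact mul_left_cancel₀ (pow_ne_zero 2 h0) h

/-- A parametrization of the depressed quartic polynomials with vanishing discriminant. -/
def nodalParam (m n : F) : F × F × F :=
  open Classical in
  if m = 0 then (6 * n, 0, 3 * (2 * n) ^ 2 - 3 * n ^ 2)
  else (6 * (-(n ^ 2 + m) / 3), -4 * (m * n),
    3 * (m + 2 * (-(n ^ 2 + m) / 3)) ^ 2 - 3 * (-(n ^ 2 + m) / 3) ^ 2)

theorem ne_zero_of_two_three (h2 : (2 : F) ≠ 0) (h3 : (3 : F) ≠ 0) :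
    (4 : F) ≠ 0 ∧ (6 : F) ≠ 0 ∧ (12 : F) ≠ 0 ∧ (16 : F) ≠ 0 ∧ (36 : F) ≠ 0 ∧ (432 : F) ≠ 0 ∧
      (27 : F) ≠ 0 ∧ (256 : F) ≠ 0 ∧ (1728 : F) ≠ 0 ∧ (8 : F) ≠ 0 := by
  refine ⟨?_, ?_, ?_, ?_, ?_, ?_, ?_, ?_, ?_, ?_⟩
  · rw [show (4 : F) = 2 ^ 2 by norm_num]; positivity
  · rw [show (6 : F) = 2 * 3 by norm_num]; positivity
  · rw [show (12 : F) = 2 ^ 2 * 3 by norm_num]; positivity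
  · rw [show (16 : F) = 2 ^ 4 by norm_num]; positivity
  · rw [show (36 : F) = 2 ^ 2 * 3 ^ 2 by norm_num]; positivity
  · rw [show (432 : F) = 2 ^ 4 * 3 ^ 3 by norm_num]; positivity
  · rw [show (27 : F) = 3 ^ 3 by norm_num]; positivity
  · rw [show (256 : F) = 2 ^ 8 by norm_num]; positivity
  · rw [show (1728 : F) = 2 ^ 6 * 3 ^ 3 by norm_num]; positivity
  · rw [show (8 : F) = 2 ^ 3 by norm_num]; positivity

/-- The values of `I` and `J` at a depressed quartic polynomial. -/
theorem coeffI_depressed (h2 : (2 : F) ≠ 0) (h3 : (3 : F) ≠ 0) (x y t : F) :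
    coeffI ![1, 0, 6 * x, -4 * y, 3 * t ^ 2 - 3 * x ^ 2] = t ^ 2 := by
  obtain ⟨-, -, -, -, h36, -⟩ := ne_zero_of_two_three h2 h3
  simp [coeffI]
  field_simp
  ring

/-- With `I = t²`, the condition `J = t³` becomes (t + x)(t - 2x)² + y² = 0, for fixed t a nodal
cubic in (x, y). If m = t - 2x is nonzero, put y = mn; then n² = -(t + x) and x = -(n² + m)/3. If m
= 0, then y = 0 and t = 2x, and n = x is the remaining parameter. These are the formulas of
`nodalParam`. -/
theorem coeffJ_depressed (h2 : (2 : F) ≠ 0) (h3 : (3 : F) ≠ 0) (x y t : F) :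
    coeffJ ![1, 0, 6 * x, -4 * y, 3 * t ^ 2 - 3 * x ^ 2] =
      t ^ 3 - ((t + x) * (t - 2 * x) ^ 2 + y ^ 2) := by
  obtain ⟨-, -, -, -, -, h432, -⟩ := ne_zero_of_two_three h2 h3
  simp [coeffJ]
  field_simp
  ring

/-- The last clause says t - m = 2x. It recovers m from the form, because t is determined by `I` and
`J`. -/
theorem coeffDisc_nodalParam (h2 : (2 : F) ≠ 0) (h3 : (3 : F) ≠ 0) (m n : F) :
    ∃ t, coeffI ![1, 0, (nodalParam m n).1, (nodalParam m n).2.1, (nodalParam m n).2.2] = t ^ 2 ∧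
      coeffJ ![1, 0, (nodalParam m n).1, (nodalParam m n).2.1, (nodalParam m n).2.2] = t ^ 3 ∧
      6 * (t - m) = 2 * (nodalParam m n).1 := by
  by_cases hm : m = 0
  · refine ⟨2 * n, ?_, ?_, ?_⟩
    · have := coeffI_depressed h2 h3 n 0 (2 * n)
      simpa [nodalParam, hm] using this
    · have := coeffJ_depressed h2 h3 n 0 (2 * n)
      simpa [nodalParam, hm] using this
    · simp [nodalParam, hm]
      ring
  · refine ⟨m + 2 * (-(n ^ 2 + m) / 3), ?_, ?_, ?_⟩
    · have := coeffI_depressed h2 h3 (-(n ^ 2 + m) / 3) (m * n) (m + 2 * (-(n ^ 2 + m) / 3))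
      simpa only [nodalParam, hm, if_false] using this
    · have := coeffJ_depressed h2 h3 (-(n ^ 2 + m) / 3) (m * n) (m + 2 * (-(n ^ 2 + m) / 3))
      simp only [nodalParam, hm, if_false]
      rw [this]
      field_simp
      ring
    · simp only [nodalParam, hm, if_false]
      ring

theorem nodalParam_injective (h2 : (2 : F) ≠ 0) (h3 : (3 : F) ≠ 0) :
    Function.Injective (fun x : F × F => nodalParam x.1 x.2) := by
  rintro ⟨m, n⟩ ⟨m', n'⟩ h
  simp only at h
  obtain ⟨h4, h6, -⟩ := ne_zero_of_two_three h2 h3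
  obtain ⟨t, hI, hJ, ht⟩ := coeffDisc_nodalParam h2 h3 m n
  obtain ⟨t', hI', hJ', ht'⟩ := coeffDisc_nodalParam h2 h3 m' n'
  rw [h] at hI hJ ht
  have e := eq_of_sq_cube (hI.symm.trans hI') (hJ.symm.trans hJ')
  rw [e] at ht
  have hm : m = m' := by
    have : 6 * m = 6 * m' := by linear_combination ht' - ht
    exact mul_left_cancel₀ h6 this
  subst hm
  by_cases hm : m = 0
  · simp [nodalParam, hm, h6] at h
    rw [hm, h.1]
  · simp [nodalParam, hm, h4] at h
    rw [h.2.1]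

theorem exists_nodalParam (h2 : (2 : F) ≠ 0) (h3 : (3 : F) ≠ 0) {p r s : F}
    (h : coeffDisc ![1, 0, p, r, s] = 0) : ∃ m n, nodalParam m n = (p, r, s) := by
  obtain ⟨h4, h6, -, -, h36, -⟩ := ne_zero_of_two_three h2 h3
  obtain ⟨t, hI, hJ⟩ := exists_sq_cube h
  obtain ⟨x, rfl⟩ : ∃ x, p = 6 * x := ⟨p / 6, by field_simp⟩
  obtain ⟨y, rfl⟩ : ∃ y, r = -4 * y := ⟨-r / 4, by field_simp⟩
  have hs : s = 3 * t ^ 2 - 3 * x ^ 2 := by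
    rw [← hI]
    simp [coeffI]
    field_simp
    ring
  subst hs
  rw [coeffJ_depressed h2 h3] at hJ
  by_cases hm : t - 2 * x = 0
  · have hy : y = 0 := by
      rw [hm] at hJ
      have : y ^ 2 = 0 := by linear_combination -hJ
      simpa using this
    have ht : t = 2 * x := by linear_combination hm
    exact ⟨0, x, by simp [nodalParam, ht, hy]⟩
  · refine ⟨t - 2 * x, y / (t - 2 * x), ?_⟩
    have e : (y / (t - 2 * x)) ^ 2 = -(t + x) := by
      field_simp
      linear_combination -hJ
    simp only [nodalParam, hm, if_false, e]
    have e2 : -(-(t + x) + (t - 2 * x)) / 3 = x := by field_simp; ring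
    rw [e2]
    refine Prod.ext rfl (Prod.ext ?_ ?_)
    · simp only
      field_simp
    · simp only
      ring

/-- Depressed monic quartics form a three-dimensional space, in which Δ = 0 is the injective image
of a plane. -/
theorem ncard_depressed [Finite F] (h2 : (2 : F) ≠ 0) (h3 : (3 : F) ≠ 0) :
    {x : F × F × F | coeffDisc ![1, 0, x.1, x.2.1, x.2.2] ≠ 0}.ncard =
      Nat.card F ^ 3 - Nat.card F ^ 2 := by
  have e : {x : F × F × F | coeffDisc ![1, 0, x.1, x.2.1, x.2.2] ≠ 0} =
      (Set.range (fun x : F × F => nodalParam x.1 x.2))ᶜ := by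
    ext ⟨p, r, s⟩
    simp only [Set.mem_ofPred_eq, Set.mem_compl_iff, Set.mem_range, Prod.exists, not_iff_not]
    constructor
    · exact exists_nodalParam h2 h3
    · rintro ⟨m, n, h⟩
      obtain ⟨t, hI, hJ, -⟩ := coeffDisc_nodalParam h2 h3 m n
      rw [h] at hI hJ
      rw [coeffDisc, hI, hJ]
      ring
  have hr : (Set.range (fun x : F × F => nodalParam x.1 x.2)).ncard = Nat.card F ^ 2 := by
    rw [← Set.image_univ, Set.ncard_image_of_injective _ (nodalParam_injective h2 h3),
      Set.ncard_univ, Nat.card_prod]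
    ring
  rw [e, Set.ncard_compl, hr, Nat.card_prod, Nat.card_prod]
  ring_nf

/-- For these forms (I, J) are themselves coordinates, so Δ = 0 is the cuspidal cubic with its q
points. -/
theorem ncard_depressed_cubic [Finite F] (h2 : (2 : F) ≠ 0) (h3 : (3 : F) ≠ 0) :
    {x : F × F | coeffDisc ![0, 1, 0, x.1, x.2] ≠ 0}.ncard = Nat.card F ^ 2 - Nat.card F := by
  obtain ⟨-, -, h12, h16, h36, h432, -⟩ := ne_zero_of_two_three h2 h3
  have hI : ∀ n k : F, coeffI ![0, 1, 0, -12 * n, -16 * k] = n := by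
    intro n k
    simp [coeffI]
    field_simp
    ring
  have hJ : ∀ n k : F, coeffJ ![0, 1, 0, -12 * n, -16 * k] = k := by
    intro n k
    simp [coeffJ]
    field_simp
    ring
  have hinj : Function.Injective (fun t : F => ((-12 * t ^ 2, -16 * t ^ 3) : F × F)) := by
    intro t t' h
    simp [h12, h16] at h
    exact eq_of_sq_cube h.1 h.2
  have e : {x : F × F | coeffDisc ![0, 1, 0, x.1, x.2] ≠ 0} =
      (Set.range (fun t : F => ((-12 * t ^ 2, -16 * t ^ 3) : F × F)))ᶜ := by
    ext ⟨r, s⟩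
    obtain ⟨n, rfl⟩ : ∃ n, r = -12 * n := ⟨-r / 12, by field_simp⟩
    obtain ⟨k, rfl⟩ : ∃ k, s = -16 * k := ⟨-s / 16, by field_simp⟩
    simp only [Set.mem_ofPred_eq, Set.mem_compl_iff, Set.mem_range, not_iff_not, coeffDisc, hI, hJ]
    constructor
    · intro h
      obtain ⟨t, rfl, rfl⟩ := exists_sq_cube h
      exact ⟨t, rfl⟩
    · rintro ⟨t, h⟩
      simp [h12, h16] at h
      rw [← h.1, ← h.2]
      ring
  rw [e, Set.ncard_compl, ← Set.image_univ, Set.ncard_image_of_injective _ hinj,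
    Set.ncard_univ, Nat.card_prod]
  ring_nf

theorem translate_ne_zero {h : F} {v : Fin 5 → F} (hv : v ≠ 0) : act 1 0 h 1 v ≠ 0 := by
  intro h0
  apply hv
  rw [← act_translate h v, h0]
  funext i
  fin_cases i <;> simp [act]

theorem quartic_ne_zero (x : F × F × F) : ![1, 0, x.1, x.2.1, x.2.2] ≠ 0 :=
  fun h => by simpa using congrFun h 0

theorem cubic_ne_zero (x : F × F) : ![0, 1, 0, x.1, x.2] ≠ 0 :=
  fun h => by simpa using congrFun h 1

theorem finite_projQuartic [Finite F] : Finite (ProjQuartic F) :=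
  Finite.of_surjective (fun v : {v : Fin 5 → F // v ≠ 0} => point v.1 v.2) fun P => by
    obtain ⟨v, hv, rfl⟩ := exists_eq_point P
    exact ⟨⟨v, hv⟩, rfl⟩

/-- Scaling and a translation Y ↦ Y - hX bring a form uniquely to depressed shape. Forms not
vanishing at infinity contribute q(q³ - q²) points, those with a simple root at infinity q(q² - q).
-/
theorem ncard_discNeZero [Finite F] (h2 : (2 : F) ≠ 0) (h3 : (3 : F) ≠ 0) :
    {P : ProjQuartic F | DiscNeZero P}.ncard = Nat.card F ^ 4 - Nat.card F ^ 2 := by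
  obtain ⟨h4, h6, h12, h16, h36, h432, -⟩ := ne_zero_of_two_three h2 h3
  set A : Set (F × F × F × F) :=
    Set.univ ×ˢ {x : F × F × F | coeffDisc ![1, 0, x.1, x.2.1, x.2.2] ≠ 0} with hA
  set B : Set (F × F × F) :=
    Set.univ ×ˢ {x : F × F | coeffDisc ![0, 1, 0, x.1, x.2] ≠ 0} with hB
  set f : F × F × F × F → ProjQuartic F := fun x =>
    point (act 1 0 x.1 1 ![1, 0, x.2.1, x.2.2.1, x.2.2.2])
      (translate_ne_zero (quartic_ne_zero x.2)) with hf
  set g : F × F × F → ProjQuartic F := fun x =>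
    point (act 1 0 x.1 1 ![0, 1, 0, x.2.1, x.2.2]) (translate_ne_zero (cubic_ne_zero x.2)) with hg
  have hfi : Function.Injective f := by
    rintro ⟨a, p, r, s⟩ ⟨a', p', r', s'⟩ h
    obtain ⟨k, hk, e⟩ := point_eq_point_iff.mp h
    have e0 := congrFun e 0
    simp [act] at e0
    rw [← e0, one_smul] at e
    have e1 := congrFun e 1
    simp [act, h4] at e1
    rw [e1] at e
    have e2 := congrArg (act 1 0 (-a') 1) e
    rw [act_translate, act_translate] at e2
    have c2 := congrFun e2 2
    have c3 := congrFun e2 3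
    have c4 := congrFun e2 4
    simp at c2 c3 c4
    rw [e1, c2, c3, c4]
  have hgi : Function.Injective g := by
    rintro ⟨a, r, s⟩ ⟨a', r', s'⟩ h
    obtain ⟨k, hk, e⟩ := point_eq_point_iff.mp h
    have e0 := congrFun e 1
    simp [act] at e0
    rw [← e0, one_smul] at e
    have e1 := congrFun e 2
    simp [act, h3] at e1
    rw [e1] at e
    have e2 := congrArg (act 1 0 (-a') 1) e
    rw [act_translate, act_translate] at e2
    have c3 := congrFun e2 3
    have c4 := congrFun e2 4
    simp at c3 c4
    rw [e1, c3, c4]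
  have hS : {P : ProjQuartic F | DiscNeZero P} = f '' A ∪ g '' B := by
    ext P
    constructor
    · intro hP
      obtain ⟨v, hv, rfl⟩ := exists_eq_point P
      have hd := (discNeZero_point h2 h3 hv).mp hP
      by_cases h0 : v 0 = 0
      -- If `v 0` and `v 1` both vanish, infinity is a multiple root, and Δ = 0.
      · have h1 : v 1 ≠ 0 := by
          intro h1
          apply hd
          simp [coeffDisc, coeffI, coeffJ, h0, h1]
          field_simp
          ring
        right
        -- The translation by `a` removes the term Y²X².
        set a := v 2 / v 1 / 3 with ha
        set w := act 1 0 a 1 ((v 1)⁻¹ • v) with hw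
        have w0 : w 0 = 0 := by simp [hw, act, h0]
        have w1 : w 1 = 1 := by simp [hw, act, h0, h1]
        have w2 : w 2 = 0 := by simp [hw, act, h0, h1, ha]; field_simp; ring
        have hwe : ![0, 1, 0, w 3, w 4] = w := by
          funext i
          fin_cases i <;> simp [w0, w1, w2]
        refine ⟨(-a, w 3, w 4), ⟨trivial, ?_⟩, ?_⟩
        · change coeffDisc ![0, 1, 0, w 3, w 4] ≠ 0
          rw [hwe, hw, coeffDisc_translate]
          simp only [coeffDisc, coeffI_smul, coeffJ_smul]
          rw [show ((v 1)⁻¹ ^ 2 * coeffI v) ^ 3 - ((v 1)⁻¹ ^ 3 * coeffJ v) ^ 2 =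
            (v 1)⁻¹ ^ 6 * coeffDisc v by rw [coeffDisc]; ring]
          exact mul_ne_zero (pow_ne_zero _ (inv_ne_zero h1)) hd
        · refine point_eq_point_iff.mpr ⟨(v 1)⁻¹, inv_ne_zero h1, ?_⟩
          simp only [hwe]
          rw [hw, act_translate]
      · left
        -- The translation by `a` removes the term Y³X.
        set a := v 1 / v 0 / 4 with ha
        set w := act 1 0 a 1 ((v 0)⁻¹ • v) with hw
        have w0 : w 0 = 1 := by simp [hw, act, h0]
        have w1 : w 1 = 0 := by simp [hw, act, h0, ha]; field_simp; ring
        have hwe : ![1, 0, w 2, w 3, w 4] = w := by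
          funext i
          fin_cases i <;> simp [w0, w1]
        refine ⟨(-a, w 2, w 3, w 4), ⟨trivial, ?_⟩, ?_⟩
        · change coeffDisc ![1, 0, w 2, w 3, w 4] ≠ 0
          rw [hwe, hw, coeffDisc_translate]
          simp only [coeffDisc, coeffI_smul, coeffJ_smul]
          rw [show ((v 0)⁻¹ ^ 2 * coeffI v) ^ 3 - ((v 0)⁻¹ ^ 3 * coeffJ v) ^ 2 =
            (v 0)⁻¹ ^ 6 * coeffDisc v by rw [coeffDisc]; ring]
          exact mul_ne_zero (pow_ne_zero _ (inv_ne_zero h0)) hd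
        · refine point_eq_point_iff.mpr ⟨(v 0)⁻¹, inv_ne_zero h0, ?_⟩
          simp only [hwe]
          rw [hw, act_translate]
    · rintro (⟨x, ⟨-, hx⟩, rfl⟩ | ⟨x, ⟨-, hx⟩, rfl⟩)
      · exact (discNeZero_point h2 h3 (translate_ne_zero (quartic_ne_zero x.2))).mpr
          (by rw [coeffDisc_translate]; exact hx)
      · exact (discNeZero_point h2 h3 (translate_ne_zero (cubic_ne_zero x.2))).mpr
          (by rw [coeffDisc_translate]; exact hx)
  have hdisj : Disjoint (f '' A) (g '' B) := by
    rw [Set.disjoint_left]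
    rintro _ ⟨x, -, rfl⟩ ⟨y, -, h⟩
    obtain ⟨k, hk, e⟩ := point_eq_point_iff.mp h
    have e0 := congrFun e 0
    simp [act] at e0
    exact hk e0.symm
  have := finite_projQuartic (F := F)
  rw [hS, Set.ncard_union_eq hdisj, Set.ncard_image_of_injective _ hfi,
    Set.ncard_image_of_injective _ hgi, hA, hB, Set.ncard_prod, Set.ncard_prod, Set.ncard_univ,
    ncard_depressed h2 h3, ncard_depressed_cubic h2 h3, Nat.mul_sub, Nat.mul_sub]
  have l1 : Nat.card F ^ 3 ≤ Nat.card F ^ 4 := Nat.pow_le_pow_right Nat.card_pos (by norm_num)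
  have l2 : Nat.card F ^ 2 ≤ Nat.card F ^ 3 := Nat.pow_le_pow_right Nat.card_pos (by norm_num)
  ring_nf
  omega

theorem card_pgl [Finite F] :
    Nat.card (Matrix.ProjGenLinGroup (Fin 2) F) = Nat.card F ^ 3 - Nat.card F := by
  have := Fintype.ofFinite F
  have h := Subgroup.card_eq_card_quotient_mul_card_subgroup
    (Subgroup.center (Matrix.GeneralLinearGroup (Fin 2) F))
  have hc : Nat.card (Subgroup.center (Matrix.GeneralLinearGroup (Fin 2) F)) = Nat.card F - 1 := by
    rw [Matrix.GeneralLinearGroup.center_eq_range_scalar, ← Nat.card_units]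
    refine (Nat.card_congr (MonoidHom.ofInjective (f := Matrix.GeneralLinearGroup.scalar (Fin 2))
      ?_).toEquiv).symm
    intro u u' e
    ext
    have := congrArg (fun g : Matrix.GeneralLinearGroup (Fin 2) F => g 0 0) e
    simpa using this
  rw [hc, Matrix.card_GL_field, Fin.prod_univ_two, ← Nat.card_eq_fintype_card] at h
  have hq : 1 < Nat.card F := Finite.one_lt_card
  have e : (Nat.card F ^ 2 - Nat.card F ^ ((0 : Fin 2) : ℕ)) *
      (Nat.card F ^ 2 - Nat.card F ^ ((1 : Fin 2) : ℕ)) =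
      (Nat.card F ^ 3 - Nat.card F) * (Nat.card F - 1) := by
    obtain ⟨m, hm⟩ : ∃ m, Nat.card F = m + 1 := ⟨Nat.card F - 1, by omega⟩
    rw [hm]
    have e1 : (m + 1) ^ 2 - (m + 1) ^ ((0 : Fin 2) : ℕ) = m * (m + 2) := by
      simp only [Fin.val_zero, pow_zero]
      rw [Nat.sub_eq_iff_eq_add (by nlinarith)]; ring
    have e2 : (m + 1) ^ 2 - (m + 1) ^ ((1 : Fin 2) : ℕ) = m * (m + 1) := by
      simp only [Fin.val_one, pow_one]
      rw [Nat.sub_eq_iff_eq_add (by nlinarith)]; ring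
    have e3 : (m + 1) ^ 3 - (m + 1) = m * (m + 1) * (m + 2) := by
      rw [Nat.sub_eq_iff_eq_add (Nat.le_self_pow (by norm_num) _)]; ring
    rw [e1, e2, e3, Nat.add_sub_cancel]
    ring
  rw [e] at h
  exact (Nat.eq_of_mul_eq_mul_right (by omega) h).symm

theorem finite_pgl [Finite F] : Finite (Matrix.ProjGenLinGroup (Fin 2) F) :=
  Finite.of_surjective _ Matrix.ProjGenLinGroup.mk_surjective

theorem ncard_orb_mul [Finite F] (P : ProjQuartic F) :
    (orb P).ncard * Nat.card (MulAction.stabilizer (Matrix.ProjGenLinGroup (Fin 2) F) P) =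
      Nat.card (Matrix.ProjGenLinGroup (Fin 2) F) := by
  rw [← Nat.card_coe_set_eq, ← Nat.card_prod]
  exact Nat.card_congr
    (MulAction.orbitProdStabilizerEquivGroup (Matrix.ProjGenLinGroup (Fin 2) F) P)

/-! ### Families of inequivalent forms -/

/-- Pairwise inequivalent points with `j`-invariant `r` and stabilizers of orders `n i`, such that
the sum of the sizes of their orbits is the order of `PGL₂`. -/
structure IsFamily {ι : Type*} [Fintype ι] (r : F) (P : ι → ProjQuartic F) (n : ι → ℕ) :
    Prop where
  disc : ∀ i, DiscNeZero (P i)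
  j : ∀ i, projJ (P i) = r
  card : ∀ i, Nat.card (MulAction.stabilizer (Matrix.ProjGenLinGroup (Fin 2) F) (P i)) = n i
  inj : ∀ i k, P k ∈ orb (P i) → i = k
  sum : ∑ i, (1 / n i : ℚ) = 1

theorem orb_eq_of_mem {P Q : ProjQuartic F} (h : Q ∈ orb P) : orb Q = orb P :=
  MulAction.orbit_eq_iff.mpr h

namespace IsFamily

variable {ι : Type*} [Fintype ι] {r : F} {P : ι → ProjQuartic F} {n : ι → ℕ}

theorem orb_injective (h : IsFamily r P n) : Function.Injective (fun i => orb (P i)) := by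
  intro i k e
  apply h.inj
  rw [show orb (P i) = orb (P k) from e]
  exact MulAction.mem_orbit_self _

theorem n_pos [Finite F] (h : IsFamily r P n) (i : ι) : 0 < n i := by
  have := finite_pgl (F := F)
  rw [← h.card i]
  exact Nat.card_pos

/-- The orbits are disjoint and the i-th has |G| / n i points, so the mass condition `sum` makes the
total |G|. -/
theorem ncard_iUnion [Finite F] (h : IsFamily r P n) :
    (⋃ i, orb (P i)).ncard = Nat.card (Matrix.ProjGenLinGroup (Fin 2) F) := by
  have := finite_projQuartic (F := F)
  have hd : Pairwise (Function.onFun Disjoint fun i => orb (P i)) := by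
    intro i k hik
    rw [Function.onFun, Set.disjoint_left]
    intro Q hi hk
    apply hik
    apply h.inj
    rw [← orb_eq_of_mem hi, orb_eq_of_mem hk]
    exact MulAction.mem_orbit_self _
  rw [Set.ncard_iUnion_of_finite (fun i => Set.toFinite _) hd, finsum_eq_sum_of_fintype]
  have : ((∑ i, (orb (P i)).ncard : ℕ) : ℚ) =
      (Nat.card (Matrix.ProjGenLinGroup (Fin 2) F) : ℚ) * ∑ i, (1 / n i : ℚ) := by
    rw [Nat.cast_sum, Finset.mul_sum]
    refine Finset.sum_congr rfl fun i _ => ?_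
    have hn : (n i : ℚ) ≠ 0 := by exact_mod_cast (h.n_pos i).ne'
    rw [← ncard_orb_mul (P i), h.card i]
    push_cast
    field_simp
  rw [h.sum, mul_one] at this
  exact_mod_cast this

/-- This is the counting argument. A family for every value of `j` gives |G| points in every fibre;
as there are exactly q·|G| points in all, no fibre has more, and each family meets every orbit in
its fibre. -/
theorem exists_mem_orb [Finite F] (h2 : (2 : F) ≠ 0) (h3 : (3 : F) ≠ 0)
    (hall : ∀ r : F, ∃ (k : ℕ) (P : Fin k → ProjQuartic F) (n : Fin k → ℕ), IsFamily r P n)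
    (h : IsFamily r P n) {Q : ProjQuartic F} (hQ : DiscNeZero Q) (hj : projJ Q = r) :
    ∃ i, Q ∈ orb (P i) := by
  have := finite_projQuartic (F := F)
  have := Fintype.ofFinite F
  have := Fintype.ofFinite (ProjQuartic F)
  classical
  set A : F → Set (ProjQuartic F) := fun s => {Q | DiscNeZero Q ∧ projJ Q = s} with hA
  have hsub : ∀ {ι' : Type} [Fintype ι'] {s : F} {P' : ι' → ProjQuartic F} {n' : ι' → ℕ},
      IsFamily s P' n' → (⋃ i, orb (P' i)) ⊆ A s := by
    intro ι' _ s P' n' h' R hR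
    obtain ⟨i, hi⟩ := Set.mem_iUnion.mp hR
    exact ⟨(discNeZero_of_mem_orb h2 h3 hi).mpr (h'.disc i),
      (projJ_of_mem_orb h2 h3 hi).trans (h'.j i)⟩
  have hge : ∀ s, Nat.card (Matrix.ProjGenLinGroup (Fin 2) F) ≤ (A s).ncard := by
    intro s
    obtain ⟨k, P', n', h'⟩ := hall s
    rw [← h'.ncard_iUnion]
    exact Set.ncard_le_ncard (hsub h')
  have htot : ∑ s, (A s).ncard = ∑ _s : F, Nat.card (Matrix.ProjGenLinGroup (Fin 2) F) := by
    have hd : Pairwise (Function.onFun Disjoint A) := by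
      intro s t hst
      rw [Function.onFun, Set.disjoint_left]
      intro R hs ht
      exact hst (hs.2.symm.trans ht.2)
    have hu : (⋃ s, A s) = {P : ProjQuartic F | DiscNeZero P} := by
      ext R
      simp [hA]
    rw [← finsum_eq_sum_of_fintype, ← Set.ncard_iUnion_of_finite (fun i => Set.toFinite _) hd, hu,
      ncard_discNeZero h2 h3, Finset.sum_const, Finset.card_univ, ← Nat.card_eq_fintype_card,
      card_pgl, smul_eq_mul, Nat.mul_sub]
    ring_nf
  -- Termwise inequalities between two equal sums are equalities.
  have heq : ∀ s, Nat.card (Matrix.ProjGenLinGroup (Fin 2) F) = (A s).ncard := fun s =>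
    (Finset.sum_eq_sum_iff_of_le (fun s _ => hge s)).mp htot.symm s (Finset.mem_univ s)
  have hsub' : (⋃ i, orb (P i)) ⊆ A r := by
    intro R hR
    obtain ⟨i, hi⟩ := Set.mem_iUnion.mp hR
    exact ⟨(discNeZero_of_mem_orb h2 h3 hi).mpr (h.disc i),
      (projJ_of_mem_orb h2 h3 hi).trans (h.j i)⟩
  have hfin : (⋃ i, orb (P i)) = A r :=
    Set.eq_of_subset_of_ncard_le hsub' (by rw [h.ncard_iUnion, heq r])
  have : Q ∈ ⋃ i, orb (P i) := hfin ▸ ⟨hQ, hj⟩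
  exact Set.mem_iUnion.mp this

theorem setOf_orbits [Finite F] (h2 : (2 : F) ≠ 0) (h3 : (3 : F) ≠ 0)
    (hall : ∀ r : F, ∃ (k : ℕ) (P : Fin k → ProjQuartic F) (n : Fin k → ℕ), IsFamily r P n)
    (h : IsFamily r P n) :
    {O ∈ orbits F | ∀ Q ∈ O, projJ Q = r} = Set.range fun i => orb (P i) := by
  ext O
  constructor
  · rintro ⟨⟨Q, hQ, rfl⟩, hj⟩
    obtain ⟨i, hi⟩ := h.exists_mem_orb h2 h3 hall hQ (hj Q (MulAction.mem_orbit_self Q))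
    exact ⟨i, (orb_eq_of_mem hi).symm⟩
  · rintro ⟨i, rfl⟩
    exact ⟨⟨P i, h.disc i, rfl⟩, fun Q hQ => (projJ_of_mem_orb h2 h3 hQ).trans (h.j i)⟩

/-- The size of the i-th orbit times d is |G| exactly when the stabilizer has order d, so orbits of
given size are counted by the entries `n i = d`. -/
theorem orbitCount_eq [Finite F] (h2 : (2 : F) ≠ 0) (h3 : (3 : F) ≠ 0)
    (hall : ∀ r : F, ∃ (k : ℕ) (P : Fin k → ProjQuartic F) (n : Fin k → ℕ), IsFamily r P n)
    (h : IsFamily r P n) (d : ℕ) : orbitCount r d = (Finset.univ.filter fun i => n i = d).card := by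
  have := finite_projQuartic (F := F)
  have e : {O ∈ orbits F | (∀ Q ∈ O, projJ Q = r) ∧
      O.ncard * d = Nat.card (Matrix.ProjGenLinGroup (Fin 2) F)} =
      (fun i => orb (P i)) '' {i | n i = d} := by
    have hs := h.setOf_orbits h2 h3 hall
    have hiff : ∀ i, (orb (P i)).ncard * d = Nat.card (Matrix.ProjGenLinGroup (Fin 2) F) ↔
        n i = d := by
      intro i
      rw [← ncard_orb_mul (P i), h.card i]
      have : 0 < (orb (P i)).ncard :=
        (Set.ncard_pos (Set.toFinite _)).mpr ⟨P i, MulAction.mem_orbit_self _⟩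
      constructor
      · intro e; exact (Nat.eq_of_mul_eq_mul_left this e).symm
      · rintro rfl; rfl
    ext O
    constructor
    · rintro ⟨hO, hj, hd⟩
      have : O ∈ Set.range fun i => orb (P i) := hs ▸ ⟨hO, hj⟩
      obtain ⟨i, rfl⟩ := this
      exact ⟨i, (hiff i).mp hd, rfl⟩
    · rintro ⟨i, hi, rfl⟩
      have : orb (P i) ∈ {O ∈ orbits F | ∀ Q ∈ O, projJ Q = r} := hs ▸ ⟨i, rfl⟩
      exact ⟨this.1, this.2, (hiff i).mpr hi⟩
  rw [orbitCount, e, Set.ncard_image_of_injective _ h.orb_injective, Set.ncard_eq_toFinset_card']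
  congr 1
  ext i
  simp

end IsFamily

end

end BinaryQuartic

end

noncomputable section

namespace BinaryQuartic

open MvPolynomial

/-! ### Forms with a root at infinity -/

section

variable {F : Type*} [Field F]

theorem row_ofCoeffs (h2 : (2 : F) ≠ 0) (h3 : (3 : F) ≠ 0) {v : Fin 5 → F} (hv : v ≠ 0) {r : F}
    {T : FormType} {H : Type} [Group H] (hd : coeffDisc v ≠ 0)
    (hj : 1728 * coeffI v ^ 3 / coeffDisc v = r) (hT : HasType (ofCoeffs v) T)
    (hH : Nonempty (MulAction.stabilizer (Matrix.ProjGenLinGroup (Fin 2) F) (point v hv) ≃* H)) :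
    Row (ofCoeffs v) r T H :=
  ⟨point v hv, isClass_ofCoeffs_iff.mpr ⟨hv, rfl⟩, (discNeZero_point h2 h3 hv).mpr hd,
    (projJ_point h2 h3 hv).trans hj, hT, hH⟩

/-- In the applications T contains one element for each possible image of a chosen root, and K
contains the elements of the stabilizer that fix this root. -/
theorem card_le_of_cosets {G : Type*} [Group G] (H : Subgroup G) (T K : Set G) [Finite G]
    (h : ∀ g ∈ H, ∃ t ∈ T, t⁻¹ * g ∈ K) : Nat.card H ≤ T.ncard * K.ncard := by
  rw [← Set.ncard_prod, ← SetLike.coe_sort_coe, Nat.card_coe_set_eq]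
  have : (H : Set G) ⊆ (fun x : G × G => x.1 * x.2) '' (T ×ˢ K) := by
    intro g hg
    obtain ⟨t, ht, hk⟩ := h g hg
    exact ⟨(t, t⁻¹ * g), ⟨ht, hk⟩, by simp⟩
  exact (Set.ncard_le_ncard this).trans (Set.ncard_image_le (Set.toFinite _))

theorem ncard_pair_le {α : Type*} (a b : α) : ({a, b} : Set α).ncard ≤ 2 := by
  refine (Set.ncard_insert_le _ _).trans ?_
  simp

theorem ncard_triple_le {α : Type*} (a b c : α) : ({a, b, c} : Set α).ncard ≤ 3 := by
  refine (Set.ncard_insert_le _ _).trans ?_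
  have := ncard_pair_le b c
  omega

theorem ncard_quadruple_le {α : Type*} (a b c d : α) : ({a, b, c, d} : Set α).ncard ≤ 4 := by
  refine (Set.ncard_insert_le _ _).trans ?_
  have := ncard_triple_le b c d
  omega

theorem inv_pgl {a b c d : F} (h : a * d - b * c ≠ 0) :
    (pgl a b c d h)⁻¹ = pgl d (-b) (-c) a (by
      rw [show d * a - -b * -c = a * d - b * c by ring]; exact h) := by
  rw [inv_eq_iff_mul_eq_one, pgl_mul_pgl, pgl_eq_one_iff]
  exact ⟨by ring, by ring, by ring⟩

/-- An element of the stabilizer either fixes the root at infinity or maps it to a root. -/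
theorem Carries.infty {a b c d : F} {v : Fin 5 → F} (h : Carries a b c d v v) (hv : v 0 = 0)
    (hb : b ≠ 0) : value v 1 (d / b) = 0 := by
  have h1 := h.value_eq_zero (L := F) (x := 0) (y := 1) (by simp [value, hv])
  simp at h1
  have h4 := value_mul b v 1 (d / b)
  rw [mul_one, mul_div_cancel₀ _ hb, h1] at h4
  exact (mul_eq_zero.mp h4.symm).resolve_left (pow_ne_zero 4 hb)

/-- If the involution `τ` in the stabilizer maps infinity to the same root as `g`, then `τ g` fixes
infinity. -/
theorem exists_inv_mul_eq {a b c d a' b' c' d' : F} {v : Fin 5 → F} (hv : v ≠ 0)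
    (h : a * d - b * c ≠ 0) (h' : a' * d' - b' * c' ≠ 0)
    (hg : Carries a b c d v v) (ht : Carries a' b' c' d' v v) (hr : b * d' = b' * d) :
    ∃ (x y z : F) (hxz : x * z - 0 * y ≠ 0), Carries x 0 y z v v ∧
      (pgl a' b' c' d' h')⁻¹ * pgl a b c d h = pgl x 0 y z hxz := by
  have hm := mul_mem (inv_mem ((mem_stabilizer_point (h := h') (hv := hv)).mpr ht))
    ((mem_stabilizer_point (h := h) (hv := hv)).mpr hg)
  rw [inv_pgl, pgl_mul_pgl] at hm ⊢
  have e : d' * b + -b' * d = 0 := by linear_combination hr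
  have hdet : (d' * a + -b' * c) * (-c' * b + a' * d) - 0 * (-c' * a + a' * c) ≠ 0 := by
    have := mul_ne_zero h h'
    intro h0
    apply this
    linear_combination h0 - (-c' * a + a' * c) * e
  refine ⟨d' * a + -b' * c, -c' * a + a' * c, -c' * b + a' * d, hdet, ?_, ?_⟩
  · rw [mem_stabilizer_point] at hm
    rwa [e] at hm
  · rw [pgl_eq_pgl_iff]
    exact ⟨1, one_ne_zero, by ring, by linear_combination -e, by ring, by ring⟩

/-! ### The forms `E_r` -/

/-- The constant `(256/27) (1 - 1728/r)`. -/
def kE (r : F) : F := 256 / 27 * (1 - 1728 / r)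

theorem formE_eq (r : F) : formE r = ofCoeffs ![0, kE r, 0, -4, 1] := by
  simp [formE, ofCoeffs, kE, map_ofNat C]
  ring

theorem kE_ne_zero (h2 : (2 : F) ≠ 0) (h3 : (3 : F) ≠ 0) {r : F} (h0 : r ≠ 0) (h : r ≠ 1728) :
    kE r ≠ 0 := by
  obtain ⟨-, -, -, -, -, -, h27, h256, -⟩ := ne_zero_of_two_three h2 h3
  rw [kE]
  refine mul_ne_zero (div_ne_zero h256 h27) ?_
  intro h'
  apply h
  field_simp at h'
  linear_combination h'

theorem kE_mul (h2 : (2 : F) ≠ 0) (h3 : (3 : F) ≠ 0) {r : F} (h0 : r ≠ 0) :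
    27 * r * kE r = 256 * (r - 1728) := by
  obtain ⟨-, -, -, -, -, -, h27, h256, -⟩ := ne_zero_of_two_three h2 h3
  rw [kE]
  field_simp

/-- With k = `kE r` one has I = k/3 and J = -k²/16, so Δ = k³(256 - 27k)/(27·256). The constant k is
chosen so that 256 - 27k = 256·1728/r, which makes the `j`-invariant equal to r. -/
theorem coeffDisc_E (h2 : (2 : F) ≠ 0) (h3 : (3 : F) ≠ 0) {r : F} (h0 : r ≠ 0) :
    coeffDisc ![0, kE r, 0, -4, 1] = 64 * kE r ^ 3 / r := by
  obtain ⟨-, -, -, -, h36, h432, h27, h256, -⟩ := ne_zero_of_two_three h2 h3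
  have hk := kE_mul h2 h3 h0
  simp [coeffDisc, coeffI, coeffJ]
  field_simp
  grind

theorem coeffI_E (h2 : (2 : F) ≠ 0) (h3 : (3 : F) ≠ 0) (r : F) :
    coeffI ![0, kE r, 0, -4, 1] = kE r / 3 := by
  obtain ⟨-, -, -, -, h36, -⟩ := ne_zero_of_two_three h2 h3
  simp [coeffI]
  field_simp
  ring

theorem value_E (r y : F) :
    value ![0, kE r, 0, -4, 1] 1 y = kE r * y ^ 3 - 4 * y + 1 := by
  simp [value]
  ring

theorem E_ne_zero (r : F) : ![0, kE r, 0, -4, 1] ≠ 0 := fun h => by simpa using congrFun h 4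

/-- The vanishing of the coefficient of Y²X² forces `c = 0`; then the ratio -4 : 1 of the last two
coefficients forces `a = d`. Hence only the identity of the stabilizer fixes infinity. -/
theorem carries_E_infty (h2 : (2 : F) ≠ 0) (h3 : (3 : F) ≠ 0) {r a c d : F} (hk : kE r ≠ 0)
    (h : a * d - 0 * c ≠ 0)
    (hc : Carries a 0 c d ![0, kE r, 0, -4, 1] ![0, kE r, 0, -4, 1]) : c = 0 ∧ a = d := by
  obtain ⟨k, hk0, e⟩ := hc
  have ha : a ≠ 0 := by rintro rfl; simp at h
  have hd : d ≠ 0 := by rintro rfl; simp at h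
  have e2 := congrFun e 2
  simp [act, h3, hk, ha, hd] at e2
  subst e2
  have h4 := (ne_zero_of_two_three h2 h3).1
  have e3 := congrFun e 3
  have e4 := congrFun e 4
  simp [act] at e3 e4
  refine ⟨rfl, ?_⟩
  have : (4 * d ^ 3) * a = (4 * d ^ 3) * d := by linear_combination e3 - 4 * e4
  exact mul_left_cancel₀ (by positivity) this

/-- The matrix has trace zero and exchanges infinity with the root (1 : y); its determinant is
-k(3ky² - 4). -/
theorem act_involution_E {k y : F} (hy : k * y ^ 3 - 4 * y + 1 = 0) :
    act (-(k * y)) k (2 * k * y ^ 2 - 4) (k * y) ![0, k, 0, -4, 1] =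
      (k ^ 2 * (3 * k * y ^ 2 - 4) ^ 2) • ![0, k, 0, -4, 1] := by
  funext i
  fin_cases i <;> simp [act] <;> grind

theorem exists_involution_E (h2 : (2 : F) ≠ 0) (h3 : (3 : F) ≠ 0) {r : F} (h0 : r ≠ 0)
    (h1728 : r ≠ 1728) {y : F} (hy : kE r * y ^ 3 - 4 * y + 1 = 0) :
    ∃ h : (-(kE r * y)) * (kE r * y) - kE r * (2 * kE r * y ^ 2 - 4) ≠ 0,
      Carries (-(kE r * y)) (kE r) (2 * kE r * y ^ 2 - 4) (kE r * y)
        ![0, kE r, 0, -4, 1] ![0, kE r, 0, -4, 1] ∧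
      pgl _ _ _ _ h ≠ 1 ∧ pgl _ _ _ _ h * pgl _ _ _ _ h = 1 := by
  have hk := kE_ne_zero h2 h3 h0 h1728
  have hkr := kE_mul h2 h3 h0
  set k := kE r with hk_def
  obtain ⟨h4, -, -, -, -, -, h27, h256, hh1728, h8⟩ := ne_zero_of_two_three h2 h3
  -- This is the derivative of kY³ - 4Y + 1 at y. A double root would give y = 3/8 and k = 256/27,
  -- that is, 1728/r = 0.
  have hs : 3 * k * y ^ 2 - 4 ≠ 0 := by
    intro h
    have h38 : 8 * y = 3 := by linear_combination -3 * hy + y * h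
    have : 27 * k = 256 := by
      linear_combination 64 * h - 3 * k * (8 * y + 3) * h38
    have e : (256 : F) * 1728 = 0 := by linear_combination hkr - r * this
    exact mul_ne_zero h256 hh1728 e
  have h : (-(k * y)) * (k * y) - k * (2 * k * y ^ 2 - 4) ≠ 0 := by
    intro h'
    apply mul_ne_zero hk hs
    linear_combination -h'
  refine ⟨h, ⟨k ^ 2 * (3 * k * y ^ 2 - 4) ^ 2, by positivity, act_involution_E hy⟩, ?_, ?_⟩
  · rw [Ne, pgl_eq_one_iff]
    exact fun h' => hk h'.1
  · rw [pgl_mul_pgl, pgl_eq_one_iff]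
    exact ⟨by ring, by ring, by ring⟩

/-- Inversion y ↦ 1/y carries the roots of kY³ - 4Y + 1 to those of Z³ - 4Z² + k, and 0 is a root of
neither. -/
theorem ncard_roots_E (h2 : (2 : F) ≠ 0) (h3 : (3 : F) ≠ 0) {r : F} (h0 : r ≠ 0)
    (h1728 : r ≠ 1728) :
    {y : F | value ![0, kE r, 0, -4, 1] 1 y = 0}.ncard =
      {w : F | w ^ 3 - 4 * w ^ 2 + 256 / 27 * (1 - 1728 / r) = 0}.ncard := by
  have hk := kE_ne_zero h2 h3 h0 h1728
  have e : {y : F | value ![0, kE r, 0, -4, 1] 1 y = 0} =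
      (fun y => y⁻¹) '' {w : F | w ^ 3 - 4 * w ^ 2 + 256 / 27 * (1 - 1728 / r) = 0} := by
    ext y
    simp only [Set.mem_ofPred_eq, value_E, Set.mem_image]
    rw [← kE]
    constructor
    · intro h
      have hy : y ≠ 0 := by rintro rfl; simp at h
      refine ⟨y⁻¹, ?_, inv_inv y⟩
      field_simp
      linear_combination h
    · rintro ⟨w, h, rfl⟩
      have hw : w ≠ 0 := by
        rintro rfl
        apply hk
        linear_combination h
      field_simp
      linear_combination h
  rw [e, Set.ncard_image_of_injective _ inv_injective]

/-- For each finite root y the stabilizer has exactly one element taking infinity to y, an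
involution. The clause `d = y * b` records this image and serves to distinguish the involutions of
different roots. -/
theorem exists_mem_stabilizer_E [Finite F] (h2 : (2 : F) ≠ 0) (h3 : (3 : F) ≠ 0) {r : F}
    (h0 : r ≠ 0) (h1728 : r ≠ 1728) {y : F} (hy : value ![0, kE r, 0, -4, 1] 1 y = 0) :
    ∃ τ ∈ MulAction.stabilizer (Matrix.ProjGenLinGroup (Fin 2) F) (point _ (E_ne_zero r)),
      τ ≠ 1 ∧ τ * τ = 1 ∧ (∀ a b c d h, τ = pgl a b c d h → d = y * b) ∧
      ∀ a b c d h, pgl a b c d h ∈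
        MulAction.stabilizer (Matrix.ProjGenLinGroup (Fin 2) F) (point _ (E_ne_zero r)) →
        b ≠ 0 → d / b = y → τ⁻¹ * pgl a b c d h = 1 := by
  rw [value_E] at hy
  obtain ⟨hdet, hc, hne, hsq⟩ := exists_involution_E h2 h3 h0 h1728 hy
  refine ⟨_, mem_stabilizer_point.mpr hc, hne, hsq, ?_, ?_⟩
  · intro a b c d h e
    obtain ⟨u, -, -, hb, -, hd⟩ := pgl_eq_pgl_iff.mp e
    rw [hb, hd]
    ring
  · intro a b c d h hm hb hy'
    rw [mem_stabilizer_point] at hm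
    obtain ⟨x, y', z, hxz, hcar, e⟩ := exists_inv_mul_eq (E_ne_zero r) h hdet hm hc (by
      rw [← hy']
      field_simp)
    rw [e, pgl_eq_one_iff]
    have := carries_E_infty h2 h3 (kE_ne_zero h2 h3 h0 h1728) hxz hcar
    exact ⟨rfl, this.1, this.2⟩

theorem mem_stabilizer_E_infty (h2 : (2 : F) ≠ 0) (h3 : (3 : F) ≠ 0) {r : F}
    (h0 : r ≠ 0) (h1728 : r ≠ 1728) {a c d : F} {h : a * d - 0 * c ≠ 0}
    (hm : pgl a 0 c d h ∈
        MulAction.stabilizer (Matrix.ProjGenLinGroup (Fin 2) F) (point _ (E_ne_zero r))) :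
    pgl a 0 c d h = 1 := by
  rw [mem_stabilizer_point] at hm
  have := carries_E_infty h2 h3 (kE_ne_zero h2 h3 h0 h1728) h hm
  exact pgl_eq_one_iff.mpr ⟨rfl, this.1, this.2⟩

theorem row_E (h2 : (2 : F) ≠ 0) (h3 : (3 : F) ≠ 0) {r : F} (h0 : r ≠ 0) (h1728 : r ≠ 1728)
    {T : FormType} {H : Type} [Group H] (hT : HasType (ofCoeffs ![0, kE r, 0, -4, 1]) T)
    (hH : Nonempty (MulAction.stabilizer (Matrix.ProjGenLinGroup (Fin 2) F)
      (point _ (E_ne_zero r)) ≃* H)) : Row (formE r) r T H := by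
  rw [formE_eq]
  have hk := kE_ne_zero h2 h3 h0 h1728
  obtain ⟨-, -, -, -, -, -, h27, -, -, h8⟩ := ne_zero_of_two_three h2 h3
  have h64 : (64 : F) ≠ 0 := by rw [show (64 : F) = 2 ^ 6 by norm_num]; positivity
  refine row_ofCoeffs h2 h3 (E_ne_zero r) ?_ ?_ hT hH
  · rw [coeffDisc_E h2 h3 h0]
    positivity
  · rw [coeffDisc_E h2 h3 h0, coeffI_E h2 h3]
    field_simp
    norm_num

theorem row_E_one [Finite F] (h2 : (2 : F) ≠ 0) (h3 : (3 : F) ≠ 0) {r : F} (hr : r ∈ Jset F 1) :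
    Row (formE r) r .F1 Unit := by
  obtain ⟨h0, h1728, hn⟩ := hr
  rw [← ncard_roots_E h2 h3 h0 h1728] at hn
  have hn0 : {y : F | value ![0, kE r, 0, -4, 1] 1 y = 0}.ncard = 0 := by omega
  refine row_E h2 h3 h0 h1728 ?_ (nonempty_mulEquiv_unit ?_)
  · change numLinearFactors _ = 1
    rw [numLinearFactors_of_infty (by simp), hn0]
  · rintro ⟨g, hg⟩
    obtain ⟨a, b, c, d, h, rfl⟩ := exists_eq_pgl g
    apply Subtype.ext
    by_cases hb : b = 0
    · subst hb
      exact mem_stabilizer_E_infty h2 h3 h0 h1728 hg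
    · have := (mem_stabilizer_point.mp hg).infty (by simp) hb
      rw [Set.ncard_eq_zero] at hn0
      exact absurd (hn0 ▸ (show d / b ∈ {y : F | value ![0, kE r, 0, -4, 1] 1 y = 0} from this))
        (Set.notMem_empty _)

theorem row_E_two [Finite F] (h2 : (2 : F) ≠ 0) (h3 : (3 : F) ≠ 0) {r : F} (hr : r ∈ Jset F 2) :
    Row (formE r) r .F2 (Cyc 2) := by
  obtain ⟨h0, h1728, hn⟩ := hr
  rw [← ncard_roots_E h2 h3 h0 h1728] at hn
  have hn1 : {y : F | value ![0, kE r, 0, -4, 1] 1 y = 0}.ncard = 1 := by omega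
  have := finite_pgl (F := F)
  refine row_E h2 h3 h0 h1728 ?_ ?_
  · change numLinearFactors _ = 2
    rw [numLinearFactors_of_infty (by simp), hn1]
  · obtain ⟨y, hy⟩ := Set.ncard_eq_one.mp hn1
    have hy' : value ![0, kE r, 0, -4, 1] 1 y = 0 := by
      have : y ∈ ({y} : Set F) := rfl
      rwa [← hy] at this
    obtain ⟨τ, hτ, hτ1, hτ2, -, hτ4⟩ := exists_mem_stabilizer_E h2 h3 h0 h1728 hy'
    have hle := card_le_of_cosets (MulAction.stabilizer (Matrix.ProjGenLinGroup (Fin 2) F)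
      (point _ (E_ne_zero r))) {1, τ} {1} (by
        intro g hg
        obtain ⟨a, b, c, d, h, rfl⟩ := exists_eq_pgl g
        by_cases hb : b = 0
        · subst hb
          exact ⟨1, by simp, by
            rw [mem_stabilizer_E_infty h2 h3 h0 h1728 hg]; simp⟩
        · have := (mem_stabilizer_point.mp hg).infty (by simp) hb
          have hm : d / b ∈ {y : F | value ![0, kE r, 0, -4, 1] 1 y = 0} := this
          rw [hy] at hm
          exact ⟨τ, by simp, hτ4 _ _ _ _ _ hg hb hm⟩)
    have := ncard_pair_le 1 τ
    rw [Set.ncard_singleton, mul_one] at hle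
    have : Nontrivial (MulAction.stabilizer (Matrix.ProjGenLinGroup (Fin 2) F)
      (point _ (E_ne_zero r))) := ⟨⟨τ, hτ⟩, 1, fun h => hτ1 (congrArg Subtype.val h)⟩
    have := Finite.one_lt_card (α := MulAction.stabilizer (Matrix.ProjGenLinGroup (Fin 2) F)
      (point _ (E_ne_zero r)))
    exact nonempty_mulEquiv_cyc_prime (by omega)

/-- Infinity has four possible images, each reached by one element, and the involutions of two
different finite roots differ; so the stabilizer is a Klein group acting simply transitively on the
roots. -/
theorem row_E_four [Finite F] (h2 : (2 : F) ≠ 0) (h3 : (3 : F) ≠ 0) {r : F} (hr : r ∈ Jset F 4) :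
    Row (formE r) r .F4 (Cyc 2 × Cyc 2) := by
  obtain ⟨h0, h1728, hn⟩ := hr
  rw [← ncard_roots_E h2 h3 h0 h1728] at hn
  have hn3 : {y : F | value ![0, kE r, 0, -4, 1] 1 y = 0}.ncard = 3 := by omega
  have := finite_pgl (F := F)
  refine row_E h2 h3 h0 h1728 ?_ ?_
  · change numLinearFactors _ = 4
    rw [numLinearFactors_of_infty (by simp), hn3]
  · obtain ⟨y₁, y₂, y₃, h12, -, -, hy⟩ := Set.ncard_eq_three.mp hn3
    have hv : ∀ y, value ![0, kE r, 0, -4, 1] 1 y = 0 ↔ y = y₁ ∨ y = y₂ ∨ y = y₃ := fun y => by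
      change y ∈ {y : F | value ![0, kE r, 0, -4, 1] 1 y = 0} ↔ _
      rw [hy]
      simp
    obtain ⟨τ₁, hτ₁, hτ₁1, hτ₁2, hτ₁3, hτ₁4⟩ :=
      exists_mem_stabilizer_E h2 h3 h0 h1728 ((hv y₁).mpr (by simp))
    obtain ⟨τ₂, hτ₂, hτ₂1, hτ₂2, hτ₂3, hτ₂4⟩ :=
      exists_mem_stabilizer_E h2 h3 h0 h1728 ((hv y₂).mpr (by simp))
    obtain ⟨τ₃, hτ₃, -, -, -, hτ₃4⟩ :=
      exists_mem_stabilizer_E h2 h3 h0 h1728 ((hv y₃).mpr (by simp))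
    have hle := card_le_of_cosets (MulAction.stabilizer (Matrix.ProjGenLinGroup (Fin 2) F)
      (point _ (E_ne_zero r))) {1, τ₁, τ₂, τ₃} {1} (by
        intro g hg
        obtain ⟨a, b, c, d, h, rfl⟩ := exists_eq_pgl g
        by_cases hb : b = 0
        · subst hb
          exact ⟨1, by simp, by
            rw [mem_stabilizer_E_infty h2 h3 h0 h1728 hg]; simp⟩
        · rcases (hv _).mp ((mem_stabilizer_point.mp hg).infty (by simp) hb) with hm | hm | hm
          · exact ⟨τ₁, by simp, hτ₁4 _ _ _ _ _ hg hb hm⟩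
          · exact ⟨τ₂, by simp, hτ₂4 _ _ _ _ _ hg hb hm⟩
          · exact ⟨τ₃, by simp, hτ₃4 _ _ _ _ _ hg hb hm⟩)
    have := ncard_quadruple_le 1 τ₁ τ₂ τ₃
    rw [Set.ncard_singleton, mul_one] at hle
    refine (nonempty_mulEquiv_klein (hle.trans this) (s := ⟨τ₁, hτ₁⟩) (t := ⟨τ₂, hτ₂⟩)
      (Subtype.ext hτ₁2) (Subtype.ext hτ₂2) (fun h => hτ₁1 (congrArg Subtype.val h))
      (fun h => hτ₂1 (congrArg Subtype.val h)) fun h => h12 ?_).2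
    have e : τ₁ = τ₂ := congrArg Subtype.val h
    obtain ⟨a, b, c, d, h, rfl⟩ := exists_eq_pgl τ₁
    have d1 := hτ₁3 _ _ _ _ _ rfl
    have d2 := hτ₂3 _ _ _ _ _ e.symm
    have hb : b ≠ 0 := by
      rintro rfl
      exact hτ₁1 (mem_stabilizer_E_infty h2 h3 h0 h1728 hτ₁)
    exact mul_right_cancel₀ hb (d1.symm.trans d2)

end

end BinaryQuartic

end

noncomputable section

namespace BinaryQuartic

open MvPolynomial

/-! ### The forms with `j = 1728` and `j = 0` and a root at infinity -/

section

variable {F : Type*} [Field F]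

/-- The coefficients of `XY(Y² - c X²)`. -/
abbrev sqV (c : F) : Fin 5 → F := ![0, 1, 0, -c, 0]

/-- The coefficients of `X(Y³ - c X³)`. -/
abbrev cubeV (c : F) : Fin 5 → F := ![0, 1, 0, 0, -c]

theorem inv_one_mul_mem {G : Type*} [Group G] {S : Set G} {g : G} (h : g ∈ S) :
    (1 : G)⁻¹ * g ∈ S := by
  simpa using h

theorem formSq_eq (c : F) : formSq c = ofCoeffs (sqV c) := by
  simp [formSq, ofCoeffs, sqV]
  ring

theorem sq_ne_zero (c : F) : (sqV c) ≠ 0 := fun h => by simpa using congrFun h 1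

theorem value_sq (c y : F) : value (sqV c) 1 y = y * (y ^ 2 - c) := by
  simp [value, sqV]
  ring

theorem row_sq (h2 : (2 : F) ≠ 0) (h3 : (3 : F) ≠ 0) {c : F} (hc : c ≠ 0)
    {T : FormType} {H : Type} [Group H] (hT : HasType (ofCoeffs (sqV c)) T)
    (hH : Nonempty (MulAction.stabilizer (Matrix.ProjGenLinGroup (Fin 2) F)
      (point _ (sq_ne_zero c)) ≃* H)) : Row (formSq c) 1728 T H := by
  rw [formSq_eq]
  obtain ⟨-, -, h12, -, h36, -⟩ := ne_zero_of_two_three h2 h3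
  have hI : coeffI (sqV c) = c / 12 := by
    simp [coeffI, sqV]
    field_simp
    norm_num
  have hJ : coeffJ (sqV c) = 0 := by simp [coeffJ, sqV]
  refine row_ofCoeffs h2 h3 (sq_ne_zero c) ?_ ?_ hT hH
  · rw [coeffDisc, hI, hJ]
    simp [hc, h12]
  · rw [coeffDisc, hI, hJ]
    field_simp
    ring

theorem pgl_diagonal_eq {a b : F} (h : a * b - 0 * 0 ≠ 0) (u : F) (hu : b = u * a)
    (h' : (1 : F) * u - 0 * 0 ≠ 0) : pgl a 0 0 b h = pgl 1 0 0 u h' := by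
  have ha : a ≠ 0 := by rintro rfl; simp at h
  rw [pgl_eq_pgl_iff]
  exact ⟨a⁻¹, inv_ne_zero ha, by simp [ha], by simp, by simp, by rw [hu]; field_simp⟩

/-- An element fixing infinity must also fix the root 0, by the missing term Y²X², and then
satisfies `a² = d²`. -/
theorem carries_sq_infty (h3 : (3 : F) ≠ 0) {a c d k : F} (hk : k ≠ 0)
    (h : a * d - 0 * c ≠ 0)
    (hc : Carries a 0 c d (sqV k) (sqV k)) :
    pgl a 0 c d h ∈ ({1, pgl 1 0 0 (-1) (by simp)} :
      Set (Matrix.ProjGenLinGroup (Fin 2) F)) := by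
  obtain ⟨m, hm0, e⟩ := hc
  have ha : a ≠ 0 := by rintro rfl; simp at h
  have hd : d ≠ 0 := by rintro rfl; simp at h
  have e2 := congrFun e 2
  simp [act, sqV, h3, ha, hd] at e2
  subst e2
  have e1 := congrFun e 1
  have e3 := congrFun e 3
  simp [act, sqV] at e1 e3
  have e4 : (a - d) * (a + d) = 0 := by
    have : (k * a * d) * ((a - d) * (a + d)) = 0 := by linear_combination k * e1 - e3
    exact (mul_eq_zero.mp this).resolve_left (by positivity)
  rcases mul_eq_zero.mp e4 with h' | h'
  · left
    exact pgl_eq_one_iff.mpr ⟨rfl, rfl, by linear_combination h'⟩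
  · right
    exact pgl_diagonal_eq _ _ (by linear_combination h') _

theorem carries_diagonal_sq (k : F) :
    Carries 1 0 0 (-1) (sqV k) (sqV k) :=
  ⟨-1, by simp, by funext i; fin_cases i <;> simp [act, sqV]; ring⟩

theorem diagonal_neg_one (h2 : (2 : F) ≠ 0) :
    pgl (1 : F) 0 0 (-1) (by simp) ≠ 1 ∧
      pgl (1 : F) 0 0 (-1) (by simp) * pgl 1 0 0 (-1) (by simp) = 1 := by
  constructor
  · rw [Ne, pgl_eq_one_iff]
    rintro ⟨-, -, h⟩
    apply h2
    linear_combination h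
  · rw [pgl_mul_pgl, pgl_eq_one_iff]
    simp

theorem row_sq_nonsquare [Finite F] (h2 : (2 : F) ≠ 0) (h3 : (3 : F) ≠ 0) {ε : F}
    (hε : ¬ IsSquare ε) : Row (formSq ε) 1728 .F2 (Cyc 2 × Cyc 2) := by
  have := finite_pgl (F := F)
  have h0 : ε ≠ 0 := by rintro rfl; exact hε (IsSquare.zero)
  have hroot : ∀ y : F, value (sqV ε) 1 y = 0 ↔ y = 0 := by
    intro y
    rw [value_sq, mul_eq_zero]
    refine ⟨fun h => h.resolve_right fun h' => hε ⟨y, by linear_combination -h'⟩, Or.inl⟩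
  refine row_sq h2 h3 h0 ?_ ?_
  · change numLinearFactors _ = 2
    rw [numLinearFactors_of_infty (by simp), show {y : F | value (sqV ε) 1 y = 0} = {0} by
      ext y; exact hroot y]
    simp
  -- Besides infinity only 0 is a root in F; the matrix (0 1; ε 0) exchanges the two.
  · have hdet : (0 : F) * 0 - 1 * ε ≠ 0 := by simpa using h0
    have hcar : Carries 0 1 ε 0 (sqV ε) (sqV ε) :=
      ⟨-ε ^ 2, by simpa using h0, by funext i; fin_cases i <;> simp [act, sqV] <;> ring⟩
    have hτ : pgl 0 1 ε 0 hdet * pgl 0 1 ε 0 hdet = 1 := by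
      rw [pgl_mul_pgl, pgl_eq_one_iff]
      simp
    have hle := card_le_of_cosets (MulAction.stabilizer (Matrix.ProjGenLinGroup (Fin 2) F)
      (point _ (sq_ne_zero ε))) {1, pgl 0 1 ε 0 hdet} {1, pgl 1 0 0 (-1) (by simp)} (by
        intro g hg
        obtain ⟨a, b, c, d, h, rfl⟩ := exists_eq_pgl g
        by_cases hb : b = 0
        · subst hb
          exact ⟨1, by simp, inv_one_mul_mem (carries_sq_infty h3 h0 _ (mem_stabilizer_point.mp hg))⟩
        · have hd := (hroot _).mp ((mem_stabilizer_point.mp hg).infty (by simp) hb)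
          have hd0 : d = 0 := by simpa [hb] using hd
          obtain ⟨x, y, z, hxz, hc, e⟩ := exists_inv_mul_eq (sq_ne_zero ε) h hdet
            (mem_stabilizer_point.mp hg) hcar (by rw [hd0]; ring)
          exact ⟨_, by simp, e ▸ carries_sq_infty h3 h0 _ hc⟩)
    have l1 := ncard_pair_le 1 (pgl 0 1 ε 0 hdet)
    have l2 := ncard_pair_le 1 (pgl (1 : F) 0 0 (-1) (by simp))
    refine (nonempty_mulEquiv_klein (hle.trans (Nat.mul_le_mul l1 l2))
      (s := ⟨_, (mem_stabilizer_point (h := by simp)).mpr (carries_diagonal_sq ε)⟩)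
      (t := ⟨_, (mem_stabilizer_point (h := hdet)).mpr hcar⟩)
      (Subtype.ext (diagonal_neg_one h2).2) (Subtype.ext hτ)
      (fun h => (diagonal_neg_one h2).1 (congrArg Subtype.val h))
      (fun h => ?_) fun h => ?_).2
    · have := (pgl_eq_one_iff (h := hdet)).mp (congrArg Subtype.val h)
      exact one_ne_zero this.1
    · have e : pgl (1 : F) 0 0 (-1) (by simp) = pgl 0 1 ε 0 hdet := congrArg Subtype.val h
      obtain ⟨u, hu, -, h', -⟩ := pgl_eq_pgl_iff.mp e
      simp at h'

theorem row_sq_one [Finite F] (h2 : (2 : F) ≠ 0) (h3 : (3 : F) ≠ 0) :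
    Row (formSq (1 : F)) 1728 .F4 (DihedralGroup 4) := by
  have := finite_pgl (F := F)
  have h4 := (ne_zero_of_two_three h2 h3).1
  have hne : (1 : F) ≠ -1 := fun h => h2 (by linear_combination h)
  have hroot : ∀ y : F, value (sqV (1 : F)) 1 y = 0 ↔ y = 0 ∨ y = 1 ∨ y = -1 := by
    intro y
    rw [value_sq, mul_eq_zero, show y ^ 2 - 1 = (y - 1) * (y + 1) by ring, mul_eq_zero,
      sub_eq_zero, add_eq_zero_iff_eq_neg]
  refine row_sq h2 h3 one_ne_zero ?_ ?_
  · change numLinearFactors _ = 4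
    rw [numLinearFactors_of_infty (by simp),
      show {y : F | value (sqV (1 : F)) 1 y = 0} = {0, 1, -1} by ext y; exact hroot y,
      Set.ncard_eq_three.mpr ⟨0, 1, -1, by simp, by simp, hne, rfl⟩]
  -- The three matrices take infinity to -1, 0 and 1. The first permutes the roots cyclically as ∞,
  -- -1, 0, 1; it is the rotation of order four, and diag(1, -1) is the reflection.
  · have d1 : (1 : F) * 1 - -1 * 1 ≠ 0 := by norm_num; exact h2
    have d2 : (0 : F) * 0 - -1 * 1 ≠ 0 := by norm_num
    have d3 : (1 : F) * 1 - 1 * -1 ≠ 0 := by norm_num; exact h2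
    have c1 : Carries (1 : F) (-1) 1 1 (sqV (1 : F)) (sqV (1 : F)) :=
      ⟨-4, by simpa using h4, by funext i; fin_cases i <;> simp [act, sqV] <;> ring⟩
    have c2 : Carries (0 : F) (-1) 1 0 (sqV (1 : F)) (sqV (1 : F)) :=
      ⟨1, by simp, by funext i; fin_cases i <;> simp [act, sqV]; norm_num⟩
    have c3 : Carries (1 : F) 1 (-1) 1 (sqV (1 : F)) (sqV (1 : F)) :=
      ⟨-4, by simpa using h4, by funext i; fin_cases i <;> simp [act, sqV] <;> ring⟩
    have hle := card_le_of_cosets (MulAction.stabilizer (Matrix.ProjGenLinGroup (Fin 2) F)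
      (point _ (sq_ne_zero (1 : F)))) {1, pgl _ _ _ _ d1, pgl _ _ _ _ d2, pgl _ _ _ _ d3}
      {1, pgl 1 0 0 (-1) (by simp)} (by
        intro g hg
        obtain ⟨a, b, c, d, h, rfl⟩ := exists_eq_pgl g
        by_cases hb : b = 0
        · subst hb
          exact ⟨1, by simp, inv_one_mul_mem (carries_sq_infty h3 one_ne_zero _ (mem_stabilizer_point.mp hg))⟩
        · rcases (hroot _).mp ((mem_stabilizer_point.mp hg).infty (by simp) hb) with hd | hd | hd
          · have hd0 : d = 0 := by simpa [hb] using hd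
            obtain ⟨x, y, z, hxz, hc, e⟩ := exists_inv_mul_eq (sq_ne_zero (1 : F)) h d2
              (mem_stabilizer_point.mp hg) c2 (by rw [hd0]; ring)
            exact ⟨_, by simp, e ▸ carries_sq_infty h3 one_ne_zero _ hc⟩
          · have hd0 : d = b := by field_simp at hd; exact hd
            obtain ⟨x, y, z, hxz, hc, e⟩ := exists_inv_mul_eq (sq_ne_zero (1 : F)) h d3
              (mem_stabilizer_point.mp hg) c3 (by rw [hd0]; ring)
            exact ⟨_, by simp, e ▸ carries_sq_infty h3 one_ne_zero _ hc⟩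
          · have hd0 : d = -b := by field_simp at hd; exact hd
            obtain ⟨x, y, z, hxz, hc, e⟩ := exists_inv_mul_eq (sq_ne_zero (1 : F)) h d1
              (mem_stabilizer_point.mp hg) c1 (by rw [hd0]; ring)
            exact ⟨_, by simp, e ▸ carries_sq_infty h3 one_ne_zero _ hc⟩)
    have l1 := ncard_quadruple_le 1 (pgl _ _ _ _ d1) (pgl _ _ _ _ d2) (pgl _ _ _ _ d3)
    have l2 := ncard_pair_le 1 (pgl (1 : F) 0 0 (-1) (by simp))
    have hsq : pgl _ _ _ _ d1 ^ 2 = pgl _ _ _ _ d2 := by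
      rw [pow_two, pgl_mul_pgl, pgl_eq_pgl_iff]
      exact ⟨2⁻¹, inv_ne_zero h2, by ring, by field_simp; ring, by field_simp; ring, by ring⟩
    refine (nonempty_mulEquiv_dihedral (hle.trans (Nat.mul_le_mul l1 l2))
      (a := ⟨_, (mem_stabilizer_point (h := d1)).mpr c1⟩)
      (b := ⟨_, (mem_stabilizer_point (h := by simp)).mpr (carries_diagonal_sq 1)⟩) (Subtype.ext ?_)
      (fun h => ?_) (Subtype.ext (diagonal_neg_one h2).2)
      (fun h => (diagonal_neg_one h2).1 (congrArg Subtype.val h)) (fun h => ?_)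
      (Subtype.ext ?_)).2
    · change pgl _ _ _ _ d1 ^ 4 = 1
      rw [show 4 = 2 * 2 by norm_num, pow_mul, hsq, pow_two, pgl_mul_pgl, pgl_eq_one_iff]
      simp
    · have e : pgl _ _ _ _ d1 ^ 2 = 1 := congrArg Subtype.val h
      rw [hsq, pgl_eq_one_iff] at e
      simp at e
    · have e : pgl (1 : F) 0 0 (-1) (by simp) = pgl _ _ _ _ d1 ^ 2 := congrArg Subtype.val h
      rw [hsq, pgl_eq_pgl_iff] at e
      obtain ⟨u, hu, h', -⟩ := e
      simp at h'
      exact hu h'.symm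
    · change pgl (1 : F) 0 0 (-1) (by simp) * pgl _ _ _ _ d1 * pgl (1 : F) 0 0 (-1) (by simp) =
        (pgl _ _ _ _ d1)⁻¹
      rw [inv_pgl, pgl_mul_pgl, pgl_mul_pgl, pgl_eq_pgl_iff]
      exact ⟨1, one_ne_zero, by ring, by ring, by ring, by ring⟩

theorem formCube_eq (c : F) : formCube c = ofCoeffs (cubeV c) := by
  simp [formCube, ofCoeffs, cubeV]
  ring

theorem cube_ne_zero (c : F) : (cubeV c) ≠ 0 := fun h => by simpa using congrFun h 1

theorem value_cube (c y : F) : value (cubeV c) 1 y = y ^ 3 - c := by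
  simp [value, cubeV]
  ring

theorem row_cube (h2 : (2 : F) ≠ 0) (h3 : (3 : F) ≠ 0) {c : F} (hc : c ≠ 0)
    {T : FormType} {H : Type} [Group H] (hT : HasType (ofCoeffs (cubeV c)) T)
    (hH : Nonempty (MulAction.stabilizer (Matrix.ProjGenLinGroup (Fin 2) F)
      (point _ (cube_ne_zero c)) ≃* H)) : Row (formCube c) 0 T H := by
  rw [formCube_eq]
  obtain ⟨-, -, h12, h16, h36, h432, h27, -⟩ := ne_zero_of_two_three h2 h3
  have hI : coeffI (cubeV c) = 0 := by simp [coeffI, cubeV]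
  have hJ : coeffJ (cubeV c) = c / 16 := by
    simp [coeffJ, cubeV]
    field_simp
    norm_num
  refine row_ofCoeffs h2 h3 (cube_ne_zero c) ?_ ?_ hT hH
  · rw [coeffDisc, hI, hJ]
    simp [hc, h16]
  · rw [hI]
    simp

/-- A transformation fixing infinity changes the constant only by a cube. The two constants are kept
separate because the lemma also distinguishes the forms for γ and γ². -/
theorem carries_cube_infty (h3 : (3 : F) ≠ 0) {a c d k m : F}
    (h : a * d - 0 * c ≠ 0) (hc : Carries a 0 c d (cubeV k) (cubeV m)) :
    c = 0 ∧ k * d ^ 3 = m * a ^ 3 := by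
  obtain ⟨n, hm0, e⟩ := hc
  have ha : a ≠ 0 := by rintro rfl; simp at h
  have hd : d ≠ 0 := by rintro rfl; simp at h
  have e2 := congrFun e 2
  simp [act, cubeV, h3, ha, hd] at e2
  subst e2
  have e1 := congrFun e 1
  have e4 := congrFun e 4
  simp [act, cubeV] at e1 e4
  refine ⟨rfl, ?_⟩
  have : d * (k * d ^ 3) = d * (m * a ^ 3) := by linear_combination e4 - m * e1
  exact mul_left_cancel₀ hd this

theorem mem_stabilizer_cube_infty (h3 : (3 : F) ≠ 0) {k ω : F} (hk : k ≠ 0) (hω : ω ≠ 0)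
    (hcube : ∀ x : F, x ^ 3 = 1 → x = 1 ∨ x = ω ∨ x = ω ^ 2) {a c d : F}
    (h : a * d - 0 * c ≠ 0)
    (hc : Carries a 0 c d (cubeV k) (cubeV k)) :
    pgl a 0 c d h ∈ ({1, pgl 1 0 0 ω (by simpa using hω),
      pgl 1 0 0 (ω ^ 2) (by simpa using hω)} : Set (Matrix.ProjGenLinGroup (Fin 2) F)) := by
  obtain ⟨rfl, e⟩ := carries_cube_infty h3 h hc
  have ha : a ≠ 0 := by rintro rfl; simp at h
  have e' := mul_left_cancel₀ hk e
  rcases hcube (d / a) (by field_simp; exact e') with h' | h' | h'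
  · left
    rw [div_eq_one_iff_eq ha] at h'
    exact pgl_eq_one_iff.mpr ⟨rfl, rfl, h'.symm⟩
  · right; left
    exact pgl_diagonal_eq _ _ ((div_eq_iff ha).mp h') _
  · right; right
    exact pgl_diagonal_eq _ _ ((div_eq_iff ha).mp h') _

theorem carries_diagonal_cube {ω : F} (hω : ω ^ 2 + ω + 1 = 0) (k : F) :
    Carries 1 0 0 ω (cubeV k) (cubeV k) := by
  have h3 : ω ^ 4 = ω := by linear_combination (ω ^ 2 - ω) * hω
  refine ⟨ω, ?_, by funext i; fin_cases i <;> simp [act, cubeV, h3]; ring⟩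
  rintro rfl
  simp at hω

theorem eq_of_cube_eq_one {ω : F} (hω : ω ^ 2 + ω + 1 = 0) {x : F} (hx : x ^ 3 = 1) :
    x = 1 ∨ x = ω ∨ x = ω ^ 2 := by
  have : (x - 1) * ((x - ω) * (x - ω ^ 2)) = 0 := by
    linear_combination hx + (-x ^ 2 + ω * x - (ω - 1)) * hω
  rcases mul_eq_zero.mp this with h | h
  · left; linear_combination h
  · rcases mul_eq_zero.mp h with h | h
    · right; left; linear_combination h
    · right; right; linear_combination h

theorem diagonal_omega {ω : F} (h3 : (3 : F) ≠ 0) (hω : ω ^ 2 + ω + 1 = 0)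
    (h : (1 : F) * ω - 0 * 0 ≠ 0) : pgl 1 0 0 ω h ≠ 1 ∧ pgl 1 0 0 ω h ^ 3 = 1 := by
  constructor
  · rw [Ne, pgl_eq_one_iff]
    rintro ⟨-, -, e⟩
    apply h3
    rw [← e] at hω
    linear_combination hω
  · rw [pow_succ, pow_two, pgl_mul_pgl, pgl_mul_pgl, pgl_eq_one_iff]
    refine ⟨by ring, by ring, ?_⟩
    linear_combination (1 - ω) * hω

/-- Infinity is the only root in F, so every element of the stabilizer fixes it and is diagonal with
entries 1 and a cube root of unity. -/
theorem row_cube_nonroot [Finite F] (h2 : (2 : F) ≠ 0) (h3 : (3 : F) ≠ 0) {ω k : F}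
    (hω : ω ^ 2 + ω + 1 = 0) (hk : k ≠ 0) (hcube : ∀ y : F, y ^ 3 ≠ k) :
    Row (formCube k) 0 .F1 (Cyc 3) := by
  have := finite_pgl (F := F)
  have hω0 : ω ≠ 0 := by rintro rfl; simp at hω
  have hroot : ∀ y : F, value (cubeV k) 1 y ≠ 0 := fun y h => by
    rw [value_cube] at h
    exact hcube y (by linear_combination h)
  refine row_cube h2 h3 hk ?_ ?_
  · change numLinearFactors _ = 1
    rw [numLinearFactors_of_infty (by simp),
      show {y : F | value (cubeV k) 1 y = 0} = ∅ by ext y; simp [hroot]]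
    simp
  · have hle := card_le_of_cosets (MulAction.stabilizer (Matrix.ProjGenLinGroup (Fin 2) F)
      (point _ (cube_ne_zero k))) {1} {1, pgl 1 0 0 ω (by simpa using hω0),
      pgl 1 0 0 (ω ^ 2) (by simpa using hω0)} (by
        intro g hg
        obtain ⟨a, b, c, d, h, rfl⟩ := exists_eq_pgl g
        by_cases hb : b = 0
        · subst hb
          exact ⟨1, by simp, inv_one_mul_mem (mem_stabilizer_cube_infty h3 hk hω0 (fun x hx => eq_of_cube_eq_one hω hx) _
              (mem_stabilizer_point.mp hg))⟩
        · exact absurd ((mem_stabilizer_point.mp hg).infty (by simp) hb) (hroot _))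
    have l1 := ncard_triple_le 1 (pgl 1 0 0 ω (by simpa using hω0))
      (pgl 1 0 0 (ω ^ 2) (by simpa using hω0))
    rw [Set.ncard_singleton, one_mul] at hle
    obtain ⟨ho1, ho3⟩ := diagonal_omega h3 hω (by simpa using hω0)
    let g : MulAction.stabilizer (Matrix.ProjGenLinGroup (Fin 2) F) (point _ (cube_ne_zero k)) :=
      ⟨_, (mem_stabilizer_point (h := by simpa using hω0)).mpr (carries_diagonal_cube hω k)⟩
    have hg : orderOf g = 3 :=
      orderOf_eq_prime (Subtype.ext ho3) fun h => ho1 (congrArg Subtype.val h)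
    have := orderOf_le_card (x := g)
    exact nonempty_mulEquiv_cyc_prime (by omega)

/-- The involution exchanges infinity with the root (1 : y). -/
theorem carries_involution_cube (h3 : (3 : F) ≠ 0) {y k : F} (hy : y ^ 3 = k) (hk : k ≠ 0) :
    ∃ h : (-y) * y - 1 * (2 * y ^ 2) ≠ 0,
      Carries (-y) 1 (2 * y ^ 2) y (cubeV k) (cubeV k) ∧
      pgl _ _ _ _ h ≠ 1 ∧ pgl _ _ _ _ h * pgl _ _ _ _ h = 1 := by
  have hy0 : y ≠ 0 := by rintro rfl; exact hk (by simpa using hy.symm)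
  have h : (-y) * y - 1 * (2 * y ^ 2) ≠ 0 := by
    rw [show (-y) * y - 1 * (2 * y ^ 2) = -(3 * y ^ 2) by ring]
    exact neg_ne_zero.mpr (by positivity)
  refine ⟨h, ⟨9 * y ^ 4, ?_, ?_⟩, ?_, ?_⟩
  · rw [show (9 : F) = 3 * 3 by norm_num]
    positivity
  · subst hy
    funext i
    fin_cases i <;> simp [act, cubeV] <;> ring
  · rw [Ne, pgl_eq_one_iff]
    exact fun h' => one_ne_zero h'.1
  · rw [pgl_mul_pgl, pgl_eq_one_iff]
    exact ⟨by ring, by ring, by ring⟩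

theorem row_cube_one_two [Finite F] (h2 : (2 : F) ≠ 0) (h3 : (3 : F) ≠ 0)
    (hcube : ∀ x : F, x ^ 3 = 1 → x = 1) : Row (formCube (1 : F)) 0 .F2 (Cyc 2) := by
  have := finite_pgl (F := F)
  have hroot : ∀ y : F, value (cubeV (1 : F)) 1 y = 0 ↔ y = 1 := fun y => by
    rw [value_cube]
    refine ⟨fun h => hcube y (by linear_combination h), ?_⟩
    rintro rfl; simp
  refine row_cube h2 h3 one_ne_zero ?_ ?_
  · change numLinearFactors _ = 2
    rw [numLinearFactors_of_infty (by simp),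
      show {y : F | value (cubeV (1 : F)) 1 y = 0} = {1} by ext y; exact hroot y]
    simp
  · obtain ⟨hdet, hcar, hτ1, hτ2⟩ := carries_involution_cube h3 (one_pow 3) (one_ne_zero (α := F))
    have hinf : ∀ {a c d : F} (h : a * d - 0 * c ≠ 0),
        Carries a 0 c d (cubeV (1 : F)) (cubeV (1 : F)) → pgl a 0 c d h = 1 := by
      intro a c d h hc
      -- Without nontrivial cube roots of unity the lemma applies with 1 in the place of ω, and its
      -- three elements coincide.
      have := mem_stabilizer_cube_infty h3 one_ne_zero (one_ne_zero (α := F))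
        (fun x hx => Or.inl (hcube x hx)) h hc
      rcases this with h | h | h
      · exact h
      · rw [h, one_eq_pgl]
      · have h' : pgl a 0 c d _ = pgl 1 0 0 (1 ^ 2) (by simp) := h
        rw [h', one_eq_pgl]
        simp only [one_pow]
    have hle := card_le_of_cosets (MulAction.stabilizer (Matrix.ProjGenLinGroup (Fin 2) F)
      (point _ (cube_ne_zero (1 : F)))) {1, pgl _ _ _ _ hdet} {1} (by
        intro g hg
        obtain ⟨a, b, c, d, h, rfl⟩ := exists_eq_pgl g
        by_cases hb : b = 0
        · subst hb
          exact ⟨1, by simp, inv_one_mul_mem (hinf _ (mem_stabilizer_point.mp hg))⟩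
        · have hd := (hroot _).mp ((mem_stabilizer_point.mp hg).infty (by simp) hb)
          have hd0 : d = b := by field_simp at hd; exact hd
          obtain ⟨x, y, z, hxz, hc, e⟩ := exists_inv_mul_eq (cube_ne_zero (1 : F)) h hdet
            (mem_stabilizer_point.mp hg) hcar (by rw [hd0]; ring)
          exact ⟨_, by simp, e ▸ hinf _ hc⟩)
    have l1 := ncard_pair_le 1 (pgl _ _ _ _ hdet)
    rw [Set.ncard_singleton, mul_one] at hle
    have : Nontrivial (MulAction.stabilizer (Matrix.ProjGenLinGroup (Fin 2) F)
      (point _ (cube_ne_zero (1 : F)))) :=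
      ⟨⟨_, (mem_stabilizer_point (h := hdet)).mpr hcar⟩, 1, fun h => hτ1 (congrArg Subtype.val h)⟩
    have := Finite.one_lt_card (α := MulAction.stabilizer (Matrix.ProjGenLinGroup (Fin 2) F)
      (point _ (cube_ne_zero (1 : F))))
    exact nonempty_mulEquiv_cyc_prime (by omega)

theorem row_cube_one [Finite F] (h2 : (2 : F) ≠ 0) (h3 : (3 : F) ≠ 0) {ω : F}
    (hω : ω ^ 2 + ω + 1 = 0) : Row (formCube (1 : F)) 0 .F4 (alternatingGroup (Fin 4)) := by
  have := finite_pgl (F := F)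
  have hω0 : ω ≠ 0 := by rintro rfl; simp at hω
  have hω3 : ω ^ 3 = 1 := by linear_combination (ω - 1) * hω
  have hω1 : ω ≠ 1 := by
    rintro rfl
    apply h3
    linear_combination hω
  have hω2 : ω ^ 2 ≠ 1 := fun h => hω1 (by linear_combination hω3 - ω * h)
  have hω12 : ω ≠ ω ^ 2 := fun h => hω2 (by linear_combination hω3 + ω * h)
  have hroot : ∀ y : F, value (cubeV (1 : F)) 1 y = 0 ↔ y = 1 ∨ y = ω ∨ y = ω ^ 2 := fun y => by
    rw [value_cube]
    refine ⟨fun h => eq_of_cube_eq_one hω (by linear_combination h), ?_⟩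
    rintro (rfl | rfl | rfl)
    · simp
    · rw [hω3, sub_self]
    · linear_combination (ω ^ 3 + 1) * hω3
  refine row_cube h2 h3 one_ne_zero ?_ ?_
  · change numLinearFactors _ = 4
    rw [numLinearFactors_of_infty (by simp),
      show {y : F | value (cubeV (1 : F)) 1 y = 0} = {1, ω, ω ^ 2} by ext y; exact hroot y,
      Set.ncard_eq_three.mpr ⟨1, ω, ω ^ 2, hω1.symm, hω2.symm, hω12, rfl⟩]
  -- The involutions moving infinity to 1 and to ω generate the Klein group, and diag(1, ω) is the
  -- element of order three. The involution for ω² is needed only to bound the order by 4·3.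
  · obtain ⟨d1, c1, hs1, hs⟩ := carries_involution_cube h3 (one_pow 3) (one_ne_zero (α := F))
    obtain ⟨d2, c2, ht1, ht⟩ := carries_involution_cube h3 hω3 (one_ne_zero (α := F))
    obtain ⟨d3, c3, -, -⟩ := carries_involution_cube h3
      (show (ω ^ 2) ^ 3 = 1 by linear_combination (ω ^ 3 + 1) * hω3) (one_ne_zero (α := F))
    have hinf : ∀ {a c d : F} (h : a * d - 0 * c ≠ 0),
        Carries a 0 c d (cubeV (1 : F)) (cubeV (1 : F)) → _ := fun h hc =>
      mem_stabilizer_cube_infty h3 one_ne_zero hω0 (fun x hx => eq_of_cube_eq_one hω hx) h hc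
    have hle := card_le_of_cosets (MulAction.stabilizer (Matrix.ProjGenLinGroup (Fin 2) F)
      (point _ (cube_ne_zero (1 : F)))) {1, pgl _ _ _ _ d1, pgl _ _ _ _ d2, pgl _ _ _ _ d3}
      {1, pgl 1 0 0 ω (by simpa using hω0), pgl 1 0 0 (ω ^ 2) (by simpa using hω0)} (by
        intro g hg
        obtain ⟨a, b, c, d, h, rfl⟩ := exists_eq_pgl g
        by_cases hb : b = 0
        · subst hb
          exact ⟨1, by simp, inv_one_mul_mem (hinf _ (mem_stabilizer_point.mp hg))⟩
        · rcases (hroot _).mp ((mem_stabilizer_point.mp hg).infty (by simp) hb) with hd | hd | hd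
          all_goals rw [div_eq_iff hb] at hd
          · obtain ⟨x, y, z, hxz, hc, e⟩ := exists_inv_mul_eq (cube_ne_zero (1 : F)) h d1
              (mem_stabilizer_point.mp hg) c1 (by rw [hd]; ring)
            exact ⟨_, by simp, e ▸ hinf _ hc⟩
          · obtain ⟨x, y, z, hxz, hc, e⟩ := exists_inv_mul_eq (cube_ne_zero (1 : F)) h d2
              (mem_stabilizer_point.mp hg) c2 (by rw [hd]; ring)
            exact ⟨_, by simp, e ▸ hinf _ hc⟩
          · obtain ⟨x, y, z, hxz, hc, e⟩ := exists_inv_mul_eq (cube_ne_zero (1 : F)) h d3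
              (mem_stabilizer_point.mp hg) c3 (by rw [hd]; ring)
            exact ⟨_, by simp, e ▸ hinf _ hc⟩)
    have l1 := ncard_quadruple_le 1 (pgl _ _ _ _ d1) (pgl _ _ _ _ d2) (pgl _ _ _ _ d3)
    have l2 := ncard_triple_le 1 (pgl 1 0 0 ω (by simpa using hω0))
      (pgl 1 0 0 (ω ^ 2) (by simpa using hω0))
    have dω : (1 : F) * ω - 0 * 0 ≠ 0 := by simpa using hω0
    obtain ⟨ho1, ho3⟩ := diagonal_omega h3 hω dω
    refine (nonempty_mulEquiv_alternating (hle.trans (Nat.mul_le_mul l1 l2))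
      (s := ⟨_, (mem_stabilizer_point (h := d1)).mpr c1⟩) (t := ⟨_, (mem_stabilizer_point (h := d2)).mpr c2⟩)
      (a := ⟨_, (mem_stabilizer_point (h := dω)).mpr (carries_diagonal_cube hω 1)⟩)
      (Subtype.ext hs) (Subtype.ext ht) (Subtype.ext ?_)
      (fun h => hs1 (congrArg Subtype.val h)) (fun h => ht1 (congrArg Subtype.val h))
      (fun h => ?_) (Subtype.ext ho3) (fun h => ho1 (congrArg Subtype.val h)) ?_).2
    · change pgl _ _ _ _ d1 * pgl _ _ _ _ d2 = pgl _ _ _ _ d2 * pgl _ _ _ _ d1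
      rw [pgl_mul_pgl, pgl_mul_pgl, pgl_eq_pgl_iff]
      refine ⟨-1, by simp, ?_, ?_, ?_, ?_⟩
      · linear_combination 2 * hω
      · ring
      · ring
      · linear_combination 2 * hω
    · have e : pgl _ _ _ _ d1 = pgl _ _ _ _ d2 := congrArg Subtype.val h
      obtain ⟨u, -, -, hb, -, hd⟩ := pgl_eq_pgl_iff.mp e
      apply hω1
      linear_combination hd - hb
    -- If the conjugate of diag(1, ω) were one of its powers, it would commute with it; comparison
    -- of the matrix entries then gives ω² = 1.
    · intro hmem
      obtain ⟨n, hn⟩ := Subgroup.mem_zpowers_iff.mp hmem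
      have hcomm := (Commute.refl (⟨_, (mem_stabilizer_point (h := dω)).mpr
        (carries_diagonal_cube hω 1)⟩ : MulAction.stabilizer (Matrix.ProjGenLinGroup (Fin 2) F)
          (point _ (cube_ne_zero (1 : F))))).zpow_left n
      rw [hn] at hcomm
      have e : pgl _ _ _ _ d1 * pgl _ _ _ _ dω * (pgl _ _ _ _ d1)⁻¹ * pgl _ _ _ _ dω =
        pgl _ _ _ _ dω * (pgl _ _ _ _ d1 * pgl _ _ _ _ dω * (pgl _ _ _ _ d1)⁻¹) :=
        congrArg Subtype.val hcomm
      rw [inv_pgl, pgl_mul_pgl, pgl_mul_pgl, pgl_mul_pgl, pgl_mul_pgl, pgl_eq_pgl_iff] at e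
      obtain ⟨u, hu, ha, hb, hc, hd⟩ := e
      have h1 : 1 - ω ≠ 0 := fun h => hω1 (by linear_combination -h)
      have hb' : u * ω = 1 := mul_left_cancel₀ h1 (by linear_combination -hb)
      have hc' : u = ω := mul_left_cancel₀ (mul_ne_zero h2 h1) (by linear_combination -hc)
      apply hω2
      rw [hc'] at hb'
      linear_combination hb'

end

end BinaryQuartic

end

noncomputable section

namespace BinaryQuartic

open MvPolynomial

/-! ### Quadratic extensions -/

section

variable {F K : Type*} [Field F] [Field K] [Algebra F K]

/-- The norm form y² - εx² is anisotropic. All statements on absence of roots and on linear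
independence below rest on this. -/
theorem eq_zero_of_sq_eq_mul_sq {ε x y : F} (hε : ¬ IsSquare ε) (h : y ^ 2 = ε * x ^ 2) :
    x = 0 ∧ y = 0 := by
  by_cases hx : x = 0
  · subst hx
    exact ⟨rfl, by simpa using h⟩
  · exact absurd ⟨y / x, by field_simp; linear_combination -h⟩ hε

theorem eq_zero_of_add_mul_root {ε u v : F} {s : K} (hε : ¬ IsSquare ε)
    (hs : s ^ 2 = algebraMap F K ε) (h : algebraMap F K u + algebraMap F K v * s = 0) :
    u = 0 ∧ v = 0 := by
  have e : u ^ 2 = ε * v ^ 2 := by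
    apply (algebraMap F K).injective
    simp only [map_pow, map_mul]
    rw [← hs]
    linear_combination (algebraMap F K u - algebraMap F K v * s) * h
  exact (eq_zero_of_sq_eq_mul_sq hε e).symm

theorem linearIndependent_one_root {ε : F} {s : K} (hε : ¬ IsSquare ε)
    (hs : s ^ 2 = algebraMap F K ε) : LinearIndependent F ![1, s] := by
  rw [LinearIndependent.pair_iff]
  intro u v h
  apply eq_zero_of_add_mul_root hε hs
  simpa [Algebra.smul_def] using h

/-- The basis `1, √ε` of a quadratic extension. -/
def rootBasis {ε : F} {s : K} (hε : ¬ IsSquare ε) (hs : s ^ 2 = algebraMap F K ε)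
    (hK : Module.finrank F K = 2) : Module.Basis (Fin 2) F K :=
  basisOfLinearIndependentOfCardEqFinrank (linearIndependent_one_root hε hs) (by simp [hK])

theorem coe_rootBasis {ε : F} {s : K} (hε : ¬ IsSquare ε) (hs : s ^ 2 = algebraMap F K ε)
    (hK : Module.finrank F K = 2) : ⇑(rootBasis hε hs hK) = ![1, s] := by
  simp [rootBasis]

theorem exists_eq_add_mul_root {ε : F} {s : K} (hε : ¬ IsSquare ε) (hs : s ^ 2 = algebraMap F K ε)
    (hK : Module.finrank F K = 2) (x : K) :
    ∃ u v : F, x = algebraMap F K u + algebraMap F K v * s := by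
  have h := (rootBasis hε hs hK).sum_repr x
  rw [Fin.sum_univ_two, coe_rootBasis] at h
  exact ⟨_, _, by simpa [Algebra.smul_def] using h.symm⟩

theorem rootBasis_repr {ε : F} {s : K} (hε : ¬ IsSquare ε) (hs : s ^ 2 = algebraMap F K ε)
    (hK : Module.finrank F K = 2) (u v : F) :
    ⇑((rootBasis hε hs hK).repr (algebraMap F K u + algebraMap F K v * s)) = ![u, v] := by
  have : algebraMap F K u + algebraMap F K v * s =
      ∑ i, (![u, v] : Fin 2 → F) i • rootBasis hε hs hK i := by
    rw [Fin.sum_univ_two, coe_rootBasis]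
    simp [Algebra.smul_def]
  rw [this, Module.Basis.repr_sum_self]

theorem leftMulMatrix_rootBasis {ε : F} {s : K} (hε : ¬ IsSquare ε)
    (hs : s ^ 2 = algebraMap F K ε) (hK : Module.finrank F K = 2) (u v : F) :
    Algebra.leftMulMatrix (rootBasis hε hs hK) (algebraMap F K u + algebraMap F K v * s) =
      !![u, v * ε; v, u] := by
  ext i j
  rw [Algebra.leftMulMatrix_eq_repr_mul, coe_rootBasis]
  fin_cases j
  · simp only [Fin.zero_eta, Matrix.cons_val_zero, mul_one, rootBasis_repr]
    fin_cases i <;> rfl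
  · have : (algebraMap F K u + algebraMap F K v * s) * s =
        algebraMap F K (v * ε) + algebraMap F K u * s := by
      rw [map_mul, ← hs]
      ring
    simp only [Fin.mk_one, Matrix.cons_val_one, Matrix.cons_val_fin_one, this, rootBasis_repr]
    fin_cases i <;> rfl

theorem trace_add_mul_root {ε : F} {s : K} (hε : ¬ IsSquare ε) (hs : s ^ 2 = algebraMap F K ε)
    (hK : Module.finrank F K = 2) (u v : F) :
    Algebra.trace F K (algebraMap F K u + algebraMap F K v * s) = 2 * u := by
  rw [Algebra.trace_eq_matrix_trace (rootBasis hε hs hK), leftMulMatrix_rootBasis]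
  simp [Matrix.trace_fin_two]
  ring

theorem norm_add_mul_root {ε : F} {s : K} (hε : ¬ IsSquare ε) (hs : s ^ 2 = algebraMap F K ε)
    (hK : Module.finrank F K = 2) (u v : F) :
    Algebra.norm F (algebraMap F K u + algebraMap F K v * s) = u ^ 2 - v ^ 2 * ε := by
  rw [Algebra.norm_eq_matrix_det (rootBasis hε hs hK), leftMulMatrix_rootBasis]
  simp [Matrix.det_fin_two]
  ring

end

/-! ### The forms `ψ'` -/

section

variable {F K : Type*} [Field F] [Field K] [Algebra F K]

/-- The coefficients of `(Y² - ε X²)((Y - aX)² - b² ε X²)`. -/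
abbrev psiV (ε a b : F) : Fin 5 → F :=
  ![1, -2 * a, a ^ 2 - b ^ 2 * ε - ε, 2 * a * ε, -(ε * (a ^ 2 - b ^ 2 * ε))]

theorem psi_ne_zero (ε a b : F) : psiV ε a b ≠ 0 := fun h => by simpa using congrFun h 0

theorem formPsi_eq {ε : F} {s : K} (hε : ¬ IsSquare ε) (hs : s ^ 2 = algebraMap F K ε)
    (hK : Module.finrank F K = 2) (a b : F) :
    formPsi ε (algebraMap F K a + algebraMap F K b * s) = ofCoeffs (psiV ε a b) := by
  rw [formPsi, trace_add_mul_root hε hs hK, norm_add_mul_root hε hs hK]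
  simp [ofCoeffs, psiV, map_ofNat C]
  ring

theorem value_psi {L : Type*} [Field L] [Algebra F L] (ε a b : F) (x y : L) :
    value (psiV ε a b) x y = (y ^ 2 - algebraMap F L ε * x ^ 2) *
      ((y - algebraMap F L a * x) ^ 2 - algebraMap F L ε * (algebraMap F L b * x) ^ 2) := by
  simp [value, psiV, map_ofNat (algebraMap F L)]
  ring

/-- The four roots of `ψ'` are distinct. -/
structure PsiData (ε a b : F) : Prop where
  nonsquare : ¬ IsSquare ε
  b_ne : b ≠ 0
  minus_ne : a ^ 2 - (b - 1) ^ 2 * ε ≠ 0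
  plus_ne : a ^ 2 - (b + 1) ^ 2 * ε ≠ 0

namespace PsiData

variable {ε a b : F}

theorem neg (h : PsiData ε a b) : PsiData ε a (-b) :=
  ⟨h.nonsquare, neg_ne_zero.mpr h.b_ne, by convert h.plus_ne using 2; ring,
    by convert h.minus_ne using 2; ring⟩

theorem eps_ne (h : PsiData ε a b) : ε ≠ 0 := by
  rintro rfl
  exact h.nonsquare IsSquare.zero

theorem not_hasRoot (h : PsiData ε a b) : ¬ HasRoot (psiV ε a b) := by
  rintro ⟨x, y, hxy, e⟩
  rw [value_psi] at e
  have hx : x = 0 ∧ y = 0 := by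
    rcases mul_eq_zero.mp e with e | e
    · exact eq_zero_of_sq_eq_mul_sq h.nonsquare (sub_eq_zero.mp e)
    · obtain ⟨h1, h2⟩ := eq_zero_of_sq_eq_mul_sq h.nonsquare (sub_eq_zero.mp e)
      have hx : x = 0 := (mul_eq_zero.mp h1).resolve_left (by simpa using h.b_ne)
      subst hx
      exact ⟨rfl, by simpa using h2⟩
  rcases hxy with h' | h'
  · exact h' hx.1
  · exact h' hx.2

/-- For α = a + b√ε put P = N(α - √ε) and Q = N(α + √ε). Then 36 I = P² - PQ + Q², while Δ is a
constant times P²Q²(P - Q)², where P - Q = 4bε. Thus `j` is `jLambda` at the cross-ratio P/Q, which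
is χ₁(α). -/
theorem coeffI_eq (ε a b : F) :
    coeffI (psiV ε a b) = ((a ^ 2 - (b - 1) ^ 2 * ε) ^ 2 -
      (a ^ 2 - (b - 1) ^ 2 * ε) * (a ^ 2 - (b + 1) ^ 2 * ε) +
      (a ^ 2 - (b + 1) ^ 2 * ε) ^ 2) / 36 := by
  simp [coeffI, psiV]
  congr 1
  ring

theorem coeffDisc_eq (h2 : (2 : F) ≠ 0) (h3 : (3 : F) ≠ 0) (ε a b : F) :
    coeffDisc (psiV ε a b) = (a ^ 2 - (b - 1) ^ 2 * ε) ^ 2 * (a ^ 2 - (b + 1) ^ 2 * ε) ^ 2 *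
      (4 * b * ε) ^ 2 / 6912 := by
  obtain ⟨-, -, -, -, h36, h432, -⟩ := ne_zero_of_two_three h2 h3
  have h6912 : (6912 : F) ≠ 0 := by
    rw [show (6912 : F) = 432 * 2 ^ 4 by norm_num]; positivity
  rw [coeffDisc, coeffI_eq]
  simp [coeffJ, psiV]
  field_simp
  ring

theorem coeffDisc_ne (h2 : (2 : F) ≠ 0) (h3 : (3 : F) ≠ 0) (h : PsiData ε a b) :
    coeffDisc (psiV ε a b) ≠ 0 := by
  obtain ⟨h4, -, -, -, h36, h432, -⟩ := ne_zero_of_two_three h2 h3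
  have h6912 : (6912 : F) ≠ 0 := by
    rw [show (6912 : F) = 432 * 2 ^ 4 by norm_num]; positivity
  have := h.minus_ne
  have := h.plus_ne
  have := h.b_ne
  have := h.eps_ne
  rw [coeffDisc_eq h2 h3]
  positivity

theorem j_eq (h2 : (2 : F) ≠ 0) (h3 : (3 : F) ≠ 0) (h : PsiData ε a b) {l : F}
    (hl : l * (a ^ 2 - (b + 1) ^ 2 * ε) = a ^ 2 - (b - 1) ^ 2 * ε) :
    1728 * coeffI (psiV ε a b) ^ 3 / coeffDisc (psiV ε a b) = jLambda l := by
  obtain ⟨h4, -, -, -, h36, h432, -⟩ := ne_zero_of_two_three h2 h3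
  have h6912 : (6912 : F) ≠ 0 := by
    rw [show (6912 : F) = 432 * 2 ^ 4 by norm_num]; positivity
  have hm := h.minus_ne
  have hp := h.plus_ne
  have hb := h.b_ne
  have he := h.eps_ne
  have e4 : 4 * b * ε = (a ^ 2 - (b - 1) ^ 2 * ε) - (a ^ 2 - (b + 1) ^ 2 * ε) := by ring
  have h4b : 4 * b * ε ≠ 0 := by positivity
  rw [coeffDisc_eq h2 h3, coeffI_eq, jLambda, e4]
  rw [e4] at h4b
  rw [← hl] at hm h4b ⊢
  generalize a ^ 2 - (b + 1) ^ 2 * ε = Q at *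
  have hl0 : l ≠ 0 := by rintro rfl; simp at hm
  have hl1 : l - 1 ≠ 0 := by
    intro h
    apply h4b
    linear_combination Q * h
  rw [show l * Q - Q = Q * (l - 1) by ring,
    show (l * Q) ^ 2 - l * Q * Q + Q ^ 2 = Q ^ 2 * (l ^ 2 - l + 1) by ring]
  generalize l ^ 2 - l + 1 = A at *
  generalize l - 1 = B at *
  field_simp
  ring

theorem sum_ne (h2 : (2 : F) ≠ 0) (h : PsiData ε a b) :
    (a ^ 2 - b ^ 2 * ε + ε) ^ 2 - ε * (2 * a) ^ 2 ≠ 0 := by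
  intro e
  obtain ⟨h1, h2'⟩ := eq_zero_of_sq_eq_mul_sq h.nonsquare (sub_eq_zero.mp e)
  have ha : a = 0 := (mul_eq_zero.mp h1).resolve_left h2
  subst ha
  have hb : ε * ((b - 1) * (b + 1)) = 0 := by linear_combination -h2'
  have hb := (mul_eq_zero.mp hb).resolve_left h.eps_ne
  rcases mul_eq_zero.mp hb with hb | hb
  · apply h.minus_ne
    linear_combination -(b - 1) * ε * hb
  · apply h.plus_ne
    linear_combination -(b + 1) * ε * hb

theorem det_conj (h2 : (2 : F) ≠ 0) (h : PsiData ε a b) :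
    -(a ^ 2 - b ^ 2 * ε + ε) * (a ^ 2 - b ^ 2 * ε + ε) - 2 * a * (-(ε * (2 * a))) ≠ 0 := by
  have := h.sum_ne h2
  contrapose! this
  linear_combination -this

theorem det_swap (h : PsiData ε a b) :
    -a * a - (1 + b) * ((1 + b) * b * ε - a ^ 2) ≠ 0 := by
  have := mul_ne_zero h.b_ne h.plus_ne
  contrapose! this
  linear_combination this

/-- The involution exchanging the roots `√ε` and `-√ε` of `ψ'`. -/
def conjE (h2 : (2 : F) ≠ 0) (h : PsiData ε a b) : Matrix.ProjGenLinGroup (Fin 2) F :=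
  pgl _ _ _ _ (h.det_conj h2)

/-- The involution exchanging the roots `√ε` and `a + b √ε` of `ψ'`. -/
def swapE (h : PsiData ε a b) : Matrix.ProjGenLinGroup (Fin 2) F :=
  pgl _ _ _ _ h.det_swap

theorem carries_conj (h2 : (2 : F) ≠ 0) (h : PsiData ε a b) :
    Carries (-(a ^ 2 - b ^ 2 * ε + ε)) (2 * a) (-(ε * (2 * a))) (a ^ 2 - b ^ 2 * ε + ε)
      (psiV ε a b) (psiV ε a b) := by
  refine ⟨((a ^ 2 - b ^ 2 * ε + ε) ^ 2 - ε * (2 * a) ^ 2) ^ 2, pow_ne_zero 2 (h.sum_ne h2), ?_⟩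
  funext i
  fin_cases i <;> simp [act, psiV] <;> ring

theorem carries_swap (h : PsiData ε a b) :
    Carries (-a) (1 + b) ((1 + b) * b * ε - a ^ 2) a (psiV ε a b) (psiV ε a b) := by
  refine ⟨(b * (a ^ 2 - (b + 1) ^ 2 * ε)) ^ 2, pow_ne_zero 2 (mul_ne_zero h.b_ne h.plus_ne), ?_⟩
  funext i
  fin_cases i <;> simp [act, psiV] <;> ring

theorem carries_swap_neg (h : PsiData ε a b) :
    Carries (-a) (1 + -b) ((1 + -b) * -b * ε - a ^ 2) a (psiV ε a b) (psiV ε a b) := by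
  have := h.neg.carries_swap
  rwa [show psiV ε a (-b) = psiV ε a b by simp [psiV]] at this

end PsiData

end

end BinaryQuartic

end

noncomputable section

namespace BinaryQuartic

open MvPolynomial

/-! ### Equivalences between the forms ψ' and their stabilizers -/

section

variable {F K : Type*} [Field F] [Field K] [Algebra F K]

theorem Carries.trans {a b c d a' b' c' d' : F} {u v w : Fin 5 → F} (hu : u ≠ 0) (hv : v ≠ 0)
    (hw : w ≠ 0) (h : a * d - b * c ≠ 0) (h' : a' * d' - b' * c' ≠ 0)
    (h1 : Carries a b c d u v) (h2 : Carries a' b' c' d' v w) :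
    Carries (a' * a + b' * c) (a' * b + b' * d) (c' * a + d' * c) (c' * b + d' * d) u w := by
  rw [← pgl_smul_point (h := h) (hv := hu) (hw := hv)] at h1
  rw [← pgl_smul_point (h := h') (hv := hv) (hw := hw), ← h1, smul_smul, pgl_mul_pgl] at h2
  exact pgl_smul_point.mp h2

theorem Carries.congr {a b c d a' b' c' d' : F} {v w : Fin 5 → F} (h : Carries a b c d v w)
    (ha : a = a') (hb : b = b') (hc : c = c') (hd : d = d') : Carries a' b' c' d' v w := by
  subst ha hb hc hd
  exact h

theorem pgl_congr {a b c d a' b' c' d' : F} (h : a * d - b * c ≠ 0)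
    (ha : a = a') (hb : b = b') (hc : c = c') (hd : d = d') :
    pgl a b c d h = pgl a' b' c' d' (by subst ha hb hc hd; exact h) := by
  subst ha hb hc hd
  rfl

/-- A class of order two with matrix `(-d b; c d)` equals its inverse. -/
theorem inv_pgl_neg {b c d : F} (h : -d * d - b * c ≠ 0) :
    (pgl (-d) b c d h)⁻¹ = pgl (-d) b c d h := by
  rw [inv_pgl, pgl_eq_pgl_iff]
  exact ⟨-1, by simp, by ring, by ring, by ring, by ring⟩

theorem pgl_neg_mul_self {b c d : F} (h : -d * d - b * c ≠ 0) :
    pgl (-d) b c d h * pgl (-d) b c d h = 1 := by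
  rw [pgl_mul_pgl, pgl_eq_one_iff]
  exact ⟨by ring, by ring, by ring⟩

namespace PsiData

variable {ε a b a' b' : F}

/-- A transformation between two forms `ψ'` that fixes `√ε`. -/
structure IsFixing (ε a b a' b' : F) (g : Matrix.ProjGenLinGroup (Fin 2) F) : Prop where
  exists_pgl : ∃ (x y : F) (h : x * x - y * (y * ε) ≠ 0), g = pgl _ _ _ _ h ∧
    Carries x y (y * ε) x (psiV ε a b) (psiV ε a' b')

theorem isFixing_of_mul {p q r A B C D x y : F} (h : A * D - B * C ≠ 0)
    (h' : -p * p - q * r ≠ 0) (ht : Carries (-p) q r p (psiV ε a' b') (psiV ε a' b'))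
    (hg : Carries A B C D (psiV ε a b) (psiV ε a' b'))
    (h1 : -p * A + q * C = x) (h2 : -p * B + q * D = y) (h3 : r * A + p * C = y * ε)
    (h4 : r * B + p * D = x) :
    IsFixing ε a b a' b' ((pgl _ _ _ _ h')⁻¹ * pgl _ _ _ _ h) := by
  have hc := (Carries.trans (psi_ne_zero ε a b) (psi_ne_zero ε a' b') (psi_ne_zero ε a' b') h h'
    hg ht).congr h1 h2 h3 h4
  rw [inv_pgl_neg, pgl_mul_pgl, pgl_congr _ h1 h2 h3 h4]
  exact ⟨_, _, _, rfl, hc⟩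

/-- The image of √ε is one of the four roots √ε, -√ε, a' ± b'√ε of the target, and each of them is
taken to √ε by the identity or by one of three involutions preserving the target. Correcting by it
leaves a transformation fixing √ε, whose matrix (x y; yε x) represents multiplication by x + y√ε. -/
theorem exists_isFixing (h2 : (2 : F) ≠ 0) {s : K} (hs : s ^ 2 = algebraMap F K ε)
    (hp : PsiData ε a' b') {A B C D : F} (h : A * D - B * C ≠ 0)
    (hg : Carries A B C D (psiV ε a b) (psiV ε a' b')) :
    ∃ t ∈ ({1, hp.conjE h2, hp.swapE, hp.neg.swapE} : Set (Matrix.ProjGenLinGroup (Fin 2) F)),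
      IsFixing ε a b a' b' (t⁻¹ * pgl A B C D h) := by
  have hz : value (psiV ε a b) 1 s = 0 := by
    rw [value_psi]
    simp [hs]
  have e := hg.value_eq_zero hz
  -- The image of √ε is u + v√ε exactly when these two equations between elements of F hold, by
  -- comparison of coordinates in the basis 1, √ε.
  have key : ∀ u v : F, (algebraMap F K C * 1 + algebraMap F K D * s) -
      (algebraMap F K u + algebraMap F K v * s) * (algebraMap F K A * 1 + algebraMap F K B * s) = 0 →
      C - u * A - v * B * ε = 0 ∧ D - u * B - v * A = 0 := by
    intro u v h
    apply eq_zero_of_add_mul_root hp.nonsquare hs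
    simp only [map_sub, map_mul, ← hs]
    linear_combination h
  rw [value_psi, ← hs, mul_eq_zero] at e
  rcases e with e | e
  · have e' : ((algebraMap F K C * 1 + algebraMap F K D * s) -
        (algebraMap F K 0 + algebraMap F K 1 * s) * (algebraMap F K A * 1 + algebraMap F K B * s)) *
        ((algebraMap F K C * 1 + algebraMap F K D * s) -
        (algebraMap F K 0 + algebraMap F K (-1) * s) *
          (algebraMap F K A * 1 + algebraMap F K B * s)) = 0 := by
      simp only [map_zero, map_neg, map_one]
      linear_combination e
    rcases mul_eq_zero.mp e' with e' | e'
    · obtain ⟨h1, h2'⟩ := key _ _ e'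
      refine ⟨1, by simp, ?_⟩
      rw [inv_one, one_mul]
      obtain rfl : C = B * ε := by linear_combination h1
      obtain rfl : D = A := by linear_combination h2'
      exact ⟨_, _, _, rfl, hg⟩
    · obtain ⟨h1, h2'⟩ := key _ _ e'
      refine ⟨_, Or.inr (Or.inl rfl), ?_⟩
      exact isFixing_of_mul h (hp.det_conj h2) (hp.carries_conj h2) hg rfl rfl
        (by linear_combination (a' ^ 2 - b' ^ 2 * ε + ε) * h1 - 2 * a' * ε * h2')
        (by linear_combination (a' ^ 2 - b' ^ 2 * ε + ε) * h2' - 2 * a' * h1)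
  · have e' : ((algebraMap F K C * 1 + algebraMap F K D * s) -
        (algebraMap F K a' + algebraMap F K b' * s) *
          (algebraMap F K A * 1 + algebraMap F K B * s)) *
        ((algebraMap F K C * 1 + algebraMap F K D * s) -
        (algebraMap F K a' + algebraMap F K (-b') * s) *
          (algebraMap F K A * 1 + algebraMap F K B * s)) = 0 := by
      simp only [map_neg]
      linear_combination e
    rcases mul_eq_zero.mp e' with e' | e'
    · obtain ⟨h1, h2'⟩ := key _ _ e'
      refine ⟨_, Or.inr (Or.inr (Or.inl rfl)), ?_⟩
      exact isFixing_of_mul h hp.det_swap hp.carries_swap hg rfl rfl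
        (by linear_combination a' * h1 - (1 + b') * ε * h2')
        (by linear_combination a' * h2' - (1 + b') * h1)
    · obtain ⟨h1, h2'⟩ := key _ _ e'
      refine ⟨_, Or.inr (Or.inr (Or.inr rfl)), ?_⟩
      exact isFixing_of_mul h hp.neg.det_swap hp.carries_swap_neg hg rfl rfl
        (by linear_combination a' * h1 - (1 - b') * ε * h2')
        (by linear_combination a' * h2' - (1 - b') * h1)

/-- The coefficient equations of a transformation fixing `√ε`. -/
theorem eqs_of_carries {x y : F} (hd : x * x - y * (y * ε) ≠ 0)
    (hε : ε ≠ 0)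
    (h : Carries x y (y * ε) x (psiV ε a b) (psiV ε a' b')) :
    2 * x * y * ε + 2 * a * (x ^ 2 + y ^ 2 * ε) + 2 * (a ^ 2 - b ^ 2 * ε) * x * y =
      2 * a' * (x ^ 2 + 2 * a * x * y + (a ^ 2 - b ^ 2 * ε) * y ^ 2) ∧
    y ^ 2 * ε ^ 2 + 2 * a * x * y * ε + (a ^ 2 - b ^ 2 * ε) * x ^ 2 =
      (a' ^ 2 - b' ^ 2 * ε) * (x ^ 2 + 2 * a * x * y + (a ^ 2 - b ^ 2 * ε) * y ^ 2) := by
  obtain ⟨k, hk, e⟩ := h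
  have e0 := congrFun e 0
  have e1 := congrFun e 1
  have e4 := congrFun e 4
  simp [act, psiV] at e0 e1 e4
  rw [← e0] at e1 e4
  constructor
  · apply mul_left_cancel₀ hd
    linear_combination -e1
  · apply mul_left_cancel₀ (mul_ne_zero hd hε)
    linear_combination -e4

/-- An element fixing √ε also fixes its conjugate, so it fixes or exchanges α and its conjugate. An
exchange requires N(α) = ε, that is P = -Q, the cross-ratio -1. -/
theorem eq_zero_of_isFixing (h2 : (2 : F) ≠ 0) (hp : PsiData ε a b) {x y : F}
    (hd : x * x - y * (y * ε) ≠ 0)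
    (h : Carries x y (y * ε) x (psiV ε a b) (psiV ε a b)) :
    y = 0 ∨ (x = 0 ∧ a ^ 2 - b ^ 2 * ε = ε) := by
  obtain ⟨e1, e2⟩ := eqs_of_carries hd hp.eps_ne h
  by_cases hy : y = 0
  · exact Or.inl hy
  right
  have f1 : x * (2 * a ^ 2 - (a ^ 2 - b ^ 2 * ε) - ε) + a * y * (a ^ 2 - b ^ 2 * ε - ε) = 0 := by
    apply mul_left_cancel₀ (mul_ne_zero h2 hy)
    linear_combination -e1
  have f2 : (ε - (a ^ 2 - b ^ 2 * ε)) * (y * (ε + (a ^ 2 - b ^ 2 * ε)) + 2 * a * x) = 0 := by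
    apply mul_left_cancel₀ hy
    linear_combination e2
  have hs := hp.sum_ne h2
  generalize hN : a ^ 2 - b ^ 2 * ε = N at *
  rcases mul_eq_zero.mp f2 with f2 | f2
  · have hN' : N = ε := by linear_combination -f2
    subst hN'
    refine ⟨?_, rfl⟩
    have : x * (a ^ 2 - N) = 0 := by
      apply mul_left_cancel₀ h2
      linear_combination f1
    refine (mul_eq_zero.mp this).resolve_right fun h => ?_
    exact hp.nonsquare ⟨a, by linear_combination -h⟩
  · exfalso
    have hx : x = 0 := by
      have : x * ((N + ε) ^ 2 - ε * (2 * a) ^ 2) = 0 := by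
        linear_combination -(N + ε) * f1 + a * (N - ε) * f2
      exact (mul_eq_zero.mp this).resolve_right hs
    subst hx
    have hN0 : N + ε = 0 := by
      apply mul_left_cancel₀ hy
      linear_combination f2
    have ha : a * (N - ε) = 0 := by
      apply mul_left_cancel₀ hy
      linear_combination f1
    apply hs
    rcases mul_eq_zero.mp ha with ha | ha
    · rw [hN0, ha]; ring
    · have : 2 * ε = 0 := by linear_combination hN0 - ha
      exact absurd this (mul_ne_zero h2 hp.eps_ne)

/-- Equivalent forms `ψ'` have the same class `{λ, λ⁻¹}`. -/
theorem param_eq_of_carries (h2 : (2 : F) ≠ 0) {s : K} (hs : s ^ 2 = algebraMap F K ε)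
    (hp : PsiData ε a b) (hp' : PsiData ε a' b') {A B C D l l' : F} (h : A * D - B * C ≠ 0)
    (hg : Carries A B C D (psiV ε a b) (psiV ε a' b'))
    (hl : l * (a ^ 2 - (b + 1) ^ 2 * ε) = a ^ 2 - (b - 1) ^ 2 * ε)
    (hl' : l' * (a' ^ 2 - (b' + 1) ^ 2 * ε) = a' ^ 2 - (b' - 1) ^ 2 * ε) :
    l' = l ∨ l' * l = 1 := by
  obtain ⟨t, -, ⟨x, y, hd, -, hc⟩⟩ := exists_isFixing h2 hs hp' h hg
  obtain ⟨e1, e2⟩ := eqs_of_carries hd hp.eps_ne hc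
  generalize hk : x ^ 2 + 2 * a * x * y + (a ^ 2 - b ^ 2 * ε) * y ^ 2 = k at *
  -- By `m1` and `m2`, k(N(α') - ε) = m(N(α) - ε) and kb' = ±mb, where m is the determinant. So the
  -- pair (kP', kQ') equals (mP, mQ) or (mQ, mP), according to the sign; in the quotient this is λ
  -- or 1/λ.
  have m1 : k * (a' ^ 2 - b' ^ 2 * ε - ε) = (x * x - y * (y * ε)) * (a ^ 2 - b ^ 2 * ε - ε) := by
    rw [← hk] at e2 ⊢
    linear_combination -e2
  have m2 : k ^ 2 * b' ^ 2 = (x * x - y * (y * ε)) ^ 2 * b ^ 2 := by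
    apply mul_left_cancel₀ (mul_ne_zero (pow_ne_zero 2 h2) hp.eps_ne)
    have e2' : k * (y ^ 2 * ε ^ 2 + 2 * a * x * y * ε + (a ^ 2 - b ^ 2 * ε) * x ^ 2) =
      k ^ 2 * (a' ^ 2 - b' ^ 2 * ε) := by rw [e2]; ring
    have e1' := congrArg (fun z => z ^ 2) e1
    rw [← hk] at e2' e1' ⊢
    linear_combination 4 * e2' - e1'
  have m3 : (k * b' - (x * x - y * (y * ε)) * b) * (k * b' + (x * x - y * (y * ε)) * b) = 0 := by
    linear_combination m2
  have hk0 : k ≠ 0 := by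
    rintro rfl
    have := mul_ne_zero hd hp.b_ne
    have : ((x * x - y * (y * ε)) * b) ^ 2 = 0 := by linear_combination -m2
    exact pow_ne_zero 2 (mul_ne_zero hd hp.b_ne) this
  generalize x * x - y * (y * ε) = m at *
  rcases mul_eq_zero.mp m3 with m3 | m3
  · left
    have h1 : k * (a' ^ 2 - (b' + 1) ^ 2 * ε) = m * (a ^ 2 - (b + 1) ^ 2 * ε) := by
      linear_combination m1 - 2 * ε * m3
    have h2' : k * (a' ^ 2 - (b' - 1) ^ 2 * ε) = m * (a ^ 2 - (b - 1) ^ 2 * ε) := by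
      linear_combination m1 + 2 * ε * m3
    apply mul_left_cancel₀ (mul_ne_zero hk0 hp'.plus_ne)
    linear_combination k * hl' + h2' - m * hl - l * h1
  · right
    have h1 : k * (a' ^ 2 - (b' + 1) ^ 2 * ε) = m * (a ^ 2 - (b - 1) ^ 2 * ε) := by
      linear_combination m1 - 2 * ε * m3
    have h2' : k * (a' ^ 2 - (b' - 1) ^ 2 * ε) = m * (a ^ 2 - (b + 1) ^ 2 * ε) := by
      linear_combination m1 + 2 * ε * m3
    apply mul_left_cancel₀ (mul_ne_zero hd hp.plus_ne)
    linear_combination m * l' * hl - l' * h1 + k * hl' + h2'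

theorem conjE_mem (h2 : (2 : F) ≠ 0) (hp : PsiData ε a b) : hp.conjE h2 ∈
    MulAction.stabilizer (Matrix.ProjGenLinGroup (Fin 2) F) (point _ (psi_ne_zero ε a b)) :=
  mem_stabilizer_point.mpr (hp.carries_conj h2)

theorem swapE_mem (hp : PsiData ε a b) : hp.swapE ∈
    MulAction.stabilizer (Matrix.ProjGenLinGroup (Fin 2) F) (point _ (psi_ne_zero ε a b)) :=
  mem_stabilizer_point.mpr hp.carries_swap

theorem conjE_mul_self (h2 : (2 : F) ≠ 0) (hp : PsiData ε a b) :
    hp.conjE h2 * hp.conjE h2 = 1 := pgl_neg_mul_self _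

theorem swapE_mul_self (hp : PsiData ε a b) : hp.swapE * hp.swapE = 1 := pgl_neg_mul_self _

theorem conjE_ne_one (h2 : (2 : F) ≠ 0) (hp : PsiData ε a b) : hp.conjE h2 ≠ 1 := by
  rw [Ne, conjE, pgl_eq_one_iff]
  rintro ⟨h, -, h'⟩
  apply hp.sum_ne h2
  rw [h]
  have : a ^ 2 - b ^ 2 * ε + ε = 0 := mul_left_cancel₀ h2 (by linear_combination -h')
  rw [this]
  ring

theorem swapE_ne_one (hp : PsiData ε a b) : hp.swapE ≠ 1 := by
  rw [Ne, swapE, pgl_eq_one_iff]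
  rintro ⟨h, h', -⟩
  apply hp.plus_ne
  linear_combination -h' + (b * ε - (b + 1) * ε) * h

theorem conjE_ne_swapE (h2 : (2 : F) ≠ 0) (hp : PsiData ε a b) : hp.conjE h2 ≠ hp.swapE := by
  rw [Ne, conjE, swapE, pgl_eq_pgl_iff]
  rintro ⟨u, hu, -, h, h', -⟩
  apply hp.plus_ne
  linear_combination -h' - ε * h

/-- The set S is to contain the elements fixing √ε: the identity alone in the Klein case, and one
involution more in the dihedral case. -/
theorem card_stabilizer_le [Finite F] (h2 : (2 : F) ≠ 0) {s : K} (hs : s ^ 2 = algebraMap F K ε)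
    (hp : PsiData ε a b) (S : Set (Matrix.ProjGenLinGroup (Fin 2) F))
    (hS : ∀ g, IsFixing ε a b a b g → g ∈ S) :
    Nat.card (MulAction.stabilizer (Matrix.ProjGenLinGroup (Fin 2) F)
      (point _ (psi_ne_zero ε a b))) ≤ 4 * S.ncard := by
  have := finite_pgl (F := F)
  refine (card_le_of_cosets _ {1, hp.conjE h2, hp.swapE, hp.neg.swapE} S fun g hg => ?_).trans
    (Nat.mul_le_mul_right _ (ncard_quadruple_le _ _ _ _))
  obtain ⟨A, B, C, D, h, rfl⟩ := exists_eq_pgl g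
  obtain ⟨t, ht, h'⟩ := exists_isFixing h2 hs hp h (mem_stabilizer_point.mp hg)
  exact ⟨t, ht, hS _ h'⟩

theorem stabilizer_klein [Finite F] (h2 : (2 : F) ≠ 0) {s : K} (hs : s ^ 2 = algebraMap F K ε)
    (hp : PsiData ε a b) (hN : a ^ 2 - b ^ 2 * ε ≠ ε) :
    Nonempty (MulAction.stabilizer (Matrix.ProjGenLinGroup (Fin 2) F)
      (point _ (psi_ne_zero ε a b)) ≃* Cyc 2 × Cyc 2) := by
  have := finite_pgl (F := F)
  have hle := card_stabilizer_le h2 hs hp {1} (by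
    rintro _ ⟨x, y, hd, rfl, hc⟩
    obtain rfl := (eq_zero_of_isFixing h2 hp hd hc).resolve_right fun h => hN h.2
    exact pgl_eq_one_iff.mpr ⟨rfl, by ring, rfl⟩)
  rw [Set.ncard_singleton, mul_one] at hle
  exact (nonempty_mulEquiv_klein hle (s := ⟨_, hp.conjE_mem h2⟩) (t := ⟨_, hp.swapE_mem⟩)
    (Subtype.ext (hp.conjE_mul_self h2)) (Subtype.ext hp.swapE_mul_self)
    (fun h => hp.conjE_ne_one h2 (congrArg Subtype.val h))
    (fun h => hp.swapE_ne_one (congrArg Subtype.val h))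
    (fun h => hp.conjE_ne_swapE h2 (congrArg Subtype.val h))).2

theorem stabilizer_dihedral [Finite F] (h2 : (2 : F) ≠ 0) {s : K} (hs : s ^ 2 = algebraMap F K ε)
    (hp : PsiData ε a b) (hN : a ^ 2 - b ^ 2 * ε = ε) :
    Nonempty (MulAction.stabilizer (Matrix.ProjGenLinGroup (Fin 2) F)
      (point _ (psi_ne_zero ε a b)) ≃* DihedralGroup 4) := by
  have := finite_pgl (F := F)
  have hε := hp.eps_ne
  -- The matrix (0 1; ε 0) fixes ±√ε and acts by α ↦ ε/α, which is conjugation of α when N(α) = ε.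
  have hσ : -(0 : F) * 0 - 1 * ε ≠ 0 := by simpa using hε
  have hσc : Carries (-0) 1 ε 0 (psiV ε a b) (psiV ε a b) := by
    refine ⟨-ε ^ 2, by simpa using hε, ?_⟩
    funext i
    fin_cases i <;> simp [act, psiV, hN] <;> ring
  have hσm := (mem_stabilizer_point (hv := psi_ne_zero ε a b) (h := hσ)).mpr hσc
  have hle := card_stabilizer_le h2 hs hp {1, pgl _ _ _ _ hσ} (by
    rintro _ ⟨x, y, hd, rfl, hc⟩
    rcases eq_zero_of_isFixing h2 hp hd hc with rfl | ⟨rfl, -⟩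
    · left
      exact pgl_eq_one_iff.mpr ⟨rfl, by ring, rfl⟩
    · right
      have hy : y ≠ 0 := by rintro rfl; simp at hd
      change pgl _ _ _ _ hd = pgl _ _ _ _ hσ
      rw [pgl_eq_pgl_iff]
      exact ⟨y⁻¹, inv_ne_zero hy, by simp, by simp [hy], by field_simp, by simp⟩)
  have hle' := hle.trans (Nat.mul_le_mul_left 4 (ncard_pair_le _ _))
  have hσσ : pgl _ _ _ _ hσ * pgl _ _ _ _ hσ = 1 := pgl_neg_mul_self hσ
  -- The product of the two involutions is the rotation of order four; its square exchanges √ε with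
  -- -√ε.
  have hsq : (hp.swapE * pgl _ _ _ _ hσ) ^ 2 = hp.conjE h2 := by
    rw [pow_two, swapE, conjE, pgl_mul_pgl, pgl_mul_pgl, pgl_eq_pgl_iff]
    have hb := hp.b_ne
    have hu : -(b * ε) ≠ 0 := neg_ne_zero.mpr (mul_ne_zero hb hε)
    refine ⟨(-(b * ε))⁻¹, inv_ne_zero hu, ?_, ?_, ?_, ?_⟩
    all_goals rw [eq_comm, inv_mul_eq_iff_eq_mul₀ hu]
    · linear_combination (-b * ε - ε) * hN
    · ring_nf
      linear_combination a * hN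
    · linear_combination (-a * ε) * hN
    · linear_combination (a ^ 2 - b ^ 2 * ε - b * ε) * hN
  refine (nonempty_mulEquiv_dihedral hle'
    (a := ⟨_, mul_mem hp.swapE_mem hσm⟩) (b := ⟨_, hσm⟩) (Subtype.ext ?_) (fun h => ?_)
    (Subtype.ext hσσ) (fun h => ?_) (fun h => ?_) (Subtype.ext ?_)).2
  · change (hp.swapE * pgl _ _ _ _ hσ) ^ 4 = 1
    rw [show 4 = 2 * 2 by norm_num, pow_mul, hsq, pow_two, hp.conjE_mul_self h2]
  · have e : (hp.swapE * pgl _ _ _ _ hσ) ^ 2 = 1 := congrArg Subtype.val h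
    rw [hsq] at e
    exact hp.conjE_ne_one h2 e
  · have e : pgl _ _ _ _ hσ = 1 := congrArg Subtype.val h
    rw [pgl_eq_one_iff] at e
    exact one_ne_zero e.1
  · have e : pgl _ _ _ _ hσ = (hp.swapE * pgl _ _ _ _ hσ) ^ 2 := congrArg Subtype.val h
    rw [hsq, conjE, pgl_eq_pgl_iff] at e
    obtain ⟨u, hu, h1, h3, h4, h5⟩ := e
    have h0 : ε * u = 0 := by
      apply mul_left_cancel₀ h2
      linear_combination -h4 - ε * h3
    exact mul_ne_zero hε hu h0
  · change pgl _ _ _ _ hσ * (hp.swapE * pgl _ _ _ _ hσ) * pgl _ _ _ _ hσ =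
      (hp.swapE * pgl _ _ _ _ hσ)⁻¹
    rw [mul_inv_rev, inv_eq_of_mul_eq_one_left hσσ, inv_eq_of_mul_eq_one_left hp.swapE_mul_self]
    simp only [mul_assoc]
    rw [hσσ, mul_one]

end PsiData

end

end BinaryQuartic

end

noncomputable section

namespace BinaryQuartic

open MvPolynomial

/-! ### Splitting fields, and the rows of the table for ψ' -/

section

variable {F K : Type*} [Field F] [Field K] [Algebra F K]

/-- If a monic form is a product of linear factors over an extension generated by its roots, then
the splitting degree is the degree of this extension. -/
theorem splittingDegree_ofCoeffs {v : Fin 5 → F} (hv : v 0 = 1) {r : Fin 4 → K}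
    (hr : ∀ y : Polynomial K, y ^ 4 + Polynomial.C (algebraMap F K (v 1)) * y ^ 3 +
      Polynomial.C (algebraMap F K (v 2)) * y ^ 2 + Polynomial.C (algebraMap F K (v 3)) * y +
      Polynomial.C (algebraMap F K (v 4)) =
      (y - Polynomial.C (r 0)) * (y - Polynomial.C (r 1)) * (y - Polynomial.C (r 2)) *
        (y - Polynomial.C (r 3)))
    (hgen : Algebra.adjoin F (Set.range r) = ⊤) :
    splittingDegree (ofCoeffs v) = Module.finrank F K := by
  rw [splittingDegree, dehomogenize_ofCoeffs]
  set p := Polynomial.C (v 0) * Polynomial.X ^ 4 + Polynomial.C (v 1) * Polynomial.X ^ 3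
        + Polynomial.C (v 2) * Polynomial.X ^ 2 + Polynomial.C (v 3) * Polynomial.X
        + Polynomial.C (v 4) with hp
  have hmap : p.map (algebraMap F K) = (Polynomial.X - Polynomial.C (r 0)) *
      (Polynomial.X - Polynomial.C (r 1)) * (Polynomial.X - Polynomial.C (r 2)) *
        (Polynomial.X - Polynomial.C (r 3)) := by
    rw [← hr, hp, hv]
    simp
  have hp0 : p ≠ 0 := by
    intro h
    have := congrArg (Polynomial.map (algebraMap F K)) h
    rw [hmap, Polynomial.map_zero] at this
    simp [Polynomial.X_sub_C_ne_zero] at this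
  have hs : Polynomial.IsSplittingField F K p := by
    constructor
    · rw [hmap]
      exact (((Polynomial.Splits.X_sub_C _).mul (Polynomial.Splits.X_sub_C _)).mul
        (Polynomial.Splits.X_sub_C _)).mul (Polynomial.Splits.X_sub_C _)
    · rw [eq_top_iff, ← hgen]
      apply Algebra.adjoin_mono
      rintro _ ⟨i, rfl⟩
      rw [Polynomial.mem_rootSet]
      refine ⟨hp0, ?_⟩
      rw [Polynomial.aeval_def, ← Polynomial.eval_map, hmap]
      fin_cases i <;> simp
  exact (Polynomial.IsSplittingField.algEquiv K p).toLinearEquiv.finrank_eq.symm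

theorem hasType_psi [Finite F] {ε a b : F} {s : K} (hs : s ^ 2 = algebraMap F K ε)
    (hK : Module.finrank F K = 2) (hp : PsiData ε a b) : HasType (ofCoeffs (psiV ε a b)) .F4' := by
  refine ⟨numLinearFactors_eq_zero hp.not_hasRoot, ?_⟩
  rw [splittingDegree_ofCoeffs (K := K) (by simp)
    (r := ![s, -s, algebraMap F K a + algebraMap F K b * s,
      algebraMap F K a - algebraMap F K b * s]), hK]
  · intro y
    simp only [psiV, Matrix.cons_val, map_mul, map_add, map_sub, map_pow, map_neg, ← hs,
      map_ofNat (algebraMap F K), map_ofNat Polynomial.C, Matrix.cons_val_zero,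
      Matrix.cons_val_one]
    ring
  · rw [eq_top_iff]
    intro x _
    obtain ⟨u, v, rfl⟩ := exists_eq_add_mul_root hp.nonsquare hs hK x
    exact add_mem (Subalgebra.algebraMap_mem _ _) (mul_mem (Subalgebra.algebraMap_mem _ _)
      (Algebra.subset_adjoin ⟨0, rfl⟩))

theorem row_psi [Finite F] (h2 : (2 : F) ≠ 0) (h3 : (3 : F) ≠ 0) {ε a b : F} {s : K}
    (hs : s ^ 2 = algebraMap F K ε) (hK : Module.finrank F K = 2) (hp : PsiData ε a b) {l : F}
    (hl : l * (a ^ 2 - (b + 1) ^ 2 * ε) = a ^ 2 - (b - 1) ^ 2 * ε) :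
    (l = -1 → Row (ofCoeffs (psiV ε a b)) (jLambda l) .F4' (DihedralGroup 4)) ∧
    (l ≠ -1 → Row (ofCoeffs (psiV ε a b)) (jLambda l) .F4' (Cyc 2 × Cyc 2)) := by
  constructor
  · rintro rfl
    refine row_ofCoeffs h2 h3 (psi_ne_zero _ _ _) (hp.coeffDisc_ne h2 h3) (hp.j_eq h2 h3 hl)
      (hasType_psi hs hK hp) (hp.stabilizer_dihedral h2 hs ?_)
    apply mul_left_cancel₀ h2
    linear_combination -hl
  · intro h
    refine row_ofCoeffs h2 h3 (psi_ne_zero _ _ _) (hp.coeffDisc_ne h2 h3) (hp.j_eq h2 h3 hl)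
      (hasType_psi hs hK hp) (hp.stabilizer_klein h2 hs fun hN => h ?_)
    apply mul_left_cancel₀ hp.plus_ne
    linear_combination hl + 2 * hN

theorem jLambda_inv (l : F) : jLambda l⁻¹ = jLambda l := by
  by_cases h0 : l = 0
  · simp [h0]
  by_cases h1 : l = 1
  · simp [h1]
  have h1' : l - 1 ≠ 0 := sub_ne_zero.mpr h1
  have h1'' : 1 - l ≠ 0 := sub_ne_zero.mpr (Ne.symm h1)
  have e : l⁻¹ - 1 = (1 - l) / l := by field_simp
  rw [jLambda, jLambda, e]
  field_simp
  ring

/-- The invariant `N((α - √ε)/(α + √ε))` of an element `α = a + b√ε`. -/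
theorem norm_ratio {ε : F} {s : K} (hε : ¬ IsSquare ε) (hs : s ^ 2 = algebraMap F K ε)
    (hK : Module.finrank F K = 2) {a b : F}
    (h : algebraMap F K a + algebraMap F K b * s + s ≠ 0) :
    Algebra.norm F ((algebraMap F K a + algebraMap F K b * s - s) /
        (algebraMap F K a + algebraMap F K b * s + s)) * (a ^ 2 - (b + 1) ^ 2 * ε) =
      a ^ 2 - (b - 1) ^ 2 * ε := by
  have e1 : algebraMap F K a + algebraMap F K b * s + s =
      algebraMap F K a + algebraMap F K (b + 1) * s := by
    rw [map_add, map_one]; ring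
  have e2 : algebraMap F K a + algebraMap F K b * s - s =
      algebraMap F K a + algebraMap F K (b - 1) * s := by
    rw [map_sub, map_one]; ring
  rw [← norm_add_mul_root hε hs hK, ← norm_add_mul_root hε hs hK, ← map_mul, ← e1, ← e2,
    div_mul_cancel₀ _ h]

theorem psiData_of_notMem {ε : F} {s : K} (hε : ¬ IsSquare ε)
    {a b : F} (h1 : algebraMap F K a + algebraMap F K b * s ∉ Set.range (algebraMap F K))
    (h2 : algebraMap F K a + algebraMap F K b * s ≠ s)
    (h3 : algebraMap F K a + algebraMap F K b * s ≠ -s) : PsiData ε a b := by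
  refine ⟨hε, ?_, ?_, ?_⟩
  · rintro rfl
    exact h1 ⟨a, by simp⟩
  · intro h
    obtain ⟨hb, ha⟩ := eq_zero_of_sq_eq_mul_sq hε (show a ^ 2 = ε * (b - 1) ^ 2 by
      linear_combination h)
    apply h2
    rw [ha, sub_eq_zero.mp hb]
    simp
  · intro h
    obtain ⟨hb, ha⟩ := eq_zero_of_sq_eq_mul_sq hε (show a ^ 2 = ε * (b + 1) ^ 2 by
      linear_combination h)
    apply h3
    rw [ha, eq_neg_of_add_eq_zero_left hb]
    simp

namespace Choices

/-- The chosen α realizes l or its inverse; `l'` is the value actually attained, and the statements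
that follow are invariant under inversion. -/
theorem psi_eq (c : Choices F K) (hK : Module.finrank F K = 2) {l : F} (h0 : l ≠ 0) (h1 : l ≠ 1) :
    ∃ a b l' : F, PsiData c.ε a b ∧ c.psi l = ofCoeffs (psiV c.ε a b) ∧
      (l' = l ∨ l' = l⁻¹) ∧ l' * (a ^ 2 - (b + 1) ^ 2 * c.ε) = a ^ 2 - (b - 1) ^ 2 * c.ε := by
  obtain ⟨m1, m2, m3⟩ := c.α_mem l h0 h1
  have hn := c.α_spec l h0 h1
  obtain ⟨a, b, e⟩ := exists_eq_add_mul_root c.ε_nonsquare c.rootε_sq hK (c.α l)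
  rw [psi, e]
  rw [e] at m1 m2 m3 hn
  refine ⟨a, b, _, psiData_of_notMem c.ε_nonsquare m1 m2 m3,
    formPsi_eq c.ε_nonsquare c.rootε_sq hK a b, hn,
    norm_ratio c.ε_nonsquare c.rootε_sq hK fun h => m3 (eq_neg_of_add_eq_zero_left h)⟩

theorem row_psi [Finite F] (h2 : (2 : F) ≠ 0) (h3 : (3 : F) ≠ 0) (c : Choices F K)
    (hK : Module.finrank F K = 2) {l : F} (h0 : l ≠ 0) (h1 : l ≠ 1) :
    (l = -1 → Row (c.psi l) (jLambda l) .F4' (DihedralGroup 4)) ∧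
    (l ≠ -1 → Row (c.psi l) (jLambda l) .F4' (Cyc 2 × Cyc 2)) := by
  obtain ⟨a, b, l', hp, e, hl, hl'⟩ := c.psi_eq hK h0 h1
  have hj : jLambda l' = jLambda l := by
    rcases hl with rfl | rfl
    · rfl
    · exact jLambda_inv l
  have hl1 : l' = -1 ↔ l = -1 := by
    rcases hl with rfl | rfl
    · rfl
    · rw [inv_eq_iff_eq_inv, inv_neg, inv_one]
  rw [e, ← hj, Ne, ← hl1]
  exact BinaryQuartic.row_psi h2 h3 c.rootε_sq hK hp hl'

/-- The forms `ψ'` for different classes `{λ, λ⁻¹}` are inequivalent, and have no root. -/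
theorem psi_inequivalent (h2 : (2 : F) ≠ 0) (c : Choices F K)
    (hK : Module.finrank F K = 2) {l m : F} (hl0 : l ≠ 0) (hl1 : l ≠ 1) (hm0 : m ≠ 0) (hm1 : m ≠ 1)
    {P Q : ProjQuartic F} (hP : IsClass (c.psi l) P) (hQ : IsClass (c.psi m) Q) (h : Q ∈ orb P) :
    m = l ∨ m * l = 1 := by
  obtain ⟨a, b, l', hp, e, hl, hl'⟩ := c.psi_eq hK hl0 hl1
  obtain ⟨a', b', m', hp', e', hm, hm'⟩ := c.psi_eq hK hm0 hm1
  rw [e] at hP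
  rw [e'] at hQ
  obtain ⟨hv, rfl⟩ := isClass_ofCoeffs_iff.mp hP
  obtain ⟨hw, rfl⟩ := isClass_ofCoeffs_iff.mp hQ
  obtain ⟨A, B, C, D, hd, hc⟩ := mem_orb_point_iff.mp h
  have := PsiData.param_eq_of_carries h2 c.rootε_sq hp hp' hd hc hl' hm'
  rcases hl with rfl | rfl <;> rcases hm with rfl | rfl
  · exact this
  · rcases this with h | h
    · right; rw [← h]; field_simp
    · left; field_simp at h; exact h.symm
  · rcases this with h | h
    · right; rw [h]; field_simp
    · left; field_simp at h; exact h
  · rcases this with h | h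
    · left; exact inv_injective h
    · right; rw [← mul_inv, inv_eq_one] at h; exact h

end Choices

end

end BinaryQuartic

end

noncomputable section

namespace BinaryQuartic

open MvPolynomial

/-! ### The forms `υ'` -/

section

variable {F : Type*} [Field F]

/-- The coefficients of `(Y² - s²DX²)² - TX²(Y² + s²DX²) + 2sDX³Y + n²DX⁴`. -/
abbrev upsV (D n s T : F) : Fin 5 → F :=
  ![1, 0, -(2 * s ^ 2 * D + T), 2 * s * D, s ^ 4 * D ^ 2 - T * s ^ 2 * D + n ^ 2 * D]

theorem ups_ne_zero (D n s T : F) : upsV D n s T ≠ 0 := fun h => by simpa using congrFun h 0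

/-- The conditions under which `upsV D n s T` is an irreducible form. -/
structure UpsData (D n s T : F) : Prop where
  nonsquare : ¬ IsSquare D
  n_ne : n ≠ 0
  rel : T ^ 2 = D * (1 + 4 * n ^ 2)

/-- The hypothesis `T = 4s²D` means that the cross-ratio is -1; this matrix is then a generator of
the stabilizer, cyclic of order four. -/
theorem act_ups_rotation {D n s T : F} (hT : T = 4 * s ^ 2 * D)
    (h : 16 * s ^ 4 * D = 1 + 4 * n ^ 2) :
    act (-(1 + 2 * n)) (4 * s) (-(4 * s * (s ^ 2 * D))) (1 - 2 * n) (upsV D n s T) =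
      (-(64 * n ^ 4)) • upsV D n s T := by
  subst hT
  funext i
  fin_cases i <;> simp [act, upsV] <;> grind

/-- With δ² = D, this is the involution exchanging the two roots -sδ ± ρ of one quadratic factor,
where 2ρ² = T + δ. It exists for every cross-ratio. -/
theorem act_ups_involution {D n s T : F} (h : T ^ 2 = D * (1 + 4 * n ^ 2)) :
    act 1 (-4 * s) (-4 * s * (s ^ 2 * D) + 2 * s * T) (-1) (upsV D n s T) =
      (16 * s ^ 4 * D - 8 * s ^ 2 * T + 1) ^ 2 • upsV D n s T := by
  funext i
  fin_cases i <;> simp [act, upsV] <;> grind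

namespace UpsData

variable {D n s T : F}

theorem D_ne (h : UpsData D n s T) : D ≠ 0 := by
  rintro rfl
  exact h.nonsquare IsSquare.zero

theorem neg (h : UpsData D n s T) : UpsData D (-n) s T :=
  ⟨h.nonsquare, neg_ne_zero.mpr h.n_ne, by rw [h.rel]; ring⟩

/-- The conditions on a matrix `(a b; c d)` that maps one root of `υ'` to a Galois conjugate over
the subfield of degree two. -/
def IsQuarter (D n s T a b c d : F) : Prop :=
  c = -b * s ^ 2 * D ∧ n * b = -s * (a + d) ∧ 2 * n * d = -a - T * b * s ∧
    a * T = -b * s * D * (1 + 2 * n)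

/-- A transformation preserving υ' and moving a root into the other quadratic factor exists only for
cross-ratio -1. The conditions of `IsQuarter` are linear in the matrix entries, and elimination
leaves `T = 4s²D`. -/
theorem isQuarter_degenerate (h2 : (2 : F) ≠ 0) (hu : UpsData D n s T) {a b c d : F}
    (hd : a * d - b * c ≠ 0) (h : IsQuarter D n s T a b c d) : T = 4 * s ^ 2 * D := by
  obtain ⟨e1, e2, e3, e4⟩ := h
  have hD := hu.D_ne
  have hn := hu.n_ne
  have hrel := hu.rel
  have f1 : T * d = b * s * D * (1 - 2 * n) := by
    apply mul_left_cancel₀ (mul_ne_zero h2 hn)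
    linear_combination T * e3 - e4 - b * s * hrel
  have f2 : d = T * b * s + 2 * n * a := by
    apply mul_left_cancel₀ hD
    linear_combination -d * hrel + T * f1 - 2 * n * D * e3
  by_cases hb : b = 0
  · subst hb
    have ha : a ≠ 0 := by
      rintro rfl
      simp at hd
    have hT : T = 0 := by
      apply mul_left_cancel₀ ha
      linear_combination e4
    subst hT
    have h1 : 1 + 4 * n ^ 2 = 0 := by
      apply mul_left_cancel₀ hD
      linear_combination -hrel
    have h2n : 1 + 2 * n ≠ 0 := by
      intro h
      apply h2
      linear_combination h1 + (1 - 2 * n) * h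
    have hs : s = 0 := by
      apply mul_left_cancel₀ (mul_ne_zero ha h2n)
      linear_combination e2 - s * f2
    rw [hs]
    ring
  · apply mul_left_cancel₀ (mul_ne_zero hb hn)
    linear_combination T * e2 - s * T * f2 - s * (1 + 2 * n) * e4 - s ^ 2 * b * hrel

/-- This is the factor of the discriminant coming from roots in different quadratic factors. It is a
norm from F(√D) whose √D-coordinate 2n does not vanish; in characteristic two `rel` would make D a
square. -/
theorem neg_pos_ne (hu : UpsData D n s T) : (4 * s ^ 2 * D - T) ^ 2 - 4 * n ^ 2 * D ≠ 0 := by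
  intro h
  have := eq_zero_of_sq_eq_mul_sq hu.nonsquare (show (4 * s ^ 2 * D - T) ^ 2 = D * (2 * n) ^ 2 by
    linear_combination h)
  have h2n := this.1
  have hT := this.2
  have hn := hu.n_ne
  by_cases h2 : (2 : F) = 0
  · exact hu.nonsquare ⟨T, by
      have := hu.rel
      rw [show (4 : F) = 2 * 2 by norm_num, h2] at this
      linear_combination -this⟩
  · exact mul_ne_zero h2 hn h2n

theorem det_involution (hu : UpsData D n s T) :
    (1 : F) * -1 - -4 * s * (-4 * s * (s ^ 2 * D) + 2 * s * T) ≠ 0 := by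
  have hD := hu.D_ne
  have := hu.neg_pos_ne
  contrapose! this
  have hrel := hu.rel
  grind

theorem det_rotation (hu : UpsData D n s T) (h2 : (2 : F) ≠ 0)
    (h : 16 * s ^ 4 * D = 1 + 4 * n ^ 2) :
    -(1 + 2 * n) * (1 - 2 * n) - 4 * s * (-(4 * s * (s ^ 2 * D))) ≠ 0 := by
  rw [show -(1 + 2 * n) * (1 - 2 * n) - 4 * s * (-(4 * s * (s ^ 2 * D))) = 2 * 2 * 2 * n ^ 2 by
    linear_combination h]
  have := hu.n_ne
  positivity

theorem pgl_eq_rotation (h2 : (2 : F) ≠ 0) (hu : UpsData D n s T) (hT : T = 4 * s ^ 2 * D)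
    (hr : 16 * s ^ 4 * D = 1 + 4 * n ^ 2) {a b c d : F}
    (hd : a * d - b * c ≠ 0) (h : IsQuarter D n s T a b c d) :
    pgl a b c d hd = pgl _ _ _ _ (hu.det_rotation h2 hr) := by
  obtain ⟨e1, e2, e3, e4⟩ := h
  have hD := hu.D_ne
  have hn := hu.n_ne
  rw [pgl_eq_pgl_iff]
  -- If `s = 0`, then `b = c = 0` and the ratio of a and d comes from the third equation. Otherwise
  -- b is nonzero and the matrix is normalized by `b = 4s`.
  by_cases hs : s = 0
  · subst hs
    have hb : b = 0 := by
      apply mul_left_cancel₀ hn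
      linear_combination e2
    subst hb
    have ha : a ≠ 0 := by
      rintro rfl
      simp at hd
    have h2n : 1 + 2 * n ≠ 0 := by
      intro h
      apply h2
      linear_combination -hr + (1 - 2 * n) * h
    refine ⟨-(1 + 2 * n) / a, div_ne_zero (neg_ne_zero.mpr h2n) ha, ?_, ?_, ?_, ?_⟩
    · field_simp
    · ring
    · rw [e1]; ring
    · rw [div_mul_eq_mul_div, eq_div_iff ha]
      linear_combination (1 - 2 * n) * e3 - d * hr
  · have f1 : 4 * s * a = -b * (1 + 2 * n) := by
      apply mul_left_cancel₀ (mul_ne_zero hs hD)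
      rw [hT] at e4
      linear_combination e4
    have hb : b ≠ 0 := by
      rintro rfl
      have : a = 0 := by
        apply mul_left_cancel₀ hs
        apply mul_left_cancel₀ (mul_ne_zero h2 h2)
        linear_combination f1
      rw [this] at hd
      simp at hd
    have h4 : (4 : F) * s ≠ 0 := by
      rw [show (4 : F) = 2 * 2 by norm_num]; positivity
    refine ⟨4 * s / b, div_ne_zero h4 hb, ?_, ?_, ?_, ?_⟩
    all_goals rw [div_mul_eq_mul_div, eq_div_iff hb]
    · linear_combination -f1
    · rw [e1]; ring
    · linear_combination f1 - 4 * e2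

end UpsData

end

end BinaryQuartic

end

noncomputable section

namespace BinaryQuartic

open MvPolynomial

/-! ### The tower of quadratic extensions that splits υ' -/

section

variable {F K L : Type*} [Field F] [Field K] [Field L] [Algebra F K] [Algebra F L] [Algebra K L]
  [IsScalarTower F K L]

namespace UpsData

variable {D n s T : F}

/-- A tower of quadratic extensions that splits a form `υ'`: `δ² = D` and `2ρ² = T + δ`. -/
structure Tower (D n s T : F) (K L : Type*) [Field K] [Field L] [Algebra F K] [Algebra F L]
    [Algebra K L] where
  δ : K
  δ_sq : δ ^ 2 = algebraMap F K D
  ρ : L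
  ρ_sq : ρ ^ 2 = algebraMap K L ((algebraMap F K T + δ) / 2)

/-- The norm of (T + δ)/2 is (T² - D)/4 = n²D, a nonsquare of F, whereas the norm of a square is a
square. So ρ generates a proper quadratic extension of K. -/
theorem nonsquare_half (h2 : (2 : F) ≠ 0) (hu : UpsData D n s T) (hK : Module.finrank F K = 2)
    {δ : K} (hδ : δ ^ 2 = algebraMap F K D) : ¬ IsSquare ((algebraMap F K T + δ) / 2) := by
  rintro ⟨x, hx⟩
  have e : (algebraMap F K T + δ) / 2 = algebraMap F K (T / 2) + algebraMap F K (1 / 2) * δ := by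
    simp [map_ofNat (algebraMap F K)]
    ring
  have hn := congrArg (Algebra.norm F) hx
  rw [e, norm_add_mul_root hu.nonsquare hδ hK, map_mul] at hn
  have h1 : n ^ 2 * D = Algebra.norm F x ^ 2 := by
    rw [pow_two (Algebra.norm F x), ← hn]
    field_simp
    linear_combination -hu.rel
  have := eq_zero_of_sq_eq_mul_sq hu.nonsquare
    (show (Algebra.norm F x) ^ 2 = D * n ^ 2 by linear_combination -h1)
  exact hu.n_ne this.1

variable (t : Tower D n s T K L)

/-- The elements 1, δ, ρ, δρ are linearly independent over F, by two applications of the quadratic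
case. One equation in L thus becomes four in F. -/
theorem eq_zero_of_coordinates (h2 : (2 : F) ≠ 0) (hu : UpsData D n s T)
    (hK : Module.finrank F K = 2) {x₀ x₁ y₀ y₁ : F}
    (h : algebraMap F L x₀ + algebraMap F L x₁ * algebraMap K L t.δ +
      (algebraMap F L y₀ + algebraMap F L y₁ * algebraMap K L t.δ) * t.ρ = 0) :
    x₀ = 0 ∧ x₁ = 0 ∧ y₀ = 0 ∧ y₁ = 0 := by
  have e : algebraMap K L (algebraMap F K x₀ + algebraMap F K x₁ * t.δ) +
      algebraMap K L (algebraMap F K y₀ + algebraMap F K y₁ * t.δ) * t.ρ = 0 := by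
    simp only [map_add, map_mul, ← IsScalarTower.algebraMap_apply]
    exact h
  obtain ⟨h3, h4⟩ := eq_zero_of_add_mul_root (hu.nonsquare_half h2 hK t.δ_sq) t.ρ_sq e
  have h3' := eq_zero_of_add_mul_root hu.nonsquare t.δ_sq h3
  have h4' := eq_zero_of_add_mul_root hu.nonsquare t.δ_sq h4
  exact ⟨h3'.1, h3'.2, h4'.1, h4'.2⟩

theorem Tower.delta_sq : (algebraMap K L t.δ) ^ 2 = algebraMap F L D := by
  rw [← map_pow, t.δ_sq, ← IsScalarTower.algebraMap_apply]

theorem Tower.two_mul_rho_sq (h2 : (2 : F) ≠ 0) :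
    2 * t.ρ ^ 2 = algebraMap F L T + algebraMap K L t.δ := by
  have : (2 : L) ≠ 0 := by
    rw [← map_ofNat (algebraMap F L)]
    exact (map_ne_zero _).mpr h2
  rw [t.ρ_sq]
  simp only [map_div₀, map_add, ← IsScalarTower.algebraMap_apply, map_ofNat]
  field_simp

/-- The element `κ` for which `κρ` is a square root of the conjugate of `ρ²`. -/
def Tower.κ : L := (algebraMap F L T * algebraMap K L t.δ - algebraMap F L D) /
  (2 * algebraMap F L n * algebraMap F L D)

theorem Tower.kappa_mul (h2 : (2 : F) ≠ 0) (hu : UpsData D n s T) :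
    2 * algebraMap F L n * algebraMap F L D * t.κ =
      algebraMap F L T * algebraMap K L t.δ - algebraMap F L D := by
  have : 2 * algebraMap F L n * algebraMap F L D ≠ 0 := by
    rw [← map_ofNat (algebraMap F L), ← map_mul, ← map_mul]
    exact (map_ne_zero _).mpr (mul_ne_zero (mul_ne_zero h2 hu.n_ne) hu.D_ne)
  rw [Tower.κ, mul_div_cancel₀ _ this]

/-- The norm of ρ² to F is n²D = (nδ)², so nδ/ρ is a square root of the conjugate (T - δ)/2. It is
written as κρ, where κ lies in the image of K. -/
theorem Tower.kappa_mul_rho_sq (h2 : (2 : F) ≠ 0) (hu : UpsData D n s T) :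
    t.κ * t.ρ ^ 2 = algebraMap F L n * algebraMap K L t.δ := by
  have h := t.kappa_mul h2 hu
  have hρ := t.two_mul_rho_sq h2
  have hδ := t.delta_sq
  have hr := congrArg (algebraMap F L) hu.rel
  simp only [map_mul, map_pow, map_add, map_one, map_ofNat] at hr
  have : (2 * 2 : L) * algebraMap F L n * algebraMap F L D ≠ 0 := by
    rw [← map_ofNat (algebraMap F L), ← map_mul, ← map_mul, ← map_mul]
    exact (map_ne_zero _).mpr (mul_ne_zero (mul_ne_zero (mul_ne_zero h2 h2) hu.n_ne) hu.D_ne)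
  apply mul_left_cancel₀ this
  linear_combination (2 * t.ρ ^ 2) * h + (algebraMap F L T * algebraMap K L t.δ -
    algebraMap F L D) * hρ + algebraMap F L T * hδ + algebraMap K L t.δ * hr

theorem Tower.two_mul_kappa_sq_mul_rho_sq (h2 : (2 : F) ≠ 0) (hu : UpsData D n s T) :
    2 * t.κ ^ 2 * t.ρ ^ 2 = algebraMap F L T - algebraMap K L t.δ := by
  have h := t.kappa_mul h2 hu
  have hρ := t.kappa_mul_rho_sq h2 hu
  have hδ := t.delta_sq
  have : algebraMap F L D ≠ 0 := (map_ne_zero _).mpr hu.D_ne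
  apply mul_left_cancel₀ this
  linear_combination 2 * algebraMap F L D * t.κ * hρ + algebraMap K L t.δ * h +
    algebraMap F L T * hδ

/-- The roots of the form in the tower. -/
def Tower.root : Fin 4 → L :=
  ![t.ρ - algebraMap F L s * algebraMap K L t.δ, -t.ρ - algebraMap F L s * algebraMap K L t.δ,
    algebraMap F L s * algebraMap K L t.δ + t.κ * t.ρ,
    algebraMap F L s * algebraMap K L t.δ - t.κ * t.ρ]

/-- Over K the form is ((Y + sδX)² - ((T + δ)/2)X²)((Y - sδX)² - ((T - δ)/2)X²), and the two factors
split by ±ρ and ±κρ. The ring R is arbitrary so that the identity serves both for values in L and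
for polynomials over L. -/
theorem Tower.product_eq {R : Type*} [CommRing R] [Algebra L R] (h2 : (2 : F) ≠ 0)
    (hu : UpsData D n s T) (x y : R) :
    y ^ 4 + algebraMap L R (algebraMap F L (-(2 * s ^ 2 * D + T))) * y ^ 2 * x ^ 2 +
      algebraMap L R (algebraMap F L (2 * s * D)) * y * x ^ 3 +
      algebraMap L R (algebraMap F L (s ^ 4 * D ^ 2 - T * s ^ 2 * D + n ^ 2 * D)) * x ^ 4 =
      (y - algebraMap L R (t.root 0) * x) * (y - algebraMap L R (t.root 1) * x) *
      (y - algebraMap L R (t.root 2) * x) * (y - algebraMap L R (t.root 3) * x) := by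
  have h20 : (2 : L) ≠ 0 := by
    rw [← map_ofNat (algebraMap F L)]
    exact (map_ne_zero _).mpr h2
  have hh : algebraMap L R 2⁻¹ * 2 = 1 := by
    rw [← map_ofNat (algebraMap L R), ← map_mul, inv_mul_cancel₀ h20, map_one]
  have hρ := congrArg (algebraMap L R) (t.two_mul_rho_sq h2)
  have hκ := congrArg (algebraMap L R) (t.two_mul_kappa_sq_mul_rho_sq h2 hu)
  have hδ := congrArg (algebraMap L R) t.delta_sq
  have hr := congrArg (algebraMap L R) (congrArg (algebraMap F L) hu.rel)
  simp only [Tower.root, Matrix.cons_val_zero, Matrix.cons_val_one, Matrix.cons_val, map_mul,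
    map_pow, map_add, map_sub, map_neg, map_one, map_ofNat] at hρ hκ hδ hr ⊢
  generalize algebraMap L R (algebraMap F L s) = s at *
  generalize algebraMap L R (algebraMap F L n) = n at *
  generalize algebraMap L R (algebraMap F L D) = D at *
  generalize algebraMap L R (algebraMap F L T) = T at *
  generalize algebraMap L R (algebraMap K L t.δ) = δ at *
  generalize algebraMap L R t.ρ = ρ at *
  generalize algebraMap L R t.κ = κ at *
  generalize algebraMap L R 2⁻¹ = h at *
  rw [← hδ] at hr ⊢
  have hρ' : ρ ^ 2 = h * (T + δ) := by linear_combination h * hρ - ρ ^ 2 * hh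
  have hκ' : κ ^ 2 * ρ ^ 2 = h * (T - δ) := by
    linear_combination h * hκ - κ ^ 2 * ρ ^ 2 * hh
  have e : (y - (ρ - s * δ) * x) * (y - (-ρ - s * δ) * x) * (y - (s * δ + κ * ρ) * x) *
      (y - (s * δ - κ * ρ) * x) = ((y + s * δ * x) ^ 2 - h * (T + δ) * x ^ 2) *
      ((y - s * δ * x) ^ 2 - h * (T - δ) * x ^ 2) := by
    rw [← hρ', ← hκ']
    ring
  rw [e]
  linear_combination hh * (T * x ^ 2 * y ^ 2 - 2 * s * δ ^ 2 * y * x ^ 3 +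
    T * s ^ 2 * δ ^ 2 * x ^ 4 - n ^ 2 * δ ^ 2 * (1 + 2 * h) * x ^ 4) - h ^ 2 * x ^ 4 * hr

theorem Tower.value_eq (h2 : (2 : F) ≠ 0) (hu : UpsData D n s T) (x y : L) :
    value (upsV D n s T) x y = (y - t.root 0 * x) * (y - t.root 1 * x) * (y - t.root 2 * x) *
      (y - t.root 3 * x) := by
  have := t.product_eq h2 hu x y
  simp only [Algebra.algebraMap_self, RingHom.id_apply] at this
  rw [← this]
  simp [value, upsV]

/-- In each factor y - root·x, after multiplication by 2nD where κ occurs, the coordinate at ρ is a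
nonzero multiple of x. Hence x = 0, and the leading coefficient 1 gives y = 0. -/
theorem not_hasRoot (t : Tower D n s T K L) (h2 : (2 : F) ≠ 0) (hu : UpsData D n s T)
    (hK : Module.finrank F K = 2) : ¬ HasRoot (upsV D n s T) := by
  rintro ⟨x, y, hxy, e⟩
  have e' : value (upsV D n s T) (algebraMap F L x) (algebraMap F L y) = 0 := by
    have := congrArg (algebraMap F L) e
    rw [map_zero] at this
    rw [← this]
    simp [value]
  have hD := hu.D_ne
  have hn := hu.n_ne
  have hκ := t.kappa_mul h2 hu
  have hδ := t.delta_sq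
  have h2D : (2 : F) * n * D ≠ 0 := by positivity
  have hx : x = 0 := by
    rw [t.value_eq h2 hu, mul_eq_zero, mul_eq_zero, mul_eq_zero] at e'
    simp only [Tower.root, Matrix.cons_val_zero, Matrix.cons_val_one, Matrix.cons_val] at e'
    rcases e' with ((e' | e') | e') | e'
    · obtain ⟨-, -, h, -⟩ := eq_zero_of_coordinates (x₀ := y) (x₁ := s * x) (y₀ := -x) (y₁ := 0)
        t h2 hu hK (by simp only [map_mul, map_neg, map_zero]; linear_combination e')
      exact neg_eq_zero.mp h
    · exact (eq_zero_of_coordinates (x₀ := y) (x₁ := s * x) (y₀ := x) (y₁ := 0)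
        t h2 hu hK (by simp only [map_mul, map_zero]; linear_combination e')).2.2.1
    · obtain ⟨-, -, h, -⟩ := eq_zero_of_coordinates (x₀ := 2 * n * D * y)
        (x₁ := -(2 * n * D * s * x)) (y₀ := D * x) (y₁ := -T * x) t h2 hu hK (by
          simp only [map_mul, map_neg, map_ofNat]
          linear_combination 2 * algebraMap F L n * algebraMap F L D * e' +
            algebraMap F L x * t.ρ * hκ)
      exact (mul_eq_zero.mp h).resolve_left hD
    · obtain ⟨-, -, h, -⟩ := eq_zero_of_coordinates (x₀ := 2 * n * D * y)
        (x₁ := -(2 * n * D * s * x)) (y₀ := -D * x) (y₁ := T * x) t h2 hu hK (by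
          simp only [map_mul, map_neg, map_ofNat]
          linear_combination 2 * algebraMap F L n * algebraMap F L D * e' -
            algebraMap F L x * t.ρ * hκ)
      exact (mul_eq_zero.mp h).resolve_left (neg_ne_zero.mpr hD)
  subst hx
  have hy : y = 0 := by simpa [value] using e
  simp [hy] at hxy

/-- A transformation preserving `υ'` is determined by the image of one root. -/
theorem cases_of_carries (t : Tower D n s T K L) (h2 : (2 : F) ≠ 0) (hu : UpsData D n s T)
    (hK : Module.finrank F K = 2) {a b c d : F}
    (hc : Carries a b c d (upsV D n s T) (upsV D n s T)) :
    (b = 0 ∧ c = 0 ∧ a = d) ∨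
    (d = -a ∧ b = -4 * s * a ∧ c = a * (-4 * s * (s ^ 2 * D) + 2 * s * T)) ∨
    IsQuarter D n s T a b c d ∨ IsQuarter D (-n) s T a b c d := by
  have e := hc.value_eq_zero (x := 1) (y := t.root 0) (by rw [t.value_eq h2 hu]; ring)
  have hD := hu.D_ne
  have hn := hu.n_ne
  have hκ := t.kappa_mul h2 hu
  have hδ := t.delta_sq
  have hρ := t.two_mul_rho_sq h2
  have hκρ := t.kappa_mul_rho_sq h2 hu
  rw [t.value_eq h2 hu, mul_eq_zero, mul_eq_zero, mul_eq_zero] at e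
  simp only [Tower.root, Matrix.cons_val_zero, Matrix.cons_val_one, Matrix.cons_val] at e
  rcases e with ((e | e) | e) | e
  · obtain ⟨h1, h3, h4, -⟩ := eq_zero_of_coordinates (x₀ := 2 * c - b * T - 2 * b * s ^ 2 * D)
      (x₁ := 2 * (s * a - d * s) - b) (y₀ := 2 * (d - a)) (y₁ := 4 * b * s) t h2 hu hK (by
        simp only [map_mul, map_sub, map_pow, map_ofNat]
        linear_combination 2 * e + algebraMap F L b * hρ +
          2 * algebraMap F L b * algebraMap F L s ^ 2 * hδ)
    have hda : d - a = 0 := (mul_eq_zero.mp h4).resolve_left h2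
    have hb : b = 0 := by linear_combination -h3 - 2 * s * hda
    subst hb
    refine Or.inl ⟨rfl, ?_, by linear_combination -hda⟩
    apply mul_left_cancel₀ h2
    linear_combination h1
  · obtain ⟨h1, h3, h4, -⟩ := eq_zero_of_coordinates (x₀ := 2 * c + b * T - 2 * b * s ^ 2 * D)
      (x₁ := 2 * (s * a - d * s) + b) (y₀ := 2 * (d + a)) (y₁ := 0) t h2 hu hK (by
        simp only [map_mul, map_sub, map_add, map_pow, map_ofNat, map_zero]
        linear_combination 2 * e - algebraMap F L b * hρ +
          2 * algebraMap F L b * algebraMap F L s ^ 2 * hδ)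
    have hda : d + a = 0 := (mul_eq_zero.mp h4).resolve_left h2
    have hb : b = -4 * s * a := by linear_combination h3 + 2 * s * hda
    refine Or.inr (Or.inl ⟨by linear_combination hda, hb, ?_⟩)
    apply mul_left_cancel₀ h2
    linear_combination h1 + (2 * s ^ 2 * D - T) * hb
  · obtain ⟨h1, h3, h4, h5⟩ := eq_zero_of_coordinates
      -- The equation is multiplied by 2nD, the denominator of κ.
      (x₀ := 2 * n * D * c + 2 * n * D ^ 2 * s ^ 2 * b)
      (x₁ := -2 * n * D * d * s - 2 * n * D * s * a - 2 * n ^ 2 * D * b)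
      (y₀ := 2 * n * D * d + D * a + T * D * b * s)
      (y₁ := -2 * n * D * s * b - T * a - D * b * s) t h2 hu hK (by
        simp only [map_mul, map_sub, map_add, map_pow, map_ofNat, map_neg]
        linear_combination 2 * algebraMap F L n * algebraMap F L D * e + t.ρ * (algebraMap F L a -
          algebraMap F L b * algebraMap F L s * algebraMap K L t.δ) * hκ +
          2 * algebraMap F L n * algebraMap F L D * algebraMap F L b * hκρ -
          (2 * algebraMap F L n * algebraMap F L D * algebraMap F L s ^ 2 * algebraMap F L b +
            algebraMap F L T * algebraMap F L b * algebraMap F L s * t.ρ) * hδ)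
    refine Or.inr (Or.inr (Or.inl ⟨?_, ?_, ?_, ?_⟩))
    · apply mul_left_cancel₀ (mul_ne_zero (mul_ne_zero h2 hn) hD)
      linear_combination h1
    · apply mul_left_cancel₀ (mul_ne_zero (mul_ne_zero h2 hn) hD)
      linear_combination -h3
    · apply mul_left_cancel₀ hD
      linear_combination h4
    · linear_combination -h5
  · obtain ⟨h1, h3, h4, h5⟩ := eq_zero_of_coordinates
      (x₀ := 2 * n * D * c + 2 * n * D ^ 2 * s ^ 2 * b)
      (x₁ := -2 * n * D * d * s - 2 * n * D * s * a + 2 * n ^ 2 * D * b)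
      (y₀ := 2 * n * D * d - D * a - T * D * b * s)
      (y₁ := -2 * n * D * s * b + T * a + D * b * s) t h2 hu hK (by
        simp only [map_mul, map_sub, map_add, map_pow, map_ofNat, map_neg]
        linear_combination 2 * algebraMap F L n * algebraMap F L D * e - t.ρ * (algebraMap F L a -
          algebraMap F L b * algebraMap F L s * algebraMap K L t.δ) * hκ -
          2 * algebraMap F L n * algebraMap F L D * algebraMap F L b * hκρ -
          (2 * algebraMap F L n * algebraMap F L D * algebraMap F L s ^ 2 * algebraMap F L b -
            algebraMap F L T * algebraMap F L b * algebraMap F L s * t.ρ) * hδ)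
    refine Or.inr (Or.inr (Or.inr ⟨?_, ?_, ?_, ?_⟩))
    · apply mul_left_cancel₀ (mul_ne_zero (mul_ne_zero h2 hn) hD)
      linear_combination h1
    · apply mul_left_cancel₀ (mul_ne_zero (mul_ne_zero h2 hn) hD)
      linear_combination -h3
    · apply mul_left_cancel₀ hD
      linear_combination -h4
    · linear_combination h5

end UpsData

end

end BinaryQuartic

end

noncomputable section

namespace BinaryQuartic

open MvPolynomial

/-! ### Invariants, stabilizers and type of υ' -/

section

variable {F K L : Type*} [Field F] [Field K] [Field L] [Algebra F K] [Algebra F L] [Algebra K L]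
  [IsScalarTower F K L]

namespace UpsData

variable {D n s T : F}

/-- With E = 4s²D - T and m² = n²D, 36 I = E² + 12m² and Δ = (E² - 4m²)²m²/432, the latter by the
relation between T, D and n. These are the values for the cross-ratio (E + 2m)/(E - 2m), which lies
in K since m does. -/
theorem coeffI_eq (D n s T : F) :
    coeffI (upsV D n s T) = ((4 * s ^ 2 * D - T) ^ 2 + 12 * n ^ 2 * D) / 36 := by
  simp [coeffI, upsV]
  congr 1
  ring

theorem coeffDisc_eq (h2 : (2 : F) ≠ 0) (h3 : (3 : F) ≠ 0) {D n s T : F}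
    (h : T ^ 2 = D * (1 + 4 * n ^ 2)) :
    coeffDisc (upsV D n s T) =
      ((4 * s ^ 2 * D - T) ^ 2 - 4 * n ^ 2 * D) ^ 2 * (n ^ 2 * D) / 432 := by
  obtain ⟨-, -, -, -, h36, h432, -⟩ := ne_zero_of_two_three h2 h3
  have hJ : coeffJ (upsV D n s T) = (72 * (4 * s ^ 2 * D - T) * n ^ 2 * D -
    2 * (4 * s ^ 2 * D - T) ^ 3) / 432 := by
    simp only [coeffJ, upsV, Matrix.cons_val]
    congr 1
    linear_combination (108 * s ^ 2 * D) * h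
  rw [coeffDisc, coeffI_eq D n s T, hJ]
  field_simp
  ring

theorem coeffDisc_ne (h2 : (2 : F) ≠ 0) (h3 : (3 : F) ≠ 0) (hu : UpsData D n s T) :
    coeffDisc (upsV D n s T) ≠ 0 := by
  obtain ⟨-, -, -, -, h36, h432, -⟩ := ne_zero_of_two_three h2 h3
  rw [coeffDisc_eq h2 h3 hu.rel]
  have := hu.neg_pos_ne
  have := hu.n_ne
  have := hu.D_ne
  positivity

/-- The cross-ratio of the roots of `υ'`. -/
def IsCrossRatio (D n s T : F) (l : K) : Prop :=
  ∃ m : K, m ^ 2 = algebraMap F K (n ^ 2 * D) ∧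
    l * (algebraMap F K (4 * s ^ 2 * D - T) - 2 * m) = algebraMap F K (4 * s ^ 2 * D - T) + 2 * m

theorem IsCrossRatio.j_eq (h2 : (2 : F) ≠ 0) (h3 : (3 : F) ≠ 0) (hu : UpsData D n s T) {l : K}
    (hl : IsCrossRatio D n s T l) :
    algebraMap F K (1728 * coeffI (upsV D n s T) ^ 3 / coeffDisc (upsV D n s T)) = jLambda l := by
  obtain ⟨m, hm, e⟩ := hl
  have k2 : (2 : K) ≠ 0 := by
    rw [← map_ofNat (algebraMap F K)]; exact (map_ne_zero _).mpr h2
  have k3 : (3 : K) ≠ 0 := by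
    rw [← map_ofNat (algebraMap F K)]; exact (map_ne_zero _).mpr h3
  obtain ⟨h4, -, -, h16, h36, h432, -⟩ := ne_zero_of_two_three k2 k3
  have hD := congrArg (algebraMap F K) (coeffDisc_eq (s := s) h2 h3 hu.rel)
  have hI := congrArg (algebraMap F K) (coeffI_eq D n s T)
  have hne := (map_ne_zero (algebraMap F K)).mpr hu.neg_pos_ne
  have hm0 : m ≠ 0 := by
    rintro rfl
    have : algebraMap F K (n ^ 2 * D) ≠ 0 :=
      (map_ne_zero _).mpr (mul_ne_zero (pow_ne_zero 2 hu.n_ne) hu.D_ne)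
    exact this (by rw [← hm]; ring)
  rw [map_div₀, map_mul, map_pow, hD, hI]
  rw [show (4 * s ^ 2 * D - T) ^ 2 - 4 * n ^ 2 * D =
    (4 * s ^ 2 * D - T) ^ 2 - 4 * (n ^ 2 * D) by ring] at hne ⊢
  rw [show (4 * s ^ 2 * D - T) ^ 2 + 12 * n ^ 2 * D =
    (4 * s ^ 2 * D - T) ^ 2 + 12 * (n ^ 2 * D) by ring]
  clear hD hI
  generalize 4 * s ^ 2 * D - T = E at *
  generalize n ^ 2 * D = N at *
  simp only [map_div₀, map_mul, map_pow, map_add, map_sub, map_ofNat] at hne ⊢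
  rw [← hm] at hne ⊢
  generalize algebraMap F K E = E at *
  have hf : (E - 2 * m) * (E + 2 * m) ≠ 0 := by
    convert hne using 1; ring
  have hq := left_ne_zero_of_mul hf
  have hp := right_ne_zero_of_mul hf
  have hl : l = (E + 2 * m) / (E - 2 * m) := by rw [eq_div_iff hq]; exact e
  have hl1 : l - 1 = 4 * m / (E - 2 * m) := by
    rw [hl]; field_simp; ring
  have hl2 : l ^ 2 - l + 1 = (E ^ 2 + 12 * m ^ 2) / (E - 2 * m) ^ 2 := by
    rw [hl]; field_simp; ring
  rw [jLambda, hl1, hl2, hl]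
  rw [show E ^ 2 - 4 * m ^ 2 = (E - 2 * m) * (E + 2 * m) by ring]
  generalize E ^ 2 + 12 * m ^ 2 = A at *
  generalize E - 2 * m = Q at *
  generalize E + 2 * m = P at *
  field_simp
  ring

theorem rotation_rel (hu : UpsData D n s T) (hT : T = 4 * s ^ 2 * D) :
    16 * s ^ 4 * D = 1 + 4 * n ^ 2 := by
  apply mul_left_cancel₀ hu.D_ne
  rw [← hu.rel, hT]
  ring

theorem carries_rotation (h2 : (2 : F) ≠ 0) (hu : UpsData D n s T) (hT : T = 4 * s ^ 2 * D) :
    Carries (-(1 + 2 * n)) (4 * s) (-(4 * s * (s ^ 2 * D))) (1 - 2 * n) (upsV D n s T)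
      (upsV D n s T) := by
  refine ⟨_, ?_, act_ups_rotation hT (hu.rotation_rel hT)⟩
  rw [show (64 : F) = 2 ^ 6 by norm_num]
  have := hu.n_ne
  exact neg_ne_zero.mpr (by positivity)

theorem carries_involution (hu : UpsData D n s T) :
    Carries 1 (-4 * s) (-4 * s * (s ^ 2 * D) + 2 * s * T) (-1) (upsV D n s T)
      (upsV D n s T) := by
  refine ⟨_, ?_, act_ups_involution hu.rel⟩
  have := hu.det_involution
  apply pow_ne_zero
  contrapose! this
  linear_combination -this

/-- The involution in the stabilizer of `υ'`. -/
def invo (hu : UpsData D n s T) : Matrix.ProjGenLinGroup (Fin 2) F :=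
  pgl _ _ _ _ hu.det_involution

theorem pgl_eq_invo (hu : UpsData D n s T) {a b c d : F} (hd : a * d - b * c ≠ 0)
    (h : d = -a ∧ b = -4 * s * a ∧ c = a * (-4 * s * (s ^ 2 * D) + 2 * s * T)) :
    pgl a b c d hd = hu.invo := by
  obtain ⟨h1, h3, h4⟩ := h
  have ha : a ≠ 0 := by
    rintro rfl
    apply hd
    rw [h3, h4]
    ring
  rw [invo, pgl_eq_pgl_iff]
  refine ⟨a⁻¹, inv_ne_zero ha, ?_, ?_, ?_, ?_⟩
  · field_simp
  · rw [h3]; field_simp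
  · rw [h4]; field_simp
  · rw [h1]; field_simp

theorem stabilizer_two [Finite F] (t : Tower D n s T K L) (h2 : (2 : F) ≠ 0)
    (hu : UpsData D n s T) (hK : Module.finrank F K = 2) (hT : T ≠ 4 * s ^ 2 * D) :
    Nonempty (MulAction.stabilizer (Matrix.ProjGenLinGroup (Fin 2) F)
      (point _ (ups_ne_zero D n s T)) ≃* Cyc 2) := by
  have := finite_pgl (F := F)
  have hle : (MulAction.stabilizer (Matrix.ProjGenLinGroup (Fin 2) F)
      (point _ (ups_ne_zero D n s T)) : Set _) ⊆ {1, hu.invo} := by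
    intro g hg
    obtain ⟨a, b, c, d, h, rfl⟩ := exists_eq_pgl g
    rcases cases_of_carries t h2 hu hK (mem_stabilizer_point.mp hg) with h' | h' | h' | h'
    · exact Or.inl (pgl_eq_one_iff.mpr h')
    · exact Or.inr (hu.pgl_eq_invo h h')
    · exact absurd (hu.isQuarter_degenerate h2 h h') hT
    · exact absurd (hu.neg.isQuarter_degenerate h2 h h') hT
  have h1 := (Set.ncard_le_ncard hle).trans (ncard_pair_le _ _)
  rw [← Nat.card_coe_set_eq, SetLike.coe_sort_coe] at h1
  have : Nontrivial (MulAction.stabilizer (Matrix.ProjGenLinGroup (Fin 2) F)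
      (point _ (ups_ne_zero D n s T))) :=
    ⟨⟨_, (mem_stabilizer_point (h := hu.det_involution)).mpr hu.carries_involution⟩, 1, fun h => by
      have h2' := (pgl_eq_one_iff (h := hu.det_involution)).mp (congrArg Subtype.val h)
      apply h2
      linear_combination h2'.2.2⟩
  have := Finite.one_lt_card (α := MulAction.stabilizer (Matrix.ProjGenLinGroup (Fin 2) F)
      (point _ (ups_ne_zero D n s T)))
  exact nonempty_mulEquiv_cyc_prime (by omega)

/-- All four images of a root occur, each by one element, and the square of the quarter turn is the
involution. -/
theorem stabilizer_four [Finite F] (t : Tower D n s T K L) (h2 : (2 : F) ≠ 0)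
    (hu : UpsData D n s T) (hK : Module.finrank F K = 2) (hT : T = 4 * s ^ 2 * D) :
    Nonempty (MulAction.stabilizer (Matrix.ProjGenLinGroup (Fin 2) F)
      (point _ (ups_ne_zero D n s T)) ≃* Cyc 4) := by
  have := finite_pgl (F := F)
  have hr := hu.rotation_rel hT
  have hr' := hu.neg.rotation_rel hT
  have hle : (MulAction.stabilizer (Matrix.ProjGenLinGroup (Fin 2) F)
      (point _ (ups_ne_zero D n s T)) : Set _) ⊆ {1, hu.invo,
        pgl _ _ _ _ (hu.det_rotation h2 hr), pgl _ _ _ _ (hu.neg.det_rotation h2 hr')} := by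
    intro g hg
    obtain ⟨a, b, c, d, h, rfl⟩ := exists_eq_pgl g
    rcases cases_of_carries t h2 hu hK (mem_stabilizer_point.mp hg) with h' | h' | h' | h'
    · exact Or.inl (pgl_eq_one_iff.mpr h')
    · exact Or.inr (Or.inl (hu.pgl_eq_invo h h'))
    · exact Or.inr (Or.inr (Or.inl (hu.pgl_eq_rotation h2 hT hr h h')))
    · exact Or.inr (Or.inr (Or.inr (hu.neg.pgl_eq_rotation h2 hT hr' h h')))
  have h1 := (Set.ncard_le_ncard hle).trans (ncard_quadruple_le _ _ _ _)
  rw [← Nat.card_coe_set_eq, SetLike.coe_sort_coe] at h1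
  have hn4 : -4 * n ≠ 0 := by
    have := hu.n_ne
    rw [show -4 * n = -(2 * 2 * n) by ring]
    exact neg_ne_zero.mpr (by positivity)
  have hsq : pgl _ _ _ _ (hu.det_rotation h2 hr) ^ 2 = hu.invo := by
    rw [pow_two, invo, pgl_mul_pgl, eq_comm, pgl_eq_pgl_iff]
    refine ⟨4 * n, ?_, ?_, ?_, ?_, ?_⟩
    · simpa using hn4
    · linear_combination -hr
    · ring
    · rw [hT]; ring
    · linear_combination -hr
  have hii : hu.invo * hu.invo = 1 := by
    rw [invo, pgl_mul_pgl, pgl_eq_one_iff]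
    exact ⟨by ring, by ring, by ring⟩
  refine (nonempty_mulEquiv_cyc_four h1 (a := ⟨_, (mem_stabilizer_point
    (h := hu.det_rotation h2 hr)).mpr (hu.carries_rotation h2 hT)⟩) (Subtype.ext ?_)
    fun h => ?_).2
  · change pgl _ _ _ _ (hu.det_rotation h2 hr) ^ 4 = 1
    rw [show 4 = 2 * 2 by norm_num, pow_mul, hsq, pow_two, hii]
  · have e : pgl _ _ _ _ (hu.det_rotation h2 hr) ^ 2 = 1 := congrArg Subtype.val h
    rw [hsq, invo, pgl_eq_one_iff] at e
    apply h2
    linear_combination e.2.2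

/-- The roots generate L: half the difference of the first two is ρ, and 2ρ² - T is δ. -/
theorem hasType [Finite F] (t : Tower D n s T K L) (h2 : (2 : F) ≠ 0)
    (hu : UpsData D n s T) (hK : Module.finrank F K = 2) (hL : Module.finrank K L = 2) :
    HasType (ofCoeffs (upsV D n s T)) .F2' := by
  refine ⟨numLinearFactors_eq_zero (not_hasRoot t h2 hu hK), ?_⟩
  rw [splittingDegree_ofCoeffs (K := L) (by simp) (r := t.root),
    ← Module.finrank_mul_finrank F K L, hK, hL]
  · intro y
    have := t.product_eq h2 hu (1 : Polynomial L) y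
    simp only [one_pow, mul_one, Polynomial.algebraMap_apply, Algebra.algebraMap_self,
      RingHom.id_apply] at this
    rw [← this]
    simp [upsV]
  · have k2 : (2 : L) ≠ 0 := by
      rw [← map_ofNat (algebraMap F L)]; exact (map_ne_zero _).mpr h2
    set S := Algebra.adjoin F (Set.range t.root) with hS
    have h0 : t.root 0 ∈ S := Algebra.subset_adjoin ⟨0, rfl⟩
    have h1 : t.root 1 ∈ S := Algebra.subset_adjoin ⟨1, rfl⟩
    have hF : ∀ x : F, algebraMap F L x ∈ S := fun x => S.algebraMap_mem x
    have hρ : t.ρ ∈ S := by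
      have e : t.ρ = algebraMap F L 2⁻¹ * (t.root 0 - t.root 1) := by
        simp only [Tower.root, Matrix.cons_val_zero, Matrix.cons_val_one, map_inv₀, map_ofNat]
        field_simp
        ring
      rw [e]
      exact mul_mem (hF _) (sub_mem h0 h1)
    have hδ : algebraMap K L t.δ ∈ S := by
      have e : algebraMap K L t.δ = algebraMap F L 2 * t.ρ ^ 2 - algebraMap F L T := by
        rw [map_ofNat]
        linear_combination -t.two_mul_rho_sq h2
      rw [e]
      exact sub_mem (mul_mem (hF _) (pow_mem hρ 2)) (hF _)
    have hKS : ∀ x : K, algebraMap K L x ∈ S := by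
      intro x
      obtain ⟨u, v, rfl⟩ := exists_eq_add_mul_root hu.nonsquare t.δ_sq hK x
      rw [map_add, map_mul, ← IsScalarTower.algebraMap_apply, ← IsScalarTower.algebraMap_apply]
      exact add_mem (hF _) (mul_mem (hF _) hδ)
    rw [eq_top_iff]
    intro x _
    obtain ⟨u, v, rfl⟩ := exists_eq_add_mul_root (hu.nonsquare_half h2 hK t.δ_sq) t.ρ_sq hL x
    exact add_mem (hKS _) (mul_mem (hKS _) hρ)

end UpsData

/-- Every field has a quadratic extension containing a square root of a given nonsquare. -/
theorem exists_quadratic_extension.{u} {K : Type u} [Field K] {θ : K} (h : ¬ IsSquare θ) :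
    ∃ (L : Type u) (_ : Field L) (_ : Algebra K L) (ρ : L), ρ ^ 2 = algebraMap K L θ ∧
      Module.finrank K L = 2 := by
  have hirr : Irreducible (Polynomial.X ^ 2 - Polynomial.C θ) :=
    X_pow_sub_C_irreducible_of_prime Nat.prime_two fun b hb => h ⟨b, by rw [← hb, pow_two]⟩
  have := Fact.mk hirr
  refine ⟨AdjoinRoot (Polynomial.X ^ 2 - Polynomial.C θ), inferInstance, inferInstance,
    AdjoinRoot.root _, ?_, ?_⟩
  · have := AdjoinRoot.eval₂_root (Polynomial.X ^ 2 - Polynomial.C θ)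
    rw [Polynomial.eval₂_sub, Polynomial.eval₂_C, Polynomial.eval₂_X_pow, sub_eq_zero] at this
    exact this
  · rw [(AdjoinRoot.powerBasis hirr.ne_zero).finrank, AdjoinRoot.powerBasis_dim,
      Polynomial.natDegree_X_pow_sub_C]

theorem row_ups [Finite F] (h2 : (2 : F) ≠ 0) (h3 : (3 : F) ≠ 0) {D n s T : F}
    (hu : UpsData D n s T) (hK : Module.finrank F K = 2) {δ : K} (hδ : δ ^ 2 = algebraMap F K D)
    {l : K} (hl : UpsData.IsCrossRatio D n s T l) :
    ∃ r : F, algebraMap F K r = jLambda l ∧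
      (l = -1 → Row (ofCoeffs (upsV D n s T)) r .F2' (Cyc 4)) ∧
      (l ≠ -1 → Row (ofCoeffs (upsV D n s T)) r .F2' (Cyc 2)) := by
  obtain ⟨L, _, _, ρ, hρ, hL⟩ := exists_quadratic_extension (hu.nonsquare_half h2 hK hδ)
  let _ : Algebra F L := ((algebraMap K L).comp (algebraMap F K)).toAlgebra
  have : IsScalarTower F K L := IsScalarTower.of_algebraMap_eq' rfl
  let t : UpsData.Tower D n s T K L := ⟨δ, hδ, ρ, hρ⟩
  refine ⟨_, hl.j_eq h2 h3 hu, ?_, ?_⟩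
  · rintro rfl
    refine row_ofCoeffs h2 h3 (ups_ne_zero _ _ _ _) (hu.coeffDisc_ne h2 h3) rfl
      (UpsData.hasType t h2 hu hK hL) (UpsData.stabilizer_four t h2 hu hK ?_)
    -- For cross-ratio -1 the numerator and denominator E ± 2m are opposite, so E = 0, that is, `T =
    -- 4s²D`.
    obtain ⟨m, -, e⟩ := hl
    have : algebraMap F K (2 * (4 * s ^ 2 * D - T)) = 0 := by
      rw [map_mul, map_ofNat]
      linear_combination -e
    have := (mul_eq_zero.mp ((map_eq_zero _).mp this)).resolve_left h2
    linear_combination -this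
  · intro h
    refine row_ofCoeffs h2 h3 (ups_ne_zero _ _ _ _) (hu.coeffDisc_ne h2 h3) rfl
      (UpsData.hasType t h2 hu hK hL) (UpsData.stabilizer_two t h2 hu hK fun hT => h ?_)
    obtain ⟨m, hm, e⟩ := hl
    have hm0 : m ≠ 0 := by
      rintro rfl
      have : algebraMap F K (n ^ 2 * D) ≠ 0 :=
        (map_ne_zero _).mpr (mul_ne_zero (pow_ne_zero 2 hu.n_ne) hu.D_ne)
      exact this (by rw [← hm]; ring)
    have k2 : (2 : K) ≠ 0 := by
      rw [← map_ofNat (algebraMap F K)]; exact (map_ne_zero _).mpr h2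
    rw [hT, sub_self, map_zero] at e
    apply mul_left_cancel₀ (mul_ne_zero k2 hm0)
    linear_combination -e

end

end BinaryQuartic

end

noncomputable section

namespace BinaryQuartic

open MvPolynomial

/-! ### The choices -/

section

variable {F K : Type*} [Field F] [Field K] [Algebra F K]

/-- In a finite field of odd order the nonzero squares have index two, so the quotient of two
nonsquares is a square. -/
theorem exists_eq_sq_mul [Finite F] (h2 : (2 : F) ≠ 0) {x y : F} (hx : ¬ IsSquare x)
    (hy : ¬ IsSquare y) : ∃ n : F, n ≠ 0 ∧ x = n ^ 2 * y := by
  have := Fintype.ofFinite F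
  classical
  have hF : ringChar F ≠ 2 := by
    intro h
    apply h2
    have := CharP.cast_eq_zero F (ringChar F)
    rw [h] at this
    exact_mod_cast this
  have hx0 : x ≠ 0 := by rintro rfl; exact hx IsSquare.zero
  have hy0 : y ≠ 0 := by rintro rfl; exact hy IsSquare.zero
  have h1 : quadraticChar F (x * y) = 1 := by
    rw [map_mul, quadraticChar_neg_one_iff_not_isSquare.mpr hx,
      quadraticChar_neg_one_iff_not_isSquare.mpr hy]
    norm_num
  obtain ⟨z, hz⟩ := (quadraticChar_one_iff_isSquare (mul_ne_zero hx0 hy0)).mp h1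
  have hz0 : z ≠ 0 := by
    rintro rfl
    rw [mul_zero] at hz
    exact mul_ne_zero hx0 hy0 hz
  refine ⟨z / y, div_ne_zero hz0 hy0, ?_⟩
  field_simp
  linear_combination hz

theorem exists_sq_eq_algebraMap [Finite F] (h2 : (2 : F) ≠ 0) {ε : F} {s : K}
    (hε : ¬ IsSquare ε) (hs : s ^ 2 = algebraMap F K ε) (x : F) :
    ∃ y : K, y ^ 2 = algebraMap F K x := by
  by_cases hx : IsSquare x
  · obtain ⟨y, rfl⟩ := hx
    exact ⟨algebraMap F K y, by rw [map_mul]; ring⟩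
  · obtain ⟨n, -, rfl⟩ := exists_eq_sq_mul h2 hx hε
    exact ⟨algebraMap F K n * s, by rw [map_mul, map_pow, ← hs]; ring⟩

/-- This is the dictionary from (Y² - uX²)² - TX²(Y² + uX²) + 2wX³Y + NX⁴ to the parameters of υ'.
Put D = T² - 4N; since D and N are nonsquares, N = n²D; and w² = uD makes s = w/D satisfy s²D = u.
-/
theorem upsData_of [Finite F] (h2 : (2 : F) ≠ 0) {u T N w : F} (hD : ¬ IsSquare (T ^ 2 - 4 * N))
    (hN : ¬ IsSquare N) (hw : w ^ 2 = u * (T ^ 2 - 4 * N)) :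
    ∃ D n s : F, UpsData D n s T ∧
      upsV D n s T = ![1, 0, -(2 * u + T), 2 * w, u ^ 2 - T * u + N] ∧
      s ^ 2 * D = u ∧ n ^ 2 * D = N := by
  obtain ⟨n, hn, e⟩ := exists_eq_sq_mul h2 hN hD
  have hD0 : T ^ 2 - 4 * N ≠ 0 := fun h => hD (by rw [h]; exact IsSquare.zero)
  have hs : (w / (T ^ 2 - 4 * N)) ^ 2 * (T ^ 2 - 4 * N) = u := by
    field_simp
    linear_combination hw
  have hs' : w / (T ^ 2 - 4 * N) * (T ^ 2 - 4 * N) = w := div_mul_cancel₀ _ hD0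
  refine ⟨T ^ 2 - 4 * N, n, w / (T ^ 2 - 4 * N), ⟨hD, hn, by linear_combination 4 * e⟩, ?_, hs,
    e.symm⟩
  rw [upsV, mul_assoc, hs, mul_assoc 2, hs', ← e,
    show (w / (T ^ 2 - 4 * N)) ^ 4 * (T ^ 2 - 4 * N) ^ 2 = u ^ 2 by rw [← hs]; ring,
    mul_assoc T, hs]

theorem formUpsilon_eq (u T N w : F) :
    (X 1 ^ 2 - C u * X 0 ^ 2) ^ 2 - C T * X 0 ^ 2 * (X 1 ^ 2 + C u * X 0 ^ 2) +
      C (2 * w) * X 0 ^ 3 * X 1 + C N * X 0 ^ 4 =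
      ofCoeffs ![1, 0, -(2 * u + T), 2 * w, u ^ 2 - T * u + N] := by
  simp [ofCoeffs, map_ofNat C]
  ring

theorem nonsquare_of_generator {ε : F} (hε : ¬ IsSquare ε) {γ : Fˣ}
    (hγ : ∀ x : Fˣ, x ∈ Subgroup.zpowers γ) : ¬ IsSquare (γ : F) := by
  intro h
  have h0 : ε ≠ 0 := by rintro rfl; exact hε IsSquare.zero
  obtain ⟨k, hk⟩ := Subgroup.mem_zpowers_iff.mp (hγ (Units.mk0 ε h0))
  apply hε
  have := congrArg (Units.val) hk
  rw [Units.val_mk0, Units.val_zpow_eq_zpow_val] at this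
  rw [← this]
  obtain ⟨y, hy⟩ := h
  exact ⟨y ^ k, by rw [hy, mul_zpow]⟩

theorem card_mod_four [Finite F] (h2 : (2 : F) ≠ 0) : Nat.card F % 4 = 1 ∨ Nat.card F % 4 = 3 := by
  have := Fintype.ofFinite F
  rw [Nat.card_eq_fintype_card]
  have hF : ringChar F ≠ 2 := by
    intro h
    apply h2
    have := CharP.cast_eq_zero F (ringChar F)
    rw [h] at this
    exact_mod_cast this
  have := FiniteField.odd_card_of_char_ne_two hF
  omega

theorem isSquare_neg_one_iff [Finite F] : IsSquare (-1 : F) ↔ Nat.card F % 4 ≠ 3 := by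
  have := Fintype.ofFinite F
  rw [Nat.card_eq_fintype_card]
  exact FiniteField.isSquare_neg_one_iff

theorem isSquare_of_mul_not [Finite F] (h2 : (2 : F) ≠ 0) {γ t : F} (hγ : ¬ IsSquare γ)
    (h : ¬ IsSquare (γ * t)) : IsSquare t := by
  have hγ0 : γ ≠ 0 := by rintro rfl; exact hγ IsSquare.zero
  obtain ⟨n, hn, e⟩ := exists_eq_sq_mul h2 h hγ
  exact ⟨n, mul_left_cancel₀ hγ0 (by linear_combination e)⟩

theorem not_isSquare_mul_sq {x n : F} (hx : ¬ IsSquare x) (hn : n ≠ 0) :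
    ¬ IsSquare (x * n ^ 2) := by
  rintro ⟨y, hy⟩
  exact hx ⟨y / n, by field_simp; linear_combination hy⟩

theorem not_isSquare_neg {x : F} (h : IsSquare (-1 : F)) (hx : ¬ IsSquare x) :
    ¬ IsSquare (-x) := by
  intro h'
  apply hx
  have := h.mul h'
  simpa using this

theorem exists_upsData_one [Finite F] (h2 : (2 : F) ≠ 0) {γ : F} (hγ : ¬ IsSquare γ)
    (hm : IsSquare (-1 : F)) {sq : F → F} (hsq : ∀ x, IsSquare x → sq x ^ 2 = x) (t : F)
    {ι η l : K} (hι : ι ^ 2 = -1) (hη : η ^ 2 = algebraMap F K γ)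
    (hl : l * (2 * algebraMap F K t + ι * η) = 2 * algebraMap F K t - ι * η) :
    ∃ D n s T : F, UpsData D n s T ∧ formUpsilon1 γ sq t = ofCoeffs (upsV D n s T) ∧
      UpsData.IsCrossRatio D n s T l := by
  have hγ0 : γ ≠ 0 := by rintro rfl; exact hγ IsSquare.zero
  have hN := not_isSquare_neg hm hγ
  -- In both cases T = 0. Either u = t, N = -γ, D = 4γ, or u = γt, N = -γ³, D = 4γ³; the second
  -- choice rescales u and a square root of N by γ and so keeps the cross-ratio. As -1 is a square,
  -- -γ is a nonsquare.
  by_cases ht : IsSquare (γ * t)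
  · obtain ⟨D, n, s, hu, e, hs, hn⟩ := upsData_of (u := t) (T := 0) (N := -γ)
      (w := -2 * sq (γ * t)) h2 (by
        convert not_isSquare_mul_sq hγ h2 using 2; ring) hN (by
        have := hsq _ ht
        linear_combination 4 * this)
    refine ⟨D, n, s, 0, hu, ?_, -(ι * η), ?_, ?_⟩
    · rw [e, ← formUpsilon_eq, formUpsilon1, if_pos ht]
      simp [map_ofNat C]
      ring
    · rw [hn, map_neg, ← hη]
      linear_combination η ^ 2 * hι
    · rw [mul_assoc, hs]
      simp only [map_sub, map_mul, map_ofNat, map_zero]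
      linear_combination 2 * hl
  · have htq := isSquare_of_mul_not h2 hγ ht
    obtain ⟨D, n, s, hu, e, hs, hn⟩ := upsData_of (u := γ * t) (T := 0) (N := -γ ^ 3)
      (w := -2 * γ ^ 2 * sq t) h2 (by
        convert not_isSquare_mul_sq hγ (mul_ne_zero h2 hγ0) using 2; ring) (by
        convert not_isSquare_mul_sq hN hγ0 using 2; ring) (by
        have := hsq _ htq
        linear_combination 4 * γ ^ 4 * this)
    refine ⟨D, n, s, 0, hu, ?_, -(algebraMap F K γ * (ι * η)), ?_, ?_⟩
    · rw [e, ← formUpsilon_eq, formUpsilon1, if_neg ht]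
      simp [map_ofNat C]
      ring
    · rw [hn, map_neg, map_pow, ← hη]
      linear_combination η ^ 6 * hι
    · rw [mul_assoc, hs]
      simp only [map_sub, map_mul, map_ofNat, map_zero]
      linear_combination 2 * algebraMap F K γ * hl

theorem exists_upsData_three [Finite F] (h2 : (2 : F) ≠ 0) {θ₀ θ₁ : F}
    (hm : ¬ IsSquare (-1 : F)) (hn : θ₀ ^ 2 + θ₁ ^ 2 = -1)
    {sq : F → F} (hsq : ∀ x, IsSquare x → sq x ^ 2 = x) (t : F)
    {ι l : K} (hι : ι ^ 2 = -1)
    (hl : l * (algebraMap F K (2 * t + θ₀) - ι) = algebraMap F K (2 * t + θ₀) + ι) :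
    ∃ D n s T : F, UpsData D n s T ∧ formUpsilon3 θ₀ θ₁ sq t = ofCoeffs (upsV D n s T) ∧
      UpsData.IsCrossRatio D n s T l := by
  have hθ1 : θ₁ ≠ 0 := by
    rintro rfl
    exact hm ⟨θ₀, by linear_combination -hn⟩
  simp only [map_add, map_mul, map_ofNat] at hl
  -- In both cases N = -1 and D = 4θ₀² + 4 = -4θ₁², a nonsquare. The cases differ by the signs of u,
  -- T and ι, which leave the cross-ratio unchanged.
  by_cases ht : IsSquare (-t)
  · obtain ⟨D, n, s, hu, e, hs, hn⟩ := upsData_of (u := t) (T := -2 * θ₀) (N := -1)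
      (w := 2 * sq (-t) * θ₁) h2 (by
        convert not_isSquare_mul_sq hm (mul_ne_zero h2 hθ1) using 2
        linear_combination 4 * hn) hm (by
        have := hsq _ ht
        linear_combination 4 * θ₁ ^ 2 * this - 4 * t * hn)
    refine ⟨D, n, s, _, hu, ?_, ι, ?_, ?_⟩
    · rw [e, ← formUpsilon_eq, formUpsilon3, if_pos ht]
      simp [map_ofNat C]
      ring
    · rw [hn, map_neg, map_one, hι]
    · rw [mul_assoc, hs]
      simp only [map_sub, map_mul, map_neg, map_ofNat]
      linear_combination 2 * hl
  · have htq : IsSquare t := isSquare_of_mul_not h2 hm (by rwa [neg_one_mul])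
    obtain ⟨D, n, s, hu, e, hs, hn⟩ := upsData_of (u := -t) (T := 2 * θ₀) (N := -1)
      (w := 2 * sq t * θ₁) h2 (by
        convert not_isSquare_mul_sq hm (mul_ne_zero h2 hθ1) using 2
        linear_combination 4 * hn) hm (by
        have := hsq _ htq
        linear_combination 4 * θ₁ ^ 2 * this + 4 * t * hn)
    refine ⟨D, n, s, _, hu, ?_, -ι, ?_, ?_⟩
    · rw [e, ← formUpsilon_eq, formUpsilon3, if_neg ht]
      simp [map_ofNat C]
      ring
    · rw [hn, map_neg, map_one]
      linear_combination hι
    · rw [mul_assoc, hs]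
      simp only [map_sub, map_mul, map_neg, map_ofNat]
      linear_combination -2 * hl

theorem N2tilde_ne_zero {l : K} [FiniteDimensional F K] (hl : l ∈ N2tilde F K) : l ≠ 0 := by
  rintro rfl
  have := hl.2
  rw [Algebra.norm_zero] at this
  exact zero_ne_one this

namespace Choices

theorem upsilon_eq [Finite F] (h2 : (2 : F) ≠ 0) [FiniteDimensional F K] (c : Choices F K) {l : K}
    (hl : l ∈ N2tilde F K) : ∃ (D n s T : F) (l' : K), UpsData D n s T ∧
      c.upsilon l = ofCoeffs (upsV D n s T) ∧ (l' = l ∨ l' = l⁻¹) ∧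
      UpsData.IsCrossRatio D n s T l' := by
  have k2 : (2 : K) ≠ 0 := by
    rw [← map_ofNat (algebraMap F K)]; exact (map_ne_zero _).mpr h2
  have hl0 := N2tilde_ne_zero hl
  have hs := c.t_spec l hl
  -- Division by zero yields zero, so this shows that the denominator in `chiT` does not vanish.
  have hχ : chiT c.ι c.η c.θ₀ (c.t l) ≠ 0 := by
    rcases hs with h | h
    · rw [h]; exact hl0
    · rw [h]; exact inv_ne_zero hl0
  rcases card_mod_four h2 with hq | hq
  · have hm : IsSquare (-1 : F) := isSquare_neg_one_iff.mpr (by omega)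
    rw [chiT, if_pos hq] at hs hχ
    have hd : algebraMap F K (c.t l) + c.ι * c.η / 2 ≠ 0 := fun h => hχ (by rw [h, div_zero])
    obtain ⟨D, n, s, T, hu, e, hc⟩ := exists_upsData_one h2
      (nonsquare_of_generator c.ε_nonsquare c.γ_generator) hm c.sq_sq (c.t l) c.ι_sq c.η_sq
      (l := (algebraMap F K (c.t l) - c.ι * c.η / 2) / (algebraMap F K (c.t l) + c.ι * c.η / 2))
      (by
        rw [show 2 * algebraMap F K (c.t l) + c.ι * c.η =
          2 * (algebraMap F K (c.t l) + c.ι * c.η / 2) by field_simp]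
        rw [mul_left_comm, div_mul_cancel₀ _ hd]
        field_simp)
    exact ⟨D, n, s, T, _, hu, by rw [upsilon, if_pos hq, e], hs, hc⟩
  · have hm : ¬ IsSquare (-1 : F) := fun h => isSquare_neg_one_iff.mp h hq
    have hq' : Nat.card F % 4 ≠ 1 := by omega
    rw [chiT, if_neg hq'] at hs hχ
    have hd : algebraMap F K (2 * c.t l + c.θ₀) - c.ι ≠ 0 := fun h => hχ (by rw [h, div_zero])
    obtain ⟨D, n, s, T, hu, e, hc⟩ := exists_upsData_three h2
      hm (c.θ_norm hq) c.sq_sq (c.t l) c.ι_sq (div_mul_cancel₀ _ hd)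
    exact ⟨D, n, s, T, _, hu, by rw [upsilon, if_neg hq', e], hs, hc⟩

theorem row_upsilon [Finite F] (h2 : (2 : F) ≠ 0) (h3 : (3 : F) ≠ 0)
    (hK : Module.finrank F K = 2) (c : Choices F K) {l : K} (hl : l ∈ N2tilde F K) :
    ∃ r : F, algebraMap F K r = jLambda l ∧ (l = -1 → Row (c.upsilon l) r .F2' (Cyc 4)) ∧
      (l ≠ -1 → Row (c.upsilon l) r .F2' (Cyc 2)) := by
  have : FiniteDimensional F K := FiniteDimensional.of_finrank_pos (by omega)
  obtain ⟨D, n, s, T, l', hu, e, hl', hc⟩ := c.upsilon_eq h2 hl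
  have hj : jLambda l' = jLambda l := by
    rcases hl' with rfl | rfl
    · rfl
    · exact jLambda_inv l
  have hl1 : l' = -1 ↔ l = -1 := by
    rcases hl' with rfl | rfl
    · rfl
    · rw [inv_eq_iff_eq_inv, inv_neg, inv_one]
  obtain ⟨δ, hδ⟩ := exists_sq_eq_algebraMap h2 c.ε_nonsquare c.rootε_sq D
  obtain ⟨r, hr, h⟩ := row_ups h2 h3 hu hK hδ hc
  rw [hl1, Ne, hl1] at h
  rw [e]
  exact ⟨r, hr.trans hj, h⟩

end Choices

end

end BinaryQuartic

end

noncomputable section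

namespace BinaryQuartic

/-! ### The `j`-invariant as a function of the cross-ratio -/

section

variable {L : Type*} [Field L]

theorem sq_sub_add_ne_of_jLambda {l : L} (hj : jLambda l ≠ 0) : l ^ 2 - l + 1 ≠ 0 := by
  intro h
  exact hj (by rw [jLambda, h]; simp)

theorem jLambda_eq_zero_iff (h2 : (2 : L) ≠ 0) {l : L} (h0 : l ≠ 0) (h1 : l ≠ 1) :
    jLambda l = 0 ↔ l ^ 2 - l + 1 = 0 := by
  have : (256 : L) ≠ 0 := by
    rw [show (256 : L) = 2 ^ 8 by norm_num]
    exact pow_ne_zero _ h2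
  rw [jLambda, div_eq_zero_iff]
  simp [this, h0, sub_ne_zero.mpr h1]

theorem jLambda_eq_1728_iff (h2 : (2 : L) ≠ 0) {l : L} (h0 : l ≠ 0) (h1 : l ≠ 1) :
    jLambda l = 1728 ↔ l = -1 ∨ l = 2 ∨ l = 2⁻¹ := by
  have h64 : (64 : L) ≠ 0 := by
    rw [show (64 : L) = 2 ^ 6 by norm_num]
    exact pow_ne_zero _ h2
  have e : jLambda l = 1728 ↔ 64 * ((l + 1) ^ 2 * (l - 2) ^ 2 * (2 * l - 1) ^ 2) = 0 := by
    rw [jLambda, div_eq_iff (mul_ne_zero (pow_ne_zero _ h0) (pow_ne_zero _ (sub_ne_zero.mpr h1))),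
      ← sub_eq_zero]
    ring_nf
  rw [e]
  simp only [mul_eq_zero, h64, false_or, pow_eq_zero_iff, ne_eq, OfNat.ofNat_ne_zero,
    not_false_eq_true, or_assoc]
  rw [add_eq_zero_iff_eq_neg, sub_eq_zero, sub_eq_zero, mul_comm, ← eq_mul_inv_iff_mul_eq₀ h2,
    one_mul]

theorem isPrimitiveRoot_neg_iff (h3 : (3 : L) ≠ 0) {l : L} :
    IsPrimitiveRoot (-l) 3 ↔ l ^ 2 - l + 1 = 0 := by
  constructor
  · intro h
    have h1 : -l ≠ 1 := h.ne_one (by norm_num)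
    have e := h.pow_eq_one
    have : (-l - 1) * (l ^ 2 - l + 1) = 0 := by linear_combination e
    exact (mul_eq_zero.mp this).resolve_left (sub_ne_zero.mpr h1)
  · intro h
    have ho : orderOf (-l) = 3 := by
      refine orderOf_eq_prime (by linear_combination (-l - 1) * h) fun h1 => h3 ?_
      have : l = -1 := by linear_combination -h1
      rw [this] at h
      linear_combination h
    rw [← ho]
    exact IsPrimitiveRoot.orderOf _

theorem generic_iff (h2 : (2 : L) ≠ 0) (h3 : (3 : L) ≠ 0) {l : L} (h0 : l ≠ 0) (h1 : l ≠ 1) :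
    Generic l ↔ jLambda l ≠ 0 ∧ jLambda l ≠ 1728 := by
  rw [Ne, jLambda_eq_zero_iff h2 h0 h1, Ne, jLambda_eq_1728_iff h2 h0 h1, Generic,
    isPrimitiveRoot_neg_iff h3]
  tauto

/-- The difference of the two `j`-invariants has a numerator that splits into six factors, one for
each transformation l, 1/l, 1 - l, 1 - 1/l, 1/(1 - l), l/(l - 1) of the anharmonic group. -/
theorem eq_of_jLambda_eq (h2 : (2 : L) ≠ 0) {l m : L} (hl0 : l ≠ 0) (hl1 : l ≠ 1)
    (hm0 : m ≠ 0) (hm1 : m ≠ 1) (h : jLambda m = jLambda l) :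
    m = l ∨ m * l = 1 ∨ m + l = 1 ∨ m * l = l - 1 ∨ m * l = m - 1 ∨ m * l = m + l := by
  have h256 : (256 : L) ≠ 0 := by
    rw [show (256 : L) = 2 ^ 8 by norm_num]
    exact pow_ne_zero _ h2
  rw [jLambda, jLambda, div_eq_div_iff
    (mul_ne_zero (pow_ne_zero _ hm0) (pow_ne_zero _ (sub_ne_zero.mpr hm1)))
    (mul_ne_zero (pow_ne_zero _ hl0) (pow_ne_zero _ (sub_ne_zero.mpr hl1)))] at h
  have e : 256 * ((m - l) * (m * l - 1) * (m + l - 1) * (m * l - (l - 1)) * (m * l - (m - 1)) *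
      (m * l - (m + l))) = 0 := by
    linear_combination h
  simp only [mul_eq_zero, h256, false_or, or_assoc] at e
  simpa only [sub_eq_zero] using e

/-- The roots of the resolvent cubic of a form with cross-ratio `l`. -/
theorem resolvent_eq (h2 : (2 : L) ≠ 0) (h3 : (3 : L) ≠ 0) {l : L} (h1 : l ≠ 1)
    (hj : jLambda l ≠ 0) (w : L) :
    w ^ 3 - 4 * w ^ 2 + 256 / 27 * (1 - 1728 / jLambda l) =
      (w + 4 * (2 - l) * (2 * l - 1) / (3 * (l ^ 2 - l + 1))) *
      (w - 4 * (1 + l) * (2 * l - 1) / (3 * (l ^ 2 - l + 1))) *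
      (w - 4 * (1 + l) * (2 - l) / (3 * (l ^ 2 - l + 1))) := by
  have hA := sq_sub_add_ne_of_jLambda hj
  have h1' := sub_ne_zero.mpr h1
  have h27 : (27 : L) ≠ 0 := by
    rw [show (27 : L) = 3 ^ 3 by norm_num]
    exact pow_ne_zero _ h3
  have h256 : (256 : L) ≠ 0 := by
    rw [show (256 : L) = 2 ^ 8 by norm_num]
    exact pow_ne_zero _ h2
  rw [jLambda]
  obtain ⟨A, e⟩ : ∃ A, A = l ^ 2 - l + 1 := ⟨_, rfl⟩
  rw [← e] at hA ⊢
  field_simp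
  rw [e]
  ring

end

/-! ### The resolvent cubic and cross-ratios in the base field -/

section

variable {F K : Type*} [Field F] [Field K] [Algebra F K]

/-- Since 27(w³ - 4w²) + 256 = (8 - 3w)²(4 + 3w), the equation can be solved for r: a root w of the
resolvent determines r. -/
theorem resolvent_eq_zero_iff (h2 : (2 : F) ≠ 0) (h3 : (3 : F) ≠ 0) {r w : F} (hr : r ≠ 0) :
    w ^ 3 - 4 * w ^ 2 + 256 / 27 * (1 - 1728 / r) = 0 ↔
      r * ((8 - 3 * w) ^ 2 * (4 + 3 * w)) = 1728 * 256 := by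
  obtain ⟨-, -, -, -, -, -, h27, h256, h1728, h8⟩ := ne_zero_of_two_three h2 h3
  have e1 : r * (1728 / r) = 1728 := mul_div_cancel₀ _ hr
  have e2 : (27 : F) * (256 / 27) = 256 := mul_div_cancel₀ _ h27
  constructor
  · intro hw
    linear_combination 27 * r * hw + (1728 / r * r - r) * e2 + 256 * e1
  · intro h
    apply mul_left_cancel₀ (mul_ne_zero h27 hr)
    linear_combination h - (1728 / r * r - r) * e2 - 256 * e1

/-- A root of the resolvent cubic yields the sum of a cross-ratio and its inverse. -/
theorem exists_trace_of_root (h2 : (2 : F) ≠ 0) (h3 : (3 : F) ≠ 0) {r w : F} (hr0 : r ≠ 0)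
    (hw : w ^ 3 - 4 * w ^ 2 + 256 / 27 * (1 - 1728 / r) = 0) :
    ∃ u : F, ∀ {L : Type*} [Field L] [Algebra F L] (l : L), l ^ 2 - algebraMap F L u * l + 1 = 0 →
      l ≠ 0 ∧ l ≠ 1 ∧ jLambda l = algebraMap F L r := by
  obtain ⟨-, -, -, -, -, -, h27, h256, h1728, h8⟩ := ne_zero_of_two_three h2 h3
  have e := (resolvent_eq_zero_iff h2 h3 hr0).mp hw
  have hne : r * ((8 - 3 * w) ^ 2 * (4 + 3 * w)) ≠ 0 := e ▸ mul_ne_zero h1728 h256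
  have hs : 8 - 3 * w ≠ 0 := fun h => hne (by rw [h]; ring)
  have hp : 4 + 3 * w ≠ 0 := fun h => hne (by rw [h]; ring)
  -- The root of the resolvent symmetric in l and 1/l is -4(5 - 2u)/(3(u - 1)) with u = l + 1/l;
  -- this is its solution for u.
  refine ⟨(20 - 3 * w) / (8 - 3 * w), fun {L} _ _ l hl => ?_⟩
  have hs' : (8 - 3 * algebraMap F L w : L) ≠ 0 := by
    have := (map_ne_zero (algebraMap F L)).mpr hs
    simpa [map_ofNat (algebraMap F L)] using this
  have hp' : (4 + 3 * algebraMap F L w : L) ≠ 0 := by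
    have := (map_ne_zero (algebraMap F L)).mpr hp
    simpa [map_ofNat (algebraMap F L)] using this
  have e' := congrArg (algebraMap F L) e
  simp only [map_mul, map_sub, map_add, map_pow, map_ofNat (algebraMap F L)] at e'
  simp only [map_div₀, map_sub, map_mul, map_ofNat (algebraMap F L)] at hl
  have hu : (l ^ 2 + 1) * (8 - 3 * algebraMap F L w) = (20 - 3 * algebraMap F L w) * l := by
    field_simp at hl
    linear_combination hl
  have hl0 : l ≠ 0 := by
    rintro rfl
    exact hs' (by linear_combination hu)
  have hl1 : l ≠ 1 := by
    rintro rfl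
    exact hp' (by linear_combination -hu)
  refine ⟨hl0, hl1, ?_⟩
  rw [jLambda, div_eq_iff (mul_ne_zero (pow_ne_zero _ hl0) (pow_ne_zero _ (sub_ne_zero.mpr hl1)))]
  have a1 : (l ^ 2 - l + 1) * (8 - 3 * algebraMap F L w) = 12 * l := by linear_combination hu
  have a2 : (l - 1) ^ 2 * (8 - 3 * algebraMap F L w) = (4 + 3 * algebraMap F L w) * l := by
    linear_combination hu
  apply mul_right_cancel₀ (pow_ne_zero 3 hs')
  calc 256 * (l ^ 2 - l + 1) ^ 3 * (8 - 3 * algebraMap F L w) ^ 3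
      = 256 * ((l ^ 2 - l + 1) * (8 - 3 * algebraMap F L w)) ^ 3 := by ring
    _ = l ^ 3 * (1728 * 256) := by rw [a1]; ring
    _ = algebraMap F L r * l ^ 2 * (8 - 3 * algebraMap F L w) ^ 2 *
        ((4 + 3 * algebraMap F L w) * l) := by rw [← e']; ring
    _ = _ := by rw [← a2]; ring

theorem algebraMap_jLambda (l : F) : algebraMap F K (jLambda l) = jLambda (algebraMap F K l) := by
  simp [jLambda, map_ofNat (algebraMap F K)]

/-- The three factors of the resolvent are rational in l. Differences of the roots are multiples of
2l - 1, l(2 - l) and (1 + l)(l - 1), hence nonzero for `j ≠ 1728`. -/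
theorem jLambda_mem_Jset_four (h2 : (2 : F) ≠ 0) (h3 : (3 : F) ≠ 0) {l : F} (h0 : l ≠ 0)
    (h1 : l ≠ 1) (hj : jLambda l ≠ 0) (hj' : jLambda l ≠ 1728) :
    jLambda l ∈ Jset F 4 := by
  refine ⟨hj, hj', ?_⟩
  have hA := sq_sub_add_ne_of_jLambda hj
  obtain ⟨h4, -⟩ := ne_zero_of_two_three h2 h3
  have hn := mt (jLambda_eq_1728_iff h2 h0 h1).mpr hj'
  push Not at hn
  obtain ⟨n1, n2, n3⟩ := hn
  have m1 : 1 + l ≠ 0 := fun h => n1 (by linear_combination h)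
  have m2 : 2 - l ≠ 0 := fun h => n2 (by linear_combination -h)
  have m3 : 2 * l - 1 ≠ 0 := fun h => n3 (eq_inv_of_mul_eq_one_left (by linear_combination h))
  have hd : 3 * (l ^ 2 - l + 1) ≠ 0 := mul_ne_zero h3 hA
  have e : {w : F | w ^ 3 - 4 * w ^ 2 + 256 / 27 * (1 - 1728 / jLambda l) = 0} =
      {-(4 * (2 - l) * (2 * l - 1) / (3 * (l ^ 2 - l + 1))),
        4 * (1 + l) * (2 * l - 1) / (3 * (l ^ 2 - l + 1)),
        4 * (1 + l) * (2 - l) / (3 * (l ^ 2 - l + 1))} := by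
    ext w
    simp only [Set.mem_ofPred_eq, resolvent_eq h2 h3 h1 hj, mul_eq_zero, sub_eq_zero, or_assoc,
      add_eq_zero_iff_eq_neg, Set.mem_insert_iff, Set.mem_singleton_iff]
  rw [e, Set.ncard_eq_three.mpr ⟨_, _, _, ?_, ?_, ?_, rfl⟩]
  · rw [← neg_div, Ne, div_left_inj' hd]
    intro h
    exact mul_ne_zero (mul_ne_zero h4 m3) h3 (by linear_combination -h)
  · rw [← neg_div, Ne, div_left_inj' hd]
    intro h
    exact mul_ne_zero (mul_ne_zero h4 m2) (mul_ne_zero h3 h0) (by linear_combination -h)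
  · rw [Ne, div_left_inj' hd]
    intro h
    exact mul_ne_zero (mul_ne_zero h4 m1) (mul_ne_zero h3 (sub_ne_zero.mpr h1))
      (by linear_combination h)

end

end BinaryQuartic

end

noncomputable section

namespace BinaryQuartic

/-! ### Cross-ratios of norm one, and the sets J₄, J₂, J₁ -/

section

variable {F K : Type*} [Field F] [Field K] [Algebra F K]

theorem inv_mem_N2tilde [FiniteDimensional F K] {l : K} (hl : l ∈ N2tilde F K) : l⁻¹ ∈ N2tilde F K :=
  ⟨fun h => hl.1 (inv_eq_one.mp h), by
    have := map_mul (Algebra.norm F) l l⁻¹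
    rwa [mul_inv_cancel₀ (N2tilde_ne_zero hl), map_one, hl.2, one_mul, eq_comm] at this⟩

theorem N2tilde_exists {ε : F} (hε : ¬ IsSquare ε) {s : K} (hs : s ^ 2 = algebraMap F K ε)
    (hK : Module.finrank F K = 2) {l : K} (hl : l ∈ N2tilde F K) :
    ∃ x y : F, l = algebraMap F K x + algebraMap F K y * s ∧ x ^ 2 - y ^ 2 * ε = 1 ∧
      l⁻¹ = algebraMap F K x - algebraMap F K y * s := by
  obtain ⟨x, y, rfl⟩ := exists_eq_add_mul_root hε hs hK l
  have hn := hl.2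
  rw [norm_add_mul_root hε hs hK] at hn
  refine ⟨x, y, rfl, hn, ?_⟩
  rw [inv_eq_iff_eq_inv]
  apply eq_inv_of_mul_eq_one_left
  have := congrArg (algebraMap F K) hn
  simp only [map_sub, map_mul, map_pow, map_one] at this
  linear_combination this - (algebraMap F K y) ^ 2 * hs

/-- If N(l) = N(1 - l) = 1, then l has trace 1, so 1 - l is the conjugate of l, which is its
inverse. -/
theorem mul_eq_one_of_add_eq_one {ε : F} (hε : ¬ IsSquare ε) {s : K} (hs : s ^ 2 = algebraMap F K ε)
    (hK : Module.finrank F K = 2) {l m : K} (hl : l ∈ N2tilde F K) (hm : m ∈ N2tilde F K)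
    (h : m + l = 1) : m * l = 1 := by
  obtain ⟨x, y, e, e1, -⟩ := N2tilde_exists hε hs hK hl
  have hn := hm.2
  rw [show m = algebraMap F K (1 - x) + algebraMap F K (-y) * s by
    rw [eq_sub_of_add_eq h, e]; simp; ring, norm_add_mul_root hε hs hK] at hn
  have hx : 2 * x = 1 := by linear_combination e1 - hn
  have e1' := congrArg (algebraMap F K) e1
  have hx' := congrArg (algebraMap F K) hx
  simp only [map_sub, map_mul, map_pow, map_one, map_ofNat (algebraMap F K)] at e1' hx'
  rw [eq_sub_of_add_eq h, e]
  linear_combination e1' - algebraMap F K y ^ 2 * hs - (algebraMap F K x + algebraMap F K y * s) * hx'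

/-- In each of the four remaining anharmonic relations, l or m can be replaced by its inverse so
that the sum is 1. The preceding lemma then reduces it to m = l or m = 1/l. -/
theorem N2tilde_eq_or_eq_inv (h2 : (2 : F) ≠ 0) {ε : F} (hε : ¬ IsSquare ε) {s : K} (hs : s ^ 2 = algebraMap F K ε)
    (hK : Module.finrank F K = 2) {l m : K} (hl : l ∈ N2tilde F K) (hm : m ∈ N2tilde F K)
    (h : jLambda m = jLambda l) : m = l ∨ m = l⁻¹ := by
  have : FiniteDimensional F K := FiniteDimensional.of_finrank_pos (by omega)
  have k2 : (2 : K) ≠ 0 := by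
    simpa [map_ofNat (algebraMap F K)] using (map_ne_zero (algebraMap F K)).mpr h2
  have hl0 := N2tilde_ne_zero hl
  have hm0 := N2tilde_ne_zero hm
  have hil := inv_mem_N2tilde hl
  have him := inv_mem_N2tilde hm
  have key := fun {l m : K} => mul_eq_one_of_add_eq_one (l := l) (m := m) hε hs hK
  rcases eq_of_jLambda_eq k2 hl0 hl.1 hm0 hm.1 h with h | h | h | h | h | h
  · exact Or.inl h
  · exact Or.inr (eq_inv_of_mul_eq_one_left h)
  · exact Or.inr (eq_inv_of_mul_eq_one_left (key hl hm h))
  · have := key hil hm (by field_simp; linear_combination h)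
    exact Or.inl ((mul_inv_eq_one₀ hl0).mp this)
  · have := key hl him (by field_simp; linear_combination h)
    exact Or.inl ((inv_mul_eq_one₀ hm0).mp this)
  · have := key hil him (by field_simp; linear_combination -h)
    rw [← mul_inv, inv_eq_one] at this
    exact Or.inr (eq_inv_of_mul_eq_one_left this)

/-- Conjugation inverts l. The root of the resolvent symmetric in l and 1/l is therefore in F, and
the other two are exchanged; they could lie in F only for l = ±1. -/
theorem mem_Jset_two (h2 : (2 : F) ≠ 0) (h3 : (3 : F) ≠ 0) {ε : F} (hε : ¬ IsSquare ε) {s : K}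
    (hs : s ^ 2 = algebraMap F K ε)
    (hK : Module.finrank F K = 2) {l : K} (hl : l ∈ N2tilde F K) {r : F}
    (hr : algebraMap F K r = jLambda l) (h0 : r ≠ 0) (h1728 : r ≠ 1728) : r ∈ Jset F 2 := by
  have : FiniteDimensional F K := FiniteDimensional.of_finrank_pos (by omega)
  have k2 : (2 : K) ≠ 0 := by
    simpa [map_ofNat (algebraMap F K)] using (map_ne_zero (algebraMap F K)).mpr h2
  have k3 : (3 : K) ≠ 0 := by
    simpa [map_ofNat (algebraMap F K)] using (map_ne_zero (algebraMap F K)).mpr h3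
  have hl0 := N2tilde_ne_zero hl
  have hj : jLambda l ≠ 0 := by rwa [← hr, map_ne_zero]
  have hl1 : l ≠ -1 := fun h => h1728 ((algebraMap F K).injective (by
    rw [hr, map_ofNat, (jLambda_eq_1728_iff k2 hl0 hl.1).mpr (Or.inl h)]))
  have hA := sq_sub_add_ne_of_jLambda hj
  obtain ⟨x, y, e, e1, e2⟩ := N2tilde_exists hε hs hK hl
  have hsum : l ^ 2 + 1 = 2 * algebraMap F K x * l := by
    have : l * l⁻¹ = 1 := mul_inv_cancel₀ hl0
    have e3 : l + l⁻¹ = 2 * algebraMap F K x := by rw [e2, e]; ring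
    linear_combination l * e3 - this
  have hx : 2 * x - 1 ≠ 0 := by
    intro h
    have := congrArg (algebraMap F K) h
    simp only [map_sub, map_mul, map_one, map_zero, map_ofNat (algebraMap F K)] at this
    exact hA (by linear_combination hsum + l * this)
  have hx' : (2 * algebraMap F K x - 1 : K) ≠ 0 := by
    simpa [map_ofNat (algebraMap F K)] using (map_ne_zero (algebraMap F K)).mpr hx
  refine ⟨h0, h1728, ?_⟩
  have hA' : l ^ 2 - l + 1 = l * (2 * algebraMap F K x - 1) := by linear_combination hsum
  have hroot : ∀ w : F, w ^ 3 - 4 * w ^ 2 + 256 / 27 * (1 - 1728 / r) = 0 ↔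
      w = -(4 * (5 - 4 * x) / (3 * (2 * x - 1))) := by
    intro w
    rw [← map_eq_zero (algebraMap F K)]
    simp only [map_sub, map_add, map_mul, map_div₀, map_pow, map_one, map_ofNat (algebraMap F K), hr,
      resolvent_eq k2 k3 hl.1 hj]
    rw [mul_assoc, mul_eq_zero_iff_right]
    · rw [← (algebraMap F K).injective.eq_iff, add_eq_zero_iff_eq_neg]
      simp only [map_sub, map_neg, map_mul, map_div₀, map_one, map_ofNat (algebraMap F K)]
      rw [hA']
      have : 4 * (2 - l) * (2 * l - 1) / (3 * (l * (2 * algebraMap F K x - 1))) =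
          4 * (5 - 4 * algebraMap F K x) / (3 * (2 * algebraMap F K x - 1)) := by
        field_simp
        linear_combination -8 * hsum
      rw [this]
    · intro h
      -- For either of the other roots, the coordinate at √ε is ±12y up to a nonzero factor, so y =
      -- 0 and l = ±1.
      have h0 : ∃ v : F, (v = 12 * y ∨ v = -12 * y) ∧ ∃ u : F,
          algebraMap F K u + algebraMap F K v * s = 0 := by
        have e3 : l * (algebraMap F K x - algebraMap F K y * s) = 1 := by
          rw [← e2, mul_inv_cancel₀ hl0]
        rw [hA'] at h
        rcases mul_eq_zero.mp h with h | h
        · refine ⟨12 * y, Or.inl rfl, 4 * (x + 1) - 3 * w * (2 * x - 1), ?_⟩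
          simp only [map_sub, map_add, map_mul, map_one, map_ofNat (algebraMap F K)]
          field_simp at h
          apply mul_left_cancel₀ hl0
          linear_combination -h - 8 * l * e - 4 * e3
        · refine ⟨-12 * y, Or.inr rfl, 4 * (x + 1) - 3 * w * (2 * x - 1), ?_⟩
          simp only [map_sub, map_add, map_mul, map_one, map_ofNat (algebraMap F K), map_neg]
          field_simp at h
          apply mul_left_cancel₀ hl0
          linear_combination -h + 4 * l * e + 8 * e3
      obtain ⟨v, hv, u, huv⟩ := h0
      have hv0 := (eq_zero_of_add_mul_root hε hs huv).2
      have h12 : (12 : F) ≠ 0 := (ne_zero_of_two_three h2 h3).2.2.1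
      have hy : y = 0 := by
        rcases hv with rfl | rfl <;> simpa [h12] using hv0
      subst hy
      have hx1 : (x - 1) * (x + 1) = 0 := by linear_combination e1
      rcases mul_eq_zero.mp hx1 with h | h
      · rw [sub_eq_zero.mp h] at e
        exact hl.1 (by simpa using e)
      · rw [eq_neg_of_add_eq_zero_left h] at e
        exact hl1 (by simpa using e)
  rw [show {w : F | w ^ 3 - 4 * w ^ 2 + 256 / 27 * (1 - 1728 / r) = 0} =
    {-(4 * (5 - 4 * x) / (3 * (2 * x - 1)))} by ext w; exact hroot w]
  simp

/-- An element `u ≠ 2` of the base field is the sum of an element of `F \ {0, 1}`, or of an element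
of norm one of the quadratic extension, and of its inverse. -/
theorem exists_trace_eq (h2 : (2 : F) ≠ 0) [Finite F] {ε : F} (hε : ¬ IsSquare ε) {s : K}
    (hs : s ^ 2 = algebraMap F K ε) (hK : Module.finrank F K = 2) {u : F} (hu : u ≠ 2) :
    (∃ l : F, l ^ 2 - u * l + 1 = 0) ∨
      ∃ l ∈ N2tilde F K, l ^ 2 - algebraMap F K u * l + 1 = 0 := by
  by_cases hd : IsSquare (u ^ 2 - 4)
  · obtain ⟨e, he⟩ := hd
    refine Or.inl ⟨(u + e) / 2, ?_⟩
    field_simp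
    linear_combination -he
  · obtain ⟨δ, hδ⟩ := exists_sq_eq_algebraMap h2 hε hs (u ^ 2 - 4)
    have k2 : (2 : K) ≠ 0 := by
      simpa [map_ofNat (algebraMap F K)] using (map_ne_zero (algebraMap F K)).mpr h2
    have e : algebraMap F K (u / 2) + algebraMap F K (1 / 2) * δ = (algebraMap F K u + δ) / 2 := by
      simp only [map_div₀, map_one, map_ofNat (algebraMap F K)]
      ring
    have hr : ((algebraMap F K u + δ) / 2) ^ 2 - algebraMap F K u * ((algebraMap F K u + δ) / 2) + 1
        = 0 := by
      simp only [map_sub, map_pow, map_ofNat (algebraMap F K)] at hδ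
      field_simp
      linear_combination hδ
    refine Or.inr ⟨(algebraMap F K u + δ) / 2, ⟨fun h => ?_, ?_⟩, hr⟩
    · rw [h] at hr
      apply hu
      apply (algebraMap F K).injective
      rw [map_ofNat]
      linear_combination -hr
    · rw [← e, norm_add_mul_root hd hδ hK]
      have : (4 : F) ≠ 0 := by
        rw [show (4 : F) = 2 * 2 by norm_num]
        exact mul_ne_zero h2 h2
      field_simp
      ring

theorem exists_lambda_of_root [Finite F] (h2 : (2 : F) ≠ 0) (h3 : (3 : F) ≠ 0) {ε : F}
    (hε : ¬ IsSquare ε) {s : K}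
    (hs : s ^ 2 = algebraMap F K ε) (hK : Module.finrank F K = 2) {r w : F} (hr0 : r ≠ 0)
    (hw : w ^ 3 - 4 * w ^ 2 + 256 / 27 * (1 - 1728 / r) = 0) :
    (∃ l : F, l ≠ 0 ∧ l ≠ 1 ∧ jLambda l = r) ∨
      ∃ l ∈ N2tilde F K, jLambda l = algebraMap F K r := by
  obtain ⟨u, hu⟩ := exists_trace_of_root h2 h3 hr0 hw
  have hu2 : u ≠ 2 := by
    rintro rfl
    exact (hu (1 : K) (by rw [map_ofNat]; norm_num)).2.1 rfl
  rcases exists_trace_eq h2 hε hs hK hu2 with ⟨l, hl⟩ | ⟨l, hl, e⟩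
  · have e : algebraMap F K l ^ 2 - algebraMap F K u * algebraMap F K l + 1 = 0 := by
      rw [← map_pow, ← map_mul, ← map_sub, ← map_one (algebraMap F K), ← map_add, hl, map_zero]
    obtain ⟨a, b, c⟩ := hu _ e
    rw [← algebraMap_jLambda] at c
    refine Or.inl ⟨l, fun h => a (by rw [h, map_zero]), fun h => b (by rw [h, map_one]),
      (algebraMap F K).injective c⟩
  · exact Or.inr ⟨l, hl, (hu _ e).2.2⟩

theorem exists_lambda_four [Finite F] (h2 : (2 : F) ≠ 0) (h3 : (3 : F) ≠ 0) {ε : F}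
    (hε : ¬ IsSquare ε) {s : K} (hs : s ^ 2 = algebraMap F K ε) (hK : Module.finrank F K = 2)
    {r : F} (hr : r ∈ Jset F 4) : ∃ l : F, l ≠ 0 ∧ l ≠ 1 ∧ jLambda l = r := by
  obtain ⟨h0, h1728, hn⟩ := hr
  obtain ⟨w, hw⟩ := Set.nonempty_of_ncard_ne_zero (s := {w : F | w ^ 3 - 4 * w ^ 2 + 256 / 27 *
    (1 - 1728 / r) = 0}) (by omega)
  refine (exists_lambda_of_root h2 h3 hε hs hK h0 hw).resolve_right ?_
  rintro ⟨l, hl, e⟩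
  have := (mem_Jset_two h2 h3 hε hs hK hl e.symm h0 h1728).2.2
  omega

theorem exists_lambda_two [Finite F] (h2 : (2 : F) ≠ 0) (h3 : (3 : F) ≠ 0) {ε : F}
    (hε : ¬ IsSquare ε) {s : K} (hs : s ^ 2 = algebraMap F K ε) (hK : Module.finrank F K = 2)
    {r : F} (hr : r ∈ Jset F 2) : ∃ l ∈ N2tilde F K, jLambda l = algebraMap F K r := by
  obtain ⟨h0, h1728, hn⟩ := hr
  obtain ⟨w, hw⟩ := Set.nonempty_of_ncard_ne_zero (s := {w : F | w ^ 3 - 4 * w ^ 2 + 256 / 27 *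
    (1 - 1728 / r) = 0}) (by omega)
  refine (exists_lambda_of_root h2 h3 hε hs hK h0 hw).resolve_left ?_
  rintro ⟨l, hl0, hl1, rfl⟩
  have := (jLambda_mem_Jset_four h2 h3 hl0 hl1 h0 h1728).2.2
  omega

/-- A root of the resolvent produces a cross-ratio in F or of norm one, so there are three roots or
exactly one; two roots are impossible. -/
theorem mem_Jset [Finite F] (h2 : (2 : F) ≠ 0) (h3 : (3 : F) ≠ 0) {ε : F}
    (hε : ¬ IsSquare ε) {s : K} (hs : s ^ 2 = algebraMap F K ε) (hK : Module.finrank F K = 2)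
    {r : F} (h0 : r ≠ 0) (h1728 : r ≠ 1728) : r ∈ Jset F 4 ∨ r ∈ Jset F 2 ∨ r ∈ Jset F 1 := by
  rcases Set.eq_empty_or_nonempty {w : F | w ^ 3 - 4 * w ^ 2 + 256 / 27 * (1 - 1728 / r) = 0} with
    h | ⟨w, hw⟩
  · exact Or.inr (Or.inr ⟨h0, h1728, by rw [h, Set.ncard_empty]⟩)
  · rcases exists_lambda_of_root h2 h3 hε hs hK h0 hw with ⟨l, hl0, hl1, rfl⟩ | ⟨l, hl, e⟩
    · exact Or.inl (jLambda_mem_Jset_four h2 h3 hl0 hl1 h0 h1728)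
    · exact Or.inr (Or.inl (mem_Jset_two h2 h3 hε hs hK hl e.symm h0 h1728))

end

end BinaryQuartic

end

noncomputable section

namespace BinaryQuartic

/-! ### Existence of the choices -/

section

variable {F K : Type*} [Field F] [Field K] [Algebra F K]

theorem ringChar_ne_two (h2 : (2 : F) ≠ 0) : ringChar F ≠ 2 := by
  intro h
  apply h2
  have := CharP.cast_eq_zero F (ringChar F)
  rw [h] at this
  exact_mod_cast this

/-- Every element of a finite field is a square in a quadratic extension. -/
theorem isSquare_algebraMap [Finite F] (h2 : (2 : F) ≠ 0) (hK : Module.finrank F K = 2) (x : F) :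
    IsSquare (algebraMap F K x) := by
  have : FiniteDimensional F K := FiniteDimensional.of_finrank_pos (by omega)
  have : Finite K := Module.finite_of_finite F
  have := Fintype.ofFinite F
  have := Fintype.ofFinite K
  have k2 : (2 : K) ≠ 0 := by
    simpa [map_ofNat (algebraMap F K)] using (map_ne_zero (algebraMap F K)).mpr h2
  by_cases hx : x = 0
  · simp [hx]
  rw [FiniteField.isSquare_iff (ringChar_ne_two k2) (by simpa using hx), ← map_pow]
  have hc : Fintype.card K = Fintype.card F ^ 2 := by
    rw [← Nat.card_eq_fintype_card, ← Nat.card_eq_fintype_card, ← hK]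
    exact Module.natCard_eq_pow_finrank
  have ho := FiniteField.odd_card_of_char_ne_two (ringChar_ne_two h2)
  obtain ⟨m, hm⟩ : ∃ m, Fintype.card F = 2 * m + 1 := ⟨Fintype.card F / 2, by omega⟩
  have e : Fintype.card K / 2 = (Fintype.card F - 1) * (m + 1) := by
    rw [hc, hm, show (2 * m + 1) ^ 2 = 2 * (2 * m * (m + 1)) + 1 by ring]
    rw [Nat.add_sub_cancel]
    omega
  rw [e, pow_mul, FiniteField.pow_card_sub_one_eq_one x hx, one_pow, map_one]

theorem exists_cayley_of_norm_eq_one {N : F} (hN : ¬ IsSquare N) {s : K}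
    (hs : s ^ 2 = algebraMap F K N) (hK : Module.finrank F K = 2) {l : K} (hl : l ∈ N2tilde F K) :
    ∃ t : F, (algebraMap F K t - s) / (algebraMap F K t + s) = l := by
  obtain ⟨x, y, e, hn, -⟩ := N2tilde_exists hN hs hK hl
  have hN0 : N ≠ 0 := by
    rintro rfl
    exact hN ⟨0, by simp⟩
  have hx : 1 - x ≠ 0 := by
    intro h
    have hx : x = 1 := by linear_combination -h
    rw [hx] at hn
    have hy : y ^ 2 * N = 0 := by linear_combination -hn
    have hy0 : y = 0 := by simpa [hN0] using hy
    apply hl.1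
    rw [e, hx, hy0]
    simp
  -- The inverse Cayley transform s(1 + l)/(1 - l) of l = x + ys is, since N(l) = 1, the element
  -- Ny/(1 - x) of F.
  refine ⟨N * y / (1 - x), ?_⟩
  have hd : algebraMap F K (N * y / (1 - x)) + s ≠ 0 := by
    intro h
    have := eq_zero_of_add_mul_root hN hs (u := N * y / (1 - x)) (v := 1) (by simpa using h)
    exact one_ne_zero this.2
  rw [div_eq_iff hd]
  have hx' : (1 - algebraMap F K x : K) ≠ 0 := by
    simpa using (map_ne_zero (algebraMap F K)).mpr hx
  have hn' := congrArg (algebraMap F K) hn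
  simp only [map_sub, map_mul, map_pow, map_one] at hn'
  rw [e, map_div₀, map_mul, map_sub, map_one]
  field_simp
  linear_combination algebraMap F K y * (algebraMap F K x - 1) * hs + s * hn'

theorem exists_cayley_of_norm {ε : F} [Finite F] (h2 : (2 : F) ≠ 0) (hε : ¬ IsSquare ε) {s : K}
    (hs : s ^ 2 = algebraMap F K ε) (hK : Module.finrank F K = 2) {l : F} (h0 : l ≠ 0)
    (h1 : l ≠ 1) :
    ∃ α : K, (α ∉ Set.range (algebraMap F K) ∧ α ≠ s ∧ α ≠ -s) ∧
      Algebra.norm F ((α - s) / (α + s)) = l := by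
  have : FiniteDimensional F K := FiniteDimensional.of_finrank_pos (by omega)
  have : Finite K := Module.finite_of_finite F
  have k2 : (2 : K) ≠ 0 := by
    simpa [map_ofNat (algebraMap F K)] using (map_ne_zero (algebraMap F K)).mpr h2
  have hs0 : s ≠ 0 := by
    rintro rfl
    apply hε
    have : ε = 0 := (map_eq_zero (algebraMap F K)).mp (by rw [← hs]; simp)
    exact ⟨0, by simp [this]⟩
  -- Take ξ of norm l and let α be its inverse Cayley transform s(1 + ξ)/(1 - ξ), so that (α - s)/(α
  -- + s) = ξ. If α were in F, numerator and denominator would be conjugate up to sign and l would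
  -- be 1.
  obtain ⟨ξ, hξ⟩ := FiniteField.norm_surjective F K l
  have hξ1 : 1 - ξ ≠ 0 := by
    intro h
    rw [← sub_eq_zero.mp h, map_one] at hξ
    exact h1 hξ.symm
  have hξ0 : ξ ≠ 0 := by
    rintro rfl
    rw [Algebra.norm_zero] at hξ
    exact h0 hξ.symm
  have e1 : s * (1 + ξ) / (1 - ξ) - s = 2 * s * ξ / (1 - ξ) := by
    field_simp
    ring
  have e2 : s * (1 + ξ) / (1 - ξ) + s = 2 * s / (1 - ξ) := by
    field_simp
    ring
  have hr : (s * (1 + ξ) / (1 - ξ) - s) / (s * (1 + ξ) / (1 - ξ) + s) = ξ := by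
    rw [e1, e2]
    field_simp
  have hn : s * (1 + ξ) / (1 - ξ) + s ≠ 0 := by
    rw [e2]
    exact div_ne_zero (mul_ne_zero k2 hs0) hξ1
  refine ⟨s * (1 + ξ) / (1 - ξ), ⟨?_, ?_, ?_⟩, by rw [hr, hξ]⟩
  · rintro ⟨a, ha⟩
    have h := norm_ratio hε hs hK (a := a) (b := 0) (by rw [ha]; simpa using hn)
    rw [ha] at h
    simp only [map_zero, zero_mul, add_zero] at h
    rw [hr, hξ] at h
    have h' : (l - 1) * (a ^ 2 - ε) = 0 := by linear_combination h
    rcases mul_eq_zero.mp h' with h' | h'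
    · exact h1 (sub_eq_zero.mp h')
    · exact hε ⟨a, by linear_combination -h'⟩
  · intro h
    rw [← sub_eq_zero, e1] at h
    exact div_ne_zero (mul_ne_zero (mul_ne_zero k2 hs0) hξ0) hξ1 h
  · intro h
    exact hn (by rw [h]; ring)

/-- A choice for each class `{x, x⁻¹}`. -/
theorem exists_inv_invariant {β γ : Type*} [InvolutiveInv β] [Nonempty γ] (S : Set β)
    (P : γ → Prop) (f : γ → β) (h : ∀ x ∈ S, ∃ y, P y ∧ f y = x) :
    ∃ g : β → γ, (∀ x, g x⁻¹ = g x) ∧ ∀ x ∈ S, P (g x) ∧ (f (g x) = x ∨ f (g x) = x⁻¹) := by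
  classical
  -- The choice depends only on the set {x, x⁻¹}, which makes it invariant under inversion.
  let c : Set β → γ := fun s => if h : ∃ y, P y ∧ f y ∈ s then h.choose else Classical.arbitrary γ
  refine ⟨fun x => c {x, x⁻¹}, fun x => ?_, fun x hx => ?_⟩
  · change c {x⁻¹, x⁻¹⁻¹} = c {x, x⁻¹}
    rw [inv_inv, Set.pair_comm]
  · obtain ⟨y, hy, e⟩ := h x hx
    have hex : ∃ y, P y ∧ f y ∈ ({x, x⁻¹} : Set β) := ⟨y, hy, Or.inl e⟩
    have : c {x, x⁻¹} = hex.choose := dif_pos hex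
    have hspec := hex.choose_spec
    rw [← this] at hspec
    exact hspec

theorem exists_theta [Finite F] (hK : Module.finrank F K = 2) {ι : K} (hι : ι ^ 2 = -1)
    (hm : ¬ IsSquare (-1 : F)) : ∃ a b : F, a ^ 2 + b ^ 2 = -1 ∧ ¬ IsSquare a := by
  have : FiniteDimensional F K := FiniteDimensional.of_finrank_pos (by omega)
  have : Finite K := Module.finite_of_finite F
  have hι' : ι ^ 2 = algebraMap F K (-1) := by simpa using hι
  obtain ⟨x, hx⟩ := FiniteField.norm_surjective F K (-1)
  obtain ⟨a, b, rfl⟩ := exists_eq_add_mul_root hm hι' hK x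
  rw [norm_add_mul_root hm hι' hK] at hx
  -- The norm of a + bι is a² + b². If a is a square, replace it by -a: both cannot be squares,
  -- because -1 is not a square, and a = 0 would give b² = -1.
  by_cases ha : IsSquare a
  · refine ⟨-a, b, by linear_combination hx, fun h => ?_⟩
    obtain ⟨u, hu⟩ := ha
    obtain ⟨v, hv⟩ := h
    by_cases hu0 : u = 0
    · apply hm
      refine ⟨b, ?_⟩
      rw [hu0] at hu
      rw [hu] at hx
      linear_combination -hx
    · refine hm ⟨v / u, ?_⟩
      field_simp
      linear_combination hv + hu
  · exact ⟨a, b, by linear_combination hx, ha⟩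

theorem nonempty_choices [Finite F] (h2 : (2 : F) ≠ 0) (hK : Module.finrank F K = 2) :
    Nonempty (Choices F K) := by
  classical
  obtain ⟨ε, hε⟩ := FiniteField.exists_nonsquare (ringChar_ne_two h2)
  obtain ⟨γ, hγ⟩ := IsCyclic.exists_generator (α := Fˣ)
  have hsq : ∀ x : F, ∃ y : K, y ^ 2 = algebraMap F K x := fun x => by
    obtain ⟨y, hy⟩ := isSquare_algebraMap h2 hK x
    exact ⟨y, by rw [hy, sq]⟩
  obtain ⟨s, hs⟩ := hsq ε
  obtain ⟨η, hη⟩ := hsq γ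
  obtain ⟨ι, hι⟩ := hsq (-1)
  rw [map_neg, map_one] at hι
  obtain ⟨θ₀, θ₁, hθ⟩ : ∃ a b : F, Nat.card F % 4 = 3 → a ^ 2 + b ^ 2 = -1 ∧ ¬ IsSquare a := by
    by_cases hq : Nat.card F % 4 = 3
    · obtain ⟨a, b, h⟩ := exists_theta hK hι (fun h => isSquare_neg_one_iff.mp h hq)
      exact ⟨a, b, fun _ => h⟩
    · exact ⟨0, 0, fun h => absurd h hq⟩
  obtain ⟨α, hα, hα'⟩ := exists_inv_invariant {l : F | l ≠ 0 ∧ l ≠ 1}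
    (fun α : K => α ∉ Set.range (algebraMap F K) ∧ α ≠ s ∧ α ≠ -s)
    (fun α => Algebra.norm F ((α - s) / (α + s)))
    (fun l hl => exists_cayley_of_norm h2 hε hs hK hl.1 hl.2)
  obtain ⟨t, ht, ht'⟩ := exists_inv_invariant (N2tilde F K) (fun _ : F => True)
    (fun t => chiT ι η θ₀ t) (fun l hl => by
      simp only [true_and]
      have k2 : (2 : K) ≠ 0 := by
        simpa [map_ofNat (algebraMap F K)] using (map_ne_zero (algebraMap F K)).mpr h2
      rcases card_mod_four h2 with hq | hq
      -- The Cayley transform is taken with s = ιη/2, whose square is -γ/4; in the other case with s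
      -- = -ι and the parameter 2t + θ₀.
      · have hN : ¬ IsSquare (-((γ : F) / 4)) := by
          apply not_isSquare_neg (isSquare_neg_one_iff.mpr (by omega))
          rintro ⟨y, hy⟩
          have h4 : (4 : F) ≠ 0 := by
            rw [show (4 : F) = 2 * 2 by norm_num]
            exact mul_ne_zero h2 h2
          rw [div_eq_iff h4] at hy
          exact nonsquare_of_generator hε hγ ⟨2 * y, by rw [hy]; ring⟩
        obtain ⟨t, ht⟩ := exists_cayley_of_norm_eq_one hN (s := ι * η / 2) (by
          rw [div_pow, mul_pow, hι, hη]
          simp only [map_neg, map_div₀, map_ofNat (algebraMap F K)]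
          ring) hK hl
        exact ⟨t, by rw [chiT, if_pos hq, ht]⟩
      · have hm : ¬ IsSquare (-1 : F) := fun h => isSquare_neg_one_iff.mp h hq
        obtain ⟨t, ht⟩ := exists_cayley_of_norm_eq_one hm (s := -ι) (by
          rw [neg_sq, hι, map_neg, map_one]) hK hl
        refine ⟨(t - θ₀) / 2, ?_⟩
        rw [chiT, if_neg (by omega), mul_div_cancel₀ _ h2, sub_add_cancel, ← ht]
        simp [sub_eq_add_neg])
  exact ⟨{ ε := ε, ε_nonsquare := hε, γ := γ, γ_generator := hγ, rootε := s, rootε_sq := hs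
           ι := ι, ι_sq := hι, η := η, η_sq := hη, θ₀ := θ₀, θ₁ := θ₁
           θ_norm := fun h => (hθ h).1
           θ₀_nonsquare := fun h => (hθ h).2
           sq := fun x => if h : IsSquare x then h.choose else 0
           sq_sq := fun x h => by
             rw [dif_pos h, sq]
             exact h.choose_spec.symm
           α := α
           α_inv := fun l _ _ => hα l
           α_mem := fun l h0 h1 => (hα' l ⟨h0, h1⟩).1
           α_spec := fun l h0 h1 => (hα' l ⟨h0, h1⟩).2
           t := t
           t_inv := fun l _ => ht l
           t_spec := fun l hl => (ht' l hl).2 }⟩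

/-! ### Cube roots of unity -/

theorem exists_omega [Finite F] (hq : Nat.card F % 3 = 1) : ∃ ω : F, ω ^ 2 + ω + 1 = 0 := by
  have : Fact (Nat.Prime 3) := ⟨Nat.prime_three⟩
  obtain ⟨x, hx⟩ := exists_prime_orderOf_dvd_card' (G := Fˣ) 3 (by
    rw [Nat.card_units]
    omega)
  refine ⟨x, ?_⟩
  have h3 : (x : F) ^ 3 = 1 := by
    rw [← Units.val_pow_eq_pow_val, ← hx, pow_orderOf_eq_one, Units.val_one]
  have h1 : (x : F) - 1 ≠ 0 := fun h => by
    rw [sub_eq_zero, Units.val_eq_one] at h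
    rw [h, orderOf_one] at hx
    omega
  have : ((x : F) - 1) * (x ^ 2 + x + 1) = 0 := by linear_combination h3
  exact (mul_eq_zero.mp this).resolve_left h1

theorem card_mod_three_of_omega [Finite F] (h3 : (3 : F) ≠ 0) {ω : F} (hω : ω ^ 2 + ω + 1 = 0) :
    Nat.card F % 3 = 1 := by
  have h0 : ω ≠ 0 := by
    rintro rfl
    simp at hω
  have ho : orderOf (Units.mk0 ω h0) = 3 := by
    have : Fact (Nat.Prime 3) := ⟨Nat.prime_three⟩
    apply orderOf_eq_prime
    · ext
      simp only [Units.val_pow_eq_pow_val, Units.val_mk0, Units.val_one]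
      linear_combination (ω - 1) * hω
    · intro h
      have h1 : ω = 1 := by simpa using congrArg Units.val h
      rw [h1] at hω
      exact h3 (by linear_combination hω)
  have hd := orderOf_dvd_natCard (Units.mk0 ω h0)
  rw [ho, Nat.card_units] at hd
  have : 0 < Nat.card F := Nat.card_pos
  have : 1 < Nat.card F := Finite.one_lt_card
  omega

theorem eq_one_of_cube_eq_one [Finite F] (h3 : (3 : F) ≠ 0) (hq : Nat.card F % 3 ≠ 1) {x : F}
    (hx : x ^ 3 = 1) : x = 1 := by
  by_contra h
  have : (x - 1) * (x ^ 2 + x + 1) = 0 := by linear_combination hx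
  exact hq (card_mod_three_of_omega h3 ((mul_eq_zero.mp this).resolve_left (sub_ne_zero.mpr h)))

theorem generator_ne_cube [Finite F] (h3 : (3 : F) ≠ 0) (hq : Nat.card F % 3 = 1) {γ : Fˣ}
    (hγ : ∀ x : Fˣ, x ∈ Subgroup.zpowers γ) (y : F) : y ^ 3 ≠ γ := by
  intro hy
  obtain ⟨ω, hω⟩ := exists_omega hq
  have h0 : ω ≠ 0 := by
    rintro rfl
    simp at hω
  have hy0 : y ≠ 0 := by
    rintro rfl
    exact γ.ne_zero (by rw [← hy]; simp)
  -- If the generator were a cube, cubing would be surjective on the finite group, hence injective,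
  -- contrary to ω³ = 1.
  have hsurj : Function.Surjective (fun x : Fˣ => x ^ 3) := by
    intro x
    obtain ⟨k, rfl⟩ := hγ x
    refine ⟨Units.mk0 y hy0 ^ k, ?_⟩
    have e : Units.mk0 y hy0 ^ 3 = γ := by
      ext
      simpa using hy
    change (Units.mk0 y hy0 ^ k) ^ 3 = γ ^ k
    rw [← e, ← zpow_natCast, ← zpow_natCast, ← zpow_mul, ← zpow_mul, mul_comm]
  have hinj := Finite.injective_iff_surjective.mpr hsurj
  have h1 : Units.mk0 ω h0 = 1 := hinj (by
    ext
    simp only [Units.val_pow_eq_pow_val, Units.val_mk0, Units.val_one]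
    linear_combination (ω - 1) * hω)
  have h1' : ω = 1 := by simpa using congrArg Units.val h1
  rw [h1'] at hω
  exact h3 (by linear_combination hω)

theorem generator_sq_ne_cube [Finite F] (h3 : (3 : F) ≠ 0) (hq : Nat.card F % 3 = 1) {γ : Fˣ}
    (hγ : ∀ x : Fˣ, x ∈ Subgroup.zpowers γ) (y : F) : y ^ 3 ≠ (γ : F) ^ 2 := by
  intro hy
  have hy0 : y ≠ 0 := by
    rintro rfl
    exact pow_ne_zero 2 γ.ne_zero (by rw [← hy]; simp)
  apply generator_ne_cube h3 hq hγ (γ / y)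
  rw [div_pow, hy]
  have := γ.ne_zero
  field_simp

end

end BinaryQuartic

end

noncomputable section

namespace BinaryQuartic

open MvPolynomial

/-! ### Equivalence of forms and its invariants -/

section

variable {F : Type*} [Field F]

theorem IsClass.unique {f : MvPolynomial (Fin 2) F} {P Q : ProjQuartic F} (hP : IsClass f P)
    (hQ : IsClass f Q) : P = Q := by
  obtain ⟨_, _, rfl⟩ := hP
  obtain ⟨_, _, rfl⟩ := hQ
  rfl

/-- Two forms define points of the same orbit. -/
def Equivalent (f g : MvPolynomial (Fin 2) F) : Prop :=
  ∃ P Q : ProjQuartic F, IsClass f P ∧ IsClass g Q ∧ Q ∈ orb P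

theorem Equivalent.symm {f g : MvPolynomial (Fin 2) F} (h : Equivalent f g) : Equivalent g f := by
  obtain ⟨P, Q, hP, hQ, h⟩ := h
  exact ⟨Q, P, hQ, hP, MulAction.mem_orbit_symm.mp h⟩

theorem IsClass.equivalent {f g : MvPolynomial (Fin 2) F} {P Q : ProjQuartic F} (hP : IsClass f P)
    (hQ : IsClass g Q) (h : Q ∈ orb P) : Equivalent f g :=
  ⟨P, Q, hP, hQ, h⟩

theorem numLinearFactors_eq_zero_iff [Finite F] {v : Fin 5 → F} :
    numLinearFactors (ofCoeffs v) = 0 ↔ ¬ HasRoot v := by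
  refine ⟨fun h => ?_, numLinearFactors_eq_zero⟩
  rw [numLinearFactors_ofCoeffs, Nat.add_eq_zero_iff, Set.ncard_eq_zero (Set.toFinite _),
    Set.ncard_eq_zero (Set.toFinite _)] at h
  rintro ⟨x, y, hxy, hv⟩
  by_cases hx : x = 0
  · subst hx
    have hy : y ≠ 0 := by tauto
    have h0 : v 0 = 0 := by simpa [value, hy] using hv
    have : () ∈ ({_u : Unit | v 0 = 0} : Set Unit) := h0
    rw [h.2] at this
    exact this
  · have h1 : value v 1 (y / x) = 0 := by
      have := value_mul x v 1 (y / x)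
      rw [mul_one, mul_div_cancel₀ _ hx, hv] at this
      exact (mul_eq_zero.mp this.symm).resolve_left (pow_ne_zero _ hx)
    have : y / x ∈ {y : F | value v 1 y = 0} := h1
    rw [h.1] at this
    exact this

theorem Equivalent.numLinearFactors [Finite F] {f g : MvPolynomial (Fin 2) F} (h : Equivalent f g)
    (hg : numLinearFactors g = 0) : numLinearFactors f = 0 := by
  obtain ⟨P, Q, hP, hQ, h⟩ := h
  obtain ⟨v, rfl⟩ := exists_eq_ofCoeffs hP.1
  obtain ⟨w, rfl⟩ := exists_eq_ofCoeffs hQ.1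
  obtain ⟨hv, rfl⟩ := isClass_ofCoeffs_iff.mp hP
  obtain ⟨hw, rfl⟩ := isClass_ofCoeffs_iff.mp hQ
  obtain ⟨a, b, c, d, hd, hc⟩ := mem_orb_point_iff.mp h
  rw [numLinearFactors_eq_zero_iff] at hg ⊢
  exact fun hr => hg (hc.hasRoot hd hr)

/-- The number of linear factors of a form of the given type. -/
def FormType.roots : FormType → ℕ
  | .F4 => 4
  | .F2 => 2
  | .F1 => 1
  | .F4' => 0
  | .F2' => 0

theorem HasType.numLinearFactors {f : MvPolynomial (Fin 2) F} {T : FormType} (h : HasType f T) :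
    numLinearFactors f = T.roots := by
  cases T
  · exact h
  · exact h
  · exact h
  · exact h.1
  · exact h.1

namespace Row

variable {f g : MvPolynomial (Fin 2) F} {r r' : F} {T T' : FormType} {H H' : Type} [Group H]
  [Group H']

theorem projJ_eq (h : Row f r T H) {P : ProjQuartic F} (hP : IsClass f P) : projJ P = r := by
  obtain ⟨Q, hQ, -, hj, -⟩ := h
  rw [hP.unique hQ, hj]

/-- Only the presence of a root in F is compared. This suffices: forms with a root and the same `j`
are separated by their stabilizers or by hand. -/
theorem roots_eq_zero_iff [Finite F] (h : Row f r T H) (h' : Row g r' T' H')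
    (e : Equivalent f g) : T.roots = 0 ↔ T'.roots = 0 := by
  obtain ⟨P, -, -, -, hT, -⟩ := h
  obtain ⟨P', -, -, -, hT', -⟩ := h'
  rw [← hT.numLinearFactors, ← hT'.numLinearFactors]
  exact ⟨e.symm.numLinearFactors, e.numLinearFactors⟩

theorem nonempty_mulEquiv (h : Row f r T H) (h' : Row g r' T' H') (e : Equivalent f g) :
    Nonempty (H ≃* H') := by
  obtain ⟨P, hP, -, -, -, ⟨φ⟩⟩ := h
  obtain ⟨P', hP', -, -, -, ⟨φ'⟩⟩ := h'
  obtain ⟨Q, Q', hQ, hQ', γ, hγ⟩ := e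
  obtain rfl := hP.unique hQ
  obtain rfl := hP'.unique hQ'
  exact ⟨φ.symm.trans ((MulAction.stabilizerEquivStabilizer hγ.symm).trans φ')⟩

theorem card_eq (h : Row f r T H) (h' : Row g r' T' H') (e : Equivalent f g) :
    Nat.card H = Nat.card H' := by
  obtain ⟨φ⟩ := h.nonempty_mulEquiv h' e
  exact Nat.card_congr φ.toEquiv

end Row

/-- This separates ψ' for the class of 2 from υ' for -1: both have `j = 1728`, no root in F and a
stabilizer of order four. -/
theorem not_nonempty_klein_equiv_cyc_four : ¬ Nonempty (Cyc 2 × Cyc 2 ≃* Cyc 4) := by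
  rintro ⟨φ⟩
  have h : ∀ x : Cyc 2 × Cyc 2, x * x = 1 := by decide
  have h' : ∀ x : Cyc 4, x * x = 1 := fun x => by
    obtain ⟨y, rfl⟩ := φ.surjective x
    rw [← map_mul, h, map_one]
  exact absurd (h' (Multiplicative.ofAdd 1)) (by decide)

end

/-! ### Lists of representatives with given `j` -/

section

variable {F K : Type*} [Field F] [Field K] [Algebra F K]

/-- The list of the representatives with `j`-invariant `r`, with the orders of their
stabilizers. -/
structure RepFamily (c : Choices F K) (r : F) (L : List (MvPolynomial (Fin 2) F × ℕ)) : Prop where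
  row : ∀ p ∈ L, ∃ (T : FormType) (H : Type) (_ : Group H), Row p.1 r T H ∧ Nat.card H = p.2
  mem : ∀ p ∈ L, p.1 ∈ c.reps
  pairwise : L.Pairwise fun p p' => ¬ Equivalent p.1 p'.1
  sum : (L.map fun p => (1 / p.2 : ℚ)).sum = 1
  complete : ∀ g ∈ c.reps, ∀ Q, IsClass g Q → projJ Q = r → ∃ p ∈ L, g = p.1

theorem RepFamily.exists_isFamily {c : Choices F K} {r : F}
    {L : List (MvPolynomial (Fin 2) F × ℕ)} (h : RepFamily c r L) :
    ∃ P : Fin L.length → ProjQuartic F, (∀ i, IsClass (L.get i).1 (P i)) ∧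
      IsFamily r P (fun i => (L.get i).2) := by
  have hp : ∀ i, ∃ P, IsClass (L.get i).1 P ∧ DiscNeZero P ∧ projJ P = r ∧
      Nat.card (MulAction.stabilizer (Matrix.ProjGenLinGroup (Fin 2) F) P) = (L.get i).2 := by
    intro i
    obtain ⟨T, H, _, ⟨P, hP, hd, hj, -, ⟨φ⟩⟩, hn⟩ := h.row _ (L.get_mem i)
    exact ⟨P, hP, hd, hj, (Nat.card_congr φ.toEquiv).trans hn⟩
  choose P hP hd hj hn using hp
  refine ⟨P, hP, hd, hj, hn, fun i k hik => ?_, ?_⟩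
  · have hpw := List.pairwise_iff_get.mp h.pairwise
    rcases lt_trichotomy i k with hlt | heq | hgt
    · exact absurd ((hP i).equivalent (hP k) hik) (hpw i k hlt)
    · exact heq
    · exact absurd ((hP i).equivalent (hP k) hik).symm (hpw k i hgt)
  · exact (Fin.sum_univ_fun_getElem L fun p => (1 / p.2 : ℚ)).trans h.sum

namespace Choices

theorem psi_inv (c : Choices F K) {l : F} (h0 : l ≠ 0) (h1 : l ≠ 1) : c.psi l⁻¹ = c.psi l := by
  rw [psi, psi, c.α_inv l h0 h1]

theorem upsilon_inv (c : Choices F K) {l : K} (hl : l ∈ N2tilde F K) :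
    c.upsilon l⁻¹ = c.upsilon l := by
  rw [upsilon, upsilon, c.t_inv l hl]

theorem psi_equivalent_iff (h2 : (2 : F) ≠ 0) (c : Choices F K)
    (hK : Module.finrank F K = 2) {l m : F} (hl0 : l ≠ 0) (hl1 : l ≠ 1) (hm0 : m ≠ 0) (hm1 : m ≠ 1)
    (h : Equivalent (c.psi l) (c.psi m)) : m = l ∨ m * l = 1 := by
  obtain ⟨P, Q, hP, hQ, h⟩ := h
  exact c.psi_inequivalent h2 hK hl0 hl1 hm0 hm1 hP hQ h

theorem exists_row_E [Finite F] (h2 : (2 : F) ≠ 0) (h3 : (3 : F) ≠ 0) (c : Choices F K)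
    (hK : Module.finrank F K = 2) {r : F} (h0 : r ≠ 0) (h1728 : r ≠ 1728) :
    ∃ (T : FormType) (H : Type) (_ : Group H), Row (formE r) r T H := by
  rcases mem_Jset h2 h3 c.ε_nonsquare c.rootε_sq hK h0 h1728 with h | h | h
  · exact ⟨_, _, _, row_E_four h2 h3 h⟩
  · exact ⟨_, _, _, row_E_two h2 h3 h⟩
  · exact ⟨_, _, _, row_E_one h2 h3 h⟩

theorem exists_row_cube_one [Finite F] (h2 : (2 : F) ≠ 0) (h3 : (3 : F) ≠ 0) :
    ∃ (T : FormType) (H : Type) (_ : Group H), Row (formCube (1 : F)) 0 T H := by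
  by_cases hq : Nat.card F % 3 = 1
  · obtain ⟨ω, hω⟩ := exists_omega hq
    exact ⟨_, _, _, row_cube_one h2 h3 hω⟩
  · exact ⟨_, _, _, row_cube_one_two h2 h3 fun x => eq_one_of_cube_eq_one h3 hq⟩

theorem row_cube_generator [Finite F] (h2 : (2 : F) ≠ 0) (h3 : (3 : F) ≠ 0) (c : Choices F K)
    (hq : Nat.card F % 3 = 1) : Row (formCube (c.γ : F)) 0 .F1 (Cyc 3) := by
  obtain ⟨ω, hω⟩ := exists_omega hq
  exact row_cube_nonroot h2 h3 hω c.γ.ne_zero (generator_ne_cube h3 hq c.γ_generator)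

theorem row_cube_generator_sq [Finite F] (h2 : (2 : F) ≠ 0) (h3 : (3 : F) ≠ 0) (c : Choices F K)
    (hq : Nat.card F % 3 = 1) : Row (formCube ((c.γ : F) ^ 2)) 0 .F1 (Cyc 3) := by
  obtain ⟨ω, hω⟩ := exists_omega hq
  exact row_cube_nonroot h2 h3 hω (pow_ne_zero 2 c.γ.ne_zero)
    (generator_sq_ne_cube h3 hq c.γ_generator)

/-- Infinity is the only root in F of both forms, so it is fixed, and then the quotient γ of the
constants would be a cube. -/
theorem not_equivalent_cube_generator [Finite F] (h3 : (3 : F) ≠ 0)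
    (c : Choices F K) (hq : Nat.card F % 3 = 1) :
    ¬ Equivalent (formCube (c.γ : F)) (formCube ((c.γ : F) ^ 2)) := by
  rintro ⟨P, Q, hP, hQ, h⟩
  rw [formCube_eq] at hP hQ
  obtain ⟨hv, rfl⟩ := isClass_ofCoeffs_iff.mp hP
  obtain ⟨hw, rfl⟩ := isClass_ofCoeffs_iff.mp hQ
  obtain ⟨x, y, z, w, hd, hc⟩ := mem_orb_point_iff.mp h
  have hv := hc.value_eq_zero (L := F) (x := 0) (y := 1) (by simp [value, cubeV])
  simp only [Algebra.algebraMap_self, RingHom.id_apply, mul_zero, mul_one, zero_add] at hv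
  have hy : y = 0 := by
    by_contra hy
    have := value_mul y (cubeV ((c.γ : F) ^ 2)) 1 (w / y)
    rw [mul_one, mul_div_cancel₀ _ hy, hv, value_cube] at this
    have := (mul_eq_zero.mp this.symm).resolve_left (pow_ne_zero _ hy)
    exact generator_sq_ne_cube h3 hq c.γ_generator _ (sub_eq_zero.mp this)
  subst hy
  have hx : x ≠ 0 := by
    rintro rfl
    simp at hd
  have := (carries_cube_infty h3 hd hc).2
  apply generator_ne_cube h3 hq c.γ_generator (w / x)
  rw [div_pow, div_eq_iff (pow_ne_zero _ hx)]
  apply mul_left_cancel₀ c.γ.ne_zero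
  linear_combination this

/-- This sorts the representatives by `j`; it is the source of the field `complete` in each list,
and hence of the uniqueness of representatives. -/
theorem reps_cases [Finite F] (h2 : (2 : F) ≠ 0) (h3 : (3 : F) ≠ 0) (c : Choices F K)
    (hK : Module.finrank F K = 2) {g : MvPolynomial (Fin 2) F} (hg : g ∈ c.reps)
    {Q : ProjQuartic F} (hQ : IsClass g Q) {r : F} (hr : projJ Q = r) :
    (r ≠ 0 ∧ r ≠ 1728 ∧ g = formE r) ∨
    (r = 1728 ∧ (g = formSq 1 ∨ g = formSq c.ε)) ∨
    (r = 0 ∧ (g = formCube 1 ∨ Nat.card F % 3 = 1 ∧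
      (g = formCube (c.γ : F) ∨ g = formCube ((c.γ : F) ^ 2)))) ∨
    (∃ l : F, l ≠ 0 ∧ l ≠ 1 ∧ jLambda l = r ∧ g = c.psi l) ∨
    (∃ l ∈ N2tilde F K, jLambda l = algebraMap F K r ∧ g = c.upsilon l) := by
  subst hr
  rcases hg with ⟨r, h0, h1, rfl⟩ | rfl | rfl | rfl | ⟨hq, rfl | rfl⟩ | ⟨l, h0, h1, rfl⟩ |
    ⟨l, hl, rfl⟩
  · obtain ⟨T, H, _, h⟩ := c.exists_row_E h2 h3 hK h0 h1
    rw [h.projJ_eq hQ]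
    exact Or.inl ⟨h0, h1, rfl⟩
  · exact Or.inr (Or.inl ⟨(row_sq_one h2 h3).projJ_eq hQ, Or.inl rfl⟩)
  · exact Or.inr (Or.inl ⟨(row_sq_nonsquare h2 h3 c.ε_nonsquare).projJ_eq hQ, Or.inr rfl⟩)
  · obtain ⟨T, H, _, h⟩ := exists_row_cube_one h2 h3
    exact Or.inr (Or.inr (Or.inl ⟨h.projJ_eq hQ, Or.inl rfl⟩))
  · exact Or.inr (Or.inr (Or.inl ⟨(c.row_cube_generator h2 h3 hq).projJ_eq hQ,
      Or.inr ⟨hq, Or.inl rfl⟩⟩))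
  · exact Or.inr (Or.inr (Or.inl ⟨(c.row_cube_generator_sq h2 h3 hq).projJ_eq hQ,
      Or.inr ⟨hq, Or.inr rfl⟩⟩))
  · have h := c.row_psi h2 h3 hK h0 h1
    refine Or.inr (Or.inr (Or.inr (Or.inl ⟨l, h0, h1, ?_, rfl⟩)))
    by_cases hl : l = -1
    · exact ((h.1 hl).projJ_eq hQ).symm
    · exact ((h.2 hl).projJ_eq hQ).symm
  · obtain ⟨r, hr, h, h'⟩ := c.row_upsilon h2 h3 hK hl
    refine Or.inr (Or.inr (Or.inr (Or.inr ⟨l, hl, ?_, rfl⟩)))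
    rw [← hr]
    by_cases hl : l = -1
    · rw [(h hl).projJ_eq hQ]
    · rw [(h' hl).projJ_eq hQ]

end Choices

end

end BinaryQuartic

end

noncomputable section

namespace BinaryQuartic

open MvPolynomial

/-! ### Symmetries of `jLambda`, and orders of the stabilizers -/

section

variable {F : Type*} [Field F]

theorem jLambda_one_sub (l : F) : jLambda (1 - l) = jLambda l := by
  rw [jLambda, jLambda]
  congr 1 <;> ring

theorem jLambda_div_sub_one {l : F} (h1 : l ≠ 1) :
    jLambda (l / (l - 1)) = jLambda l := by
  have h1' := sub_ne_zero.mpr h1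
  have e : l / (l - 1) = 1 - (1 - l)⁻¹ := by
    rw [← neg_sub l 1, inv_neg]
    field_simp
    ring
  rw [e, jLambda_one_sub, jLambda_inv, jLambda_one_sub]

theorem jLambda_neg_one (h2 : (2 : F) ≠ 0) : jLambda (-1 : F) = 1728 := by
  have : (-1 : F) ≠ 1 := fun h => h2 (by linear_combination -h)
  exact (jLambda_eq_1728_iff h2 (neg_ne_zero.mpr one_ne_zero) this).mpr (Or.inl rfl)

theorem card_cyc (n : ℕ) : Nat.card (Cyc n) = n :=
  (Nat.card_congr Multiplicative.toAdd).trans (Nat.card_zmod n)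

theorem card_klein : Nat.card (Cyc 2 × Cyc 2) = 4 := by
  rw [Nat.card_prod, card_cyc]

theorem card_dihedral : Nat.card (DihedralGroup 4) = 8 := by
  rw [DihedralGroup.nat_card]

theorem card_alternating : Nat.card (alternatingGroup (Fin 4)) = 12 := by
  rw [nat_card_alternatingGroup]
  simp only [Nat.card_eq_fintype_card, Fintype.card_fin]
  rfl

end

/-! ### The list of representatives for each value of `j` -/

section

variable {F K : Type*} [Field F] [Field K] [Algebra F K]

theorem neg_one_mem_N2tilde (h2 : (2 : F) ≠ 0) (hK : Module.finrank F K = 2) :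
    (-1 : K) ∈ N2tilde F K := by
  have k2 : (2 : K) ≠ 0 := by
    simpa [map_ofNat (algebraMap F K)] using (map_ne_zero (algebraMap F K)).mpr h2
  refine ⟨fun h => k2 (by linear_combination -h), ?_⟩
  have := Algebra.norm_algebraMap (S := K) (-1 : F)
  rw [hK, map_neg, map_one] at this
  rw [this]
  ring

theorem sq_eq_one_of_mem_N2tilde (hK : Module.finrank F K = 2) {x : F}
    (h : algebraMap F K x ∈ N2tilde F K) : x ^ 2 = 1 := by
  have := h.2
  rwa [Algebra.norm_algebraMap, hK] at this

namespace Choices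

theorem row_psi_generic [Finite F] (h2 : (2 : F) ≠ 0) (h3 : (3 : F) ≠ 0) (c : Choices F K)
    (hK : Module.finrank F K = 2) {l r : F} (h0 : l ≠ 0) (h1 : l ≠ 1) (hl : l ≠ -1) (hr : jLambda l = r) :
    Row (c.psi l) r .F4' (Cyc 2 × Cyc 2) :=
  hr ▸ (c.row_psi h2 h3 hK h0 h1).2 hl

theorem row_psi_neg_one [Finite F] (h2 : (2 : F) ≠ 0) (h3 : (3 : F) ≠ 0) (c : Choices F K)
    (hK : Module.finrank F K = 2) : Row (c.psi (-1)) 1728 .F4' (DihedralGroup 4) := by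
  have := (c.row_psi h2 h3 hK (l := -1) (neg_ne_zero.mpr one_ne_zero)
    (fun h => h2 (by linear_combination -h))).1 rfl
  rwa [jLambda_neg_one h2] at this

theorem row_upsilon_generic [Finite F] (h2 : (2 : F) ≠ 0) (h3 : (3 : F) ≠ 0) (c : Choices F K)
    (hK : Module.finrank F K = 2) {l : K} {r : F} (h : l ∈ N2tilde F K) (hl : l ≠ -1)
    (hr : jLambda l = algebraMap F K r) : Row (c.upsilon l) r .F2' (Cyc 2) := by
  obtain ⟨r', hr', -, hrow⟩ := c.row_upsilon h2 h3 hK h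
  obtain rfl : r' = r := (algebraMap F K).injective (hr'.trans hr)
  exact hrow hl

theorem row_upsilon_neg_one [Finite F] (h2 : (2 : F) ≠ 0) (h3 : (3 : F) ≠ 0) (c : Choices F K)
    (hK : Module.finrank F K = 2) : Row (c.upsilon (-1)) 1728 .F2' (Cyc 4) := by
  have k2 : (2 : K) ≠ 0 := by
    simpa [map_ofNat (algebraMap F K)] using (map_ne_zero (algebraMap F K)).mpr h2
  obtain ⟨r', hr', hrow, -⟩ := c.row_upsilon h2 h3 hK (neg_one_mem_N2tilde h2 hK)
  obtain rfl : r' = 1728 := (algebraMap F K).injective (by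
    rw [hr', jLambda_neg_one k2, map_ofNat])
  exact hrow rfl

theorem psi_mem_reps (c : Choices F K) {l : F} (h0 : l ≠ 0) (h1 : l ≠ 1) : c.psi l ∈ c.reps :=
  Or.inr (Or.inr (Or.inr (Or.inr (Or.inr (Or.inl ⟨l, h0, h1, rfl⟩)))))

theorem upsilon_mem_reps (c : Choices F K) {l : K} (hl : l ∈ N2tilde F K) : c.upsilon l ∈ c.reps :=
  Or.inr (Or.inr (Or.inr (Or.inr (Or.inr (Or.inr ⟨l, hl, rfl⟩)))))

theorem formE_mem_reps (c : Choices F K) {r : F} (h0 : r ≠ 0) (h1 : r ≠ 1728) : formE r ∈ c.reps :=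
  Or.inl ⟨r, h0, h1, rfl⟩

/-- The six cross-ratios l, 1/l, 1 - l, 1/(1 - l), l/(l - 1), 1 - 1/l fall into three classes under
inversion. These are distinct since `j ≠ 0, 1728`, so there are three forms ψ' besides `formE r`,
all with stabilizers of order four. -/
theorem repFamily_four [Finite F] (h2 : (2 : F) ≠ 0) (h3 : (3 : F) ≠ 0) (c : Choices F K)
    (hK : Module.finrank F K = 2) {r : F} (hr : r ∈ Jset F 4) {l : F} (h0 : l ≠ 0) (h1 : l ≠ 1)
    (hl : jLambda l = r) :
    RepFamily c r [(formE r, 4), (c.psi l, 4), (c.psi (1 - l), 4), (c.psi (l / (l - 1)), 4)] := by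
  obtain ⟨r0, r1, hn⟩ := id hr
  have hl' := hl
  subst hl'
  have h1' := sub_ne_zero.mpr h1
  have hm : ∀ m : F, jLambda m = jLambda l → m ≠ -1 := by
    rintro m hm rfl
    rw [jLambda_neg_one h2] at hm
    exact r1 hm.symm
  have hA := sq_sub_add_ne_of_jLambda r0
  have hn := mt (jLambda_eq_1728_iff h2 h0 h1).mpr r1
  push Not at hn
  obtain ⟨n1, n2, n3⟩ := hn
  have p0 : 1 - l ≠ 0 := sub_ne_zero.mpr h1.symm
  have p1 : 1 - l ≠ 1 := by simpa using h0
  have q0 : l / (l - 1) ≠ 0 := div_ne_zero h0 h1'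
  have q1 : l / (l - 1) ≠ 1 := by
    rw [Ne, div_eq_one_iff_eq h1']
    exact fun h => one_ne_zero (α := F) (by linear_combination h)
  have rE := row_E_four h2 h3 hr
  have rl := c.row_psi_generic h2 h3 hK h0 h1 n1 rfl
  have rp := c.row_psi_generic h2 h3 hK p0 p1 (hm _ (jLambda_one_sub l)) (jLambda_one_sub l)
  have rq := c.row_psi_generic h2 h3 hK q0 q1 (hm _ (jLambda_div_sub_one h1))
    (jLambda_div_sub_one h1)
  refine ⟨?_, ?_, ?_, by norm_num, ?_⟩
  · simp only [List.forall_mem_cons, List.not_mem_nil, false_imp_iff, implies_true, and_true]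
    exact ⟨⟨_, _, _, rE, card_klein⟩, ⟨_, _, _, rl, card_klein⟩, ⟨_, _, _, rp, card_klein⟩,
      ⟨_, _, _, rq, card_klein⟩⟩
  · simp only [List.forall_mem_cons, List.not_mem_nil, false_imp_iff, implies_true, and_true]
    exact ⟨c.formE_mem_reps r0 r1, c.psi_mem_reps h0 h1, c.psi_mem_reps p0 p1,
      c.psi_mem_reps q0 q1⟩
  · simp only [List.pairwise_cons, List.forall_mem_cons, List.not_mem_nil, false_imp_iff,
      implies_true, and_true, List.Pairwise.nil]
    have hroots : ¬ (FormType.F4.roots = 0 ↔ FormType.F4'.roots = 0) := by decide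
    refine ⟨⟨fun h => hroots (rE.roots_eq_zero_iff rl h), fun h => hroots (rE.roots_eq_zero_iff rp h),
      fun h => hroots (rE.roots_eq_zero_iff rq h)⟩, ⟨fun h => ?_, fun h => ?_⟩, fun h => ?_⟩
    · rcases c.psi_equivalent_iff h2 hK h0 h1 p0 p1 h with h | h
      · exact n3 (eq_inv_of_mul_eq_one_left (by linear_combination -h))
      · exact hA (by linear_combination -h)
    · rcases c.psi_equivalent_iff h2 hK h0 h1 q0 q1 h with h | h
      · rw [div_eq_iff h1'] at h
        exact n2 (mul_left_cancel₀ h0 (by linear_combination -h))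
      · field_simp at h
        exact hA (by linear_combination h)
    · rcases c.psi_equivalent_iff h2 hK p0 p1 q0 q1 h with h | h
      · rw [div_eq_iff h1'] at h
        exact hA (by linear_combination h)
      · field_simp at h
        exact n1 (mul_left_cancel₀ p0 (by linear_combination h))
  · intro g hg Q hQ hj
    simp only [List.exists_mem_cons_iff, List.not_mem_nil, false_and, exists_false, or_false]
    rcases c.reps_cases h2 h3 hK hg hQ hj with ⟨-, -, e⟩ | ⟨e, -⟩ | ⟨e, -⟩ | ⟨m, m0, m1, e, rfl⟩ |
      ⟨m, hm, e, -⟩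
    · exact Or.inl e
    · exact absurd e r1
    · exact absurd e r0
    · right
      rcases eq_of_jLambda_eq h2 h0 h1 m0 m1 e with e | e | e | e | e | e
      · exact Or.inl (by rw [e])
      · left
        rw [← c.psi_inv h0 h1, eq_inv_of_mul_eq_one_left e]
      · right; left
        rw [eq_sub_of_add_eq e]
      · right; right
        rw [← c.psi_inv q0 q1]
        congr 1
        field_simp
        exact e
      · right; left
        rw [← c.psi_inv p0 p1]
        congr 1
        apply eq_inv_of_mul_eq_one_left
        linear_combination -e
      · right; right
        congr 1
        field_simp
        linear_combination e
    · have := (mem_Jset_two h2 h3 c.ε_nonsquare c.rootε_sq hK hm e.symm r0 r1).2.2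
      have := hr.2.2
      omega

/-- Over J₂ the elements of norm one with this `j` form a single class, and no cross-ratio lies in
F, as that would give three roots of the resolvent. -/
theorem repFamily_two [Finite F] (h2 : (2 : F) ≠ 0) (h3 : (3 : F) ≠ 0) (c : Choices F K)
    (hK : Module.finrank F K = 2) {r : F} (hr : r ∈ Jset F 2) {l : K} (h : l ∈ N2tilde F K)
    (hl : jLambda l = algebraMap F K r) :
    RepFamily c r [(formE r, 2), (c.upsilon l, 2)] := by
  obtain ⟨r0, r1, hn⟩ := id hr
  have k2 : (2 : K) ≠ 0 := by
    simpa [map_ofNat (algebraMap F K)] using (map_ne_zero (algebraMap F K)).mpr h2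
  have hl1 : l ≠ -1 := by
    rintro rfl
    rw [jLambda_neg_one k2] at hl
    exact r1 ((algebraMap F K).injective (by rw [← hl, map_ofNat]))
  have rE := row_E_two h2 h3 hr
  have rl := c.row_upsilon_generic h2 h3 hK h hl1 hl
  refine ⟨?_, ?_, ?_, by norm_num, ?_⟩
  · simp only [List.forall_mem_cons, List.not_mem_nil, false_imp_iff, implies_true, and_true]
    exact ⟨⟨_, _, _, rE, card_cyc 2⟩, ⟨_, _, _, rl, card_cyc 2⟩⟩
  · simp only [List.forall_mem_cons, List.not_mem_nil, false_imp_iff, implies_true, and_true]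
    exact ⟨c.formE_mem_reps r0 r1, c.upsilon_mem_reps h⟩
  · simp only [List.pairwise_cons, List.forall_mem_cons, List.not_mem_nil, false_imp_iff,
      implies_true, and_true, List.Pairwise.nil]
    have hroots : ¬ (FormType.F2.roots = 0 ↔ FormType.F2'.roots = 0) := by decide
    exact fun h => hroots (rE.roots_eq_zero_iff rl h)
  · intro g hg Q hQ hj
    simp only [List.exists_mem_cons_iff, List.not_mem_nil, false_and, exists_false, or_false]
    rcases c.reps_cases h2 h3 hK hg hQ hj with ⟨-, -, e⟩ | ⟨e, -⟩ | ⟨e, -⟩ | ⟨m, m0, m1, e, rfl⟩ |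
      ⟨m, hm, e, rfl⟩
    · exact Or.inl e
    · exact absurd e r1
    · exact absurd e r0
    · subst e
      have := (jLambda_mem_Jset_four h2 h3 m0 m1 r0 r1).2.2
      omega
    · right
      rcases N2tilde_eq_or_eq_inv h2 c.ε_nonsquare c.rootε_sq hK h hm (e.trans hl.symm) with rfl | rfl
      · rfl
      · rw [c.upsilon_inv h]

theorem repFamily_one [Finite F] (h2 : (2 : F) ≠ 0) (h3 : (3 : F) ≠ 0) (c : Choices F K)
    (hK : Module.finrank F K = 2) {r : F} (hr : r ∈ Jset F 1) : RepFamily c r [(formE r, 1)] := by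
  obtain ⟨r0, r1, hn⟩ := id hr
  have rE := row_E_one h2 h3 hr
  refine ⟨?_, ?_, by simp, by norm_num, ?_⟩
  · simp only [List.forall_mem_cons, List.not_mem_nil, false_imp_iff, implies_true, and_true]
    exact ⟨_, _, _, rE, by simp⟩
  · simp only [List.forall_mem_cons, List.not_mem_nil, false_imp_iff, implies_true, and_true]
    exact c.formE_mem_reps r0 r1
  · intro g hg Q hQ hj
    simp only [List.exists_mem_cons_iff, List.not_mem_nil, false_and, exists_false, or_false]
    rcases c.reps_cases h2 h3 hK hg hQ hj with ⟨-, -, e⟩ | ⟨e, -⟩ | ⟨e, -⟩ | ⟨m, m0, m1, e, rfl⟩ |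
      ⟨m, hm, e, rfl⟩
    · exact e
    · exact absurd e r1
    · exact absurd e r0
    · subst e
      have := (jLambda_mem_Jset_four h2 h3 m0 m1 r0 r1).2.2
      omega
    · have := (mem_Jset_two h2 h3 c.ε_nonsquare c.rootε_sq hK hm e.symm r0 r1).2.2
      omega

theorem row_psi_two [Finite F] (h2 : (2 : F) ≠ 0) (h3 : (3 : F) ≠ 0) (c : Choices F K)
    (hK : Module.finrank F K = 2) {l : F} (hl : l = 2 ∨ l = 2⁻¹) : Row (c.psi l) 1728 .F4' (Cyc 2 × Cyc 2) := by
  have h20 : (2 : F) ≠ 1 := fun h => one_ne_zero (α := F) (by linear_combination h)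
  have h0 : l ≠ 0 := by
    rcases hl with rfl | rfl
    · exact h2
    · exact inv_ne_zero h2
  have h1 : l ≠ 1 := by
    rcases hl with rfl | rfl
    · exact h20
    · rwa [Ne, inv_eq_one]
  refine c.row_psi_generic h2 h3 hK h0 h1 ?_ ((jLambda_eq_1728_iff h2 h0 h1).mpr (Or.inr hl))
  rcases hl with rfl | rfl
  · exact fun h => h3 (by linear_combination h)
  · rw [Ne, inv_eq_iff_eq_inv, inv_neg, inv_one]
    exact fun h => h3 (by linear_combination h)

/-- The masses are 1/8 + 1/4 + 1/8 + 1/4 + 1/4. The cross-ratios -1, 2, 1/2 in F form the classes of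
-1 and of 2. -/
theorem repFamily_1728 [Finite F] (h2 : (2 : F) ≠ 0) (h3 : (3 : F) ≠ 0) (c : Choices F K)
    (hK : Module.finrank F K = 2) : RepFamily c 1728 [(formSq 1, 8), (formSq c.ε, 4), (c.psi (-1), 8),
    (c.psi 2, 4), (c.upsilon (-1), 4)] := by
  have h20 : (2 : F) ≠ 1 := fun h => one_ne_zero (α := F) (by linear_combination h)
  have hn1 : (-1 : F) ≠ 1 := fun h => h2 (by linear_combination -h)
  have hn0 : (-1 : F) ≠ 0 := neg_ne_zero.mpr one_ne_zero
  have k2 : (2 : K) ≠ 0 := by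
    simpa [map_ofNat (algebraMap F K)] using (map_ne_zero (algebraMap F K)).mpr h2
  have r1 := row_sq_one (F := F) h2 h3
  have r2 := row_sq_nonsquare h2 h3 c.ε_nonsquare
  have r3 := c.row_psi_neg_one h2 h3 hK
  have r4 := c.row_psi_two h2 h3 hK (Or.inl rfl)
  have r5 := c.row_upsilon_neg_one h2 h3 hK
  refine ⟨?_, ?_, ?_, by norm_num, ?_⟩
  · simp only [List.forall_mem_cons, List.not_mem_nil, false_imp_iff, implies_true, and_true]
    exact ⟨⟨_, _, _, r1, card_dihedral⟩, ⟨_, _, _, r2, card_klein⟩, ⟨_, _, _, r3, card_dihedral⟩,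
      ⟨_, _, _, r4, card_klein⟩, ⟨_, _, _, r5, card_cyc 4⟩⟩
  · simp only [List.forall_mem_cons, List.not_mem_nil, false_imp_iff, implies_true, and_true]
    exact ⟨Or.inr (Or.inl rfl), Or.inr (Or.inr (Or.inl rfl)), c.psi_mem_reps hn0 hn1,
      c.psi_mem_reps h2 h20, c.upsilon_mem_reps (neg_one_mem_N2tilde h2 hK)⟩
  · simp only [List.pairwise_cons, List.forall_mem_cons, List.not_mem_nil, false_imp_iff,
      implies_true, and_true, List.Pairwise.nil]
    have a1 : ¬ (FormType.F4.roots = 0 ↔ FormType.F4'.roots = 0) := by decide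
    have a2 : ¬ (FormType.F4.roots = 0 ↔ FormType.F2'.roots = 0) := by decide
    have a3 : ¬ (FormType.F2.roots = 0 ↔ FormType.F4'.roots = 0) := by decide
    have a4 : ¬ (FormType.F2.roots = 0 ↔ FormType.F2'.roots = 0) := by decide
    have b1 : Nat.card (DihedralGroup 4) ≠ Nat.card (Cyc 2 × Cyc 2) := by
      rw [card_dihedral, card_klein]; norm_num
    have b2 : Nat.card (DihedralGroup 4) ≠ Nat.card (Cyc 4) := by
      rw [card_dihedral, card_cyc]; norm_num
    exact ⟨⟨fun h => b1 (r1.card_eq r2 h), fun h => a1 (r1.roots_eq_zero_iff r3 h),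
      fun h => a1 (r1.roots_eq_zero_iff r4 h), fun h => a2 (r1.roots_eq_zero_iff r5 h)⟩,
      ⟨fun h => a3 (r2.roots_eq_zero_iff r3 h), fun h => a3 (r2.roots_eq_zero_iff r4 h),
        fun h => a4 (r2.roots_eq_zero_iff r5 h)⟩,
      ⟨fun h => b1 (r3.card_eq r4 h), fun h => b2 (r3.card_eq r5 h)⟩,
      fun h => not_nonempty_klein_equiv_cyc_four (r4.nonempty_mulEquiv r5 h)⟩
  · intro g hg Q hQ hj
    have h1728 := (ne_zero_of_two_three h2 h3).2.2.2.2.2.2.2.2.1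
    simp only [List.exists_mem_cons_iff, List.not_mem_nil, false_and, exists_false, or_false]
    rcases c.reps_cases h2 h3 hK hg hQ hj with ⟨-, e, -⟩ | ⟨-, e | e⟩ | ⟨e, -⟩ |
      ⟨m, m0, m1, e, rfl⟩ | ⟨m, hm, e, rfl⟩
    · exact absurd rfl e
    · exact Or.inl e
    · exact Or.inr (Or.inl e)
    · exact absurd e h1728
    · right; right
      rcases (jLambda_eq_1728_iff h2 m0 m1).mp e with rfl | rfl | rfl
      · exact Or.inl rfl
      · exact Or.inr (Or.inl rfl)
      · rw [c.psi_inv h2 h20]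
        exact Or.inr (Or.inl rfl)
    · right; right; right; right
      -- Among the elements of norm one only -1 and its inverse, which is -1 again, have this `j`.
      rw [← jLambda_neg_one h2, algebraMap_jLambda, map_neg, map_one] at e
      rcases N2tilde_eq_or_eq_inv h2 c.ε_nonsquare c.rootε_sq hK (neg_one_mem_N2tilde h2 hK) hm e
        with rfl | rfl
      · rfl
      · rw [inv_neg, inv_one]

theorem row_psi_omega [Finite F] (h2 : (2 : F) ≠ 0) (h3 : (3 : F) ≠ 0) (c : Choices F K)
    (hK : Module.finrank F K = 2) {l : F} (hl : l ^ 2 - l + 1 = 0) :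
    l ≠ 0 ∧ l ≠ 1 ∧ Row (c.psi l) 0 .F4' (Cyc 2 × Cyc 2) := by
  have h0 : l ≠ 0 := by
    rintro rfl
    simp at hl
  have h1 : l ≠ 1 := by
    rintro rfl
    simp at hl
  refine ⟨h0, h1, c.row_psi_generic h2 h3 hK h0 h1 ?_ ((jLambda_eq_zero_iff h2 h0 h1).mpr hl)⟩
  rintro rfl
  exact h3 (by linear_combination hl)

theorem row_upsilon_omega [Finite F] (h2 : (2 : F) ≠ 0) (h3 : (3 : F) ≠ 0) (c : Choices F K)
    (hK : Module.finrank F K = 2) {l : K} (h : l ∈ N2tilde F K) (hl : l ^ 2 - l + 1 = 0) :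
    Row (c.upsilon l) 0 .F2' (Cyc 2) := by
  have : FiniteDimensional F K := FiniteDimensional.of_finrank_pos (by omega)
  have k2 : (2 : K) ≠ 0 := by
    simpa [map_ofNat (algebraMap F K)] using (map_ne_zero (algebraMap F K)).mpr h2
  have k3 : (3 : K) ≠ 0 := by
    simpa [map_ofNat (algebraMap F K)] using (map_ne_zero (algebraMap F K)).mpr h3
  refine c.row_upsilon_generic h2 h3 hK h ?_ ?_
  · rintro rfl
    exact k3 (by linear_combination hl)
  · rw [map_zero, jLambda_eq_zero_iff k2 (N2tilde_ne_zero h) h.1, hl]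

/-- The masses are 1/12 + 1/3 + 1/3 + 1/4. Both roots of l² - l + 1 lie in F and are inverse to each
other, so they give one form ψ' and no υ'. -/
theorem repFamily_zero_one [Finite F] (h2 : (2 : F) ≠ 0) (h3 : (3 : F) ≠ 0) (c : Choices F K)
    (hK : Module.finrank F K = 2) (hq : Nat.card F % 3 = 1) {l : F} (hl : l ^ 2 - l + 1 = 0) :
    RepFamily c 0 [(formCube 1, 12), (formCube (c.γ : F), 3), (formCube ((c.γ : F) ^ 2), 3),
      (c.psi l, 4)] := by
  have : FiniteDimensional F K := FiniteDimensional.of_finrank_pos (by omega)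
  have k2 : (2 : K) ≠ 0 := by
    simpa [map_ofNat (algebraMap F K)] using (map_ne_zero (algebraMap F K)).mpr h2
  obtain ⟨ω, hω⟩ := exists_omega hq
  have r1 := row_cube_one h2 h3 hω
  have r2 := c.row_cube_generator h2 h3 hq
  have r3 := c.row_cube_generator_sq h2 h3 hq
  obtain ⟨h0, h1, r4⟩ := c.row_psi_omega h2 h3 hK hl
  refine ⟨?_, ?_, ?_, by norm_num, ?_⟩
  · simp only [List.forall_mem_cons, List.not_mem_nil, false_imp_iff, implies_true, and_true]
    exact ⟨⟨_, _, _, r1, card_alternating⟩, ⟨_, _, _, r2, card_cyc 3⟩, ⟨_, _, _, r3, card_cyc 3⟩,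
      ⟨_, _, _, r4, card_klein⟩⟩
  · simp only [List.forall_mem_cons, List.not_mem_nil, false_imp_iff, implies_true, and_true]
    exact ⟨Or.inr (Or.inr (Or.inr (Or.inl rfl))),
      Or.inr (Or.inr (Or.inr (Or.inr (Or.inl ⟨hq, Or.inl rfl⟩)))),
      Or.inr (Or.inr (Or.inr (Or.inr (Or.inl ⟨hq, Or.inr rfl⟩)))), c.psi_mem_reps h0 h1⟩
  · simp only [List.pairwise_cons, List.forall_mem_cons, List.not_mem_nil, false_imp_iff,
      implies_true, and_true, List.Pairwise.nil]
    have b1 : Nat.card (alternatingGroup (Fin 4)) ≠ Nat.card (Cyc 3) := by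
      rw [card_alternating, card_cyc]; norm_num
    have b2 : Nat.card (alternatingGroup (Fin 4)) ≠ Nat.card (Cyc 2 × Cyc 2) := by
      rw [card_alternating, card_klein]; norm_num
    have b3 : Nat.card (Cyc 3) ≠ Nat.card (Cyc 2 × Cyc 2) := by
      rw [card_cyc, card_klein]; norm_num
    exact ⟨⟨fun h => b1 (r1.card_eq r2 h), fun h => b1 (r1.card_eq r3 h),
      fun h => b2 (r1.card_eq r4 h)⟩, ⟨c.not_equivalent_cube_generator h3 hq,
      fun h => b3 (r2.card_eq r4 h)⟩, fun h => b3 (r3.card_eq r4 h)⟩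
  · intro g hg Q hQ hj
    have h1728 := (ne_zero_of_two_three h2 h3).2.2.2.2.2.2.2.2.1
    simp only [List.exists_mem_cons_iff, List.not_mem_nil, false_and, exists_false, or_false]
    rcases c.reps_cases h2 h3 hK hg hQ hj with ⟨e, -⟩ | ⟨e, -⟩ | ⟨-, e | ⟨-, e | e⟩⟩ |
      ⟨m, m0, m1, e, rfl⟩ | ⟨m, hm, e, rfl⟩
    · exact absurd rfl e
    · exact absurd e.symm h1728
    · exact Or.inl e
    · exact Or.inr (Or.inl e)
    · exact Or.inr (Or.inr (Or.inl e))
    · right; right; right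
      rw [jLambda_eq_zero_iff h2 m0 m1] at e
      have : (m - l) * (m + l - 1) = 0 := by linear_combination e - hl
      rcases mul_eq_zero.mp this with h | h
      · rw [sub_eq_zero.mp h]
      · rw [← c.psi_inv h0 h1]
        congr 1
        apply eq_inv_of_mul_eq_one_left
        linear_combination l * h - hl
    -- A root m of m² - m + 1 lies in F, where the norm is squaring. Then m² = 1, hence m = 2 and 3
    -- = 0.
    · exfalso
      rw [map_zero, jLambda_eq_zero_iff k2 (N2tilde_ne_zero hm) hm.1] at e
      have hl' : algebraMap F K l ^ 2 - algebraMap F K l + 1 = 0 := by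
        rw [← map_pow, ← map_sub, ← map_one (algebraMap F K), ← map_add, hl, map_zero]
      have hlm : ∀ x : F, x ^ 2 - x + 1 = 0 → m ≠ algebraMap F K x := by
        rintro x hx rfl
        have h1 := sq_eq_one_of_mem_N2tilde hK hm
        have hx2 : x = 2 := by linear_combination h1 - hx
        rw [hx2] at hx
        exact h3 (by linear_combination hx)
      have : (m - algebraMap F K l) * (m - algebraMap F K (1 - l)) = 0 := by
        rw [map_sub, map_one]
        linear_combination e - hl'
      rcases mul_eq_zero.mp this with h | h
      · exact hlm l hl (sub_eq_zero.mp h)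
      · exact hlm (1 - l) (by linear_combination hl) (sub_eq_zero.mp h)

/-- The masses are 1/2 + 1/2. Without cube roots of unity in F, the roots of l² - l + 1 occur only
among elements of norm one. -/
theorem repFamily_zero_two [Finite F] (h2 : (2 : F) ≠ 0) (h3 : (3 : F) ≠ 0) (c : Choices F K)
    (hK : Module.finrank F K = 2) (hq : Nat.card F % 3 ≠ 1) {l : K} (h : l ∈ N2tilde F K)
    (hl : l ^ 2 - l + 1 = 0) : RepFamily c 0 [(formCube 1, 2), (c.upsilon l, 2)] := by
  have : FiniteDimensional F K := FiniteDimensional.of_finrank_pos (by omega)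
  have k2 : (2 : K) ≠ 0 := by
    simpa [map_ofNat (algebraMap F K)] using (map_ne_zero (algebraMap F K)).mpr h2
  have r1 := row_cube_one_two h2 h3 fun x => eq_one_of_cube_eq_one (x := x) h3 hq
  have r2 := c.row_upsilon_omega h2 h3 hK h hl
  refine ⟨?_, ?_, ?_, by norm_num, ?_⟩
  · simp only [List.forall_mem_cons, List.not_mem_nil, false_imp_iff, implies_true, and_true]
    exact ⟨⟨_, _, _, r1, card_cyc 2⟩, ⟨_, _, _, r2, card_cyc 2⟩⟩
  · simp only [List.forall_mem_cons, List.not_mem_nil, false_imp_iff, implies_true, and_true]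
    exact ⟨Or.inr (Or.inr (Or.inr (Or.inl rfl))), c.upsilon_mem_reps h⟩
  · simp only [List.pairwise_cons, List.forall_mem_cons, List.not_mem_nil, false_imp_iff,
      implies_true, and_true, List.Pairwise.nil]
    have hroots : ¬ (FormType.F2.roots = 0 ↔ FormType.F2'.roots = 0) := by decide
    exact fun h => hroots (r1.roots_eq_zero_iff r2 h)
  · intro g hg Q hQ hj
    have h1728 := (ne_zero_of_two_three h2 h3).2.2.2.2.2.2.2.2.1
    simp only [List.exists_mem_cons_iff, List.not_mem_nil, false_and, exists_false, or_false]
    rcases c.reps_cases h2 h3 hK hg hQ hj with ⟨e, -⟩ | ⟨e, -⟩ | ⟨-, e | ⟨e, -⟩⟩ |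
      ⟨m, m0, m1, e, rfl⟩ | ⟨m, hm, e, rfl⟩
    · exact absurd rfl e
    · exact absurd e.symm h1728
    · exact Or.inl e
    · exact absurd e hq
    · rw [jLambda_eq_zero_iff h2 m0 m1] at e
      exact absurd (card_mod_three_of_omega h3 (ω := -m) (by linear_combination e)) hq
    · right
      have e' : jLambda m = jLambda l := by
        rw [e, map_zero, (jLambda_eq_zero_iff k2 (N2tilde_ne_zero h) h.1).mpr hl]
      rcases N2tilde_eq_or_eq_inv h2 c.ε_nonsquare c.rootε_sq hK h hm e' with rfl | rfl
      · rfl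
      · rw [c.upsilon_inv h]

end Choices

end

end BinaryQuartic

end

noncomputable section

namespace BinaryQuartic

open MvPolynomial

/-! ### Counting along fibres -/

theorem ncard_eq_sum_fiber {α β : Type*} [Finite α] [Fintype β] (S : Set α) (h : α → β) :
    S.ncard = ∑ b, {x ∈ S | h x = b}.ncard := by
  classical
  have := Fintype.ofFinite α
  rw [Set.ncard_eq_toFinset_card']
  rw [Finset.card_eq_sum_card_fiberwise (f := h) (t := Finset.univ) (fun _ _ => Finset.mem_coe.mpr (Finset.mem_univ _))]
  refine Finset.sum_congr rfl fun b _ => ?_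
  rw [Set.ncard_eq_toFinset_card']
  congr 1
  ext x
  simp

theorem ncard_eq_mul_of_fiber {α β : Type*} [Finite α] [Finite β] (S : Set α) (J : Set β) (h : α → β)
    {m : ℕ} (hJ : ∀ b ∈ J, {x ∈ S | h x = b}.ncard = m) (hS : ∀ x ∈ S, h x ∈ J) :
    S.ncard = m * J.ncard := by
  classical
  have := Fintype.ofFinite β
  have e : ∀ b, {x ∈ S | h x = b}.ncard = if b ∈ J then m else 0 := by
    intro b
    split_ifs with hb
    · exact hJ b hb
    · rw [Set.ncard_eq_zero (Set.toFinite _), Set.eq_empty_iff_forall_notMem]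
      rintro x ⟨hx, rfl⟩
      exact hb (hS x hx)
  rw [ncard_eq_sum_fiber S h, Finset.sum_congr rfl fun b _ => e b, Finset.sum_ite,
    Finset.sum_const_zero, add_zero, Finset.sum_const, smul_eq_mul, mul_comm,
    Set.ncard_eq_toFinset_card']
  congr 2
  ext b
  simp

section

variable {F : Type*} [Field F]

/-! ### The number of roots of the resolvent cubics -/

/-- The number of roots in `F` of the resolvent cubic. -/
def resolventRoots (r : F) : ℕ :=
  {w : F | w ^ 3 - 4 * w ^ 2 + 256 / 27 * (1 - 1728 / r) = 0}.ncard

/-- The pairs (r, w) are counted by w, since r = 1728·256/((8 - 3w)²(4 + 3w)). The four elements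
8/3, -4/3, 0, 4 drop out: at the first two r is not defined, and at the last two r = 1728; the value
r = 0 is never taken. -/
theorem sum_resolventRoots [Fintype F] (h2 : (2 : F) ≠ 0) (h3 : (3 : F) ≠ 0) [DecidableEq F] :
    ∑ r ∈ (Finset.univ.erase (0 : F)).erase 1728, resolventRoots r + 4 = Fintype.card F := by
  obtain ⟨h4, -, h12, h16, -, -, h27, h256, h1728, h8⟩ := ne_zero_of_two_three h2 h3
  set T : Set F := {w | w ≠ 0 ∧ w ≠ 4 ∧ 8 - 3 * w ≠ 0 ∧ 4 + 3 * w ≠ 0} with hT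
  have hd : ∀ w ∈ T, (8 - 3 * w) ^ 2 * (4 + 3 * w) ≠ 0 := fun w hw =>
    mul_ne_zero (pow_ne_zero _ hw.2.2.1) hw.2.2.2
  set h : F → F := fun w => 1728 * 256 / ((8 - 3 * w) ^ 2 * (4 + 3 * w)) with hh
  have hcard : T.ncard + 4 = Fintype.card F := by
    have e : Tᶜ = {0, 4, 8 / 3, -4 / 3} := by
      ext w
      simp only [hT, Set.mem_compl_iff, Set.mem_ofPred_eq, Set.mem_insert_iff,
        Set.mem_singleton_iff]
      rw [eq_div_iff h3, eq_div_iff h3]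
      have a1 : 8 - 3 * w = 0 ↔ w * 3 = 8 :=
        ⟨fun h => by linear_combination -h, fun h => by linear_combination -h⟩
      have a2 : 4 + 3 * w = 0 ↔ w * 3 = -4 :=
        ⟨fun h => by linear_combination h, fun h => by linear_combination h⟩
      rw [Ne, Ne, Ne, Ne, a1, a2]
      tauto
    have h4' : ({0, 4, 8 / 3, -4 / 3} : Set F).ncard = 4 := by
      rw [Set.ncard_insert_of_notMem, Set.ncard_eq_three.mpr ⟨_, _, _, ?_, ?_, ?_, rfl⟩]
      · rw [Ne, eq_div_iff h3]
        exact fun h => h4 (by linear_combination h)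
      · rw [Ne, eq_div_iff h3]
        exact fun h => h16 (by linear_combination h)
      · rw [Ne, div_left_inj' h3]
        exact fun h => h12 (by linear_combination h)
      · simp only [Set.mem_insert_iff, Set.mem_singleton_iff, not_or]
        exact ⟨h4.symm, (div_ne_zero h8 h3).symm, (div_ne_zero (neg_ne_zero.mpr h4) h3).symm⟩
    rw [← h4', ← e, Set.ncard_add_ncard_compl, Nat.card_eq_fintype_card]
  have hfib : ∀ r ∈ (Finset.univ.erase (0 : F)).erase 1728,
      resolventRoots r = {w ∈ T | h w = r}.ncard := by
    intro r hr
    simp only [Finset.mem_erase, Finset.mem_univ, and_true] at hr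
    rw [resolventRoots]
    congr 1
    ext w
    simp only [Set.mem_ofPred_eq, resolvent_eq_zero_iff h2 h3 hr.2]
    constructor
    · intro e
      have hne : r * ((8 - 3 * w) ^ 2 * (4 + 3 * w)) ≠ 0 := e ▸ mul_ne_zero h1728 h256
      have hw : w ∈ T := by
        refine ⟨?_, ?_, fun h => hne (by rw [h]; ring), fun h => hne (by rw [h]; ring)⟩
        · rintro rfl
          exact hr.1 (mul_right_cancel₀ h256 (by linear_combination e))
        · rintro rfl
          exact hr.1 (mul_right_cancel₀ h256 (by linear_combination e))
      refine ⟨hw, ?_⟩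
      rw [hh]
      simp only
      rw [div_eq_iff (hd w hw), e]
    · rintro ⟨hw, e⟩
      rw [hh] at e
      simp only at e
      rw [div_eq_iff (hd w hw)] at e
      exact e.symm
  have h0 : {w ∈ T | h w = 0}.ncard = 0 := by
    rw [Set.ncard_eq_zero (Set.toFinite _), Set.eq_empty_iff_forall_notMem]
    rintro w ⟨hw, e⟩
    exact div_ne_zero (mul_ne_zero h1728 h256) (hd w hw) e
  have h1 : {w ∈ T | h w = 1728}.ncard = 0 := by
    rw [Set.ncard_eq_zero (Set.toFinite _), Set.eq_empty_iff_forall_notMem]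
    rintro w ⟨hw, e⟩
    rw [hh] at e
    simp only at e
    rw [div_eq_iff (hd w hw)] at e
    have : (1728 * 27 : F) * (w ^ 2 * (w - 4)) = 0 := by linear_combination -e
    simp only [mul_eq_zero, h1728, h27, pow_eq_zero_iff, ne_eq, OfNat.ofNat_ne_zero,
      not_false_eq_true, false_or, sub_eq_zero] at this
    rcases this with h | h
    · exact hw.1 h
    · exact hw.2.1 h
  rw [← hcard, ncard_eq_sum_fiber T h, Finset.sum_congr rfl hfib,
    ← Finset.add_sum_erase Finset.univ _ (Finset.mem_univ (0 : F)), h0,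
    ← Finset.add_sum_erase (Finset.univ.erase (0 : F)) _
      (Finset.mem_erase.mpr ⟨h1728, Finset.mem_univ _⟩), h1]
  ring

/-! ### Orbits -/

open Classical in
/-- The `j`-invariant of an orbit. -/
def orbitJ (O : Set (ProjQuartic F)) : F :=
  if h : O.Nonempty then projJ h.some else 0

theorem orbitJ_orb (h2 : (2 : F) ≠ 0) (h3 : (3 : F) ≠ 0) (P : ProjQuartic F) :
    orbitJ (orb P) = projJ P := by
  have h : (orb P).Nonempty := ⟨P, MulAction.mem_orbit_self P⟩
  rw [orbitJ, dif_pos h]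
  exact projJ_of_mem_orb h2 h3 h.some_mem

theorem orbitJ_eq_iff (h2 : (2 : F) ≠ 0) (h3 : (3 : F) ≠ 0) {O : Set (ProjQuartic F)}
    (hO : O ∈ orbits F) {r : F} : orbitJ O = r ↔ ∀ Q ∈ O, projJ Q = r := by
  obtain ⟨P, -, rfl⟩ := hO
  rw [orbitJ_orb h2 h3]
  exact ⟨fun h Q hQ => (projJ_of_mem_orb h2 h3 hQ).trans h,
    fun h => h P (MulAction.mem_orbit_self P)⟩

end

end BinaryQuartic

end

noncomputable section

namespace BinaryQuartic

open MvPolynomial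

/-! ### Counting orbits, and uniqueness of representatives -/

section

variable {F K : Type*} [Field F] [Field K] [Algebra F K]

open Classical in
/-- The number of orbits with `j`-invariant `r`. -/
def numOrbits (r : F) : ℕ :=
  if r = 0 then (if Nat.card F % 3 = 1 then 4 else 2) else if r = 1728 then 5
  else resolventRoots r + 1

namespace Choices

theorem exists_repFamily [Finite F] (h2 : (2 : F) ≠ 0) (h3 : (3 : F) ≠ 0) (c : Choices F K)
    (hK : Module.finrank F K = 2) (r : F) :
    ∃ L, RepFamily c r L ∧ (r ∈ Jset F 4 ∨ r ∈ Jset F 2 ∨ r ∈ Jset F 1 ∨ r = 1728 ∨ r = 0) ∧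
      (∀ p ∈ L, p.2 ∈ ({1, 2, 3, 4, 12, 8} : Set ℕ)) ∧ L.length = numOrbits r := by
  have h1728 := (ne_zero_of_two_three h2 h3).2.2.2.2.2.2.2.2.1
  by_cases r0 : r = 0
  · subst r0
    rw [numOrbits, if_pos rfl]
    by_cases hq : Nat.card F % 3 = 1
    · obtain ⟨ω, hω⟩ := exists_omega hq
      refine ⟨_, c.repFamily_zero_one h2 h3 hK hq (l := -ω) (by linear_combination hω), by simp,
        by simp, by simp [hq]⟩
    -- The polynomial l² - l + 1 is the case u = 1 of l² - ul + 1. A root in F would be minus a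
    -- primitive cube root of unity, so the root has norm one.
    · have h21 : (1 : F) ≠ 2 := fun h => one_ne_zero (α := F) (by linear_combination -h)
      have hex := (exists_trace_eq h2 c.ε_nonsquare c.rootε_sq hK h21).resolve_left (by
        rintro ⟨l, hl⟩
        exact hq (card_mod_three_of_omega h3 (ω := -l) (by linear_combination hl)))
      obtain ⟨l, hl, e⟩ := hex
      rw [map_one, one_mul] at e
      exact ⟨_, c.repFamily_zero_two h2 h3 hK hq hl e, by simp, by simp, by simp [hq]⟩
  rw [numOrbits, if_neg r0]
  by_cases r1 : r = 1728
  · subst r1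
    rw [if_pos rfl]
    exact ⟨_, c.repFamily_1728 h2 h3 hK, by simp, by simp, by simp⟩
  rw [if_neg r1]
  rcases mem_Jset h2 h3 c.ε_nonsquare c.rootε_sq hK r0 r1 with h | h | h
  · obtain ⟨l, l0, l1, hl⟩ := exists_lambda_four h2 h3 c.ε_nonsquare c.rootε_sq hK h
    exact ⟨_, c.repFamily_four h2 h3 hK h l0 l1 hl, by simp [h], by simp, h.2.2.symm⟩
  · obtain ⟨l, l0, hl⟩ := exists_lambda_two h2 h3 c.ε_nonsquare c.rootε_sq hK h
    exact ⟨_, c.repFamily_two h2 h3 hK h l0 hl, by simp [h], by simp, h.2.2.symm⟩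
  · exact ⟨_, c.repFamily_one h2 h3 hK h, by simp [h], by simp, h.2.2.symm⟩

theorem exists_isFamily [Finite F] (h2 : (2 : F) ≠ 0) (h3 : (3 : F) ≠ 0) (c : Choices F K)
    (hK : Module.finrank F K = 2) (r : F) :
    ∃ (k : ℕ) (P : Fin k → ProjQuartic F) (n : Fin k → ℕ), IsFamily r P n := by
  obtain ⟨L, hL, -⟩ := c.exists_repFamily h2 h3 hK r
  obtain ⟨P, -, hP⟩ := hL.exists_isFamily
  exact ⟨_, P, _, hP⟩

end Choices

namespace RepFamily

theorem orbitCount_eq [Finite F] (h2 : (2 : F) ≠ 0) (h3 : (3 : F) ≠ 0) {c : Choices F K}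
    (hK : Module.finrank F K = 2) {r : F} {L : List (MvPolynomial (Fin 2) F × ℕ)}
    (h : RepFamily c r L) (d : ℕ) :
    orbitCount r d = (Finset.univ.filter fun i : Fin L.length => (L.get i).2 = d).card := by
  obtain ⟨P, -, hP⟩ := h.exists_isFamily
  exact hP.orbitCount_eq h2 h3 (c.exists_isFamily h2 h3 hK) d

theorem ncard_orbits [Finite F] (h2 : (2 : F) ≠ 0) (h3 : (3 : F) ≠ 0) {c : Choices F K}
    (hK : Module.finrank F K = 2) {r : F} {L : List (MvPolynomial (Fin 2) F × ℕ)}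
    (h : RepFamily c r L) : {O ∈ orbits F | orbitJ O = r}.ncard = L.length := by
  obtain ⟨P, -, hP⟩ := h.exists_isFamily
  have e : {O ∈ orbits F | orbitJ O = r} = {O ∈ orbits F | ∀ Q ∈ O, projJ Q = r} := by
    ext O
    exact and_congr_right fun hO => orbitJ_eq_iff h2 h3 hO
  rw [e, hP.setOf_orbits h2 h3 (c.exists_isFamily h2 h3 hK), ← Set.image_univ,
    Set.ncard_image_of_injective _ hP.orb_injective, Set.ncard_univ, Nat.card_eq_fintype_card,
    Fintype.card_fin]

/-- All forms of the list but the first one belong to the class `X` of forms, none of which is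
equivalent to the first one. -/
theorem ncard_fiber [Finite F] (h2 : (2 : F) ≠ 0) (h3 : (3 : F) ≠ 0) {c : Choices F K}
    (hK : Module.finrank F K = 2) {r : F} {e : MvPolynomial (Fin 2) F} {n : ℕ}
    {L : List (MvPolynomial (Fin 2) F × ℕ)} (h : RepFamily c r ((e, n) :: L))
    (X : Set (MvPolynomial (Fin 2) F)) (hL : ∀ p ∈ L, p.1 ∈ X)
    (hX : ∀ f ∈ X, ∀ P, IsClass f P → DiscNeZero P ∧ ¬ Equivalent e f) :
    {O ∈ {O | ∃ f ∈ X, ∃ P, IsClass f P ∧ O = orb P} | orbitJ O = r}.ncard = L.length := by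
  have := finite_projQuartic (F := F)
  obtain ⟨P, hc, hP⟩ := h.exists_isFamily
  have hn := h.ncard_orbits h2 h3 hK
  have hs : ∀ O : Set (ProjQuartic F), O ∈ orbits F ∧ orbitJ O = r ↔ ∃ i, orb (P i) = O := by
    intro O
    have := hP.setOf_orbits h2 h3 (c.exists_isFamily h2 h3 hK)
    rw [Set.ext_iff] at this
    refine Iff.trans ?_ (this O)
    exact and_congr_right fun hO => orbitJ_eq_iff h2 h3 hO
  have h0 : orb (P ⟨0, by simp⟩) ∈ {O ∈ orbits F | orbitJ O = r} := (hs _).mpr ⟨_, rfl⟩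
  have hset : {O ∈ {O | ∃ f ∈ X, ∃ P, IsClass f P ∧ O = orb P} | orbitJ O = r} =
      {O ∈ orbits F | orbitJ O = r} \ {orb (P ⟨0, by simp⟩)} := by
    ext O
    constructor
    · rintro ⟨⟨f, hf, Q, hQ, rfl⟩, hj⟩
      refine ⟨⟨⟨Q, (hX f hf Q hQ).1, rfl⟩, hj⟩, fun heq => (hX f hf Q hQ).2 ?_⟩
      refine (hc ⟨0, by simp⟩).equivalent hQ ?_
      rw [← Set.mem_singleton_iff.mp heq]
      exact MulAction.mem_orbit_self Q
    · rintro ⟨hO, hne⟩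
      refine ⟨?_, hO.2⟩
      obtain ⟨⟨i, hi⟩, rfl⟩ := (hs O).mp hO
      cases i with
      | zero => exact absurd rfl hne
      | succ i =>
        refine ⟨_, hL (L.get ⟨i, by simpa using hi⟩) (List.get_mem _ _), _, ?_, rfl⟩
        exact hc ⟨i + 1, hi⟩
  rw [hset, Set.ncard_sdiff_singleton_of_mem h0, hn]
  simp

end RepFamily

/-- The orbits over r ≠ 0, 1728 number one more than the roots of the resolvent, in all (q - 4) + (q
- 2). To this come five orbits over 1728 and four or two over 0. -/
theorem ncard_orbits [Finite F] (h2 : (2 : F) ≠ 0) (h3 : (3 : F) ≠ 0) (c : Choices F K)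
    (hK : Module.finrank F K = 2) :
    (orbits F).ncard = 2 * Nat.card F + 1 + if Nat.card F % 3 = 1 then 2 else 0 := by
  classical
  have := finite_projQuartic (F := F)
  have := Fintype.ofFinite F
  have h1728 := (ne_zero_of_two_three h2 h3).2.2.2.2.2.2.2.2.1
  have hr : ∀ r : F, {O ∈ orbits F | orbitJ O = r}.ncard = numOrbits r := by
    intro r
    obtain ⟨L, hL, -, -, hn⟩ := c.exists_repFamily h2 h3 hK r
    rw [hL.ncard_orbits h2 h3 hK, hn]
  have hm : (1728 : F) ∈ Finset.univ.erase (0 : F) :=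
    Finset.mem_erase.mpr ⟨h1728, Finset.mem_univ _⟩
  have hsum : ∑ r ∈ (Finset.univ.erase (0 : F)).erase 1728, numOrbits r =
      ∑ r ∈ (Finset.univ.erase (0 : F)).erase 1728, (resolventRoots r + 1) := by
    refine Finset.sum_congr rfl fun r hr => ?_
    simp only [Finset.mem_erase, Finset.mem_univ, and_true] at hr
    rw [numOrbits, if_neg hr.2, if_neg hr.1]
  have hs := sum_resolventRoots (F := F) h2 h3
  have hc : ((Finset.univ.erase (0 : F)).erase 1728).card + 2 = Fintype.card F := by
    have h1 := Finset.card_erase_add_one hm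
    have h2 := Finset.card_erase_add_one (Finset.mem_univ (0 : F))
    rw [Finset.card_univ] at h2
    omega
  rw [ncard_eq_sum_fiber _ (orbitJ (F := F)), Finset.sum_congr rfl fun r _ => hr r,
    ← Finset.add_sum_erase Finset.univ _ (Finset.mem_univ (0 : F)),
    ← Finset.add_sum_erase (Finset.univ.erase (0 : F)) _ hm, hsum, Finset.sum_add_distrib,
    Finset.sum_const, smul_eq_mul, mul_one, Nat.card_eq_fintype_card]
  have n0 : numOrbits (0 : F) = if Nat.card F % 3 = 1 then 4 else 2 := by
    rw [numOrbits, if_pos rfl]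
  have n1 : numOrbits (1728 : F) = 5 := by
    rw [numOrbits, if_neg h1728, if_pos rfl]
  rw [n0, n1, Nat.card_eq_fintype_card]
  split_ifs <;> omega

namespace Choices

/-- The list for the `j` of the orbit meets it by the counting argument. Any other representative in
the orbit has the same `j`, hence belongs to the same list, whose members are pairwise inequivalent.
-/
theorem existsUnique_rep [Finite F] (h2 : (2 : F) ≠ 0) (h3 : (3 : F) ≠ 0) (c : Choices F K)
    (hK : Module.finrank F K = 2) {O : Set (ProjQuartic F)} (hO : O ∈ orbits F) :
    ∃! P : ProjQuartic F, P ∈ O ∧ ∃ f ∈ c.reps, IsClass f P := by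
  obtain ⟨Q, hQ, rfl⟩ := hO
  obtain ⟨L, hL, -⟩ := c.exists_repFamily h2 h3 hK (projJ Q)
  obtain ⟨P, hc, hP⟩ := hL.exists_isFamily
  obtain ⟨i, hi⟩ := hP.exists_mem_orb h2 h3 (c.exists_isFamily h2 h3 hK) hQ rfl
  refine ⟨P i, ⟨MulAction.mem_orbit_symm.mp hi, _, hL.mem _ (List.get_mem _ _), hc i⟩, ?_⟩
  rintro P' ⟨hP', f, hf, hfc⟩
  obtain ⟨p, hp, rfl⟩ := hL.complete f hf P' hfc (projJ_of_mem_orb h2 h3 hP')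
  obtain ⟨k, rfl⟩ := List.get_of_mem hp
  obtain rfl := hfc.unique (hc k)
  rw [orb_eq_of_mem hi] at hP'
  rw [hP.inj i k hP']

theorem exists_orbit_data [Finite F] (h2 : (2 : F) ≠ 0) (h3 : (3 : F) ≠ 0) (c : Choices F K)
    (hK : Module.finrank F K = 2) {O : Set (ProjQuartic F)} (hO : O ∈ orbits F) :
    ∃ r : F, (∀ P ∈ O, projJ P = r) ∧
      (r ∈ Jset F 4 ∨ r ∈ Jset F 2 ∨ r ∈ Jset F 1 ∨ r = 1728 ∨ r = 0) ∧
      ∃ d ∈ ({1, 2, 3, 4, 12, 8} : Set ℕ),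
        O.ncard * d = Nat.card (Matrix.ProjGenLinGroup (Fin 2) F) := by
  obtain ⟨Q, hQ, rfl⟩ := hO
  obtain ⟨L, hL, hr, hd, -⟩ := c.exists_repFamily h2 h3 hK (projJ Q)
  obtain ⟨P, hc, hP⟩ := hL.exists_isFamily
  obtain ⟨i, hi⟩ := hP.exists_mem_orb h2 h3 (c.exists_isFamily h2 h3 hK) hQ rfl
  refine ⟨projJ Q, fun P hP => projJ_of_mem_orb h2 h3 hP, hr, (L.get i).2,
    hd _ (List.get_mem _ _), ?_⟩
  rw [orb_eq_of_mem hi, ← hP.card i, ncard_orb_mul]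

/-- Over each r in J₄ lie four orbits, and all but that of `formE r`, the only one with roots in F,
come from forms ψ'. -/
theorem ncard_psi_orbits [Finite F] (h2 : (2 : F) ≠ 0) (h3 : (3 : F) ≠ 0) (c : Choices F K)
    (hK : Module.finrank F K = 2) :
    {O | ∃ l : F, l ≠ 0 ∧ l ≠ 1 ∧ Generic l ∧ ∃ P, IsClass (c.psi l) P ∧ O = orb P}.ncard =
      3 * (Jset F 4).ncard := by
  have := finite_projQuartic (F := F)
  set X : Set (MvPolynomial (Fin 2) F) :=
    {f | ∃ l : F, l ≠ 0 ∧ l ≠ 1 ∧ Generic l ∧ f = c.psi l} with hX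
  have e : {O | ∃ l : F, l ≠ 0 ∧ l ≠ 1 ∧ Generic l ∧ ∃ P, IsClass (c.psi l) P ∧ O = orb P} =
      {O | ∃ f ∈ X, ∃ P, IsClass f P ∧ O = orb P} := by
    ext O
    constructor
    · rintro ⟨l, a, b, d, h⟩
      exact ⟨_, ⟨l, a, b, d, rfl⟩, h⟩
    · rintro ⟨_, ⟨l, a, b, d, rfl⟩, h⟩
      exact ⟨l, a, b, d, h⟩
  rw [e]
  have hrow : ∀ l : F, l ≠ 0 → l ≠ 1 → Generic l →
      Row (c.psi l) (jLambda l) .F4' (Cyc 2 × Cyc 2) :=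
    fun l l0 l1 hl => c.row_psi_generic h2 h3 hK l0 l1 hl.1 rfl
  apply ncard_eq_mul_of_fiber _ _ orbitJ
  · intro r hr
    obtain ⟨l, l0, l1, hl⟩ := exists_lambda_four h2 h3 c.ε_nonsquare c.rootε_sq hK hr
    refine (c.repFamily_four h2 h3 hK hr l0 l1 hl).ncard_fiber h2 h3 hK X ?_ ?_
    · have hg : ∀ m : F, m ≠ 0 → m ≠ 1 → jLambda m = jLambda l → c.psi m ∈ X :=
        fun m m0 m1 hm => ⟨m, m0, m1, (generic_iff h2 h3 m0 m1).mpr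
          ⟨by rw [hm, hl]; exact hr.1, by rw [hm, hl]; exact hr.2.1⟩, rfl⟩
      have l1' := sub_ne_zero.mpr l1
      simp only [List.forall_mem_cons, List.not_mem_nil, false_imp_iff, implies_true, and_true]
      refine ⟨hg l l0 l1 rfl, hg _ (sub_ne_zero.mpr l1.symm) (by simpa using l0)
        (jLambda_one_sub l), hg _ (div_ne_zero l0 l1') ?_ (jLambda_div_sub_one l1)⟩
      rw [Ne, div_eq_one_iff_eq l1']
      exact fun h => one_ne_zero (α := F) (by linear_combination h)
    · rintro _ ⟨m, m0, m1, hm, rfl⟩ P hP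
      have hr' := hrow m m0 m1 hm
      refine ⟨?_, fun h => ?_⟩
      · obtain ⟨Q, hQ, hd, -⟩ := hr'
        rwa [hP.unique hQ]
      · have := (row_E_four h2 h3 hr).roots_eq_zero_iff hr' h
        exact absurd this (by decide)
  · rintro _ ⟨_, ⟨l, l0, l1, hl, rfl⟩, P, hP, rfl⟩
    rw [orbitJ_orb h2 h3, (hrow l l0 l1 hl).projJ_eq hP]
    have := (generic_iff h2 h3 l0 l1).mp hl
    exact jLambda_mem_Jset_four h2 h3 l0 l1 this.1 this.2

theorem exists_row_upsilon_generic [Finite F] (h2 : (2 : F) ≠ 0) (h3 : (3 : F) ≠ 0)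
    (c : Choices F K) (hK : Module.finrank F K = 2) {l : K} (h : l ∈ N2tilde F K)
    (hl : Generic l) :
    ∃ r ∈ Jset F 2, algebraMap F K r = jLambda l ∧ Row (c.upsilon l) r .F2' (Cyc 2) := by
  have : FiniteDimensional F K := FiniteDimensional.of_finrank_pos (by omega)
  have k2 : (2 : K) ≠ 0 := by
    simpa [map_ofNat (algebraMap F K)] using (map_ne_zero (algebraMap F K)).mpr h2
  have k3 : (3 : K) ≠ 0 := by
    simpa [map_ofNat (algebraMap F K)] using (map_ne_zero (algebraMap F K)).mpr h3
  obtain ⟨r, hr, -, hrow⟩ := c.row_upsilon h2 h3 hK h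
  obtain ⟨g0, g1⟩ := (generic_iff k2 k3 (N2tilde_ne_zero h) h.1).mp hl
  refine ⟨r, mem_Jset_two h2 h3 c.ε_nonsquare c.rootε_sq hK h hr ?_ ?_, hr, hrow hl.1⟩
  · rintro rfl
    exact g0 (by rw [← hr, map_zero])
  · rintro rfl
    exact g1 (by rw [← hr, map_ofNat])

theorem ncard_upsilon_orbits [Finite F] (h2 : (2 : F) ≠ 0) (h3 : (3 : F) ≠ 0) (c : Choices F K)
    (hK : Module.finrank F K = 2) :
    {O | ∃ l ∈ N2tilde F K, Generic l ∧ ∃ P, IsClass (c.upsilon l) P ∧ O = orb P}.ncard =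
      (Jset F 2).ncard := by
  have : FiniteDimensional F K := FiniteDimensional.of_finrank_pos (by omega)
  have := finite_projQuartic (F := F)
  have k2 : (2 : K) ≠ 0 := by
    simpa [map_ofNat (algebraMap F K)] using (map_ne_zero (algebraMap F K)).mpr h2
  have k3 : (3 : K) ≠ 0 := by
    simpa [map_ofNat (algebraMap F K)] using (map_ne_zero (algebraMap F K)).mpr h3
  set X : Set (MvPolynomial (Fin 2) F) :=
    {f | ∃ l ∈ N2tilde F K, Generic l ∧ f = c.upsilon l} with hX
  have e : {O | ∃ l ∈ N2tilde F K, Generic l ∧ ∃ P, IsClass (c.upsilon l) P ∧ O = orb P} =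
      {O | ∃ f ∈ X, ∃ P, IsClass f P ∧ O = orb P} := by
    ext O
    constructor
    · rintro ⟨l, a, b, h⟩
      exact ⟨_, ⟨l, a, b, rfl⟩, h⟩
    · rintro ⟨_, ⟨l, a, b, rfl⟩, h⟩
      exact ⟨l, a, b, h⟩
  rw [e, ← one_mul (Jset F 2).ncard]
  apply ncard_eq_mul_of_fiber _ _ orbitJ
  · intro r hr
    obtain ⟨l, hl, hj⟩ := exists_lambda_two h2 h3 c.ε_nonsquare c.rootε_sq hK hr
    refine (c.repFamily_two h2 h3 hK hr hl hj).ncard_fiber h2 h3 hK X ?_ ?_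
    · simp only [List.forall_mem_cons, List.not_mem_nil, false_imp_iff, implies_true, and_true]
      refine ⟨l, hl, (generic_iff k2 k3 (N2tilde_ne_zero hl) hl.1).mpr ⟨?_, ?_⟩, rfl⟩
      · rw [hj, map_ne_zero]
        exact hr.1
      · rw [hj, ← map_ofNat (algebraMap F K), (algebraMap F K).injective.ne_iff]
        exact hr.2.1
    · rintro _ ⟨m, hm, hg, rfl⟩ P hP
      obtain ⟨s, -, -, hr'⟩ := c.exists_row_upsilon_generic h2 h3 hK hm hg
      refine ⟨?_, fun h => ?_⟩
      · obtain ⟨Q, hQ, hd, -⟩ := hr'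
        rwa [hP.unique hQ]
      · have := (row_E_two h2 h3 hr).roots_eq_zero_iff hr' h
        exact absurd this (by decide)
  · rintro _ ⟨_, ⟨l, hl, hg, rfl⟩, P, hP, rfl⟩
    obtain ⟨s, hs, -, hr'⟩ := c.exists_row_upsilon_generic h2 h3 hK hl hg
    rw [orbitJ_orb h2 h3, hr'.projJ_eq hP]
    exact hs

end Choices

end

end BinaryQuartic

end

/-! ### The classification theorem -/

theorem theorem1p1 {F : Type*} [Field F] [Finite F] (h2 : ringChar F ≠ 2) (h3 : ringChar F ≠ 3)
    {q : ℕ} (hq : Nat.card F = q) {μ : ℤ} (hμ : μ = 1 ∨ μ = -1) (hqμ : (q : ℤ) ≡ μ [ZMOD 3])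
    {K : Type*} [Field K] [Algebra F K] (hK : Module.finrank F K = 2) :
    -- the number of forms and the number of orbits
    {P : ProjQuartic F | DiscNeZero P}.ncard = q ^ 4 - q ^ 2 ∧
    ((orbits F).ncard : ℤ) = 2 * q + 2 + μ ∧
    -- the table of orbits covers all orbits
    (∀ O ∈ orbits F, ∃ r : F, (∀ P ∈ O, projJ P = r) ∧
      (r ∈ Jset F 4 ∨ r ∈ Jset F 2 ∨ r ∈ Jset F 1 ∨ r = 1728 ∨ r = 0) ∧
      ∃ d ∈ ({1, 2, 3, 4, 12, 8} : Set ℕ),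
        O.ncard * d = Nat.card (Matrix.ProjGenLinGroup (Fin 2) F)) ∧
    -- the table of orbits
    (∀ r ∈ Jset F 4, orbitCount r 1 = 0 ∧ orbitCount r 2 = 0 ∧ orbitCount r 3 = 0 ∧
      orbitCount r 4 = 4 ∧ orbitCount r 12 = 0 ∧ orbitCount r 8 = 0) ∧
    (∀ r ∈ Jset F 2, orbitCount r 1 = 0 ∧ orbitCount r 2 = 2 ∧ orbitCount r 3 = 0 ∧
      orbitCount r 4 = 0 ∧ orbitCount r 12 = 0 ∧ orbitCount r 8 = 0) ∧
    (∀ r ∈ Jset F 1, orbitCount r 1 = 1 ∧ orbitCount r 2 = 0 ∧ orbitCount r 3 = 0 ∧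
      orbitCount r 4 = 0 ∧ orbitCount r 12 = 0 ∧ orbitCount r 8 = 0) ∧
    (orbitCount (1728 : F) 1 = 0 ∧ orbitCount (1728 : F) 2 = 0 ∧ orbitCount (1728 : F) 3 = 0 ∧
      orbitCount (1728 : F) 4 = 3 ∧ orbitCount (1728 : F) 12 = 0 ∧
      orbitCount (1728 : F) 8 = 2) ∧
    (orbitCount (0 : F) 1 = 0 ∧ (orbitCount (0 : F) 2 : ℤ) = 1 - μ ∧
      (orbitCount (0 : F) 3 : ℤ) = 1 + μ ∧ (orbitCount (0 : F) 4 : ℤ) = (1 + μ) / 2 ∧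
      (orbitCount (0 : F) 12 : ℤ) = (1 + μ) / 2 ∧ orbitCount (0 : F) 8 = 0) ∧
    -- the choices needed for the list of representatives can be made
    Nonempty (Choices F K) ∧
    ∀ c : Choices F K,
      -- every orbit is represented exactly once
      (∀ O ∈ orbits F, ∃! P : ProjQuartic F, P ∈ O ∧ ∃ f ∈ c.reps, IsClass f P) ∧
      -- the list of representatives, with `j`-invariant, type and stabilizer
      (∀ r ∈ Jset F 4, Row (formE r) r .F4 (Cyc 2 × Cyc 2)) ∧
      (∀ r ∈ Jset F 2, Row (formE r) r .F2 (Cyc 2)) ∧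
      (∀ r ∈ Jset F 1, Row (formE r) r .F1 Unit) ∧
      Row (formSq (1 : F)) 1728 .F4 (DihedralGroup 4) ∧
      Row (formSq c.ε) 1728 .F2 (Cyc 2 × Cyc 2) ∧
      (q ≡ 1 [MOD 3] →
        Row (formCube (1 : F)) 0 .F4 (alternatingGroup (Fin 4)) ∧
        Row (formCube (c.γ : F)) 0 .F1 (Cyc 3) ∧
        Row (formCube ((c.γ : F) ^ 2)) 0 .F1 (Cyc 3)) ∧
      (q ≡ 2 [MOD 3] → Row (formCube (1 : F)) 0 .F2 (Cyc 2)) ∧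
      Row (c.psi (-1)) 1728 .F4' (DihedralGroup 4) ∧
      (∀ l : F, l = 2 ∨ l = 2⁻¹ → Row (c.psi l) 1728 .F4' (Cyc 2 × Cyc 2)) ∧
      (∀ l : F, IsPrimitiveRoot (-l) 3 → Row (c.psi l) 0 .F4' (Cyc 2 × Cyc 2)) ∧
      (∀ l : F, l ≠ 0 → l ≠ 1 → Generic l →
        jLambda l ∈ Jset F 4 ∧ Row (c.psi l) (jLambda l) .F4' (Cyc 2 × Cyc 2)) ∧
      {O | ∃ l : F, l ≠ 0 ∧ l ≠ 1 ∧ Generic l ∧ ∃ P, IsClass (c.psi l) P ∧ O = orb P}.ncard =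
        3 * (Jset F 4).ncard ∧
      Row (c.upsilon (-1)) 1728 .F2' (Cyc 4) ∧
      (∀ l ∈ N2tilde F K, IsPrimitiveRoot (-l) 3 → Row (c.upsilon l) 0 .F2' (Cyc 2)) ∧
      (∀ l ∈ N2tilde F K, Generic l → ∃ r ∈ Jset F 2,
        algebraMap F K r = jLambda l ∧ Row (c.upsilon l) r .F2' (Cyc 2)) ∧
      {O | ∃ l ∈ N2tilde F K, Generic l ∧ ∃ P, IsClass (c.upsilon l) P ∧ O = orb P}.ncard =
        (Jset F 2).ncard := by
  subst hq
  have h2' : (2 : F) ≠ 0 := Ring.two_ne_zero h2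
  have h3' : (3 : F) ≠ 0 := by
    intro h
    have hd := ringChar.dvd (R := F) (x := 3) (by exact_mod_cast h)
    rcases (Nat.dvd_prime Nat.prime_three).mp hd with h1 | h1
    · exact CharP.ringChar_ne_one h1
    · exact h3 h1
  have hμ' : (Nat.card F % 3 = 1 ∧ μ = 1) ∨ (Nat.card F % 3 = 2 ∧ μ = -1) := by
    rw [Int.ModEq] at hqμ
    omega
  have : FiniteDimensional F K := FiniteDimensional.of_finrank_pos (by omega)
  have k3 : (3 : K) ≠ 0 := by
    simpa [map_ofNat (algebraMap F K)] using (map_ne_zero (algebraMap F K)).mpr h3'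
  have hne := nonempty_choices h2' hK
  -- The first part does not mention the choices, so any one of them may serve for its proof.
  obtain ⟨c⟩ := id hne
  refine ⟨ncard_discNeZero h2' h3', ?_, fun O hO => c.exists_orbit_data h2' h3' hK hO, ?_, ?_, ?_,
    ?_, ?_, hne, fun c => ⟨fun O hO => c.existsUnique_rep h2' h3' hK hO,
      fun r hr => row_E_four h2' h3' hr, fun r hr => row_E_two h2' h3' hr,
      fun r hr => row_E_one h2' h3' hr, row_sq_one h2' h3',
      row_sq_nonsquare h2' h3' c.ε_nonsquare, ?_, ?_, c.row_psi_neg_one h2' h3' hK,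
      fun l hl => c.row_psi_two h2' h3' hK hl, ?_, ?_, c.ncard_psi_orbits h2' h3' hK,
      c.row_upsilon_neg_one h2' h3' hK, ?_, fun l hl hg =>
        c.exists_row_upsilon_generic h2' h3' hK hl hg, c.ncard_upsilon_orbits h2' h3' hK⟩⟩
  · rw [ncard_orbits h2' h3' c hK]
    rcases hμ' with ⟨hq, rfl⟩ | ⟨hq, rfl⟩
    · rw [if_pos hq]
      push_cast
      ring
    · rw [if_neg (by omega)]
      push_cast
      ring
  · intro r hr
    obtain ⟨l, l0, l1, hl⟩ := exists_lambda_four h2' h3' c.ε_nonsquare c.rootε_sq hK hr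
    have h := c.repFamily_four h2' h3' hK hr l0 l1 hl
    simp only [h.orbitCount_eq h2' h3' hK]
    -- The stabilizer orders in the list are explicit numerals, so the counts are evaluated by
    -- computation.
    exact ⟨rfl, rfl, rfl, rfl, rfl, rfl⟩
  · intro r hr
    obtain ⟨l, l0, hl⟩ := exists_lambda_two h2' h3' c.ε_nonsquare c.rootε_sq hK hr
    have h := c.repFamily_two h2' h3' hK hr l0 hl
    simp only [h.orbitCount_eq h2' h3' hK]
    exact ⟨rfl, rfl, rfl, rfl, rfl, rfl⟩
  · intro r hr
    have h := c.repFamily_one h2' h3' hK hr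
    simp only [h.orbitCount_eq h2' h3' hK]
    exact ⟨rfl, rfl, rfl, rfl, rfl, rfl⟩
  · have h := c.repFamily_1728 h2' h3' hK
    simp only [h.orbitCount_eq h2' h3' hK]
    exact ⟨rfl, rfl, rfl, rfl, rfl, rfl⟩
  · rcases hμ' with ⟨hq, rfl⟩ | ⟨hq, rfl⟩
    · obtain ⟨ω, hω⟩ := exists_omega hq
      have h := c.repFamily_zero_one h2' h3' hK hq (l := -ω) (by linear_combination hω)
      simp only [h.orbitCount_eq h2' h3' hK]
      exact ⟨rfl, rfl, rfl, rfl, rfl, rfl⟩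
    · have h21 : (1 : F) ≠ 2 := fun h => one_ne_zero (α := F) (by linear_combination -h)
      obtain ⟨l, hl, e⟩ := (exists_trace_eq h2' c.ε_nonsquare c.rootε_sq hK h21).resolve_left (by
        rintro ⟨l, hl⟩
        have := card_mod_three_of_omega h3' (ω := -l) (by linear_combination hl)
        omega)
      rw [map_one, one_mul] at e
      have h := c.repFamily_zero_two h2' h3' hK (by omega) hl e
      simp only [h.orbitCount_eq h2' h3' hK]
      exact ⟨rfl, rfl, rfl, rfl, rfl, rfl⟩
  · intro hq
    obtain ⟨ω, hω⟩ := exists_omega hq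
    exact ⟨row_cube_one h2' h3' hω, c.row_cube_generator h2' h3' hq,
      c.row_cube_generator_sq h2' h3' hq⟩
  · intro hq
    have hq' : Nat.card F % 3 = 2 := hq
    exact row_cube_one_two h2' h3' fun x => eq_one_of_cube_eq_one (x := x) h3' (by omega)
  · intro l hl
    exact (c.row_psi_omega h2' h3' hK ((isPrimitiveRoot_neg_iff h3').mp hl)).2.2
  · intro l l0 l1 hg
    have hj := (generic_iff h2' h3' l0 l1).mp hg
    exact ⟨jLambda_mem_Jset_four h2' h3' l0 l1 hj.1 hj.2,
      c.row_psi_generic h2' h3' hK l0 l1 hg.1 rfl⟩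
  · intro l hl h
    exact c.row_upsilon_omega h2' h3' hK hl ((isPrimitiveRoot_neg_iff k3).mp h)
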